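/- **Setting.** Let $\Omega\subset\mathbb{R}^n$ be open (possibly unbounded) and $Lu=-\operatorname{div}(a(x)\nabla u)+c(x)u$, where $a=(a^{ij})$ is a measurable symmetric real matrix with $\Lambda^{-1}|\xi|^2\le a^{ij}(x)\xi_i\xi_j\le\Lambda|\xi|^2$ for a.e. $x\in\Omega$ and all $\xi\in\mathbb{R}^n$ ($\Lambda>0$), and $c\in L^\infty_{\rm loc}(\Omega)$ is real. $L$ carries a boundary condition, given by a linear space $\mathcal V\supset C_c^\infty(\Omega)$ of real functions $w\in L^2(\Omega)$ with $\nabla w\in L^2(\Omega)$ and $|c|^{1/2}w\in L^2(\Omega)$, such that for some constants $C_1,C_2$ $$\int_\Omega(|\nabla w|^2+|c|w^2)\,dx\le C_1\int_\Omega(a\nabla w\cdot\nabla w+cw^2)\,dx+C_2\int_\Omega w^2\,dx,\qquad w\in\mathcal V$$ (this is automatic if $c\ge0$, or if $c$ is bounded below). Suppose that $L^2(\Omega)$ has an orthonormal basis $(\phi_k)_{k\ge0}\subset\mathcal V$ of weak eigenfunctions, $$\int_\Omega (a\nabla\phi_k\cdot\nabla w+c\phi_kw)\,dx=\lambda_k\int_\Omega\phi_kw\,dx\quad\text{for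 all }w\in\mathcal V,\qquad 0\le\lambda_0\le\lambda_1\le\cdots.$$ For $u\in L^2(\mathbb{R}\times\Omega)$ (complex valued) let $u_k(t)=\int_\Omega u(t,x)\phi_k(x)\,dx$ and $\widehat{u_k}(\rho)=(2\pi)^{-1/2}\int_{\mathbb R}u_k(t)e^{-i\rho t}\,dt$. Let $H=\partial_t+L$. For $0<s\le1$, $u\in\operatorname{Dom}(H^s)$ means $\int_{\mathbb R}\sum_k|i\rho+\lambda_k|^s|\widehat{u_k}(\rho)|^2\,d\rho<\infty$, and for $u,v\in\operatorname{Dom}(H^s)$ $$\langle H^su,v\rangle=\int_{\mathbb R}\sum_{k\ge0}(i\rho+\lambda_k)^s\,\widehat{u_k}(\rho)\overline{\widehat{v_k}(\rho)}\,d\rho$$ with the principal branch of the power. Further, $e^{-\tau H}u(t,x)=\sum_k e^{-\tau\lambda_k}u_k(t-\tau)\phi_k(x)$. Let $D=\Omega\times(0,\infty)$, with points $(x,y)$. A function $w\in L^2(D,y^{1-2s}dxdy)$ belongs to $H^1_{L,y}(D)$ if it has weak derivatives $\nabla_xw,\partial_yw\in L^2(D,y^{1-2s}dxdy)$ and, with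 $w_k(y)=\int_\Omega w(x,y)\phi_k(x)\,dx$, $$[w]^2=\int_0^\infty\!\!\int_\Omega y^{1-2s}\big(a\nabla_xw\cdot\overline{\nabla_xw}+c|w|^2+|\partial_yw|^2\big)dx\,dy=\int_0^\infty y^{1-2s}\sum_k\lambda_k|w_k(y)|^2dy+\int_0^\infty\!\!\int_\Omega y^{1-2s}|\partial_yw|^2dx\,dy<\infty ;$$ its norm is $\|w\|^2_{H^1_{L,y}(D)}=\|w\|^2_{L^2(D,y^{1-2s}dxdy)}+[w]^2$. **Theorem.** Let $0<s<1$ and $u\in\operatorname{Dom}(H^s)$, and suppose that $u_k=0$ for every $k$ with $\lambda_k=0$. For $y>0$ let $$U(\cdot,\cdot,y)=\frac{y^{2s}}{4^s\Gamma(s)}\int_0^\infty e^{-y^2/(4\tau)}\,e^{-\tau H}u\,\frac{d\tau}{\tau^{1+s}}\in L^2(\mathbb{R}\times\Omega),\qquad U(\cdot,\cdot,0)=u.$$ Then $U\in L^2(\mathbb{R};H^1_{L,y}(D))\cap C^\infty((0,\infty);L^2(\mathbb{R}\times\Omega))\cap C([0,\infty);L^2(\mathbb{R}\times\Omega))$.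 For every $y>0$ and every real-valued $v\in C_c^\infty(\mathbb{R}\times\Omega)$, both $U(\cdot,\cdot,y)$ and $v$ are in $\operatorname{Dom}(H)$ and $$\langle HU,v\rangle=\int_{\mathbb R}\int_\Omega\Big(\tfrac{1-2s}{y}\partial_y+\partial_{yy}\Big)U\,v\,dx\,dt=y^{2s-1}\int_{\mathbb R}\int_\Omega\partial_y(y^{1-2s}\partial_yU)\,v\,dx\,dt .$$ Moreover $U$ is a weak solution of $$\partial_tU=y^{-(1-2s)}\operatorname{div}_{x,y}\big(y^{1-2s}B(x)\nabla_{x,y}U\big)-c(x)U,\qquad B(x)=\begin{bmatrix}a(x)&0\\0&1\end{bmatrix},$$ in the following sense. For every real-valued $V\in C_c^\infty(\mathbb{R}\times\Omega\times[0,\infty))$ and every $y>0$, $$\int_{\mathbb R}\int_\Omega U\,\partial_tV\,dx\,dt=\int_{\mathbb R}\int_\Omega\big(a\nabla_xU\cdot\nabla_xV+c\,UV\big)dx\,dt-\int_{\mathbb R}\int_\Omega\Big(\tfrac{1-2s}{y}\partial_y+\partial_{yy}\Big)U\,V\,dx\,dt,$$ and $V(\cdot,\cdot,0)\in\operatorname{Dom}(H^s)$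 with $$\int_0^\infty\!\!\int_{\mathbb R}\int_\Omega y^{1-2s}U\,\partial_tV\,dx\,dt\,dy=\int_0^\infty\!\!\int_{\mathbb R}\int_\Omega y^{1-2s}\big(B\nabla_{x,y}U\cdot\nabla_{x,y}V+c\,UV\big)dx\,dt\,dy-\frac{\Gamma(1-s)}{4^{s-1/2}\Gamma(s)}\langle H^su,V(\cdot,\cdot,0)\rangle .$$ -/

import Mathlib

open MeasureTheory Set Filter Topology TopologicalSpace
open scoped ContDiff Distributions FourierTransform ComplexConjugate InnerProductSpace

noncomputable section

namespace ParabolicExtension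

/-- `ℝⁿ` with its Euclidean structure. -/
abbrev Sp (n : ℕ) : Type := EuclideanSpace ℝ (Fin n)

/-- The `i`-th coordinate vector of `ℝⁿ`. -/
abbrev e {n : ℕ} (i : Fin n) : Sp n := EuclideanSpace.single i 1

/-- The open cylinder `ℝ × Ω`, with points `(t, x)`. -/
def cyl {n : ℕ} (Ω : Opens (Sp n)) : Opens (ℝ × Sp n) :=
  ⟨univ ×ˢ (Ω : Set (Sp n)), isOpen_univ.prod Ω.isOpen⟩

/-- `D = {(x, y) : x ∈ Ω, y > 0}`. -/
def halfCyl {n : ℕ} (Ω : Opens (Sp n)) : Opens (Sp n × ℝ) :=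
  ⟨(Ω : Set (Sp n)) ×ˢ Ioi 0, Ω.isOpen.prod isOpen_Ioi⟩

/-- `ℝ × Ω × ℝ`, with points `(t, x, y)`. The restrictions to `y ≥ 0` of the test functions on this
set are exactly the elements of `C_c^∞(ℝ × Ω × [0, ∞))`. -/
def fullCyl {n : ℕ} (Ω : Opens (Sp n)) : Opens (ℝ × Sp n × ℝ) :=
  ⟨univ ×ˢ ((Ω : Set (Sp n)) ×ˢ univ), isOpen_univ.prod (Ω.isOpen.prod isOpen_univ)⟩

/-- Lebesgue measure on `Ω`. -/
abbrev mΩ {n : ℕ} (Ω : Opens (Sp n)) : Measure (Sp n) := volume.restrict (Ω : Set (Sp n))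

/-- Lebesgue measure on `ℝ × Ω`. -/
abbrev mCyl {n : ℕ} (Ω : Opens (Sp n)) : Measure (ℝ × Sp n) := (volume : Measure ℝ).prod (mΩ Ω)

/-- The measure `y^{1-2s} dy` on `(0, ∞)`. -/
def wMeas (s : ℝ) : Measure ℝ :=
  (volume.restrict (Ioi (0 : ℝ))).withDensity fun y => ENNReal.ofReal (y ^ (1 - 2 * s))

instance (s : ℝ) : SFinite (wMeas s) := by unfold wMeas; infer_instance

/-- The measure `y^{1-2s} dx dy` on `D`. -/
abbrev mD {n : ℕ} (Ω : Opens (Sp n)) (s : ℝ) : Measure (Sp n × ℝ) := (mΩ Ω).prod (wMeas s)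

/-- The measure `y^{1-2s} dt dx dy` on `ℝ × Ω × (0, ∞)`. -/
abbrev mExt {n : ℕ} (Ω : Opens (Sp n)) (s : ℝ) : Measure (ℝ × Sp n × ℝ) :=
  (volume : Measure ℝ).prod (mD Ω s)

/-- The real Hilbert space `L²(Ω)`. -/
abbrev L2 {n : ℕ} (Ω : Opens (Sp n)) : Type := Lp ℝ 2 (mΩ Ω)

/-- The complex Hilbert space `L²(ℝ × Ω)`. -/
abbrev L2Cyl {n : ℕ} (Ω : Opens (Sp n)) : Type := Lp ℂ 2 (mCyl Ω)

/-! ### Weak derivatives -/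

/-- `g` is the weak derivative of `w` in the direction `v` in the open set `S`. -/
def HasWeakDeriv {X F : Type*} [NormedAddCommGroup X] [NormedSpace ℝ X] [MeasureSpace X]
    [NormedAddCommGroup F] [NormedSpace ℝ F] (S : Opens X) (v : X) (w g : X → F) : Prop :=
  LocallyIntegrableOn w (S : Set X) ∧ LocallyIntegrableOn g (S : Set X) ∧
    ∀ ψ : 𝓓(S, ℝ), ∫ x in (S : Set X), (fderiv ℝ ψ x v) • w x = -∫ x in (S : Set X), ψ x • g x

open Classical in
/-- The weak partial derivative `∂ᵢ w` in `Ω` (which is unique a.e. in `Ω`), and `0` if there is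
none. -/
def wpartial {n : ℕ} (Ω : Opens (Sp n)) (i : Fin n) (w : Sp n → ℝ) : Sp n → ℝ :=
  if h : ∃ g, HasWeakDeriv Ω (e i) w g then h.choose else 0

/-! ### The elliptic operator `L = -div(a ∇) + c` -/

/-- The conditions on the coefficients of `L`: `a` is measurable, symmetric, and uniformly elliptic
(hence bounded) with ellipticity constant `Λ`; `c` is in `L^∞_loc(Ω)`. -/
structure IsAdmissible {n : ℕ} (Ω : Opens (Sp n)) (a : Sp n → Matrix (Fin n) (Fin n) ℝ)
    (c : Sp n → ℝ) (Λ : ℝ) : Prop where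
  pos : 0 < Λ
  meas_a : ∀ i j, AEMeasurable (fun x => a x i j) (mΩ Ω)
  symm : ∀ᵐ x ∂(mΩ Ω), (a x).IsSymm
  elliptic : ∀ᵐ x ∂(mΩ Ω), ∀ ξ : Fin n → ℝ,
    Λ⁻¹ * ∑ i, ξ i ^ 2 ≤ ∑ i, ∑ j, a x i j * ξ i * ξ j ∧
      ∑ i, ∑ j, a x i j * ξ i * ξ j ≤ Λ * ∑ i, ξ i ^ 2
  meas_c : AEMeasurable c (mΩ Ω)
  locBdd_c : ∀ K : Set (Sp n), IsCompact K → K ⊆ Ω → ∃ M : ℝ, ∀ᵐ x ∂(volume.restrict K), |c x| ≤ M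

/-- `w ∈ L²(Ω)` has finite energy: `∇w ∈ L²(Ω)` (weak gradient) and `|c|^{1/2} w ∈ L²(Ω)`. -/
def HasFiniteEnergy {n : ℕ} (Ω : Opens (Sp n)) (c : Sp n → ℝ) (w : L2 Ω) : Prop :=
  (∀ i, ∃ g : Sp n → ℝ, MemLp g 2 (mΩ Ω) ∧ HasWeakDeriv Ω (e i) w g) ∧
    Integrable (fun x => |c x| * w x ^ 2) (mΩ Ω)

/-- The bilinear form of `L`, `∫_Ω a ∇w·∇v dx + ∫_Ω c w v dx`. -/
def energyForm {n : ℕ} (Ω : Opens (Sp n)) (a : Sp n → Matrix (Fin n) (Fin n) ℝ) (c : Sp n → ℝ)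
    (w v : L2 Ω) : ℝ :=
  ∫ x, ((∑ i, ∑ j, a x i j * wpartial Ω i w x * wpartial Ω j v x) + c x * w x * v x) ∂(mΩ Ω)

/-- A boundary condition for `L`, given by its form domain `𝒱`: a space of functions of finite
energy that contains `C_c^∞(Ω)` and on which the form of `L` plus a multiple of the `L²` norm
controls the energy. The last condition holds automatically when `c ≥ 0`, or `c` is bounded below.
The Dirichlet condition is `𝒱 = H¹₀(Ω)`, the Neumann condition is `𝒱 = H¹(Ω)` (for bounded `c`). -/
structure IsFormDomain {n : ℕ} (Ω : Opens (Sp n)) (a : Sp n → Matrix (Fin n) (Fin n) ℝ)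
    (c : Sp n → ℝ) (𝒱 : Submodule ℝ (L2 Ω)) : Prop where
  energy : ∀ w ∈ 𝒱, HasFiniteEnergy Ω c w
  test : ∀ (ψ : 𝓓(Ω, ℝ)) (w : L2 Ω), w =ᵐ[mΩ Ω] ψ → w ∈ 𝒱
  coercive : ∃ C₁ C₂ : ℝ, ∀ w ∈ 𝒱,
    ∫ x, ((∑ i, wpartial Ω i w x ^ 2) + |c x| * w x ^ 2) ∂(mΩ Ω) ≤
      C₁ * energyForm Ω a c w w + C₂ * ‖w‖ ^ 2

/-- The orthonormal basis `(φ_k)` of `L²(Ω)` consists of weak eigenfunctions of `L`, with the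
boundary condition `𝒱`, for the nonnegative eigenvalues `λ_0 ≤ λ_1 ≤ ⋯`. -/
structure IsEigenbasis {n : ℕ} (Ω : Opens (Sp n)) (a : Sp n → Matrix (Fin n) (Fin n) ℝ)
    (c : Sp n → ℝ) (𝒱 : Submodule ℝ (L2 Ω)) (lam : ℕ → ℝ) (φ : HilbertBasis ℕ ℝ (L2 Ω)) :
    Prop where
  nonneg : ∀ k, 0 ≤ lam k
  mono : Monotone lam
  mem : ∀ k, φ k ∈ 𝒱
  eigen : ∀ k, ∀ w ∈ 𝒱, energyForm Ω a c (φ k) w = lam k * ∫ x, φ k x * w x ∂(mΩ Ω)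

/-! ### Components and tensor products -/

theorem memLp_component {n : ℕ} {Ω : Opens (Sp n)} (u : L2Cyl Ω) (f : L2 Ω) :
    MemLp (fun t => ∫ x, u (t, x) * (f x : ℂ) ∂(mΩ Ω)) 2 (volume : Measure ℝ) := by
  have hf : AEStronglyMeasurable (fun x => (f x : ℂ)) (mΩ Ω) :=
    Complex.continuous_ofReal.comp_aestronglyMeasurable (Lp.aestronglyMeasurable f)
  have hu : AEStronglyMeasurable u (mCyl Ω) := Lp.aestronglyMeasurable u
  have hm : AEStronglyMeasurable (fun p : ℝ × Sp n => u p * (f p.2 : ℂ)) (mCyl Ω) :=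
    hu.mul hf.comp_snd
  refine ⟨hm.integral_prod_right', ?_⟩
  have h2 : (2 : ENNReal) ≠ 0 := by norm_num
  have hlt : ∀ {X : Type} {F : Type} [MeasurableSpace X] [NormedAddCommGroup F] {μ : Measure X}
      {g : X → F}, eLpNorm g 2 μ < ⊤ ↔ ∫⁻ x, ‖g x‖ₑ ^ (2 : ℝ) ∂μ < ⊤ := by
    intro X F _ _ μ g
    have := eLpNorm_lt_top_iff_lintegral_rpow_enorm_lt_top (f := g) (μ := μ) h2 (by norm_num)
    simpa using this
  rw [hlt]
  have hU : ∫⁻ p, ‖u p‖ₑ ^ (2 : ℝ) ∂(mCyl Ω) < ⊤ := hlt.1 (Lp.eLpNorm_lt_top u)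
  have hF : ∫⁻ x, ‖f x‖ₑ ^ (2 : ℝ) ∂(mΩ Ω) < ⊤ := hlt.1 (Lp.eLpNorm_lt_top f)
  have hum : AEMeasurable (fun p => ‖u p‖ₑ ^ (2 : ℝ)) (mCyl Ω) := hu.enorm.pow_const _
  rw [lintegral_prod _ hum] at hU
  have key : ∀ᵐ t : ℝ, ‖∫ x, u (t, x) * (f x : ℂ) ∂(mΩ Ω)‖ₑ ^ (2 : ℝ) ≤
      (∫⁻ x, ‖u (t, x)‖ₑ ^ (2 : ℝ) ∂(mΩ Ω)) * ∫⁻ x, ‖f x‖ₑ ^ (2 : ℝ) ∂(mΩ Ω) := by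
    filter_upwards [hu.prodMk_left] with t ht
    have h1 : ‖∫ x, u (t, x) * (f x : ℂ) ∂(mΩ Ω)‖ₑ ≤
        ∫⁻ x, ‖u (t, x)‖ₑ * ‖f x‖ₑ ∂(mΩ Ω) := by
      refine (enorm_integral_le_lintegral_enorm _).trans_eq (lintegral_congr fun x => ?_)
      rw [enorm_mul]
      congr 1
      rw [← ofReal_norm, ← ofReal_norm, Complex.norm_real]
    have h3 := h1.trans (ENNReal.lintegral_mul_le_Lp_mul_Lq (mΩ Ω) Real.HolderConjugate.two_two
      ht.enorm (Lp.aestronglyMeasurable f).enorm)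
    calc _ ≤ _ := ENNReal.rpow_le_rpow h3 (by norm_num : (0 : ℝ) ≤ 2)
      _ = _ := by
        rw [ENNReal.mul_rpow_of_nonneg _ _ (by norm_num), ← ENNReal.rpow_mul, ← ENNReal.rpow_mul]
        norm_num
  calc _ ≤ _ := lintegral_mono_ae key
    _ = _ := lintegral_mul_const'' _ hum.lintegral_prod_right'
    _ < ⊤ := ENNReal.mul_lt_top hU hF

theorem memLp_tensor {n : ℕ} {Ω : Opens (Sp n)} (g : Lp ℂ 2 (volume : Measure ℝ)) (τ : ℝ)
    (f : L2 Ω) : MemLp (fun p : ℝ × Sp n => g (p.1 - τ) * (f p.2 : ℂ)) 2 (mCyl Ω) := by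
  have hg : MemLp (fun t => g (t - τ)) 2 (volume : Measure ℝ) :=
    (Lp.memLp g).comp_measurePreserving (measurePreserving_sub_right volume τ)
  have hf : MemLp (fun x => (f x : ℂ)) 2 (mΩ Ω) := (Lp.memLp f).ofReal
  have hm : AEStronglyMeasurable (fun p : ℝ × Sp n => g (p.1 - τ) * (f p.2 : ℂ)) (mCyl Ω) :=
    hg.1.comp_fst.mul hf.1.comp_snd
  refine ⟨hm, ?_⟩
  have h2 : (2 : ENNReal) ≠ 0 := by norm_num
  have h2' : (2 : ENNReal) ≠ ⊤ := by norm_num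
  have h1 := (eLpNorm_lt_top_iff_lintegral_rpow_enorm_lt_top h2 h2').1 hg.2
  have h3 := (eLpNorm_lt_top_iff_lintegral_rpow_enorm_lt_top h2 h2').1 hf.2
  rw [eLpNorm_lt_top_iff_lintegral_rpow_enorm_lt_top h2 h2']
  have h4 : ∀ p : ℝ × Sp n, ‖g (p.1 - τ) * (f p.2 : ℂ)‖ₑ ^ (2 : ENNReal).toReal =
      ‖g (p.1 - τ)‖ₑ ^ (2 : ENNReal).toReal * ‖(f p.2 : ℂ)‖ₑ ^ (2 : ENNReal).toReal := by
    intro p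
    rw [enorm_mul, ENNReal.mul_rpow_of_nonneg _ _ (by norm_num)]
  rw [lintegral_congr h4, lintegral_prod_mul (hg.1.enorm.pow_const _) (hf.1.enorm.pow_const _)]
  exact ENNReal.mul_lt_top h1 h3

/-- `u_k(t) = ∫_Ω u(t, x) φ_k(x) dx`, as an element of `L²(ℝ)`. -/
def component {n : ℕ} {Ω : Opens (Sp n)} (φ : HilbertBasis ℕ ℝ (L2 Ω)) (u : L2Cyl Ω) (k : ℕ) :
    Lp ℂ 2 (volume : Measure ℝ) :=
  (memLp_component u (φ k)).toLp _

/-- The Fourier transform of `u_k` in `t`, normalized as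
`û_k(ρ) = (2π)^{-1/2} ∫ u_k(t) e^{-iρt} dt`. -/
def componentHat {n : ℕ} {Ω : Opens (Sp n)} (φ : HilbertBasis ℕ ℝ (L2 Ω)) (u : L2Cyl Ω) (k : ℕ)
    (ρ : ℝ) : ℂ :=
  ((2 * Real.pi) ^ (-(1 / 2 : ℝ)) : ℝ) *
    (𝓕 (component φ u k) : Lp ℂ 2 (volume : Measure ℝ)) (ρ / (2 * Real.pi))

/-- The symbol `iρ + λ_k` of `H = ∂_t + L`. -/
def symb (lam : ℕ → ℝ) (k : ℕ) (ρ : ℝ) : ℂ := Complex.I * ρ + lam k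

/-- `u ∈ Dom(H^s)`. -/
def MemDomH {n : ℕ} {Ω : Opens (Sp n)} (φ : HilbertBasis ℕ ℝ (L2 Ω)) (lam : ℕ → ℝ) (s : ℝ)
    (u : L2Cyl Ω) : Prop :=
  ∫⁻ ρ : ℝ, ∑' k, ENNReal.ofReal (‖symb lam k ρ‖ ^ s * ‖componentHat φ u k ρ‖ ^ 2) < ⊤

/-- The pairing `⟨H^s u, v⟩` for `u, v ∈ Dom(H^s)`, with the principal branch of the power. -/
def pairH {n : ℕ} {Ω : Opens (Sp n)} (φ : HilbertBasis ℕ ℝ (L2 Ω)) (lam : ℕ → ℝ) (s : ℝ)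
    (u v : L2Cyl Ω) : ℂ :=
  ∫ ρ : ℝ, ∑' k, symb lam k ρ ^ (s : ℂ) * componentHat φ u k ρ * conj (componentHat φ v k ρ)

/-- The semigroup `e^{-τH} u (t, x) = ∑_k e^{-τ λ_k} u_k(t - τ) φ_k(x)`, the series being taken in
`L²(ℝ × Ω)`. -/
def heat {n : ℕ} {Ω : Opens (Sp n)} (φ : HilbertBasis ℕ ℝ (L2 Ω)) (lam : ℕ → ℝ) (τ : ℝ)
    (u : L2Cyl Ω) : L2Cyl Ω :=
  ∑' k, Real.exp (-(τ * lam k)) • (memLp_tensor (component φ u k) τ (φ k)).toLp _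

/-- The extension of `u`, as a curve `y ↦ U(·, ·, y)` in `L²(ℝ × Ω)`, `y > 0`:
`U(y) = y^{2s} / (4^s Γ(s)) ∫_0^∞ e^{-y²/(4τ)} e^{-τH} u dτ / τ^{1+s}`. -/
def extension {n : ℕ} {Ω : Opens (Sp n)} (φ : HilbertBasis ℕ ℝ (L2 Ω)) (lam : ℕ → ℝ) (s : ℝ)
    (u : L2Cyl Ω) (y : ℝ) : L2Cyl Ω :=
  (y ^ (2 * s) / (4 ^ s * Real.Gamma s)) •
    ∫ τ in Ioi (0 : ℝ), (Real.exp (-(y ^ 2 / (4 * τ))) / τ ^ (1 + s)) • heat φ lam τ u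

/-! ### Test functions -/

theorem memLp_test {n : ℕ} {Ω : Opens (Sp n)} (v : 𝓓(cyl Ω, ℝ)) :
    MemLp (fun p => (v p : ℂ)) 2 (mCyl Ω) :=
  (Complex.continuous_ofReal.comp v.continuous).memLp_of_hasCompactSupport
    (v.hasCompactSupport.comp_left Complex.ofReal_zero)

/-- A test function on `ℝ × Ω` as an element of `L²(ℝ × Ω)`. -/
def testL2 {n : ℕ} {Ω : Opens (Sp n)} (v : 𝓓(cyl Ω, ℝ)) : L2Cyl Ω := (memLp_test v).toLp _

/-- The trace `V(·, ·, 0)` of a test function `V`. -/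
def bottom {n : ℕ} {Ω : Opens (Sp n)} (V : 𝓓(fullCyl Ω, ℝ)) : 𝓓(cyl Ω, ℝ) where
  toFun := fun p => V (p.1, p.2, 0)
  contDiff' := V.contDiff.comp (contDiff_fst.prodMk (contDiff_snd.prodMk contDiff_const))
  hasCompactSupport' := by
    have hemb : Topology.IsClosedEmbedding (fun p : ℝ × Sp n => (p.1, p.2, (0 : ℝ))) :=
      .of_continuous_injective_isClosedMap (by fun_prop)
        (fun p q h => by simp only [Prod.mk.injEq] at h; exact Prod.ext h.1 h.2.1)
        (fun s hs => by
          have : (fun p : ℝ × Sp n => (p.1, p.2, (0 : ℝ))) '' s =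
              (fun q : ℝ × Sp n × ℝ => (q.1, q.2.1)) ⁻¹' s ∩ {q | q.2.2 = 0} := by
            ext ⟨t, x, y⟩
            simp only [mem_image, Prod.mk.injEq, Prod.exists, mem_inter_iff, mem_preimage,
              mem_ofPred_eq]
            constructor
            · rintro ⟨t', x', h, rfl, rfl, rfl⟩
              exact ⟨h, rfl⟩
            · rintro ⟨h, rfl⟩
              exact ⟨t, x, h, rfl, rfl, rfl⟩
          rw [this]
          exact (hs.preimage (by fun_prop)).inter (isClosed_eq (by fun_prop) continuous_const))
    exact V.hasCompactSupport.comp_isClosedEmbedding hemb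
  tsupport_subset' := by
    intro p hp
    have h := V.tsupport_subset (tsupport_comp_subset_preimage V
      (f := fun p : ℝ × Sp n => (p.1, p.2, (0 : ℝ))) (by fun_prop) hp)
    exact ⟨mem_univ _, h.2.1⟩

/-! ### The space `L²(ℝ; H¹_{L,y}(D))` -/

/-- `∫_0^∞ y^{1-2s} ∑_k λ_k |w_k(y)|² dy`, where `w_k(y) = ∫_Ω w(x, y) φ_k(x) dx`. -/
def spectralEnergy {n : ℕ} {Ω : Opens (Sp n)} (φ : HilbertBasis ℕ ℝ (L2 Ω)) (lam : ℕ → ℝ) (s : ℝ)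
    (w : Sp n × ℝ → ℂ) : ENNReal :=
  ∫⁻ y, ∑' k, ENNReal.ofReal (lam k * ‖∫ x, w (x, y) * (φ k x : ℂ) ∂(mΩ Ω)‖ ^ 2) ∂(wMeas s)

/-- `w ∈ H¹_{L,y}(D)`, with weak derivatives `∇_x w = g` and `∂_y w = h`. The two expressions
`∫∫ y^{1-2s} (a ∇w·∇w + c w²)` and `∫ y^{1-2s} ∑_k λ_k |w_k(y)|²` for the part of the energy in `x`
are finite and agree. -/
structure MemH1 {n : ℕ} (Ω : Opens (Sp n)) (a : Sp n → Matrix (Fin n) (Fin n) ℝ) (c : Sp n → ℝ)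
    (φ : HilbertBasis ℕ ℝ (L2 Ω)) (lam : ℕ → ℝ) (s : ℝ) (w : Sp n × ℝ → ℂ)
    (g : Fin n → Sp n × ℝ → ℂ) (h : Sp n × ℝ → ℂ) : Prop where
  memLp : MemLp w 2 (mD Ω s)
  weak_x : ∀ i, HasWeakDeriv (halfCyl Ω) (e i, 0) w (g i)
  weak_y : HasWeakDeriv (halfCyl Ω) (0, 1) w h
  memLp_x : ∀ i, MemLp (g i) 2 (mD Ω s)
  memLp_y : MemLp h 2 (mD Ω s)
  memLp_c : Integrable (fun q => |c q.1| * ‖w q‖ ^ 2) (mD Ω s)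
  spectral : spectralEnergy φ lam s w < ⊤
  energy_eq : ∫ q, ((∑ i, ∑ j, a q.1 i j * (g i q * conj (g j q)).re) + c q.1 * ‖w q‖ ^ 2) ∂(mD Ω s) =
    (spectralEnergy φ lam s w).toReal

/-- The square of the norm of `w` in `H¹_{L,y}(D)`, where `h = ∂_y w`. -/
def normSqH1 {n : ℕ} {Ω : Opens (Sp n)} (φ : HilbertBasis ℕ ℝ (L2 Ω)) (lam : ℕ → ℝ) (s : ℝ)
    (w h : Sp n × ℝ → ℂ) : ENNReal :=
  ∫⁻ q, ‖w q‖ₑ ^ 2 ∂(mD Ω s) + (spectralEnergy φ lam s w + ∫⁻ q, ‖h q‖ₑ ^ 2 ∂(mD Ω s))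

/-- `U ∈ L²(ℝ; H¹_{L,y}(D))`, where `U` is a function of `(t, x, y)` with weak derivatives
`∇_x U = G` and `∂_y U = Y`. -/
structure MemL2H1 {n : ℕ} (Ω : Opens (Sp n)) (a : Sp n → Matrix (Fin n) (Fin n) ℝ) (c : Sp n → ℝ)
    (φ : HilbertBasis ℕ ℝ (L2 Ω)) (lam : ℕ → ℝ) (s : ℝ) (U : ℝ × Sp n × ℝ → ℂ)
    (G : Fin n → ℝ × Sp n × ℝ → ℂ) (Y : ℝ × Sp n × ℝ → ℂ) : Prop where
  meas : AEStronglyMeasurable U (mExt Ω s)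
  memLp_x : ∀ i, MemLp (G i) 2 (mExt Ω s)
  meas_y : AEStronglyMeasurable Y (mExt Ω s)
  mem : ∀ᵐ t : ℝ, MemH1 Ω a c φ lam s (fun q => U (t, q)) (fun i q => G i (t, q)) (fun q => Y (t, q))
  norm : ∫⁻ t : ℝ, normSqH1 (Ω := Ω) φ lam s (fun q => U (t, q)) (fun q => Y (t, q)) < ⊤

/-- For every `y > 0`, the function `U` of `(t, x, y)` represents the curve `y ↦ 𝒰 y` in
`L²(ℝ × Ω)`, `G` its weak gradient in `x`, and `Y` its derivative in `y`. -/
structure Represents {n : ℕ} (Ω : Opens (Sp n)) (𝒰 : ℝ → L2Cyl Ω) (U : ℝ × Sp n × ℝ → ℂ)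
    (G : Fin n → ℝ × Sp n × ℝ → ℂ) (Y : ℝ × Sp n × ℝ → ℂ) : Prop where
  val : ∀ y : ℝ, 0 < y → (fun p : ℝ × Sp n => U (p.1, p.2, y)) =ᵐ[mCyl Ω] (𝒰 y : L2Cyl Ω)
  grad : ∀ y : ℝ, 0 < y → ∀ i, MemLp (fun p : ℝ × Sp n => G i (p.1, p.2, y)) 2 (mCyl Ω) ∧
    HasWeakDeriv (cyl Ω) (0, e i) (fun p => U (p.1, p.2, y)) (fun p => G i (p.1, p.2, y))
  dy : ∀ y : ℝ, 0 < y → (fun p : ℝ × Sp n => Y (p.1, p.2, y)) =ᵐ[mCyl Ω]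
    (deriv 𝒰 y : L2Cyl Ω)

end ParabolicExtension

end

open ParabolicExtension

noncomputable section

namespace ParabolicExtension

section

/-! ### The subordination integral -/

section Subordination

variable {E : Type*} [NormedAddCommGroup E] [NormedSpace ℝ E]

/-! The spectral transform `u ↦ (û_k(ρ))` is an isometry of `L²(ℝ × Ω)` into `L²(ℝ × ℕ)`. It turns
`e^{-τH}` into multiplication by `e^{-τz}`, where `z = iρ + λ_k` (`specFun_heat`), and hence the
extension into multiplication by a scalar function `m_z(y)`, the normalized subordination integral
of `e^{-τz}` (`specFun_extension`). Since `u` has no component with `λ_k = 0`, only `Re z > 0`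
matters, and monotonicity of the eigenvalues bounds the positive ones below by some `δ > 0`.

The scalar theory rests on one recursion, `subord_expo_recursion`, obtained by integrating a
`τ`-derivative. With exponent `s` it is the Bessel equation `(y^{1-2s} m')' = y^{1-2s} z m`. With
exponent `s - 1` it shows that the flux `q = y^{1-2s} m'` is a multiple of `z ∫ e^{-y²/(4τ)} τ^{-s}
e^{-τz} dτ`. Consequently `q` tends to `-κ z^s` at `y = 0`, with `κ = Γ(1-s)/(4^{s-1/2} Γ(s))`,
tends to `0` at infinity, and is bounded by a multiple of `|z| (Re z)^{s-1}` uniformly in `y`. The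
identity `(Re(q conj m))' = y^{1-2s} (|m'|² + Re z |m|²)` then bounds the energy of `m` by `κ |z|^s`
(`lintegral_energy_subExt_expo`). Integrating against `|û_k(ρ)|²` gives the finite energy of `U` for
`u ∈ Dom(H^s)` (`lintegral_energy_extension`). Smoothness in `y` and continuity at `0` need only
that `e^{-τH}` is a bounded strongly continuous semigroup.

To pass from the spectral side to `x`-derivatives, the first order data of an element of the form
domain are its weak gradient together with `|c|^{1/2} w`. In these data the form of `L` has bounded
coefficients although `c` need not be bounded. Coercivity bounds the data of `∑ b_k φ_k` by `∑ (1 +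
λ_k) b_k²`, so the series of tensor products converge in `L²` and produce the weak gradient of `U`
(`hasSum_jetCyl`, `hasWeakDeriv_jetCyl`). The eigenfunction equation, used on almost every time
slice of a test function, diagonalizes the form (`hasSum_formLp`), while `∂_t` becomes `iρ`
(`specFun_dirDeriv_time`). Together they give the equation at fixed `y`, `weak_equation_slice`.

Membership in `L²(ℝ; H¹_{L,y}(D))` concerns individual functions of `(x, y)` for almost every `t`.
Jointly measurable representatives are chosen that are correct for every `y > 0`. Fatou's lemma
gives, for almost every slice, a subsequence of the eigenfunction expansion that converges together
with its first order data (`ae_liminf_eq_zero`, `isFormSlice_of_liminf`). The derivative in `y` is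
obtained by writing `U` pointwise as the primitive of its derivative (`ae_eq_add_primitive`).

The global identity `weak_form` comes from integrating `d/dy ⟨y^{1-2s} ∂_y U, V(y)⟩` over `(0, ∞)`.
The boundary term at `0` is the pairing with `H^s u`. For fixed `V` it is dominated convergence on
the spectral side. Replacing `V(y)` by `V(0)` uses that the flux is bounded, uniformly in `y`, as a
functional on `L²(ℝ; Dom(L^{1/2})) ∩ H¹(ℝ; L²(Ω))` (`exists_enorm_inner_flux_le`), and that `V(y)`
tends to `V(0)` in that norm (`tendsto_parabolicNormSq`). -/

/-- The kernel `e^{-p/τ} τ^{-1-r}`. -/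
def subKernel (r p τ : ℝ) : ℝ := Real.exp (-(p / τ)) / τ ^ (1 + r)

/-- The subordination integral `∫_0^∞ e^{-p/τ} τ^{-1-r} h(τ) dτ`. -/
def subord (h : ℝ → E) (r p : ℝ) : E := ∫ τ in Ioi (0 : ℝ), subKernel r p τ • h τ

theorem subKernel_nonneg (r p : ℝ) {τ : ℝ} (hτ : 0 < τ) : 0 ≤ subKernel r p τ := by
  unfold subKernel; positivity

theorem continuousOn_subKernel (r p : ℝ) : ContinuousOn (subKernel r p) (Ioi 0) := by
  intro τ hτ
  have h0 : τ ≠ 0 := (mem_Ioi.1 hτ).ne'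
  unfold subKernel
  refine ContinuousAt.continuousWithinAt ?_
  refine ContinuousAt.div ?_ (Real.continuousAt_rpow_const _ _ (Or.inl h0))
    (Real.rpow_pos_of_pos hτ _).ne'
  exact (Real.continuous_exp.continuousAt).comp ((continuousAt_const.div continuousAt_id h0).neg)

/-- The substitution `τ = 1/x` turns the kernel into the Gamma integrand `x^{r-1} e^{-px}`. The
right-hand side has the shape of the change of variables formula for powers, with exponent `-1`, so
that both integrability and the value of the integral follow. -/
theorem subKernel_eq_comp_inv (r p : ℝ) {τ : ℝ} (hτ : 0 < τ) :
    subKernel r p τ =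
      (|(-1 : ℝ)| * τ ^ ((-1 : ℝ) - 1)) •
        ((τ ^ (-1 : ℝ)) ^ (r - 1) * Real.exp (-(p * τ ^ (-1 : ℝ)))) := by
  unfold subKernel
  rw [← Real.rpow_mul hτ.le, abs_neg, abs_one, one_mul, smul_eq_mul, ← mul_assoc,
    ← Real.rpow_add hτ, Real.rpow_neg_one, div_eq_mul_inv p, div_eq_mul_inv, mul_comm,
    ← Real.rpow_neg hτ.le]
  ring_nf

theorem integrableOn_subKernel {r p : ℝ} (hr : 0 < r) (hp : 0 < p) :
    IntegrableOn (subKernel r p) (Ioi 0) := by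
  have h1 : IntegrableOn (fun x : ℝ => x ^ (r - 1) * Real.exp (-(p * x))) (Ioi 0) := by
    have := integrableOn_rpow_mul_exp_neg_mul_rpow (s := r - 1) (by linarith) one_pos hp
    simpa using this
  have h2 := (integrableOn_Ioi_comp_rpow_iff _ (by norm_num : (-1 : ℝ) ≠ 0)).2 h1
  exact h2.congr_fun (fun τ hτ => (subKernel_eq_comp_inv r p hτ).symm) measurableSet_Ioi

theorem integral_subKernel {r p : ℝ} (hr : 0 < r) (hp : 0 < p) :
    ∫ τ in Ioi (0 : ℝ), subKernel r p τ = (1 / p) ^ r * Real.Gamma r := by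
  rw [← Real.integral_rpow_mul_exp_neg_mul_Ioi hr hp,
    ← integral_comp_rpow_Ioi (fun x : ℝ => x ^ (r - 1) * Real.exp (-(p * x)))
      (by norm_num : (-1 : ℝ) ≠ 0)]
  exact setIntegral_congr_fun measurableSet_Ioi fun τ hτ => subKernel_eq_comp_inv r p hτ

theorem integrableOn_subKernel_smul {h : ℝ → E} {M r p : ℝ}
    (hm : AEStronglyMeasurable h (volume.restrict (Ioi 0))) (hM : ∀ τ > 0, ‖h τ‖ ≤ M)
    (hr : 0 < r) (hp : 0 < p) : IntegrableOn (fun τ => subKernel r p τ • h τ) (Ioi 0) := by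
  refine Integrable.smul_bdd (integrableOn_subKernel hr hp) M hm ?_
  exact (ae_restrict_iff' measurableSet_Ioi).2 (ae_of_all _ fun τ hτ => hM τ hτ)

theorem subKernel_mono (r : ℝ) {p q τ : ℝ} (hpq : p ≤ q) (hτ : 0 < τ) :
    subKernel r q τ ≤ subKernel r p τ := by
  unfold subKernel
  gcongr

theorem hasDerivAt_subKernel (r p : ℝ) {τ : ℝ} (hτ : 0 < τ) :
    HasDerivAt (fun p => subKernel r p τ) (-subKernel (r + 1) p τ) p := by
  unfold subKernel
  have h := ((((hasDerivAt_id p).div_const τ).neg).exp).div_const (τ ^ (1 + r))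
  convert! h using 1
  rw [show 1 + (r + 1) = (1 + r) + 1 by ring, Real.rpow_add hτ, Real.rpow_one]
  have := (Real.rpow_pos_of_pos hτ (1 + r)).ne'
  simp only [id_eq, Pi.neg_apply]
  field_simp

/-- Differentiation in `p` brings down `-1/τ`, which raises `r` by one. The kernel decreases in `p`,
so on `q > p/2` its value at `p/2` serves as dominating function. -/
theorem hasDerivAt_subord {h : ℝ → E} {M r p : ℝ}
    (hm : AEStronglyMeasurable h (volume.restrict (Ioi 0))) (hM : ∀ τ > 0, ‖h τ‖ ≤ M)
    (hr : 0 < r) (hp : 0 < p) : HasDerivAt (subord h r) (-subord h (r + 1) p) p := by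
  have hmk : ∀ r p, AEStronglyMeasurable (fun τ => subKernel r p τ • h τ)
      (volume.restrict (Ioi 0)) := fun r p =>
    ((continuousOn_subKernel r p).aestronglyMeasurable measurableSet_Ioi).smul hm
  have key := hasDerivAt_integral_of_dominated_loc_of_deriv_le
    (μ := volume.restrict (Ioi (0 : ℝ))) (F := fun p τ => subKernel r p τ • h τ)
    (F' := fun p τ => (-subKernel (r + 1) p τ) • h τ) (x₀ := p)
    (bound := fun τ => subKernel (r + 1) (p / 2) τ * M) (s := Ioi (p / 2))
    (Ioi_mem_nhds (by linarith)) (Eventually.of_forall fun q => hmk r q)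
    (integrableOn_subKernel_smul hm hM hr hp) (by simpa only [neg_smul] using! (hmk (r + 1) p).neg)
    ?_ ((integrableOn_subKernel (by linarith) (by linarith)).mul_const M) ?_
  · have := key.2
    simp only [neg_smul, integral_neg] at this
    exact this
  · refine (ae_restrict_iff' measurableSet_Ioi).2 (ae_of_all _ fun τ hτ q hq => ?_)
    rw [norm_smul, norm_neg, Real.norm_of_nonneg (subKernel_nonneg _ _ hτ)]
    exact mul_le_mul (subKernel_mono _ (le_of_lt hq) hτ) (hM τ hτ) (norm_nonneg _)
      (subKernel_nonneg _ _ hτ)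
  · refine (ae_restrict_iff' measurableSet_Ioi).2 (ae_of_all _ fun τ hτ q hq => ?_)
    exact (hasDerivAt_subKernel r q hτ).smul_const (h τ)

/-- Each derivative changes `r` to `r + 1`, so the induction on the order must leave `r` free. -/
theorem contDiffOn_subord {h : ℝ → E} {M : ℝ}
    (hm : AEStronglyMeasurable h (volume.restrict (Ioi 0))) (hM : ∀ τ > 0, ‖h τ‖ ≤ M)
    (n : ℕ) : ∀ {r : ℝ}, 0 < r → ContDiffOn ℝ n (subord h r) (Ioi 0) := by
  induction n with
  | zero =>
    intro r hr
    rw [Nat.cast_zero, contDiffOn_zero]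
    exact fun p hp => (hasDerivAt_subord hm hM hr hp).continuousAt.continuousWithinAt
  | succ n ih =>
    intro r hr
    rw [Nat.cast_succ, contDiffOn_succ_iff_deriv_of_isOpen isOpen_Ioi]
    refine ⟨fun p hp => (hasDerivAt_subord hm hM hr hp).differentiableAt.differentiableWithinAt,
      by simp, ?_⟩
    exact (ih (r := r + 1) (by linarith)).neg.congr fun p hp =>
      (hasDerivAt_subord hm hM hr hp).deriv

/-- The normalized subordination integral
`y^{2s} / (4^s Γ(s)) ∫_0^∞ e^{-y²/(4τ)} τ^{-1-s} h(τ) dτ`. -/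
def subExt (s : ℝ) (h : ℝ → E) (y : ℝ) : E :=
  (y ^ (2 * s) / (4 ^ s * Real.Gamma s)) • subord h s (y ^ 2 / 4)

theorem contDiffOn_subExt {h : ℝ → E} {M s : ℝ}
    (hm : AEStronglyMeasurable h (volume.restrict (Ioi 0))) (hM : ∀ τ > 0, ‖h τ‖ ≤ M)
    (hs : 0 < s) : ContDiffOn ℝ ∞ (subExt s h) (Ioi 0) := by
  have h1 : ContDiffOn ℝ ∞ (subord h s) (Ioi 0) :=
    contDiffOn_infty.2 fun n => contDiffOn_subord hm hM n hs
  refine ContDiffOn.smul ?_ (h1.comp (f := fun y : ℝ => y ^ 2 / 4) (by fun_prop) ?_)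
  · refine ContDiffOn.div_const (fun y hy => ?_) _
    exact (Real.contDiffAt_rpow_const_of_ne (mem_Ioi.1 hy).ne').contDiffWithinAt
  · intro y hy
    have : 0 < y := hy
    simp only [mem_Ioi]; positivity

/-- The kernel at scale `1`, a probability density on `(0, ∞)`. -/
theorem integral_subKernel_quarter {s : ℝ} (hs : 0 < s) :
    ∫ τ in Ioi (0 : ℝ), subKernel s (1 / 4) τ = 4 ^ s * Real.Gamma s := by
  rw [integral_subKernel hs (by norm_num)]
  norm_num

/-- The scaling `τ = y²σ` removes `y` from the kernel and exhibits `subExt` as an average of the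
values `h (y²σ)` against a fixed probability density. The bound by `sup ‖h‖` and the limit as `y →
0` are read off from this form. -/
theorem subExt_eq {h : ℝ → E} {s y : ℝ} (hy : 0 < y) :
    subExt s h y = (4 ^ s * Real.Gamma s)⁻¹ •
      ∫ σ in Ioi (0 : ℝ), subKernel s (1 / 4) σ • h (y ^ 2 * σ) := by
  have hy2 : 0 < y ^ 2 := by positivity
  have h1 := integral_comp_mul_left_Ioi (fun τ => subKernel s (y ^ 2 / 4) τ • h τ) 0 hy2
  rw [mul_zero] at h1
  have h2 : ∫ τ in Ioi (0 : ℝ), subKernel s (y ^ 2 / 4) τ • h τ =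
      (y ^ 2) • ∫ σ in Ioi (0 : ℝ), subKernel s (y ^ 2 / 4) (y ^ 2 * σ) • h (y ^ 2 * σ) := by
    rw [h1, smul_smul, mul_inv_cancel₀ hy2.ne', one_smul]
  unfold subExt subord
  rw [h2, div_eq_mul_inv, mul_comm, mul_smul, ← integral_smul, ← integral_smul]
  congr 1
  refine setIntegral_congr_fun measurableSet_Ioi fun σ hσ => ?_
  have hσ : 0 < σ := hσ
  simp only [smul_smul]
  congr 1
  unfold subKernel
  rw [Real.mul_rpow hy2.le hσ.le, ← Real.rpow_natCast y 2, ← Real.rpow_mul hy.le]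
  have e1 : y ^ (((2 : ℕ) : ℝ) * (1 + s)) = y ^ ((2 : ℕ) : ℝ) * y ^ (2 * s) := by
    rw [← Real.rpow_add hy]; push_cast; ring_nf
  have e2 : y ^ ((2 : ℕ) : ℝ) / 4 / (y ^ ((2 : ℕ) : ℝ) * σ) = 1 / 4 / σ := by
    have := (Real.rpow_pos_of_pos hy ((2 : ℕ) : ℝ)).ne'
    field_simp
  rw [e1, e2]
  have := (Real.rpow_pos_of_pos hy ((2 : ℕ) : ℝ)).ne'
  have := (Real.rpow_pos_of_pos hy (2 * s)).ne'
  have := (Real.rpow_pos_of_pos hσ (1 + s)).ne'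
  field_simp

theorem norm_subExt_le {h : ℝ → E} {M s y : ℝ} (hM : ∀ τ > 0, ‖h τ‖ ≤ M) (hs : 0 < s)
    (hy : 0 < y) : ‖subExt s h y‖ ≤ M := by
  have hG : 0 < 4 ^ s * Real.Gamma s := by have := Real.Gamma_pos_of_pos hs; positivity
  rw [subExt_eq hy, norm_smul, norm_inv, Real.norm_of_nonneg hG.le, inv_mul_le_iff₀ hG]
  refine (norm_integral_le_of_norm_le
    ((integrableOn_subKernel hs (by norm_num : (0 : ℝ) < 1 / 4)).mul_const M) ?_).trans_eq ?_
  · refine (ae_restrict_iff' measurableSet_Ioi).2 (ae_of_all _ fun σ hσ => ?_)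
    have hσ : 0 < σ := hσ
    rw [norm_smul, Real.norm_of_nonneg (subKernel_nonneg _ _ hσ)]
    exact mul_le_mul_of_nonneg_left (hM _ (by positivity)) (subKernel_nonneg _ _ hσ)
  · rw [integral_mul_const, integral_subKernel_quarter hs]

theorem tendsto_subExt [CompleteSpace E] {h : ℝ → E} {M s : ℝ} {l : E}
    (hm : ContinuousOn h (Ioi 0)) (hM : ∀ τ > 0, ‖h τ‖ ≤ M)
    (hs : 0 < s) (hl : Tendsto h (𝓝[>] 0) (𝓝 l)) : Tendsto (subExt s h) (𝓝[>] 0) (𝓝 l) := by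
  have hG : 0 < 4 ^ s * Real.Gamma s := by have := Real.Gamma_pos_of_pos hs; positivity
  have h1 : Tendsto (fun y : ℝ => ∫ σ in Ioi (0 : ℝ), subKernel s (1 / 4) σ • h (y ^ 2 * σ))
      (𝓝[>] 0) (𝓝 (∫ σ in Ioi (0 : ℝ), subKernel s (1 / 4) σ • l)) := by
    refine tendsto_integral_filter_of_dominated_convergence
      (fun σ => subKernel s (1 / 4) σ * M) ?_ ?_
      ((integrableOn_subKernel hs (by norm_num : (0 : ℝ) < 1 / 4)).mul_const M) ?_
    · filter_upwards [self_mem_nhdsWithin] with y hy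
      have hy : 0 < y := hy
      refine ((continuousOn_subKernel s (1 / 4)).smul
        (hm.comp (by fun_prop) ?_)).aestronglyMeasurable measurableSet_Ioi
      intro σ hσ
      have hσ : 0 < σ := hσ
      exact mem_Ioi.2 (by positivity)
    · filter_upwards [self_mem_nhdsWithin] with y hy
      have hy : 0 < y := hy
      refine (ae_restrict_iff' measurableSet_Ioi).2 (ae_of_all _ fun σ hσ => ?_)
      have hσ : 0 < σ := hσ
      rw [norm_smul, Real.norm_of_nonneg (subKernel_nonneg _ _ hσ)]
      exact mul_le_mul_of_nonneg_left (hM _ (by positivity)) (subKernel_nonneg _ _ hσ)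
    · refine (ae_restrict_iff' measurableSet_Ioi).2 (ae_of_all _ fun σ hσ => ?_)
      have hσ : 0 < σ := hσ
      refine (hl.comp (tendsto_nhdsWithin_iff.2 ⟨?_, ?_⟩)).const_smul _
      · have : Tendsto (fun y : ℝ => y ^ 2 * σ) (𝓝 0) (𝓝 (0 ^ 2 * σ)) :=
          Continuous.tendsto (by fun_prop) 0
        simp only [ne_eq, OfNat.ofNat_ne_zero, not_false_eq_true, zero_pow, zero_mul] at this
        exact this.mono_left nhdsWithin_le_nhds
      · filter_upwards [self_mem_nhdsWithin] with y hy
        have hy : 0 < y := hy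
        exact mem_Ioi.2 (by positivity)
  have h2 := h1.const_smul (4 ^ s * Real.Gamma s)⁻¹
  rw [integral_smul_const, integral_subKernel_quarter hs, smul_smul, inv_mul_cancel₀ hG.ne',
    one_smul] at h2
  refine h2.congr' ?_
  filter_upwards [self_mem_nhdsWithin] with y hy
  exact (subExt_eq hy).symm

/-- `y^{1-2s} d/dy` of the normalized subordination integral. -/
def subExtFlux (s : ℝ) (h : ℝ → E) (y : ℝ) : E :=
  (4 ^ s * Real.Gamma s)⁻¹ •
    ((2 * s) • subord h s (y ^ 2 / 4) - (y ^ 2 / 2) • subord h (s + 1) (y ^ 2 / 4))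

theorem hasDerivAt_subord_sq {h : ℝ → E} {M r y : ℝ}
    (hm : AEStronglyMeasurable h (volume.restrict (Ioi 0))) (hM : ∀ τ > 0, ‖h τ‖ ≤ M)
    (hr : 0 < r) (hy : 0 < y) :
    HasDerivAt (fun y : ℝ => subord h r (y ^ 2 / 4)) (-(y / 2) • subord h (r + 1) (y ^ 2 / 4))
      y := by
  have h1 := hasDerivAt_subord hm hM hr (p := y ^ 2 / 4) (by positivity)
  have h2 : HasDerivAt (fun y : ℝ => y ^ 2 / 4) (y / 2) y := by
    convert! (hasDerivAt_pow 2 y).div_const 4 using 1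
    simp only [Nat.cast_ofNat, Nat.add_one_sub_one, pow_one]; ring
  have h3 := h1.scomp y h2
  convert! h3 using 1
  simp

theorem hasDerivAt_subExt {h : ℝ → E} {M s y : ℝ}
    (hm : AEStronglyMeasurable h (volume.restrict (Ioi 0))) (hM : ∀ τ > 0, ‖h τ‖ ≤ M)
    (hs : 0 < s) (hy : 0 < y) :
    HasDerivAt (subExt s h) (y ^ (2 * s - 1) • subExtFlux s h y) y := by
  have h1 := hasDerivAt_subord_sq hm hM hs hy
  have h2 := ((Real.hasDerivAt_rpow_const (p := 2 * s) (Or.inl hy.ne')).div_const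
    (4 ^ s * Real.Gamma s)).smul h1
  convert! h2 using 1
  unfold subExtFlux
  rw [smul_smul, smul_sub, smul_smul, smul_smul, smul_smul, sub_eq_neg_add, ← neg_smul]
  have e : y ^ (2 * s) = y ^ (2 * s - 1) * y := by
    rw [← Real.rpow_add_one hy.ne']; ring_nf
  rw [e]
  congr 2 <;> ring

/-- The terms with `subord h (s + 1)` are collected so that the bracket is the left-hand side of
`subord_expo_recursion` with `r = s` and `p = y²/4`. -/
theorem hasDerivAt_subExtFlux {h : ℝ → E} {M s y : ℝ}
    (hm : AEStronglyMeasurable h (volume.restrict (Ioi 0))) (hM : ∀ τ > 0, ‖h τ‖ ≤ M)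
    (hs : 0 < s) (hy : 0 < y) :
    HasDerivAt (subExtFlux s h) ((y * (4 ^ s * Real.Gamma s)⁻¹) •
      ((y ^ 2 / 4) • subord h (s + 2) (y ^ 2 / 4) - (1 + s) • subord h (s + 1) (y ^ 2 / 4))) y := by
  have h1 := hasDerivAt_subord_sq hm hM hs hy
  have h2 := hasDerivAt_subord_sq hm hM (r := s + 1) (by linarith) hy
  have h3 : HasDerivAt (fun y : ℝ => y ^ 2 / 2) y y := by
    convert! (hasDerivAt_pow 2 y).div_const 2 using 1
    simp
  have h4 := ((h1.const_smul (2 * s)).sub (h3.smul h2)).const_smul (4 ^ s * Real.Gamma s)⁻¹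
  convert! h4 using 1
  rw [mul_comm, mul_smul, show s + 1 + 1 = s + 2 by ring]
  congr 1
  module

end Subordination

end

/-! ### The fundamental theorem of calculus on a half line, with limits at both ends -/

section

/-- Redefining `f` at `a` as its limit from the right makes it continuous there and changes no
derivative on `(a, ∞)`. In this way the value that an expression such as a power of `y` takes at `0`
plays no role. -/
theorem integral_Ioi_of_hasDerivAt_of_tendsto_nhdsGT {E : Type*} [NormedAddCommGroup E]
    [NormedSpace ℝ E] [CompleteSpace E] {f f' : ℝ → E} {a : ℝ} {l m : E}
    (hderiv : ∀ x ∈ Ioi a, HasDerivAt f (f' x) x) (f'int : IntegrableOn f' (Ioi a))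
    (h0 : Tendsto f (𝓝[>] a) (𝓝 l)) (hf : Tendsto f atTop (𝓝 m)) :
    ∫ x in Ioi a, f' x = m - l := by
  rw [← Ici_sdiff_left] at h0
  have hd : ∀ x ∈ Ioi a, HasDerivAt (Function.update f a l) (f' x) x := by
    intro x (hx : a < x)
    apply (hderiv x hx).congr_of_eventuallyEq
    filter_upwards [eventually_ne_nhds hx.ne'] with y hy
    exact Function.update_of_ne hy l f
  have ht : Tendsto (Function.update f a l) atTop (𝓝 m) := by
    apply hf.congr'
    filter_upwards [eventually_ne_atTop a] with x hx
    exact (Function.update_of_ne hx l f).symm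
  simpa using integral_Ioi_of_hasDerivAt_of_tendsto (continuousWithinAt_update_same.mpr h0)
    hd f'int ht

theorem integrableOn_Ioi_deriv_of_nonneg_nhdsGT {f f' : ℝ → ℝ} {a l m : ℝ}
    (hderiv : ∀ x ∈ Ioi a, HasDerivAt f (f' x) x) (hpos : ∀ x ∈ Ioi a, 0 ≤ f' x)
    (h0 : Tendsto f (𝓝[>] a) (𝓝 l)) (hf : Tendsto f atTop (𝓝 m)) : IntegrableOn f' (Ioi a) := by
  rw [← Ici_sdiff_left] at h0
  have hd : ∀ x ∈ Ioi a, HasDerivAt (Function.update f a l) (f' x) x := by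
    intro x (hx : a < x)
    apply (hderiv x hx).congr_of_eventuallyEq
    filter_upwards [eventually_ne_nhds hx.ne'] with y hy
    exact Function.update_of_ne hy l f
  have ht : Tendsto (Function.update f a l) atTop (𝓝 m) := by
    apply hf.congr'
    filter_upwards [eventually_ne_atTop a] with x hx
    exact (Function.update_of_ne hx l f).symm
  exact integrableOn_Ioi_deriv_of_nonneg (continuousWithinAt_update_same.mpr h0) hd hpos ht

/-! ### The exponential as input of the subordination integral -/

/-- `τ ↦ e^{-τz}`. -/
def expo (z : ℂ) (τ : ℝ) : ℂ := Complex.exp (-(τ * z))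

theorem norm_expo (z : ℂ) (τ : ℝ) : ‖expo z τ‖ = Real.exp (-(τ * z.re)) := by
  simp [expo, Complex.norm_exp]

theorem norm_expo_le_one {z : ℂ} (hz : 0 ≤ z.re) {τ : ℝ} (hτ : 0 ≤ τ) : ‖expo z τ‖ ≤ 1 := by
  rw [norm_expo, Real.exp_le_one_iff]
  nlinarith [mul_nonneg hτ hz]

theorem continuous_expo (z : ℂ) : Continuous (expo z) := by unfold expo; fun_prop

theorem hasDerivAt_expo (z : ℂ) (τ : ℝ) : HasDerivAt (expo z) (-z * expo z τ) τ := by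
  have h : HasDerivAt (fun τ : ℝ => -((τ : ℂ) * z)) (-(1 * z)) τ :=
    ((Complex.ofRealCLM.hasDerivAt (x := τ)).mul_const z).neg
  convert! h.cexp using 1
  unfold expo; ring

theorem integrableOn_rpow_mul_expo {a : ℝ} (ha : -1 < a) {z : ℂ} (hz : 0 < z.re) :
    IntegrableOn (fun τ : ℝ => τ ^ a • expo z τ) (Ioi 0) := by
  have h1 := integrableOn_rpow_mul_exp_neg_mul_rpow ha one_pos hz
  refine Integrable.mono' h1 ?_ ?_
  · refine ContinuousOn.aestronglyMeasurable (fun τ hτ => ?_) measurableSet_Ioi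
    exact ((Real.continuousAt_rpow_const _ _ (Or.inl (mem_Ioi.1 hτ).ne')).smul
      (continuous_expo z).continuousAt).continuousWithinAt
  · refine (ae_restrict_iff' measurableSet_Ioi).2 (ae_of_all _ fun τ hτ => ?_)
    have hτ : 0 < τ := hτ
    rw [norm_smul, norm_expo, Real.norm_of_nonneg (by positivity), Real.rpow_one,
      neg_mul, mul_comm z.re]

theorem integral_rpow_smul_expo_ofReal {a : ℝ} (ha : 0 < a) {x : ℝ} (hx : 0 < x) :
    ∫ τ in Ioi (0 : ℝ), τ ^ (a - 1) • expo x τ = Real.Gamma a * (x : ℂ) ^ (-a : ℂ) := by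
  have h := Complex.integral_cpow_mul_exp_neg_mul_Ioi (a := (a : ℂ)) (by simpa using ha) hx
  rw [Complex.Gamma_ofReal, one_div, Complex.inv_cpow _ _ (by
    rw [Complex.arg_ofReal_of_nonneg hx.le]; exact Real.pi_pos.ne), ← Complex.cpow_neg,
    mul_comm] at h
  rw [← h]
  refine setIntegral_congr_fun measurableSet_Ioi fun τ hτ => ?_
  have hτ : 0 < τ := hτ
  simp only [expo, Complex.real_smul]
  rw [Complex.ofReal_cpow hτ.le, mul_comm (x : ℂ)]
  push_cast; rfl

/-- Differentiation under the integral sign in the half plane `Re w > Re z / 2`, where the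
derivative of the integrand is dominated by `τ^a e^{-τ Re z / 2}`. -/
theorem hasDerivAt_integral_rpow_smul_expo {a : ℝ} (ha : 0 < a) {z : ℂ} (hz : 0 < z.re) :
    DifferentiableAt ℂ (fun z => ∫ τ in Ioi (0 : ℝ), τ ^ (a - 1) • expo z τ) z := by
  have hm : ∀ z : ℂ, ∀ b : ℝ, AEStronglyMeasurable (fun τ : ℝ => τ ^ b • expo z τ)
      (volume.restrict (Ioi 0)) := fun z b => by
    refine ContinuousOn.aestronglyMeasurable (fun τ hτ => ?_) measurableSet_Ioi
    exact ((Real.continuousAt_rpow_const _ _ (Or.inl (mem_Ioi.1 hτ).ne')).smul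
      (continuous_expo z).continuousAt).continuousWithinAt
  have h2 := integrableOn_rpow_mul_exp_neg_mul_rpow (s := a) (by linarith) one_pos
    (by linarith : 0 < z.re / 2)
  refine (hasDerivAt_integral_of_dominated_loc_of_deriv_le
    (μ := volume.restrict (Ioi (0 : ℝ))) (F := fun z (τ : ℝ) => τ ^ (a - 1) • expo z τ)
    (F' := fun z τ => -(τ ^ (a - 1) • ((τ : ℂ) * expo z τ))) (x₀ := z)
    (s := {w : ℂ | z.re / 2 < w.re})
    ((isOpen_lt continuous_const Complex.continuous_re).mem_nhds (by simp; linarith))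
    (Eventually.of_forall fun q => hm q _) (integrableOn_rpow_mul_expo (by linarith) hz)
    ?_ ?_ h2 ?_).2.differentiableAt
  · refine (AEStronglyMeasurable.congr (hm z a) ?_).neg
    refine (ae_restrict_iff' measurableSet_Ioi).2 (ae_of_all _ fun τ hτ => ?_)
    have hτ : 0 < τ := hτ
    simp only [Complex.real_smul]
    rw [← mul_assoc, ← Complex.ofReal_mul, ← Real.rpow_add_one hτ.ne']
    simp
  · refine (ae_restrict_iff' measurableSet_Ioi).2 (ae_of_all _ fun τ hτ w hw => ?_)
    have hτ : 0 < τ := hτ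
    have hw : z.re / 2 < w.re := hw
    rw [norm_neg, norm_smul, norm_mul, norm_expo, Complex.norm_real, Real.norm_of_nonneg hτ.le,
      Real.norm_of_nonneg (by positivity), ← mul_assoc, ← Real.rpow_add_one hτ.ne',
      sub_add_cancel, Real.rpow_one]
    gcongr
    nlinarith
  · refine (ae_restrict_iff' measurableSet_Ioi).2 (ae_of_all _ fun τ hτ w hw => ?_)
    have h : HasDerivAt (fun z : ℂ => -((τ : ℂ) * z)) (-((τ : ℂ) * 1)) w :=
      ((hasDerivAt_id w).const_mul (τ : ℂ)).neg
    have := (h.cexp).const_mul ((τ ^ (a - 1) : ℝ) : ℂ)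
    convert! this using 1
    rw [mul_one, ← smul_neg, Complex.real_smul]
    congr 1
    unfold expo; ring

/-- Both sides are holomorphic in the right half plane and agree on the positive real axis, in
particular at the points `1 + 1/(n+1)`, which accumulate at `1`. The identity theorem does the rest;
this is where the principal branch of the power enters. -/
theorem integral_rpow_smul_expo {a : ℝ} (ha : 0 < a) {z : ℂ} (hz : 0 < z.re) :
    ∫ τ in Ioi (0 : ℝ), τ ^ (a - 1) • expo z τ = Real.Gamma a * z ^ (-a : ℂ) := by
  set H : Set ℂ := {w : ℂ | 0 < w.re} with hH
  have hO : IsOpen H := isOpen_lt continuous_const Complex.continuous_re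
  have h1 : AnalyticOnNhd ℂ (fun z => ∫ τ in Ioi (0 : ℝ), τ ^ (a - 1) • expo z τ) H :=
    DifferentiableOn.analyticOnNhd (fun w hw =>
      (hasDerivAt_integral_rpow_smul_expo ha hw).differentiableWithinAt) hO
  have h2 : AnalyticOnNhd ℂ (fun z : ℂ => Real.Gamma a * z ^ (-a : ℂ)) H := by
    refine DifferentiableOn.analyticOnNhd (fun w hw => ?_) hO
    exact ((differentiableAt_id.cpow_const (Or.inl hw)).const_mul _).differentiableWithinAt
  have hp : IsPreconnected H := (convex_halfSpace_re_gt 0).isPreconnected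
  refine h1.eqOn_of_preconnected_of_frequently_eq h2 hp (z₀ := 1) (by simp [hH]) ?_ hz
  have ht : Tendsto (fun n : ℕ => (((1 : ℝ) + 1 / ((n : ℝ) + 1) : ℝ) : ℂ)) atTop (𝓝[≠] 1) := by
    refine tendsto_nhdsWithin_iff.2 ⟨?_, Eventually.of_forall fun n => ?_⟩
    · have := (tendsto_one_div_add_atTop_nhds_zero_nat (𝕜 := ℝ)).const_add 1
      rw [add_zero] at this
      simpa only [Complex.ofReal_one, Function.comp_def] using
        (Complex.continuous_ofReal.tendsto 1).comp this
    · rw [mem_compl_singleton_iff, ← Complex.ofReal_one, Ne, Complex.ofReal_inj]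
      have : 0 < 1 / ((n : ℝ) + 1) := by positivity
      linarith
  refine ht.frequently (Eventually.frequently (Eventually.of_forall fun n => ?_))
  exact integral_rpow_smul_expo_ofReal ha (by positivity)

theorem subKernel_eq_mul_pow (r p : ℝ) (N : ℕ) {τ : ℝ} (hτ : 0 < τ) :
    subKernel r p τ = subKernel (r + N) p τ * τ ^ N := by
  unfold subKernel
  rw [show 1 + (r + N) = 1 + r + N by ring, Real.rpow_add hτ (1 + r) N, Real.rpow_natCast]
  have := (Real.rpow_pos_of_pos hτ (1 + r)).ne'
  field_simp

/-- For `r ≤ 0` the kernel alone is not integrable at infinity. A factor `τ^N` with `r + N > 0` is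
moved to the exponential, where `τ^N e^{-τ Re z} ≤ N! / (Re z)^N`. The case `r = s - 1 < 0` is the
one needed for the flux. -/
theorem integrableOn_subKernel_smul_expo (r : ℝ) {p : ℝ} (hp : 0 < p) {z : ℂ} (hz : 0 < z.re) :
    IntegrableOn (fun τ => subKernel r p τ • expo z τ) (Ioi 0) := by
  obtain ⟨N, hN⟩ := exists_nat_gt (-r)
  have h := integrableOn_subKernel_smul (h := fun τ : ℝ => τ ^ N • expo z τ)
    (M := N.factorial / z.re ^ N) (r := r + N) (p := p)
    (by have := continuous_expo z; exact (by fun_prop : Continuous fun τ : ℝ =>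
      τ ^ N • expo z τ).aestronglyMeasurable) ?_ (by linarith) hp
  · refine h.congr_fun (fun τ hτ => ?_) measurableSet_Ioi
    simp only [subKernel_eq_mul_pow r p N hτ, mul_smul]
  · intro τ hτ
    have hτ : 0 < τ := hτ
    have h1 := Real.pow_div_factorial_le_exp (τ * z.re) (by positivity) N
    rw [norm_smul, norm_expo, Real.norm_of_nonneg (by positivity), Real.exp_neg, ← div_eq_mul_inv]
    rw [div_le_div_iff₀ (Real.exp_pos _) (by positivity), ← mul_pow]
    rw [div_le_iff₀ (by positivity)] at h1
    linarith

theorem tendsto_subKernel_zero (r : ℝ) {p : ℝ} (hp : 0 < p) :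
    Tendsto (subKernel r p) (𝓝[>] 0) (𝓝 0) := by
  have h := (tendsto_rpow_mul_exp_neg_mul_atTop_nhds_zero (1 + r) p hp).comp tendsto_inv_nhdsGT_zero
  refine h.congr' ?_
  filter_upwards [self_mem_nhdsWithin] with τ hτ
  have hτ : 0 < τ := hτ
  simp only [Function.comp, subKernel]
  rw [Real.inv_rpow hτ.le, mul_comm, div_eq_mul_inv, div_eq_mul_inv, neg_mul]

theorem hasDerivAt_subKernel_smul_expo (r p : ℝ) (z : ℂ) {τ : ℝ} (hτ : 0 < τ) :
    HasDerivAt (fun τ => subKernel r p τ • expo z τ)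
      (p • (subKernel (r + 2) p τ • expo z τ) - (1 + r) • (subKernel (r + 1) p τ • expo z τ) -
        z * (subKernel r p τ • expo z τ)) τ := by
  have h1 : HasDerivAt (fun τ => -(p / τ)) (p / τ ^ 2) τ := by
    have := ((hasDerivAt_inv hτ.ne').const_mul p).neg
    convert! this using 1; ring
  have h2 : HasDerivAt (fun τ : ℝ => τ ^ (-(1 + r))) (-(1 + r) * τ ^ (-(1 + r) - 1)) τ :=
    Real.hasDerivAt_rpow_const (Or.inl hτ.ne')
  have h3 : HasDerivAt (subKernel r p)
      (p * subKernel (r + 2) p τ - (1 + r) * subKernel (r + 1) p τ) τ := by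
    have h4 := h1.exp.mul h2
    refine (h4.congr_of_eventuallyEq ?_).congr_deriv ?_
    · filter_upwards [lt_mem_nhds hτ] with x hx
      simp only [subKernel, Pi.mul_apply]
      rw [Real.rpow_neg hx.le, div_eq_mul_inv]
    · unfold subKernel
      rw [show 1 + (r + 2) = (1 + r) + (2 : ℕ) by push_cast; ring, Real.rpow_add hτ,
        show 1 + (r + 1) = 1 + r + 1 by ring, Real.rpow_add_one hτ.ne',
        Real.rpow_natCast, Real.rpow_sub_one hτ.ne', Real.rpow_neg hτ.le]
      have := (Real.rpow_pos_of_pos hτ (1 + r)).ne'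
      field_simp
      ring
  have h5 := h3.smul (hasDerivAt_expo z τ)
  convert! h5 using 1
  simp only [Complex.real_smul]
  push_cast; ring

/-- The `τ`-derivative of `subKernel r p τ • e^{-τz}` has integral zero over `(0, ∞)`: at `0` the
factor `e^{-p/τ}` beats every power, and at infinity an integrable function with integrable
derivative tends to zero. The case `r = s` is the equation in `y` for the extension, and `r = s - 1`
simplifies its flux. -/
theorem subord_expo_recursion (r : ℝ) {p : ℝ} (hp : 0 < p) {z : ℂ} (hz : 0 < z.re) :
    p • subord (expo z) (r + 2) p - (1 + r) • subord (expo z) (r + 1) p =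
      z * subord (expo z) r p := by
  have i2 := integrableOn_subKernel_smul_expo (r + 2) hp hz
  have i1 := integrableOn_subKernel_smul_expo (r + 1) hp hz
  have i0 := integrableOn_subKernel_smul_expo r hp hz
  have hi := ((i2.smul p).sub (i1.smul (1 + r))).sub (i0.const_mul z)
  have hd := fun τ (hτ : τ ∈ Ioi (0 : ℝ)) => hasDerivAt_subKernel_smul_expo r p z (mem_Ioi.1 hτ)
  have h0 : Tendsto (fun τ => subKernel r p τ • expo z τ) (𝓝[>] 0) (𝓝 0) := by
    have := (tendsto_subKernel_zero r hp).smul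
      (((continuous_expo z).tendsto 0).mono_left nhdsWithin_le_nhds)
    simpa using this
  have h := integral_Ioi_of_hasDerivAt_of_tendsto_nhdsGT hd hi h0
    (tendsto_zero_of_hasDerivAt_of_integrableOn_Ioi hd hi i0)
  have e := integral_sub ((i2.smul p).sub (i1.smul (1 + r))) (i0.const_mul z)
  have e' := integral_sub (i2.smul p) (i1.smul (1 + r))
  simp only [Pi.sub_apply, Pi.smul_apply] at e e'
  rw [e, e', integral_const_mul, integral_smul, integral_smul, sub_zero] at h
  exact sub_eq_zero.1 h

/-- Dropping `e^{-p/τ} ≤ 1` leaves the Gamma integral of `τ^{-s} e^{-τ Re z}`, which converges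
because `s < 1`. The resulting bound does not depend on `p`. -/
theorem subord_expo_sub_one_le {s p : ℝ} (hs : s < 1) (hp : 0 ≤ p) {z : ℂ} (hz : 0 < z.re) :
    ‖subord (expo z) (s - 1) p‖ ≤ Real.Gamma (1 - s) * z.re ^ (s - 1) := by
  have h1 := Real.integral_rpow_mul_exp_neg_mul_Ioi (a := 1 - s) (by linarith) hz
  have h2 := integrableOn_rpow_mul_exp_neg_mul_rpow (s := 1 - s - 1) (by linarith) one_pos hz
  simp only [Real.rpow_one, neg_mul] at h2
  have e : (1 / z.re) ^ (1 - s) * Real.Gamma (1 - s) = Real.Gamma (1 - s) * z.re ^ (s - 1) := by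
    rw [one_div, Real.inv_rpow hz.le, ← Real.rpow_neg hz.le, mul_comm]; ring_nf
  rw [← e, ← h1]
  refine norm_integral_le_of_norm_le h2 ?_
  refine (ae_restrict_iff' measurableSet_Ioi).2 (ae_of_all _ fun τ hτ => ?_)
  have hτ : 0 < τ := hτ
  rw [norm_smul, norm_expo, Real.norm_of_nonneg (subKernel_nonneg _ _ hτ), mul_comm z.re]
  refine mul_le_mul_of_nonneg_right ?_ (Real.exp_pos _).le
  unfold subKernel
  rw [show 1 + (s - 1) = s by ring, show 1 - s - 1 = -s by ring, Real.rpow_neg hτ.le,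
    div_eq_mul_inv]
  exact mul_le_of_le_one_left (by positivity) (Real.exp_le_one_iff.2 (by
    have := div_nonneg hp hτ.le; linarith))

/-- Dominated convergence for `subord (expo z) (s - 1)` along a filter of parameters. -/
theorem tendsto_subord_expo {s : ℝ} (hs : s < 1) {z : ℂ} (hz : 0 < z.re) {l : Filter ℝ}
    [l.IsCountablyGenerated] (hl : ∀ᶠ p in l, 0 ≤ p) {k : ℝ → ℝ}
    (hk : ∀ τ > 0, Tendsto (fun p => subKernel (s - 1) p τ) l (𝓝 (k τ))) :
    Tendsto (subord (expo z) (s - 1)) l (𝓝 (∫ τ in Ioi (0 : ℝ), k τ • expo z τ)) := by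
  have h2 := integrableOn_rpow_mul_exp_neg_mul_rpow (s := 1 - s - 1) (by linarith) one_pos hz
  refine tendsto_integral_filter_of_dominated_convergence _ ?_ ?_ h2 ?_
  · refine Eventually.of_forall fun p => ?_
    exact ((continuousOn_subKernel _ p).smul (continuous_expo z).continuousOn).aestronglyMeasurable
      measurableSet_Ioi
  · filter_upwards [hl] with p hp
    refine (ae_restrict_iff' measurableSet_Ioi).2 (ae_of_all _ fun τ hτ => ?_)
    have hτ : 0 < τ := hτ
    rw [norm_smul, norm_expo, Real.norm_of_nonneg (subKernel_nonneg _ _ hτ), Real.rpow_one,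
      neg_mul, mul_comm z.re]
    refine mul_le_mul_of_nonneg_right ?_ (Real.exp_pos _).le
    unfold subKernel
    rw [show 1 + (s - 1) = s by ring, show 1 - s - 1 = -s by ring, Real.rpow_neg hτ.le,
      div_eq_mul_inv]
    exact mul_le_of_le_one_left (by positivity) (Real.exp_le_one_iff.2 (by
      have := div_nonneg hp hτ.le; linarith))
  · refine (ae_restrict_iff' measurableSet_Ioi).2 (ae_of_all _ fun τ hτ => ?_)
    exact (hk τ hτ).smul_const _

theorem tendsto_subord_expo_zero {s : ℝ} (hs : s < 1) {z : ℂ} (hz : 0 < z.re) :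
    Tendsto (subord (expo z) (s - 1)) (𝓝[>] 0) (𝓝 (Real.Gamma (1 - s) * z ^ ((s : ℂ) - 1))) := by
  have h := tendsto_subord_expo hs hz (l := 𝓝[>] 0) (k := fun τ => τ ^ ((1 - s) - 1))
    (by filter_upwards [self_mem_nhdsWithin] with p hp using le_of_lt hp) ?_
  · rw [integral_rpow_smul_expo (by linarith) hz] at h
    convert! h using 3
    push_cast; ring_nf
  · intro τ hτ
    have hc : Continuous fun p => subKernel (s - 1) p τ := by unfold subKernel; fun_prop
    have := (hc.tendsto 0).mono_left (nhdsWithin_le_nhds (s := Ioi 0))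
    convert! this using 2
    unfold subKernel
    rw [show 1 + (s - 1) = s by ring, show 1 - s - 1 = -s by ring, Real.rpow_neg (le_of_lt hτ)]
    simp

theorem tendsto_subord_expo_atTop {s : ℝ} (hs : s < 1) {z : ℂ} (hz : 0 < z.re) :
    Tendsto (subord (expo z) (s - 1)) atTop (𝓝 0) := by
  have h := tendsto_subord_expo hs hz (l := atTop) (k := fun _ => 0)
    (eventually_ge_atTop 0) ?_
  · simpa using h
  · intro τ hτ
    have h1 : Tendsto (fun p : ℝ => Real.exp (-(p / τ))) atTop (𝓝 0) :=
      Real.tendsto_exp_neg_atTop_nhds_zero.comp (tendsto_id.atTop_div_const hτ)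
    simpa [subKernel] using h1.div_const (τ ^ (1 + (s - 1)))

/-- This is the recursion at `r = s - 1`. In the definition of the flux both terms are singular as
`y → 0`; here their cancellation has been carried out. -/
theorem subExtFlux_expo {s y : ℝ} (hy : 0 < y) {z : ℂ} (hz : 0 < z.re) :
    subExtFlux s (expo z) y =
      -(2 * (4 ^ s * Real.Gamma s)⁻¹ : ℝ) * (z * subord (expo z) (s - 1) (y ^ 2 / 4)) := by
  rw [← subord_expo_recursion (s - 1) (by positivity : 0 < y ^ 2 / 4) hz]
  rw [show s - 1 + 2 = s + 1 by ring, sub_add_cancel, show 1 + (s - 1) = s by ring]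
  unfold subExtFlux
  simp only [Complex.real_smul]
  push_cast; ring

/-- The recursion at `r = s`, combined with `y^{1-2s} y^{2s} = y` to absorb the prefactor of
`subExt`. It is the Bessel equation in divergence form. -/
theorem hasDerivAt_subExtFlux_expo {s y : ℝ} (hs : 0 < s) (hy : 0 < y) {z : ℂ} (hz : 0 < z.re) :
    HasDerivAt (subExtFlux s (expo z)) (y ^ (1 - 2 * s) • (z * subExt s (expo z) y)) y := by
  have h := hasDerivAt_subExtFlux (continuous_expo z).aestronglyMeasurable
    (fun τ hτ => norm_expo_le_one hz.le (le_of_lt hτ)) hs hy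
  rw [subord_expo_recursion s (by positivity : 0 < y ^ 2 / 4) hz] at h
  convert! h using 1
  unfold subExt
  simp only [Complex.real_smul]
  have : y ^ (1 - 2 * s) * y ^ (2 * s) = y := by rw [← Real.rpow_add hy]; simp
  have : (y ^ (1 - 2 * s) : ℝ) * (y ^ (2 * s) : ℝ) = (y : ℂ) := by exact_mod_cast this
  rw [Complex.ofReal_mul, ← this]
  push_cast
  ring

/-- As `p → 0` the subordination integral of order `s - 1` tends to `Γ(1-s) z^{s-1}`, and the factor
`z` completes the power. The constant takes its final form because `4^{1/2} = 2`. -/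
theorem tendsto_subExtFlux_expo_zero {s : ℝ} (hs1 : s < 1) {z : ℂ} (hz : 0 < z.re) :
    Tendsto (subExtFlux s (expo z)) (𝓝[>] 0)
      (𝓝 (-(Real.Gamma (1 - s) / (4 ^ (s - 1 / 2) * Real.Gamma s) : ℝ) * z ^ (s : ℂ))) := by
  have h1 : Tendsto (fun y : ℝ => y ^ 2 / 4) (𝓝[>] 0) (𝓝[>] 0) := by
    refine tendsto_nhdsWithin_iff.2 ⟨?_, ?_⟩
    · have : Tendsto (fun y : ℝ => y ^ 2 / 4) (𝓝 0) (𝓝 (0 ^ 2 / 4)) :=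
        Continuous.tendsto (by fun_prop) 0
      simp only [ne_eq, OfNat.ofNat_ne_zero, not_false_eq_true, zero_pow, zero_div] at this
      exact this.mono_left nhdsWithin_le_nhds
    · filter_upwards [self_mem_nhdsWithin] with y hy
      have hy : 0 < y := hy
      exact mem_Ioi.2 (by positivity)
  have h2 := (((tendsto_subord_expo_zero hs1 hz).comp h1).const_mul z).const_mul
    (-(2 * (4 ^ s * Real.Gamma s)⁻¹ : ℝ) : ℂ)
  have hz0 : z ≠ 0 := by rintro rfl; simp at hz
  have e : (-(2 * (4 ^ s * Real.Gamma s)⁻¹ : ℝ) : ℂ) *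
      (z * (Real.Gamma (1 - s) * z ^ ((s : ℂ) - 1))) =
      -(Real.Gamma (1 - s) / (4 ^ (s - 1 / 2) * Real.Gamma s) : ℝ) * z ^ (s : ℂ) := by
    rw [Complex.cpow_sub _ _ hz0, Complex.cpow_one, Real.rpow_sub (by norm_num) s (1 / 2),
      ← Real.sqrt_eq_rpow, show (4 : ℝ) = 2 ^ 2 by norm_num, Real.sqrt_sq (by norm_num)]
    have : (2 : ℝ) / ((2 ^ 2) ^ s * Real.Gamma s) * Real.Gamma (1 - s) =
      Real.Gamma (1 - s) / ((2 ^ 2) ^ s / 2 * Real.Gamma s) := by field_simp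
    rw [← this]
    push_cast
    field_simp
  rw [e] at h2
  refine h2.congr' ?_
  filter_upwards [self_mem_nhdsWithin] with y hy
  exact (subExtFlux_expo hy hz).symm

theorem norm_subExtFlux_expo_le {s y : ℝ} (hs0 : 0 < s) (hs1 : s < 1) (hy : 0 < y) {z : ℂ}
    (hz : 0 < z.re) : ‖subExtFlux s (expo z) y‖ ≤
      2 * (4 ^ s * Real.Gamma s)⁻¹ * Real.Gamma (1 - s) * (‖z‖ * z.re ^ (s - 1)) := by
  have hG := Real.Gamma_pos_of_pos hs0
  rw [subExtFlux_expo hy hz, norm_mul, norm_neg, norm_mul, Complex.norm_real,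
    Real.norm_of_nonneg (by positivity)]
  have := subord_expo_sub_one_le hs1 (by positivity : 0 ≤ y ^ 2 / 4) hz
  calc _ ≤ 2 * (4 ^ s * Real.Gamma s)⁻¹ * (‖z‖ * (Real.Gamma (1 - s) * z.re ^ (s - 1))) := by
        gcongr
    _ = _ := by ring

/-- The energy of the extension of an exponential. -/
theorem lintegral_energy_subExt_expo {s : ℝ} (hs0 : 0 < s) (hs1 : s < 1) {z : ℂ}
    (hz : 0 < z.re) :
    ∫⁻ y, ENNReal.ofReal (‖y ^ (2 * s - 1) • subExtFlux s (expo z) y‖ ^ 2 +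
        z.re * ‖subExt s (expo z) y‖ ^ 2) ∂(wMeas s) ≤
      ENNReal.ofReal (Real.Gamma (1 - s) / (4 ^ (s - 1 / 2) * Real.Gamma s) * ‖z‖ ^ s) := by
  set m := subExt s (expo z) with hmdef
  set q := subExtFlux s (expo z) with hqdef
  have hM : ∀ τ > 0, ‖expo z τ‖ ≤ 1 := fun τ hτ => norm_expo_le_one hz.le (le_of_lt hτ)
  have hmeas : AEStronglyMeasurable (expo z) (volume.restrict (Ioi (0 : ℝ))) :=
    (continuous_expo z).aestronglyMeasurable
  have dm : ∀ y ∈ Ioi (0 : ℝ), HasDerivAt m (y ^ (2 * s - 1) • q y) y := fun y hy =>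
    hasDerivAt_subExt hmeas hM hs0 hy
  have dq : ∀ y ∈ Ioi (0 : ℝ), HasDerivAt q (y ^ (1 - 2 * s) • (z * m y)) y := fun y hy =>
    hasDerivAt_subExtFlux_expo hs0 hy hz
  -- Multiplying the equation `q' = y^{1-2s} z m` by `conj m` makes the energy density the
  -- derivative of `G`. The energy is therefore `-G(0+)`, because `G` vanishes at infinity.
  set G : ℝ → ℝ := fun y => (q y * conj (m y)).re
  set G' : ℝ → ℝ := fun y => y ^ (1 - 2 * s) *
    (‖y ^ (2 * s - 1) • q y‖ ^ 2 + z.re * ‖m y‖ ^ 2)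
  have dG : ∀ y ∈ Ioi (0 : ℝ), HasDerivAt G (G' y) y := by
    intro y hy
    have hy0 : 0 < y := hy
    have h1 := Complex.reCLM.hasFDerivAt.comp_hasDerivAt y
      ((dq y hy).mul ((Complex.conjCLE.toContinuousLinearMap.hasFDerivAt).comp_hasDerivAt y
        (dm y hy)))
    convert! h1 using 1
    simp only [Complex.reCLM_apply, ContinuousLinearEquiv.coe_coe, Complex.conjCLE_apply,
      Complex.real_smul, map_mul, Complex.conj_ofReal, Function.comp]
    have e1 : y ^ (1 - 2 * s) * (y ^ (2 * s - 1)) ^ 2 = y ^ (2 * s - 1) := by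
      rw [← Real.rpow_natCast, ← Real.rpow_mul hy0.le, ← Real.rpow_add hy0]; push_cast; ring_nf
    have e2 : ((y ^ (1 - 2 * s) : ℝ) * (z * m y) * conj (m y) +
        q y * ((y ^ (2 * s - 1) : ℝ) * conj (q y)) : ℂ) =
        (y ^ (1 - 2 * s) : ℝ) * ((‖m y‖ ^ 2 : ℝ) * z) + (y ^ (2 * s - 1) * ‖q y‖ ^ 2 : ℝ) := by
      have a1 := Complex.mul_conj' (m y)
      have a2 := Complex.mul_conj' (q y)
      push_cast
      linear_combination ((y ^ (1 - 2 * s) : ℝ) * z : ℂ) * a1 + ((y ^ (2 * s - 1) : ℝ) : ℂ) * a2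
    rw [e2]
    simp only [Complex.add_re, Complex.re_ofReal_mul, Complex.ofReal_re, G', norm_smul,
      Real.norm_of_nonneg (Real.rpow_nonneg hy0.le _), mul_pow]
    rw [mul_add, ← mul_assoc, e1]
    ring
  have pG : ∀ y ∈ Ioi (0 : ℝ), 0 ≤ G' y := fun y hy => by
    have hy0 : 0 < y := hy
    positivity
  have l0 : Tendsto G (𝓝[>] 0) (𝓝
      ((-(Real.Gamma (1 - s) / (4 ^ (s - 1 / 2) * Real.Gamma s) : ℝ) * z ^ (s : ℂ) *
        conj (1 : ℂ)).re)) := by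
    have h1 : Tendsto m (𝓝[>] 0) (𝓝 1) := by
      refine tendsto_subExt (continuous_expo z).continuousOn hM hs0 ?_
      have := ((continuous_expo z).tendsto 0).mono_left (nhdsWithin_le_nhds (s := Ioi 0))
      simpa [expo] using this
    exact (Complex.continuous_re.tendsto _).comp ((tendsto_subExtFlux_expo_zero hs1 hz).mul
      ((Complex.continuous_conj.tendsto 1).comp h1))
  have l1 : Tendsto G atTop (𝓝 0) := by
    have h1 : Tendsto q atTop (𝓝 0) := by
      have h2 : Tendsto (fun y : ℝ => y ^ 2 / 4) atTop atTop :=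
        (tendsto_pow_atTop two_ne_zero).atTop_div_const (by norm_num)
      have h3 := (((tendsto_subord_expo_atTop hs1 hz).comp h2).const_mul z).const_mul
        (-(2 * (4 ^ s * Real.Gamma s)⁻¹ : ℝ) : ℂ)
      simp only [mul_zero] at h3
      refine h3.congr' ?_
      filter_upwards [eventually_gt_atTop 0] with y hy
      exact (subExtFlux_expo hy hz).symm
    have h1' := h1.norm
    rw [norm_zero] at h1'
    refine squeeze_zero_norm' ?_ h1'
    filter_upwards [eventually_gt_atTop 0] with y hy
    refine (Complex.abs_re_le_norm _).trans ?_
    rw [norm_mul, RCLike.norm_conj]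
    exact mul_le_of_le_one_right (norm_nonneg _) (norm_subExt_le hM hs0 hy)
  -- Finiteness of the energy is not known in advance: it follows from `G' ≥ 0` and the existence of
  -- both limits of `G`.
  have hi := integrableOn_Ioi_deriv_of_nonneg_nhdsGT dG pG l0 l1
  have hv := integral_Ioi_of_hasDerivAt_of_tendsto_nhdsGT dG hi l0 l1
  have cm : ContinuousOn m (Ioi 0) := fun y hy => (dm y hy).continuousAt.continuousWithinAt
  have cq : ContinuousOn q (Ioi 0) := fun y hy => (dq y hy).continuousAt.continuousWithinAt
  have cp : ∀ b : ℝ, ContinuousOn (fun y : ℝ => y ^ b) (Ioi 0) := fun b y hy =>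
    (Real.continuousAt_rpow_const _ _ (Or.inl (mem_Ioi.1 hy).ne')).continuousWithinAt
  unfold wMeas
  rw [lintegral_withDensity_eq_lintegral_mul₀' (by
      exact ((cp _).aemeasurable measurableSet_Ioi).ennreal_ofReal) (by
      refine AEMeasurable.mono_ac ?_ (withDensity_absolutelyContinuous _ _)
      exact ((((cp _).smul cq).norm.pow 2).add ((cm.norm.pow 2).const_smul z.re)).aemeasurable
        measurableSet_Ioi |>.ennreal_ofReal)]
  have : ∫⁻ y in Ioi (0 : ℝ), ENNReal.ofReal (G' y) = ENNReal.ofReal (∫ y in Ioi (0 : ℝ), G' y) :=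
    (ofReal_integral_eq_lintegral_ofReal hi
      ((ae_restrict_iff' measurableSet_Ioi).2 (ae_of_all _ pG))).symm
  refine (le_of_eq ?_).trans (this.le.trans ?_)
  · refine setLIntegral_congr_fun measurableSet_Ioi fun y hy => ?_
    have hy0 : 0 < y := hy
    simp only [Pi.mul_apply]
    rw [← ENNReal.ofReal_mul (by positivity)]
  · rw [hv]
    refine ENNReal.ofReal_le_ofReal ?_
    rw [zero_sub]
    refine (neg_le_abs _).trans ((Complex.abs_re_le_norm _).trans ?_)
    have hz0 : z ≠ 0 := by rintro rfl; simp at hz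
    have h1 : 0 < Real.Gamma (1 - s) := Real.Gamma_pos_of_pos (by linarith)
    have h2 : 0 < Real.Gamma s := Real.Gamma_pos_of_pos hs0
    rw [map_one, mul_one, norm_mul, norm_neg, Complex.norm_real, Real.norm_of_nonneg (by positivity),
      Complex.norm_cpow_real]

end

section

/-! ### Curves in `L²` and functions of several variables -/

section Curves

variable {α β : Type*} [MeasurableSpace α] [MeasurableSpace β] {μ : Measure α}

/-- A measurable curve in `L²` is represented by a jointly measurable function, for every value of
the parameter. -/
theorem exists_measurable_representative [SeparableSpace (Lp ℂ 2 μ)]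
    [MeasurableSpace (Lp ℂ 2 μ)] [BorelSpace (Lp ℂ 2 μ)]
    {Φ : β → Lp ℂ 2 μ} (hΦ : Measurable Φ) :
    ∃ U : α × β → ℂ, Measurable U ∧ ∀ b, (fun a => U (a, b)) =ᵐ[μ] Φ b := by
  set d := denseSeq (Lp ℂ 2 μ) with hd
  have hex : ∀ (N : ℕ) (b : β), ∃ j, dist (d j) (Φ b) < (1 / 2 : ℝ) ^ N := fun N b => by
    obtain ⟨j, hj⟩ := (denseRange_denseSeq (Lp ℂ 2 μ)).exists_dist_lt (Φ b)
      (by positivity : (0 : ℝ) < (1 / 2) ^ N)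
    exact ⟨j, by rwa [dist_comm]⟩
  classical
  -- The first element of a dense sequence within `2^{-N}` of `Φ b`. As a function of `b` the
  -- approximation takes countably many values, and this gives joint measurability in `(a, b)`.
  set J : ℕ → β → ℕ := fun N b => Nat.find (hex N b)
  have hJ : ∀ N, Measurable (J N) := fun N => by
    refine measurable_find _ fun j => ?_
    exact measurableSet_lt (measurable_const.dist hΦ) measurable_const
  have hJd : ∀ N b, dist (d (J N b)) (Φ b) < (1 / 2 : ℝ) ^ N := fun N b => Nat.find_spec (hex N b)
  set V : ℕ → α × β → ℂ := fun N q => d (J N q.2) q.1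
  have hV : ∀ N, Measurable (V N) := fun N => by
    have h1 : Measurable fun q : α × ℕ => d q.2 q.1 :=
      measurable_from_prod_countable_left fun n => (Lp.stronglyMeasurable (d n)).measurable
    exact h1.comp (measurable_fst.prodMk ((hJ N).comp measurable_snd))
  refine ⟨fun q => limUnder atTop fun N => V N q,
    (StronglyMeasurable.limUnder fun N => (hV N).stronglyMeasurable).measurable, fun b => ?_⟩
  have hnorm : ∀ N, eLpNorm (⇑(d (J N b)) - ⇑(Φ b)) 2 μ < ENNReal.ofReal ((1 / 2 : ℝ) ^ N) := by
    intro N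
    rw [← Lp.edist_def, edist_dist]
    exact (ENNReal.ofReal_lt_ofReal_iff (by positivity)).2 (hJd N b)
  -- The rate `2^{-N}` is summable, so the approximations converge almost everywhere for every
  -- single `b`, without a subsequence depending on `b`.
  have hcau : ∀ᵐ a ∂μ, ∃ l : ℂ, Tendsto (fun N => d (J N b) a) atTop (𝓝 l) := by
    refine Lp.ae_tendsto_of_cauchy_eLpNorm (p := 2) (fun N => Lp.aestronglyMeasurable _) (by norm_num)
      (B := fun N => 2 * ENNReal.ofReal ((1 / 2 : ℝ) ^ N)) ?_ fun N i j hi hj => ?_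
    · rw [ENNReal.tsum_mul_left]
      refine ENNReal.mul_ne_top (by norm_num) ?_
      rw [← ENNReal.ofReal_tsum_of_nonneg (fun n => by positivity) summable_geometric_two]
      exact ENNReal.ofReal_ne_top
    · have hmono : ∀ i, N ≤ i → ENNReal.ofReal ((1 / 2 : ℝ) ^ i) ≤
          ENNReal.ofReal ((1 / 2 : ℝ) ^ N) := fun i hi =>
        ENNReal.ofReal_le_ofReal (pow_le_pow_of_le_one (by norm_num) (by norm_num) hi)
      have e : ⇑(d (J i b)) - ⇑(d (J j b)) =
          (⇑(d (J i b)) - ⇑(Φ b)) - (⇑(d (J j b)) - ⇑(Φ b)) := by abel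
      rw [e, two_mul]
      refine (eLpNorm_sub_le ((Lp.aestronglyMeasurable _).sub (Lp.aestronglyMeasurable _))
        ((Lp.aestronglyMeasurable _).sub (Lp.aestronglyMeasurable _)) (by norm_num)).trans_lt ?_
      exact ENNReal.add_lt_add ((hnorm i).trans_le (hmono i hi)) ((hnorm j).trans_le (hmono j hj))
  have hmeas : TendstoInMeasure μ (fun N => ⇑(d (J N b))) atTop (Φ b) := by
    refine tendstoInMeasure_of_tendsto_eLpNorm (p := 2) (by norm_num)
      (fun N => Lp.aestronglyMeasurable _) (Lp.aestronglyMeasurable _) ?_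
    refine tendsto_of_tendsto_of_tendsto_of_le_of_le tendsto_const_nhds ?_ (fun N => zero_le)
      (fun N => (hnorm N).le)
    have := ENNReal.tendsto_ofReal (tendsto_pow_atTop_nhds_zero_of_lt_one
      (by norm_num : (0 : ℝ) ≤ 1 / 2) (by norm_num))
    simpa using this
  obtain ⟨ns, hns, hlim⟩ := hmeas.exists_seq_tendsto_ae
  filter_upwards [hcau, hlim] with a ⟨l, hl⟩ ha
  have h1 : l = Φ b a := tendsto_nhds_unique (hl.comp hns.tendsto_atTop) ha
  rw [← h1]
  exact hl.limUnder_eq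

theorem lintegral_enorm_restrict_le (f : Lp ℂ 2 μ) (S : Set α) :
    ∫⁻ x in S, ‖f x‖ₑ ∂μ ≤ ‖f‖ₑ * (μ S) ^ (1 / 2 : ℝ) := by
  have h := eLpNorm_le_eLpNorm_mul_rpow_measure_univ (μ := μ.restrict S) (f := f) (p := 1) (q := 2)
    (by norm_num) (Lp.aestronglyMeasurable f).restrict
  rw [eLpNorm_one_eq_lintegral_enorm] at h
  refine h.trans ?_
  rw [Measure.restrict_apply_univ, Lp.enorm_def]
  norm_num
  gcongr
  exact Measure.restrict_le_self

/-- The Bochner integral of an integrable curve in `L²` is computed pointwise. -/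
theorem coeFn_integral_eq [SigmaFinite μ] {m : Measure β} [SFinite m] {Φ : β → Lp ℂ 2 μ}
    (hΦ : Integrable Φ m) {φ : α × β → ℂ} (hφ : AEStronglyMeasurable φ (μ.prod m))
    (h : ∀ᵐ b ∂m, (fun a => φ (a, b)) =ᵐ[μ] Φ b) :
    (∫ b, Φ b ∂m : Lp ℂ 2 μ) =ᵐ[μ] fun a => ∫ b, φ (a, b) ∂m := by
  have hint : ∀ S : Set α, MeasurableSet S → μ S < ⊤ →
      Integrable φ ((μ.restrict S).prod m) := by
    intro S hS hμ
    have hr : (μ.restrict S).prod m = (μ.prod m).restrict (S ×ˢ univ) := by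
      rw [← Measure.prod_restrict, Measure.restrict_univ]
    refine ⟨by rw [hr]; exact hφ.restrict, ?_⟩
    rw [HasFiniteIntegral, lintegral_prod_symm _ (by rw [hr]; exact hφ.restrict.enorm)]
    calc _ ≤ ∫⁻ b, ‖Φ b‖ₑ * (μ S) ^ (1 / 2 : ℝ) ∂m := by
          refine lintegral_mono_ae ?_
          filter_upwards [h] with b hb
          refine (le_of_eq ?_).trans (lintegral_enorm_restrict_le (Φ b) S)
          refine lintegral_congr_ae ?_
          filter_upwards [ae_restrict_of_ae hb] with a ha
          rw [ha]
      _ = (∫⁻ b, ‖Φ b‖ₑ ∂m) * (μ S) ^ (1 / 2 : ℝ) :=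
          lintegral_mul_const'' _ hΦ.1.enorm
      _ < ⊤ := ENNReal.mul_lt_top hΦ.2
          (ENNReal.rpow_lt_top_of_nonneg (by norm_num) hμ.ne)
  -- Both sides are compared through their integrals over sets of finite measure. On the left,
  -- pairing with an indicator commutes with the Bochner integral. On the right Fubini's theorem
  -- applies, since by Cauchy–Schwarz `φ` is integrable over such a set.
  refine ae_eq_of_forall_setIntegral_eq_of_sigmaFinite ?_ ?_ ?_
  · intro S hS hμ
    refine ⟨(Lp.aestronglyMeasurable _).restrict, ?_⟩
    exact (lintegral_enorm_restrict_le _ S).trans_lt (ENNReal.mul_lt_top enorm_lt_top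
      (ENNReal.rpow_lt_top_of_nonneg (by norm_num) hμ.ne))
  · exact fun S hS hμ => (hint S hS hμ).integral_prod_left
  · intro S hS hμ
    rw [← L2.inner_indicatorConstLp_one hS hμ.ne,
      ← integral_inner hΦ, integral_integral_swap (f := fun a b => φ (a, b)) (hint S hS hμ)]
    refine integral_congr_ae ?_
    filter_upwards [h] with b hb
    rw [L2.inner_indicatorConstLp_one hS hμ.ne]
    exact integral_congr_ae (ae_restrict_of_ae (hb.mono fun a ha => ha.symm))

end Curves

/-! ### Curves in `L²` given by continuous functions with common compact support -/

section CompactSupport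

variable {X : Type*} [MeasurableSpace X] {μ : Measure X}

theorem norm_le_of_bound_of_eq_zero {f : Lp ℂ 2 μ} {F : X → ℂ} (hf : f =ᵐ[μ] F)
    {K : Set X} (hK : MeasurableSet K) (hKμ : μ K < ⊤) (h0 : ∀ p, p ∉ K → F p = 0) {ε : ℝ}
    (hF : ∀ p, ‖F p‖ ≤ ε) (hε : 0 ≤ ε) : ‖f‖ ≤ ε * (μ K).toReal ^ (1 / 2 : ℝ) := by
  have e : f =ᵐ[μ] K.indicator F := hf.trans (ae_of_all _ fun p => by
    by_cases hp : p ∈ K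
    · rw [indicator_of_mem hp]
    · rw [indicator_of_notMem hp, h0 p hp])
  have h1 : eLpNorm f 2 μ ≤ eLpNorm (K.indicator fun _ => (ε : ℝ)) 2 μ := by
    rw [eLpNorm_congr_ae e]
    refine eLpNorm_mono fun p => ?_
    by_cases hp : p ∈ K
    · rw [indicator_of_mem hp, indicator_of_mem hp, Real.norm_of_nonneg hε]; exact hF p
    · rw [indicator_of_notMem hp, indicator_of_notMem hp]; simp
  rw [Lp.norm_def]
  refine (ENNReal.toReal_mono ?_ h1).trans (le_of_eq ?_)
  · exact (memLp_indicator_const 2 hK ε (Or.inr hKμ.ne)).2.ne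
  · rw [eLpNorm_indicator_const hK (by norm_num) (by norm_num)]
    rw [ENNReal.toReal_mul, ← ENNReal.toReal_rpow]
    simp [abs_of_nonneg hε]

theorem exists_uniform_dist_lt {X : Type*} [PseudoMetricSpace X] {E : Type*} [PseudoMetricSpace E] {D : X × ℝ → E}
    (hD : Continuous D) {K : Set X} (hK : IsCompact K) (y₀ : ℝ) {ε : ℝ} (hε : 0 < ε) :
    ∃ δ > 0, ∀ y, |y - y₀| < δ → ∀ p ∈ K, dist (D (p, y)) (D (p, y₀)) < ε := by
  have hc : IsCompact (K ×ˢ Icc (y₀ - 1) (y₀ + 1)) := hK.prod isCompact_Icc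
  obtain ⟨δ, hδ, h⟩ := Metric.uniformContinuousOn_iff.1
    (hc.uniformContinuousOn_of_continuous hD.continuousOn) ε hε
  refine ⟨min δ 1, by positivity, fun y hy p hp => h _ ⟨hp, ?_⟩ _ ⟨hp, ?_⟩ ?_⟩
  · have := (abs_lt.1 (hy.trans_le (min_le_right _ _)))
    constructor <;> simp only <;> linarith
  · constructor <;> simp only <;> linarith
  · rw [Prod.dist_eq, dist_self, Real.dist_eq]
    simpa [hδ] using hy.trans_le (min_le_left _ _)

variable [PseudoMetricSpace X] [OpensMeasurableSpace X] [T2Space X] [IsFiniteMeasureOnCompacts μ]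

theorem tendsto_Lp_of_continuous {f : ℝ → Lp ℂ 2 μ} {Φ : X × ℝ → ℂ} (hΦ : Continuous Φ)
    (hf : ∀ y, f y =ᵐ[μ] fun p => Φ (p, y)) {K : Set X} (hK : IsCompact K) {y₀ : ℝ}
    (h0 : ∀ y p, |y - y₀| < 1 → p ∉ K → Φ (p, y) = 0) : Tendsto f (𝓝 y₀) (𝓝 (f y₀)) := by
  rw [Metric.tendsto_nhds]
  intro ε hε
  set c := (μ K).toReal ^ (1 / 2 : ℝ)
  have hc : 0 ≤ c := by positivity
  obtain ⟨δ, hδ, h⟩ := exists_uniform_dist_lt hΦ hK y₀ (by positivity : 0 < ε / (2 * (c + 1)))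
  filter_upwards [Metric.ball_mem_nhds y₀ (by positivity : 0 < min δ 1)] with y hy
  rw [Metric.mem_ball, Real.dist_eq] at hy
  have hy1 := hy.trans_le (min_le_right _ _)
  have key := norm_le_of_bound_of_eq_zero (f := f y - f y₀)
    (F := fun p => Φ (p, y) - Φ (p, y₀)) (K := K) (ε := ε / (2 * (c + 1)))
    ((Lp.coeFn_sub _ _).trans ((hf y).sub (hf y₀))) hK.measurableSet hK.measure_lt_top
    (fun p hp => by rw [h0 y p hy1 hp, h0 y₀ p (by simp) hp, sub_zero]) (fun p => ?_)
    (by positivity)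
  · rw [dist_eq_norm]
    refine key.trans_lt ?_
    change ε / (2 * (c + 1)) * c < ε
    rw [div_mul_eq_mul_div, div_lt_iff₀ (by positivity)]
    nlinarith
  · by_cases hp : p ∈ K
    · rw [← dist_eq_norm]; exact (h y (hy.trans_le (min_le_left _ _)) p hp).le
    · rw [h0 y p hy1 hp, h0 y₀ p (by simp) hp]; simp; positivity

/-- The mean value inequality for `Φ(p, y) - y D(p, y₀)` bounds the remainder by `|y - y₀|` times
the oscillation of `D`, uniformly for `p ∈ K`. Off `K` the remainder vanishes, so passing to the
`L²` norm costs only the factor `μ(K)^{1/2}`. -/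
theorem hasDerivAt_Lp_of_continuous {f : ℝ → Lp ℂ 2 μ} {g : Lp ℂ 2 μ} {Φ D : X × ℝ → ℂ}
    (hD : Continuous D) (hΦD : ∀ p y, HasDerivAt (fun y => Φ (p, y)) (D (p, y)) y) {y₀ : ℝ}
    (hf : ∀ y, f y =ᵐ[μ] fun p => Φ (p, y)) (hg : g =ᵐ[μ] fun p => D (p, y₀))
    {K : Set X} (hK : IsCompact K) (h0 : ∀ y p, |y - y₀| < 1 → p ∉ K → Φ (p, y) = 0) :
    HasDerivAt f g y₀ := by
  rw [hasDerivAt_iff_isLittleO, Asymptotics.isLittleO_iff]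
  intro ε hε
  set c := (μ K).toReal ^ (1 / 2 : ℝ)
  have hc : 0 ≤ c := by positivity
  obtain ⟨δ, hδ, h⟩ := exists_uniform_dist_lt hD hK y₀ (by positivity : 0 < ε / (c + 1))
  have hD0 : ∀ p, p ∉ K → D (p, y₀) = 0 := fun p hp => by
    refine (hΦD p y₀).unique ((hasDerivAt_const y₀ (0 : ℂ)).congr_of_eventuallyEq ?_)
    filter_upwards [Metric.ball_mem_nhds y₀ one_pos] with y hy
    exact h0 y p (by rwa [Metric.mem_ball, Real.dist_eq] at hy) hp
  filter_upwards [Metric.ball_mem_nhds y₀ (by positivity : 0 < min δ 1)] with y hy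
  rw [Metric.mem_ball, Real.dist_eq] at hy
  have hy1 := hy.trans_le (min_le_right _ _)
  have hyδ := hy.trans_le (min_le_left _ _)
  have key := norm_le_of_bound_of_eq_zero (f := f y - f y₀ - (y - y₀) • g)
    (F := fun p => Φ (p, y) - Φ (p, y₀) - (y - y₀) • D (p, y₀)) (K := K)
    (ε := ε / (c + 1) * |y - y₀|) ?_ hK.measurableSet hK.measure_lt_top
    (fun p hp => by rw [h0 y p hy1 hp, h0 y₀ p (by simp) hp, hD0 p hp]; simp) (fun p => ?_)
    (by positivity)
  · refine key.trans ?_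
    change ε / (c + 1) * |y - y₀| * c ≤ ε * ‖y - y₀‖
    rw [Real.norm_eq_abs, mul_right_comm]
    refine mul_le_mul_of_nonneg_right ?_ (abs_nonneg _)
    rw [div_mul_eq_mul_div, div_le_iff₀ (by positivity)]
    nlinarith
  · refine (Lp.coeFn_sub _ _).trans (((Lp.coeFn_sub _ _).trans ((hf y).sub (hf y₀))).sub
      ((Lp.coeFn_smul _ _).trans ?_))
    filter_upwards [hg] with p hp
    simp [hp]
  · by_cases hp : p ∈ K
    · have hder : ∀ x ∈ Metric.ball y₀ δ, HasDerivWithinAt (fun y => Φ (p, y) - y • D (p, y₀))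
          (D (p, x) - D (p, y₀)) (Metric.ball y₀ δ) x := fun x hx => by
        have h1 := (hΦD p x).sub ((hasDerivAt_id x).smul_const (D (p, y₀)))
        simpa using! h1.hasDerivWithinAt
      have := (convex_ball y₀ δ).norm_image_sub_le_of_norm_hasDerivWithin_le hder
        (C := ε / (c + 1)) (fun x hx => by
          rw [← dist_eq_norm]
          exact (h x (by rwa [Metric.mem_ball, Real.dist_eq] at hx) p hp).le)
        (Metric.mem_ball_self hδ) (by rwa [Metric.mem_ball, Real.dist_eq] : y ∈ Metric.ball y₀ δ)
      rw [Real.norm_eq_abs] at this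
      convert! this using 2
      rw [sub_smul]; abel
    · rw [h0 y p hy1 hp, h0 y₀ p (by simp) hp, hD0 p hp]; simp; positivity

end CompactSupport

end

section

/-! ### Translations and the Fourier transform on `L²(ℝ)` -/

/-- The translation `g ↦ g(· - τ)` on `L²(ℝ)`. -/
def shiftLp (τ : ℝ) : Lp ℂ 2 (volume : Measure ℝ) →ₗᵢ[ℂ] Lp ℂ 2 (volume : Measure ℝ) :=
  Lp.compMeasurePreservingₗᵢ ℂ (fun t => t - τ) (measurePreserving_sub_right volume τ)

theorem coeFn_shiftLp (τ : ℝ) (g : Lp ℂ 2 (volume : Measure ℝ)) :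
    shiftLp τ g =ᵐ[volume] fun t => g (t - τ) :=
  Lp.coeFn_compMeasurePreserving g (measurePreserving_sub_right volume τ)

/-- The modulation `e^{-2πiτξ}`. -/
def modul (τ ξ : ℝ) : ℂ := Complex.exp (-(2 * Real.pi * τ * ξ : ℝ) * Complex.I)

theorem norm_modul (τ ξ : ℝ) : ‖modul τ ξ‖ = 1 := by
  unfold modul
  rw [← Complex.ofReal_neg, Complex.norm_exp_ofReal_mul_I]

theorem continuous_modul (τ : ℝ) : Continuous (modul τ) := by unfold modul; fun_prop

theorem memLp_modul_mul (τ : ℝ) (g : Lp ℂ 2 (volume : Measure ℝ)) :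
    MemLp (fun ξ => modul τ ξ * g ξ) 2 volume :=
  (Lp.memLp g).of_le ((continuous_modul τ).aestronglyMeasurable.mul (Lp.aestronglyMeasurable g))
    (ae_of_all _ fun ξ => by rw [norm_mul, norm_modul, one_mul])

theorem fourier_comp_sub (f : SchwartzMap ℝ ℂ) (τ ξ : ℝ) :
    𝓕 (f.compSubConstCLM ℂ τ) ξ = modul τ ξ * 𝓕 f ξ := by
  have h := congrFun (Fourier.fourierIntegral_comp_add_right Real.fourierChar volume (f : ℝ → ℂ) (-τ)) ξ
  have e1 : ∀ g : SchwartzMap ℝ ℂ, 𝓕 g ξ = Fourier.fourierIntegral Real.fourierChar volume g ξ :=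
    fun g => by
      rw [SchwartzMap.fourier_coe, Real.fourier_real_eq, Fourier.fourierIntegral_def]
  rw [e1, e1]
  have e2 : (f.compSubConstCLM ℂ τ : ℝ → ℂ) = (f : ℝ → ℂ) ∘ fun v => v + -τ := by
    ext v; simp [sub_eq_add_neg]
  rw [e2, h]
  rw [Circle.smul_def, smul_eq_mul, Real.fourierChar_apply]
  congr 1
  unfold modul
  congr 1
  push_cast; ring

/-- Both sides are isometric in `g`, so it is enough to check the identity on the dense set of
Schwartz functions. -/
theorem fourier_shiftLp (τ : ℝ) (g : Lp ℂ 2 (volume : Measure ℝ)) :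
    𝓕 (shiftLp τ g) = (memLp_modul_mul τ (𝓕 g)).toLp _ := by
  refine (SchwartzMap.denseRange_toLpCLM (E := ℝ) (F := ℂ) (p := 2) (μ := volume)
    ENNReal.ofNat_ne_top).induction_on (p := fun g : Lp ℂ 2 (volume : Measure ℝ) =>
      𝓕 (shiftLp τ g) = (memLp_modul_mul τ (𝓕 g)).toLp _) g ?_ fun f => ?_
  · refine isClosed_eq ?_ ?_
    · exact (Lp.fourierTransformₗᵢ ℝ ℂ).continuous.comp (shiftLp τ).continuous
    · refine Isometry.continuous fun g₁ g₂ => ?_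
      rw [← (Lp.fourierTransformₗᵢ ℝ ℂ).isometry.edist_eq g₁ g₂, Lp.edist_def, Lp.edist_def]
      refine eLpNorm_congr_norm_ae ?_
      filter_upwards [(memLp_modul_mul τ (𝓕 g₁)).coeFn_toLp,
        (memLp_modul_mul τ (𝓕 g₂)).coeFn_toLp] with ξ h1 h2
      rw [Pi.sub_apply, Pi.sub_apply, h1, h2, ← mul_sub, norm_mul, norm_modul, one_mul]
      rfl
  · have h1 : shiftLp τ (SchwartzMap.toLpCLM ℝ ℂ 2 volume f) =
        (f.compSubConstCLM ℂ τ).toLp 2 := by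
      refine Lp.ext ?_
      refine (coeFn_shiftLp τ _).trans ?_
      have h2 := (measurePreserving_sub_right volume τ).quasiMeasurePreserving.ae_eq_comp
        (f.coeFn_toLp 2 volume)
      refine h2.trans ?_
      filter_upwards [(f.compSubConstCLM ℂ τ).coeFn_toLp 2 volume] with t ht
      rw [ht]; rfl
    rw [h1, SchwartzMap.toLp_fourier_eq]
    refine Lp.ext ?_
    have h3 : 𝓕 (SchwartzMap.toLpCLM ℝ ℂ 2 volume f) = (𝓕 f).toLp 2 := SchwartzMap.toLp_fourier_eq f
    rw [h3]
    filter_upwards [(𝓕 (f.compSubConstCLM ℂ τ)).coeFn_toLp 2 volume,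
      (memLp_modul_mul τ ((𝓕 f).toLp 2)).coeFn_toLp, (𝓕 f).coeFn_toLp 2 volume] with ξ h1 h2 h3
    rw [h1, h2, h3, fourier_comp_sub]

/-- The Fourier transform with the normalization `(2π)^{-1/2} ∫ g(t) e^{-iρt} dt`. -/
def hat (g : Lp ℂ 2 (volume : Measure ℝ)) (ρ : ℝ) : ℂ :=
  ((2 * Real.pi) ^ (-(1 / 2 : ℝ)) : ℝ) *
    (𝓕 g : Lp ℂ 2 (volume : Measure ℝ)) (ρ / (2 * Real.pi))

theorem measurable_hat (g : Lp ℂ 2 (volume : Measure ℝ)) : Measurable (hat g) :=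
  (((Lp.stronglyMeasurable (𝓕 g : Lp ℂ 2 (volume : Measure ℝ))).measurable.comp
    (measurable_id.div_const _)).const_mul _)

theorem map_div_two_pi : Measure.map (fun ρ : ℝ => ρ / (2 * Real.pi)) volume =
    ENNReal.ofReal (2 * Real.pi) • volume := by
  have h := Real.map_volume_mul_right (a := (2 * Real.pi)⁻¹) (by positivity)
  rw [inv_inv, abs_of_pos (by positivity)] at h
  exact h

theorem ae_comp_div_two_pi {P : ℝ → Prop} (h : ∀ᵐ ξ : ℝ, P ξ) :
    ∀ᵐ ρ : ℝ, P (ρ / (2 * Real.pi)) := by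
  refine ae_of_ae_map (f := fun ρ : ℝ => ρ / (2 * Real.pi)) (by fun_prop) ?_
  rw [map_div_two_pi]
  exact Measure.ae_smul_measure h _

theorem hat_add (g₁ g₂ : Lp ℂ 2 (volume : Measure ℝ)) :
    hat (g₁ + g₂) =ᵐ[volume] hat g₁ + hat g₂ := by
  have e : 𝓕 (g₁ + g₂) = 𝓕 g₁ + 𝓕 g₂ := (Lp.fourierTransformₗᵢ ℝ ℂ).map_add g₁ g₂
  filter_upwards [ae_comp_div_two_pi (Lp.coeFn_add (𝓕 g₁) (𝓕 g₂))] with ρ h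
  simp only [hat, Pi.add_apply, e] at h ⊢
  rw [h, mul_add]

theorem hat_smul (c : ℂ) (g : Lp ℂ 2 (volume : Measure ℝ)) :
    hat (c • g) =ᵐ[volume] c • hat g := by
  have e : 𝓕 (c • g) = c • 𝓕 g := (Lp.fourierTransformₗᵢ ℝ ℂ).map_smul c g
  filter_upwards [ae_comp_div_two_pi (Lp.coeFn_smul c (𝓕 g))] with ρ h
  simp only [hat, Pi.smul_apply, e, smul_eq_mul] at h ⊢
  rw [h]; ring

theorem hat_shiftLp (τ : ℝ) (g : Lp ℂ 2 (volume : Measure ℝ)) :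
    hat (shiftLp τ g) =ᵐ[volume] fun ρ => Complex.exp (-(τ * (Complex.I * ρ))) * hat g ρ := by
  filter_upwards [ae_comp_div_two_pi ((memLp_modul_mul τ (𝓕 g)).coeFn_toLp)] with ρ h
  simp only [hat, fourier_shiftLp] at h ⊢
  rw [h]
  have e : modul τ (ρ / (2 * Real.pi)) = Complex.exp (-(τ * (Complex.I * ρ))) := by
    unfold modul
    have : 2 * Real.pi * τ * (ρ / (2 * Real.pi)) = τ * ρ := by
      have := Real.pi_pos.ne'; field_simp
    rw [this]
    congr 1
    push_cast; ring
  rw [e]; ring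

/-- Plancherel's theorem: the square of the factor `(2π)^{-1/2}` cancels the Jacobian of the
dilation `ρ = 2πξ` between the two normalizations. -/
theorem lintegral_hat (g : Lp ℂ 2 (volume : Measure ℝ)) :
    ∫⁻ ρ, ‖hat g ρ‖ₑ ^ 2 = ‖g‖ₑ ^ 2 := by
  have h1 : ∫⁻ ρ : ℝ, ‖(𝓕 g : Lp ℂ 2 (volume : Measure ℝ)) (ρ / (2 * Real.pi))‖ₑ ^ 2 =
      ENNReal.ofReal (2 * Real.pi) * ∫⁻ ξ, ‖(𝓕 g : Lp ℂ 2 (volume : Measure ℝ)) ξ‖ₑ ^ 2 := by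
    rw [← smul_eq_mul (ENNReal.ofReal _), ← lintegral_smul_measure, ← map_div_two_pi, lintegral_map _ (by fun_prop)]
    exact (Lp.stronglyMeasurable _).measurable.enorm.pow_const 2
  have h2 : ∫⁻ ξ, ‖(𝓕 g : Lp ℂ 2 (volume : Measure ℝ)) ξ‖ₑ ^ 2 = ‖g‖ₑ ^ 2 := by
    have h3 : ‖(𝓕 g : Lp ℂ 2 (volume : Measure ℝ))‖ₑ = ‖g‖ₑ := by
      rw [← ofReal_norm, ← ofReal_norm, Lp.norm_fourier_eq]
    rw [← h3, Lp.enorm_def, eLpNorm_eq_lintegral_rpow_enorm_toReal (by norm_num) (by norm_num)]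
    norm_num
    rw [← ENNReal.rpow_natCast, ← ENNReal.rpow_mul]
    norm_num
  have h4 : ∀ ρ : ℝ, ‖hat g ρ‖ₑ ^ 2 = ENNReal.ofReal (2 * Real.pi)⁻¹ *
      ‖(𝓕 g : Lp ℂ 2 (volume : Measure ℝ)) (ρ / (2 * Real.pi))‖ₑ ^ 2 := fun ρ => by
    unfold hat
    rw [enorm_mul, mul_pow]
    congr 1
    rw [← ofReal_norm, Complex.norm_real, Real.norm_of_nonneg (by positivity),
      ← ENNReal.ofReal_pow (by positivity), ← Real.rpow_natCast, ← Real.rpow_mul (by positivity)]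
    norm_num
    rw [Real.rpow_neg_one]
    congr 1
    rw [mul_inv]; ring
  simp_rw [h4]
  rw [lintegral_const_mul' _ _ ENNReal.ofReal_ne_top, h1, h2, ← mul_assoc,
    ← ENNReal.ofReal_mul (by positivity), inv_mul_cancel₀ (by positivity), ENNReal.ofReal_one,
    one_mul]

end

section

/-! ### Square integrable functions on products -/

section ProductL2

variable {α β F : Type*} [MeasurableSpace α] [MeasurableSpace β] {μ : Measure α} {ν : Measure β}
  [NormedAddCommGroup F]

theorem eLpNorm_two_sq (f : α → F) : eLpNorm f 2 μ ^ 2 = ∫⁻ x, ‖f x‖ₑ ^ 2 ∂μ := by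
  rw [eLpNorm_eq_lintegral_rpow_enorm_toReal (by norm_num) (by norm_num), ← ENNReal.rpow_natCast,
    ← ENNReal.rpow_mul]
  norm_num

theorem memLp_two_iff_lintegral {f : α → F} :
    MemLp f 2 μ ↔ AEStronglyMeasurable f μ ∧ ∫⁻ x, ‖f x‖ₑ ^ 2 ∂μ < ⊤ := by
  rw [MemLp, ← eLpNorm_two_sq]
  simp [ENNReal.pow_lt_top_iff]

theorem enorm_sq_eq_lintegral (f : Lp F 2 μ) : ‖f‖ₑ ^ 2 = ∫⁻ x, ‖f x‖ₑ ^ 2 ∂μ := by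
  rw [Lp.enorm_def, eLpNorm_two_sq]

theorem memLp_two_prod_right [SFinite ν] {f : α × β → F} (hf : MemLp f 2 (μ.prod ν)) :
    ∀ᵐ a ∂μ, MemLp (fun b => f (a, b)) 2 ν := by
  rw [memLp_two_iff_lintegral, lintegral_prod _ (by exact hf.1.enorm.pow_const 2)] at hf
  filter_upwards [hf.1.prodMk_left, ae_lt_top' (hf.1.enorm.pow_const 2).lintegral_prod_right'
    hf.2.ne] with a h1 h2
  exact memLp_two_iff_lintegral.2 ⟨h1, h2⟩

end ProductL2

/-! ### Tensor products and components -/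

variable {n : ℕ} {Ω : Opens (Sp n)}

theorem coeFn_tensor (g : Lp ℂ 2 (volume : Measure ℝ)) (f : L2 Ω) :
    ((memLp_tensor g 0 f).toLp _ : L2Cyl Ω) =ᵐ[mCyl Ω] fun p => g p.1 * (f p.2 : ℂ) :=
  (memLp_tensor g 0 f).coeFn_toLp.trans (ae_of_all _ fun p => by simp)

theorem inner_tensor_toLp (g g' : Lp ℂ 2 (volume : Measure ℝ)) (f f' : L2 Ω) :
    ⟪((memLp_tensor g 0 f).toLp _ : L2Cyl Ω), (memLp_tensor g' 0 f').toLp _⟫_ℂ =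
      ⟪g, g'⟫_ℂ * (⟪f, f'⟫_ℝ : ℝ) := by
  rw [L2.inner_def, L2.inner_def, L2.inner_def, ← integral_complex_ofReal, ← integral_prod_mul]
  refine integral_congr_ae ?_
  filter_upwards [coeFn_tensor g f, coeFn_tensor g' f'] with p h h'
  rw [h, h']
  simp only [RCLike.inner_apply, map_mul, Complex.conj_ofReal, conj_trivial, Complex.ofReal_mul]
  ring

theorem norm_tensor_toLp (g : Lp ℂ 2 (volume : Measure ℝ)) (f : L2 Ω) :
    ‖((memLp_tensor g 0 f).toLp _ : L2Cyl Ω)‖ = ‖f‖ * ‖g‖ := by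
  have h := inner_tensor_toLp g g f f
  rw [inner_self_eq_norm_sq_to_K, inner_self_eq_norm_sq_to_K, real_inner_self_eq_norm_sq] at h
  have h2 : ‖((memLp_tensor g 0 f).toLp _ : L2Cyl Ω)‖ ^ 2 = (‖f‖ * ‖g‖) ^ 2 := by
    have : ((‖((memLp_tensor g 0 f).toLp _ : L2Cyl Ω)‖ ^ 2 : ℝ) : ℂ) =
      (((‖f‖ * ‖g‖) ^ 2 : ℝ) : ℂ) := by
        push_cast at h ⊢
        rw [mul_pow, mul_comm]
        exact h
    exact_mod_cast this
  exact (sq_eq_sq₀ (norm_nonneg _) (by positivity)).1 h2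

/-- `g ↦ g ⊗ f`, as a map `L²(ℝ) → L²(ℝ × Ω)`. -/
def tensorLp (f : L2 Ω) : Lp ℂ 2 (volume : Measure ℝ) →L[ℂ] L2Cyl Ω :=
  LinearMap.mkContinuous
    { toFun := fun g => (memLp_tensor g 0 f).toLp _
      map_add' := fun g g' => by
        refine Lp.ext ?_
        have h0 : ∀ᵐ p ∂(mCyl Ω), (g + g') p.1 = g p.1 + g' p.1 :=
          Measure.quasiMeasurePreserving_fst.ae (Lp.coeFn_add g g')
        filter_upwards [coeFn_tensor (g + g') f, h0, Lp.coeFn_add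
          ((memLp_tensor g 0 f).toLp _ : L2Cyl Ω) ((memLp_tensor g' 0 f).toLp _),
          coeFn_tensor g f, coeFn_tensor g' f] with p h1 h2 h3 h4 h5
        rw [h1, h2, h3, Pi.add_apply, h4, h5, add_mul]
      map_smul' := fun c g => by
        refine Lp.ext ?_
        have h0 : ∀ᵐ p ∂(mCyl Ω), (c • g) p.1 = c • g p.1 :=
          Measure.quasiMeasurePreserving_fst.ae (Lp.coeFn_smul c g)
        filter_upwards [coeFn_tensor (c • g) f, h0, Lp.coeFn_smul c
          ((memLp_tensor g 0 f).toLp _ : L2Cyl Ω), coeFn_tensor g f] with p h1 h2 h3 h4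
        rw [h1, h2, RingHom.id_apply, h3, Pi.smul_apply, h4, smul_eq_mul, smul_eq_mul, mul_assoc] }
    ‖f‖ fun g => (norm_tensor_toLp g f).le

theorem coeFn_tensorLp (f : L2 Ω) (g : Lp ℂ 2 (volume : Measure ℝ)) :
    tensorLp f g =ᵐ[mCyl Ω] fun p => g p.1 * (f p.2 : ℂ) := coeFn_tensor g f

theorem inner_tensorLp (f f' : L2 Ω) (g g' : Lp ℂ 2 (volume : Measure ℝ)) :
    ⟪tensorLp f g, tensorLp f' g'⟫_ℂ = ⟪g, g'⟫_ℂ * (⟪f, f'⟫_ℝ : ℝ) := inner_tensor_toLp g g' f f'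

theorem norm_tensorLp (f : L2 Ω) (g : Lp ℂ 2 (volume : Measure ℝ)) :
    ‖tensorLp f g‖ = ‖f‖ * ‖g‖ := norm_tensor_toLp g f

theorem toLp_tensor_eq (f : L2 Ω) (τ : ℝ) (g : Lp ℂ 2 (volume : Measure ℝ)) :
    (memLp_tensor g τ f).toLp _ = tensorLp f (shiftLp τ g) := by
  refine Lp.ext ?_
  have h0 : ∀ᵐ p ∂(mCyl Ω), (shiftLp τ g) p.1 = g (p.1 - τ) :=
    Measure.quasiMeasurePreserving_fst.ae (coeFn_shiftLp τ g)
  filter_upwards [(memLp_tensor g τ f).coeFn_toLp, h0, coeFn_tensorLp f (shiftLp τ g)]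
    with p h1 h2 h3
  rw [h1, h3, h2]

/-- By Fubini, taking the component along `f` is adjoint to tensoring with `f`. Linearity and
continuity of the component map then come for free. -/
theorem inner_tensorLp_left (f : L2 Ω) (g : Lp ℂ 2 (volume : Measure ℝ)) (u : L2Cyl Ω) :
    ⟪tensorLp f g, u⟫_ℂ = ⟪g, (memLp_component u f).toLp _⟫_ℂ := by
  have hi := L2.integrable_inner (𝕜 := ℂ) (tensorLp f g) u
  rw [L2.inner_def, L2.inner_def]
  have h1 : ∀ᵐ p ∂(mCyl Ω), ⟪tensorLp f g p, u p⟫_ℂ = conj (g p.1) * (u p * (f p.2 : ℂ)) := by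
    filter_upwards [coeFn_tensorLp f g] with p h
    rw [h, RCLike.inner_apply, map_mul, Complex.conj_ofReal]
    ring
  rw [integral_congr_ae h1, integral_prod _ (hi.congr h1)]
  refine integral_congr_ae ?_
  filter_upwards [(memLp_component u f).coeFn_toLp] with t ht
  rw [ht, RCLike.inner_apply, integral_const_mul, mul_comm]

/-- `u ↦ ∫_Ω u(·, x) f(x) dx`, as a map `L²(ℝ × Ω) → L²(ℝ)`. -/
def compLp (f : L2 Ω) : L2Cyl Ω →L[ℂ] Lp ℂ 2 (volume : Measure ℝ) :=
  ContinuousLinearMap.adjoint (tensorLp f)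

theorem compLp_apply (f : L2 Ω) (u : L2Cyl Ω) : compLp f u = (memLp_component u f).toLp _ := by
  refine ext_inner_left ℂ fun g => ?_
  rw [← inner_tensorLp_left, compLp, ContinuousLinearMap.adjoint_inner_right]

theorem component_eq (φ : HilbertBasis ℕ ℝ (L2 Ω)) (u : L2Cyl Ω) (k : ℕ) :
    component φ u k = compLp (φ k) u := (compLp_apply (φ k) u).symm

theorem coeFn_compLp (f : L2 Ω) (u : L2Cyl Ω) :
    compLp f u =ᵐ[volume] fun t => ∫ x, u (t, x) * (f x : ℂ) ∂(mΩ Ω) := by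
  rw [compLp_apply]; exact (memLp_component u f).coeFn_toLp

theorem compLp_tensorLp (f f' : L2 Ω) (g : Lp ℂ 2 (volume : Measure ℝ)) :
    compLp f (tensorLp f' g) = ((⟪f, f'⟫_ℝ : ℝ) : ℂ) • g := by
  refine ext_inner_left ℂ fun g' => ?_
  rw [compLp, ContinuousLinearMap.adjoint_inner_right, inner_tensorLp, inner_smul_right, mul_comm]

variable (φ : HilbertBasis ℕ ℝ (L2 Ω))

theorem orthogonalFamily_tensorLp : OrthogonalFamily ℂ (fun _ : ℕ => Lp ℂ 2 (volume : Measure ℝ))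
    fun k => (⟨(tensorLp (φ k)).toLinearMap, fun g => by
      rw [ContinuousLinearMap.coe_coe, norm_tensorLp, φ.orthonormal.1 k, one_mul]⟩ :
        Lp ℂ 2 (volume : Measure ℝ) →ₗᵢ[ℂ] L2Cyl Ω) := by
  intro j k hjk g g'
  have := inner_tensorLp (φ j) (φ k) g g'
  rw [φ.orthonormal.2 hjk] at this
  simpa using this

/-- The `φ_k` form a basis of the real space, so real and imaginary parts are treated separately. -/
theorem ae_eq_zero_of_integral_mul_eq_zero {w : Sp n → ℂ} (hw : MemLp w 2 (mΩ Ω))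
    (h : ∀ k, ∫ x, w x * (φ k x : ℂ) ∂(mΩ Ω) = 0) : w =ᵐ[mΩ Ω] 0 := by
  have key : ∀ (r : Sp n → ℝ) (hr : MemLp r 2 (mΩ Ω)),
      (∀ k, ∫ x, r x * φ k x ∂(mΩ Ω) = 0) → r =ᵐ[mΩ Ω] 0 := by
    intro r hr h0
    have : hr.toLp r = 0 := by
      refine φ.repr.injective ?_
      ext k
      rw [φ.repr_apply_apply, map_zero, L2.inner_def]
      have : ∫ x, ⟪φ k x, hr.toLp r x⟫_ℝ ∂(mΩ Ω) = ∫ x, r x * φ k x ∂(mΩ Ω) := by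
        refine integral_congr_ae ?_
        filter_upwards [hr.coeFn_toLp] with x hx
        rw [hx]; simp
      rw [this, h0]; rfl
    exact (hr.coeFn_toLp.symm.trans (by rw [this])).trans (Lp.coeFn_zero _ _ _)
  have hint : ∀ k, Integrable (fun x => w x * (φ k x : ℂ)) (mΩ Ω) := fun k => by
    simpa [mul_comm] using! hw.integrable_mul ((Lp.memLp (φ k)).ofReal (K := ℂ))
  have hre := key _ hw.re fun k => by
    have := congrArg Complex.re (h k)
    rw [← Complex.reCLM_apply, ← ContinuousLinearMap.integral_comp_comm _ (hint k)] at this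
    simpa using this
  have him := key _ hw.im fun k => by
    have := congrArg Complex.im (h k)
    rw [← Complex.imCLM_apply, ← ContinuousLinearMap.integral_comp_comm _ (hint k)] at this
    simpa using this
  filter_upwards [hre, him] with x h1 h2
  exact Complex.ext h1 h2

theorem eq_zero_of_compLp_eq_zero {u : L2Cyl Ω} (h : ∀ k, compLp (φ k) u = 0) : u = 0 := by
  refine Lp.ext (EventuallyEq.trans ?_ (Lp.coeFn_zero _ _ _).symm)
  have hm : Measurable u := (Lp.stronglyMeasurable u).measurable
  have h1 : ∀ᵐ t : ℝ, ∀ k, ∫ x, u (t, x) * (φ k x : ℂ) ∂(mΩ Ω) = 0 := ae_all_iff.2 fun k => by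
    have := coeFn_compLp (φ k) u
    rw [h k] at this
    filter_upwards [this, Lp.coeFn_zero ℂ 2 (volume : Measure ℝ)] with t h1 h2
    rw [← h1, h2]; rfl
  refine (Measure.ae_prod_iff_ae_ae (measurableSet_eq_fun hm measurable_const)).2 ?_
  filter_upwards [h1, memLp_two_prod_right (Lp.memLp u)] with t h2 h3
  exact ae_eq_zero_of_integral_mul_eq_zero φ h3 h2

/-- Totality: a function orthogonal to all `g ⊗ φ_k` has vanishing components, so almost every time
slice is orthogonal to the basis and is zero. -/
theorem isHilbertSum_tensorLp : IsHilbertSum ℂ (fun _ : ℕ => Lp ℂ 2 (volume : Measure ℝ))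
    fun k => (⟨(tensorLp (φ k)).toLinearMap, fun g => by
      rw [ContinuousLinearMap.coe_coe, norm_tensorLp, φ.orthonormal.1 k, one_mul]⟩ :
        Lp ℂ 2 (volume : Measure ℝ) →ₗᵢ[ℂ] L2Cyl Ω) := by
  refine IsHilbertSum.mk (orthogonalFamily_tensorLp φ) ?_
  rw [top_le_iff, Submodule.topologicalClosure_eq_top_iff, Submodule.eq_bot_iff]
  intro u hu
  refine eq_zero_of_compLp_eq_zero φ fun k => ?_
  refine ext_inner_left ℂ fun g => ?_
  rw [compLp, ContinuousLinearMap.adjoint_inner_right, inner_zero_right]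
  exact (Submodule.mem_orthogonal _ u).1 hu _
    ((le_iSup (fun k => LinearMap.range _) k : _ ≤ _) ⟨g, rfl⟩)

theorem summable_tensorLp {f : ℕ → Lp ℂ 2 (volume : Measure ℝ)}
    (hf : Summable fun k => ‖f k‖ ^ 2) : Summable fun k => tensorLp (φ k) (f k) := by
  have := (orthogonalFamily_tensorLp φ).summable_iff_norm_sq_summable f
  exact this.2 hf

theorem compLp_tsum {f : ℕ → Lp ℂ 2 (volume : Measure ℝ)}
    (hf : Summable fun k => ‖f k‖ ^ 2) (k : ℕ) :
    compLp (φ k) (∑' j, tensorLp (φ j) (f j)) = f k := by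
  rw [ContinuousLinearMap.map_tsum _ (summable_tensorLp φ hf), tsum_eq_single k fun j hj => ?_]
  · rw [compLp_tensorLp, real_inner_self_eq_norm_sq, φ.orthonormal.1 k]; simp
  · rw [compLp_tensorLp, φ.orthonormal.2 hj.symm]; simp

theorem hasSum_norm_sq_compLp (u : L2Cyl Ω) :
    HasSum (fun k => ‖compLp (φ k) u‖ ^ 2) (‖u‖ ^ 2) := by
  have hV := isHilbertSum_tensorLp φ
  set w := hV.linearIsometryEquiv u with hw
  have h1 : u = ∑' k, tensorLp (φ k) (w k) := by
    have := hV.linearIsometryEquiv_symm_apply w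
    rw [hw, LinearIsometryEquiv.symm_apply_apply] at this
    exact this
  have h2 : Summable fun k => ‖w k‖ ^ 2 := by
    have := (lp.memℓp w).summable (by norm_num)
    simpa using this
  have h3 : ∀ k, compLp (φ k) u = w k := fun k => by rw [h1, compLp_tsum φ h2]
  simp_rw [h3]
  have h4 := lp.hasSum_norm (by norm_num : 0 < (2 : ENNReal).toReal) w
  rw [show ‖w‖ = ‖u‖ from LinearIsometryEquiv.norm_map _ u] at h4
  simpa using h4

theorem eq_of_compLp_eq {u v : L2Cyl Ω} (h : ∀ k, compLp (φ k) u = compLp (φ k) v) : u = v := by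
  rw [← sub_eq_zero]
  exact eq_zero_of_compLp_eq_zero φ fun k => by rw [map_sub, h k, sub_self]

theorem hasSum_tensorLp_compLp (u : L2Cyl Ω) :
    HasSum (fun k => tensorLp (φ k) (compLp (φ k) u)) u := by
  have h := (hasSum_norm_sq_compLp φ u).summable
  convert! (summable_tensorLp φ h).hasSum
  exact eq_of_compLp_eq φ fun k => (compLp_tsum φ h k).symm

end

section

/-! ### The spectral transform -/

/-- The measure `dρ ⊗ #` on the spectral side `ℝ × ℕ`. -/
def mFreq : Measure (ℝ × ℕ) := (volume : Measure ℝ).prod Measure.count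

instance : SigmaFinite mFreq := by unfold mFreq; infer_instance

theorem ae_mFreq_of_forall {P : ℝ × ℕ → Prop} (h : ∀ k, ∀ᵐ ρ : ℝ, P (ρ, k)) :
    ∀ᵐ q ∂mFreq, P q := by
  rw [ae_iff]
  have hsub : {q | ¬P q} ⊆ ⋃ k : ℕ, {ρ : ℝ | ¬P (ρ, k)} ×ˢ {k} := by
    rintro ⟨ρ, k⟩ hq
    exact mem_iUnion.2 ⟨k, hq, rfl⟩
  refine measure_mono_null hsub (measure_iUnion_null fun k => ?_)
  rw [mFreq, Measure.prod_prod, ae_iff.1 (h k), zero_mul]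

theorem lintegral_mFreq {f : ℝ × ℕ → ENNReal} (hf : Measurable f) :
    ∫⁻ q, f q ∂mFreq = ∫⁻ ρ : ℝ, ∑' k, f (ρ, k) := by
  rw [mFreq, lintegral_prod _ hf.aemeasurable]
  simp_rw [lintegral_count]

theorem lintegral_mFreq' {f : ℝ × ℕ → ENNReal} (hf : Measurable f) :
    ∫⁻ q, f q ∂mFreq = ∑' k, ∫⁻ ρ : ℝ, f (ρ, k) := by
  rw [lintegral_mFreq hf]
  exact lintegral_tsum (f := fun k ρ => f (ρ, k))
    fun k => (hf.comp measurable_prodMk_right).aemeasurable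

theorem integral_mFreq {f : ℝ × ℕ → ℂ} (hf : Integrable f mFreq) :
    ∫ q, f q ∂mFreq = ∫ ρ : ℝ, ∑' k, f (ρ, k) := by
  rw [mFreq] at hf ⊢
  rw [integral_prod _ hf]
  refine integral_congr_ae ?_
  filter_upwards [hf.prod_right_ae] with ρ hρ
  rw [integral_countable hρ]
  simp [Measure.real]

variable {n : ℕ} {Ω : Opens (Sp n)} (φ : HilbertBasis ℕ ℝ (L2 Ω)) (lam : ℕ → ℝ)

/-- The function `(ρ, k) ↦ û_k(ρ)`. -/
def specFun (u : L2Cyl Ω) (q : ℝ × ℕ) : ℂ := hat (compLp (φ q.2) u) q.1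

theorem componentHat_eq (u : L2Cyl Ω) (k : ℕ) (ρ : ℝ) :
    componentHat φ u k ρ = specFun φ u (ρ, k) := by
  unfold componentHat specFun hat
  rw [component_eq]

theorem measurable_specFun (u : L2Cyl Ω) : Measurable (specFun φ u) :=
  measurable_from_prod_countable_left fun k => measurable_hat (compLp (φ k) u)

theorem lintegral_specFun (u : L2Cyl Ω) : ∫⁻ q, ‖specFun φ u q‖ₑ ^ 2 ∂mFreq = ‖u‖ₑ ^ 2 := by
  rw [lintegral_mFreq' ((measurable_specFun φ u).enorm.pow_const 2)]
  simp only [specFun, lintegral_hat]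
  have h := hasSum_norm_sq_compLp φ u
  have e : ∀ {E : Type} [NormedAddCommGroup E] (f : E), ‖f‖ₑ ^ 2 = ENNReal.ofReal (‖f‖ ^ 2) :=
    fun f => by rw [← ofReal_norm, ENNReal.ofReal_pow (norm_nonneg _)]
  simp_rw [e]
  rw [← h.tsum_eq, ENNReal.ofReal_tsum_of_nonneg (fun k => by positivity) h.summable]

theorem memLp_specFun (u : L2Cyl Ω) : MemLp (specFun φ u) 2 mFreq := by
  refine memLp_two_iff_lintegral.2 ⟨(measurable_specFun φ u).aestronglyMeasurable, ?_⟩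
  rw [lintegral_specFun]
  exact ENNReal.pow_lt_top enorm_lt_top

/-- The spectral transform `u ↦ (û_k)`, an isometry of `L²(ℝ × Ω)` into `L²(ℝ × ℕ)`. -/
def specLp : L2Cyl Ω →ₗᵢ[ℂ] Lp ℂ 2 mFreq where
  toFun u := (memLp_specFun φ u).toLp _
  map_add' u v := by
    rw [← MemLp.toLp_add, MemLp.toLp_eq_toLp_iff]
    refine ae_mFreq_of_forall fun k => ?_
    filter_upwards [hat_add (compLp (φ k) u) (compLp (φ k) v)] with ρ h
    simpa [specFun] using h
  map_smul' c u := by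
    rw [RingHom.id_apply, ← MemLp.toLp_const_smul, MemLp.toLp_eq_toLp_iff]
    refine ae_mFreq_of_forall fun k => ?_
    filter_upwards [hat_smul c (compLp (φ k) u)] with ρ h
    simpa [specFun] using h
  norm_map' u := by
    have h : ‖(memLp_specFun φ u).toLp _‖ₑ ^ 2 = ‖u‖ₑ ^ 2 := by
      rw [enorm_sq_eq_lintegral, ← lintegral_specFun φ u]
      refine lintegral_congr_ae ?_
      filter_upwards [(memLp_specFun φ u).coeFn_toLp] with q hq
      rw [hq]
    rw [← ofReal_norm, ← ofReal_norm, ← ENNReal.ofReal_pow (norm_nonneg _),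
      ← ENNReal.ofReal_pow (norm_nonneg _),
      ENNReal.ofReal_eq_ofReal_iff (by positivity) (by positivity)] at h
    exact (sq_eq_sq₀ (norm_nonneg _) (norm_nonneg _)).1 h

theorem coeFn_specLp (u : L2Cyl Ω) : specLp φ u =ᵐ[mFreq] specFun φ u :=
  (memLp_specFun φ u).coeFn_toLp

theorem inner_eq_integral_specFun (u v : L2Cyl Ω) :
    ⟪v, u⟫_ℂ = ∫ q, specFun φ u q * conj (specFun φ v q) ∂mFreq := by
  rw [← (specLp φ).inner_map_map, L2.inner_def]
  refine integral_congr_ae ?_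
  filter_upwards [coeFn_specLp φ u, coeFn_specLp φ v] with q h1 h2
  rw [h1, h2, RCLike.inner_apply]

/-- The symbol `iρ + λ_k`, as a function on `ℝ × ℕ`. -/
def symbol (q : ℝ × ℕ) : ℂ := symb lam q.2 q.1

theorem measurable_symbol : Measurable (symbol lam) := by
  refine measurable_from_prod_countable_left fun k => ?_
  unfold symbol symb
  fun_prop

@[simp]
theorem symbol_re (q : ℝ × ℕ) : (symbol lam q).re = lam q.2 := by simp [symbol, symb]

@[simp]
theorem symbol_im (q : ℝ × ℕ) : (symbol lam q).im = q.1 := by simp [symbol, symb]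

theorem memDomH_iff (s : ℝ) (u : L2Cyl Ω) : MemDomH φ lam s u ↔
    ∫⁻ q, ENNReal.ofReal (‖symbol lam q‖ ^ s * ‖specFun φ u q‖ ^ 2) ∂mFreq < ⊤ := by
  have hm : Measurable fun q => ENNReal.ofReal (‖symbol lam q‖ ^ s * ‖specFun φ u q‖ ^ 2) :=
    (((measurable_symbol lam).norm.pow_const s).mul
      ((measurable_specFun φ u).norm.pow_const 2)).ennreal_ofReal
  rw [lintegral_mFreq hm]
  unfold MemDomH
  simp only [componentHat_eq, symbol]

theorem pairH_eq (s : ℝ) (u v : L2Cyl Ω)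
    (h : Integrable (fun q => symbol lam q ^ (s : ℂ) * specFun φ u q * conj (specFun φ v q))
      mFreq) :
    pairH φ lam s u v =
      ∫ q, symbol lam q ^ (s : ℂ) * specFun φ u q * conj (specFun φ v q) ∂mFreq := by
  rw [integral_mFreq h]
  unfold pairH
  simp only [componentHat_eq, symbol]

/-! ### The semigroup -/

theorem heat_eq (τ : ℝ) (u : L2Cyl Ω) : heat φ lam τ u =
    ∑' k, tensorLp (φ k) (Real.exp (-(τ * lam k)) • shiftLp τ (compLp (φ k) u)) := by
  unfold heat
  refine tsum_congr fun k => ?_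
  rw [toLp_tensor_eq, component_eq]
  exact (ContinuousLinearMap.map_smul_of_tower _ _ _).symm

variable {lam}

theorem compLp_heat (hlam : ∀ k, 0 ≤ lam k) {τ : ℝ} (hτ : 0 ≤ τ) (u : L2Cyl Ω) (k : ℕ) :
    compLp (φ k) (heat φ lam τ u) = Real.exp (-(τ * lam k)) • shiftLp τ (compLp (φ k) u) := by
  rw [heat_eq]
  refine compLp_tsum φ (Summable.of_nonneg_of_le (fun k => by positivity) (fun k => ?_)
    (hasSum_norm_sq_compLp φ u).summable) k
  rw [norm_smul, Real.norm_of_nonneg (Real.exp_pos _).le, LinearIsometry.norm_map]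
  have : Real.exp (-(τ * lam k)) ≤ 1 := Real.exp_le_one_iff.2 (by
    have := mul_nonneg hτ (hlam k); linarith)
  gcongr
  exact mul_le_of_le_one_left (norm_nonneg _) this

/-- The translation in `t` contributes `e^{-iρτ}` and the decay contributes `e^{-τλ_k}`; their
product is the exponential of the symbol. -/
theorem specFun_heat (hlam : ∀ k, 0 ≤ lam k) {τ : ℝ} (hτ : 0 ≤ τ) (u : L2Cyl Ω) :
    specFun φ (heat φ lam τ u) =ᵐ[mFreq] fun q => expo (symbol lam q) τ * specFun φ u q := by
  refine ae_mFreq_of_forall fun k => ?_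
  have h1 := hat_smul (Real.exp (-(τ * lam k)) : ℂ) (shiftLp τ (compLp (φ k) u))
  filter_upwards [h1, hat_shiftLp τ (compLp (φ k) u)] with ρ h1 h2
  simp only [specFun]
  have e : (Real.exp (-(τ * lam k)) • shiftLp τ (compLp (φ k) u)) =
    ((Real.exp (-(τ * lam k)) : ℝ) : ℂ) • shiftLp τ (compLp (φ k) u) :=
      (Complex.coe_smul _ _).symm
  rw [compLp_heat φ hlam hτ, e]
  rw [Pi.smul_apply, h2, smul_eq_mul, ← mul_assoc] at h1
  push_cast at h1 ⊢
  rw [h1]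
  congr 1
  rw [← Complex.exp_add]
  unfold expo symbol symb
  congr 1
  ring

theorem norm_heat_le (hlam : ∀ k, 0 ≤ lam k) {τ : ℝ} (hτ : 0 ≤ τ) (u : L2Cyl Ω) :
    ‖heat φ lam τ u‖ ≤ ‖u‖ := by
  rw [← (specLp φ).norm_map, ← (specLp φ).norm_map u]
  refine Lp.norm_le_norm_of_ae_le ?_
  filter_upwards [coeFn_specLp φ (heat φ lam τ u), coeFn_specLp φ u, specFun_heat φ hlam hτ u]
    with q h1 h2 h3
  rw [h1, h2, h3, norm_mul]
  exact mul_le_of_le_one_left (norm_nonneg _)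
    (norm_expo_le_one (by rw [symbol_re]; exact hlam _) hτ)

theorem heat_zero (hlam : ∀ k, 0 ≤ lam k) (u : L2Cyl Ω) : heat φ lam 0 u = u := by
  refine eq_of_compLp_eq φ fun k => ?_
  rw [compLp_heat φ hlam le_rfl]
  have : shiftLp 0 (compLp (φ k) u) = compLp (φ k) u := by
    refine Lp.ext ((coeFn_shiftLp 0 _).trans (ae_of_all _ fun t => by simp))
  rw [this]; simp

/-- Dominated convergence on the spectral side: the exponentials converge pointwise and differ by at
most `2`. -/
theorem continuousOn_heat (hlam : ∀ k, 0 ≤ lam k) (u : L2Cyl Ω) :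
    ContinuousOn (fun τ => heat φ lam τ u) (Ici 0) := by
  intro σ hσ
  rw [ContinuousWithinAt, tendsto_iff_edist_tendsto_0]
  have key : ∀ τ ∈ Ici (0 : ℝ), edist (heat φ lam τ u) (heat φ lam σ u) ^ 2 =
      ∫⁻ q, ‖(expo (symbol lam q) τ - expo (symbol lam q) σ) * specFun φ u q‖ₑ ^ 2 ∂mFreq := by
    intro τ hτ
    rw [← (specLp φ).isometry.edist_eq, edist_eq_enorm_sub, enorm_sq_eq_lintegral]
    refine lintegral_congr_ae ?_
    filter_upwards [Lp.coeFn_sub (specLp φ (heat φ lam τ u)) (specLp φ (heat φ lam σ u)),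
      coeFn_specLp φ (heat φ lam τ u), coeFn_specLp φ (heat φ lam σ u),
      specFun_heat φ hlam hτ u, specFun_heat φ hlam hσ u] with q h1 h2 h3 h4 h5
    rw [h1, Pi.sub_apply, h2, h3, h4, h5, sub_mul]
  have hlim : Tendsto (fun τ => ∫⁻ q, ‖(expo (symbol lam q) τ - expo (symbol lam q) σ) *
      specFun φ u q‖ₑ ^ 2 ∂mFreq) (𝓝[Ici 0] σ) (𝓝 (∫⁻ _ : ℝ × ℕ, 0 ∂mFreq)) := by
    refine tendsto_lintegral_filter_of_dominated_convergence
      (fun q => 4 * ‖specFun φ u q‖ₑ ^ 2) ?_ ?_ ?_ ?_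
    · refine Eventually.of_forall fun τ => ?_
      have h1 : ∀ τ, Measurable fun q => expo (symbol lam q) τ := fun τ => by
        unfold expo
        exact Complex.measurable_exp.comp ((measurable_symbol lam).const_mul _).neg
      exact (((h1 τ).sub (h1 σ)).mul (measurable_specFun φ u)).enorm.pow_const 2
    · filter_upwards [self_mem_nhdsWithin] with τ hτ
      refine ae_of_all _ fun q => ?_
      rw [enorm_mul, mul_pow]
      gcongr
      have h1 : ‖expo (symbol lam q) τ - expo (symbol lam q) σ‖ₑ ≤ 2 := by
        rw [← ofReal_norm]
        refine ENNReal.ofReal_le_of_le_toReal ?_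
        have hz : 0 ≤ (symbol lam q).re := by rw [symbol_re]; exact hlam _
        have := (norm_sub_le (expo (symbol lam q) τ) (expo (symbol lam q) σ)).trans
          (add_le_add (norm_expo_le_one hz hτ) (norm_expo_le_one hz hσ))
        rw [ENNReal.toReal_ofNat]
        linarith
      calc _ ≤ (2 : ENNReal) ^ 2 := by gcongr
        _ = 4 := by norm_num
    · rw [lintegral_const_mul _ ((measurable_specFun φ u).enorm.pow_const 2), lintegral_specFun]
      exact ENNReal.mul_ne_top (by norm_num) (ENNReal.pow_ne_top enorm_ne_top)
    · refine ae_of_all _ fun q => ?_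
      have hc : Continuous fun τ => ‖(expo (symbol lam q) τ - expo (symbol lam q) σ) *
          specFun φ u q‖ₑ ^ 2 := by
        have := continuous_expo (symbol lam q)
        exact (ENNReal.continuous_pow 2).comp
          (continuous_enorm.comp ((this.sub continuous_const).mul continuous_const))
      have := (hc.tendsto σ).mono_left (nhdsWithin_le_nhds (s := Ici 0))
      simpa using this
  rw [lintegral_zero] at hlim
  have h2 := (hlim.congr' (by
    filter_upwards [self_mem_nhdsWithin] with τ hτ using (key τ hτ).symm)).ennrpow_const (1 / 2)
  simp only [← ENNReal.rpow_natCast, ← ENNReal.rpow_mul] at h2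
  simpa using h2

/-! ### The extension -/

theorem extension_eq_subExt (s : ℝ) (u : L2Cyl Ω) :
    extension φ lam s u = subExt s (fun τ => heat φ lam τ u) := by
  ext1 y
  unfold extension subExt subord subKernel
  simp only [div_div]

theorem aestronglyMeasurable_heat (hlam : ∀ k, 0 ≤ lam k) (u : L2Cyl Ω) :
    AEStronglyMeasurable (fun τ => heat φ lam τ u) (volume.restrict (Ioi 0)) :=
  ((continuousOn_heat φ hlam u).mono Ioi_subset_Ici_self).aestronglyMeasurable measurableSet_Ioi

theorem contDiffOn_extension (hlam : ∀ k, 0 ≤ lam k) {s : ℝ} (hs : 0 < s) (u : L2Cyl Ω) :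
    ContDiffOn ℝ ∞ (extension φ lam s u) (Ioi 0) := by
  rw [extension_eq_subExt]
  exact contDiffOn_subExt (aestronglyMeasurable_heat φ hlam u)
    (fun τ hτ => norm_heat_le φ hlam (le_of_lt hτ) u) hs

theorem tendsto_extension (hlam : ∀ k, 0 ≤ lam k) {s : ℝ} (hs : 0 < s) (u : L2Cyl Ω) :
    Tendsto (extension φ lam s u) (𝓝[>] 0) (𝓝 u) := by
  rw [extension_eq_subExt]
  refine tendsto_subExt ((continuousOn_heat φ hlam u).mono Ioi_subset_Ici_self)
    (fun τ hτ => norm_heat_le φ hlam (le_of_lt hτ) u) hs ?_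
  have h := (continuousOn_heat φ hlam u) 0 self_mem_Ici
  rw [ContinuousWithinAt, heat_zero φ hlam] at h
  exact h.mono_left (nhdsWithin_mono _ Ioi_subset_Ici_self)

theorem measurable_subKernel (r p : ℝ) : Measurable (subKernel r p) := by
  unfold subKernel
  fun_prop

theorem measurable_expo_symbol :
    Measurable fun q : (ℝ × ℕ) × ℝ => expo (symbol lam q.1) q.2 := by
  unfold expo
  have : Measurable fun q : (ℝ × ℕ) × ℝ => symbol lam q.1 :=
    (measurable_symbol lam).comp measurable_fst
  have h2 : Measurable fun q : (ℝ × ℕ) × ℝ => (q.2 : ℂ) := by fun_prop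
  exact Complex.measurable_exp.comp (h2.mul this).neg

/-- The isometry `specLp` commutes with the Bochner integral, and by `coeFn_integral_eq` the
integral in `L²(ℝ × ℕ)` may be computed pointwise, where it becomes the scalar subordination
integral. -/
theorem specFun_subord (hlam : ∀ k, 0 ≤ lam k) (u : L2Cyl Ω) {r p : ℝ} (hr : 0 < r) (hp : 0 < p) :
    specFun φ (subord (fun τ => heat φ lam τ u) r p) =ᵐ[mFreq]
      fun q => subord (expo (symbol lam q)) r p * specFun φ u q := by
  have hi := integrableOn_subKernel_smul (aestronglyMeasurable_heat φ hlam u)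
    (fun τ hτ => norm_heat_le φ hlam (le_of_lt hτ) u) hr hp
  have h1 : specLp φ (subord (fun τ => heat φ lam τ u) r p) =
      ∫ τ in Ioi (0 : ℝ), specLp φ (subKernel r p τ • heat φ lam τ u) :=
    (ContinuousLinearMap.integral_comp_comm
      ((specLp φ).toContinuousLinearMap.restrictScalars ℝ) hi).symm
  have h2 := coeFn_integral_eq (m := volume.restrict (Ioi (0 : ℝ)))
    (Φ := fun τ => specLp φ (subKernel r p τ • heat φ lam τ u))
    (((specLp φ).toContinuousLinearMap.restrictScalars ℝ).integrable_comp hi)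
    (φ := fun q => subKernel r p q.2 • (expo (symbol lam q.1) q.2 * specFun φ u q.1))
    (((measurable_subKernel r p).comp measurable_snd).smul (measurable_expo_symbol.mul
      ((measurable_specFun φ u).comp measurable_fst))).aestronglyMeasurable ?_
  · rw [← h1] at h2
    filter_upwards [h2, coeFn_specLp φ (subord (fun τ => heat φ lam τ u) r p)] with q h3 h4
    rw [← h4, h3]
    simp only [← smul_mul_assoc]
    rw [integral_mul_const]
    rfl
  · refine (ae_restrict_iff' measurableSet_Ioi).2 (ae_of_all _ fun τ hτ => ?_)
    have e : specLp φ (subKernel r p τ • heat φ lam τ u) =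
        subKernel r p τ • specLp φ (heat φ lam τ u) :=
      ((specLp φ).toContinuousLinearMap.restrictScalars ℝ).map_smul _ _
    rw [e]
    filter_upwards [Lp.coeFn_smul (subKernel r p τ) (specLp φ (heat φ lam τ u)),
      coeFn_specLp φ (heat φ lam τ u), specFun_heat φ hlam (le_of_lt hτ) u] with q h1 h2 h3
    rw [h1, Pi.smul_apply, h2, h3]

theorem specFun_smul (c : ℝ) (u : L2Cyl Ω) :
    specFun φ (c • u) =ᵐ[mFreq] fun q => (c : ℂ) * specFun φ u q := by
  have e : specLp φ (c • u) = c • specLp φ u :=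
    ((specLp φ).toContinuousLinearMap.restrictScalars ℝ).map_smul _ _
  filter_upwards [coeFn_specLp φ (c • u), coeFn_specLp φ u, Lp.coeFn_smul c (specLp φ u)]
    with q h1 h2 h3
  rw [← h1, e, h3, Pi.smul_apply, h2, Complex.real_smul]

theorem specFun_sub (u v : L2Cyl Ω) :
    specFun φ (u - v) =ᵐ[mFreq] fun q => specFun φ u q - specFun φ v q := by
  filter_upwards [coeFn_specLp φ (u - v), coeFn_specLp φ u, coeFn_specLp φ v,
    Lp.coeFn_sub (specLp φ u) (specLp φ v)] with q h1 h2 h3 h4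
  rw [← h1, map_sub, h4, Pi.sub_apply, h2, h3]

/-- The symbol has real part `λ_k`, so the transform of `u` is concentrated where `Re z > 0`. The
scalar identities are therefore needed only there. -/
theorem specFun_eq_zero {u : L2Cyl Ω} (hu0 : ∀ k, lam k = 0 → component φ u k = 0) :
    ∀ᵐ q ∂mFreq, lam q.2 = 0 → specFun φ u q = 0 := by
  refine ae_mFreq_of_forall fun k => ?_
  by_cases hk : lam k = 0
  · have h1 := hu0 k hk
    rw [component_eq] at h1
    have h2 := hat_smul 0 (0 : Lp ℂ 2 (volume : Measure ℝ))
    filter_upwards [h2] with ρ h _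
    rw [specFun, h1]
    simpa using h
  · exact ae_of_all _ fun ρ h => absurd h hk

theorem specFun_extension (hlam : ∀ k, 0 ≤ lam k) (u : L2Cyl Ω) {s y : ℝ} (hs : 0 < s)
    (hy : 0 < y) : specFun φ (extension φ lam s u y) =ᵐ[mFreq]
      fun q => subExt s (expo (symbol lam q)) y * specFun φ u q := by
  rw [extension_eq_subExt]
  unfold subExt
  filter_upwards [specFun_smul φ (y ^ (2 * s) / (4 ^ s * Real.Gamma s))
    (subord (fun τ => heat φ lam τ u) s (y ^ 2 / 4)),
    specFun_subord φ hlam u hs (by positivity : 0 < y ^ 2 / 4)] with q h1 h2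
  rw [h1, h2, Complex.real_smul, mul_assoc]

/-- `y^{1-2s} ∂_y U`. -/
def flux (lam : ℕ → ℝ) (s : ℝ) (u : L2Cyl Ω) (y : ℝ) : L2Cyl Ω :=
  subExtFlux s (fun τ => heat φ lam τ u) y

/-- `y^{1-2s} (∂_{yy} + (1-2s)/y ∂_y) U`. -/
def fluxDeriv (lam : ℕ → ℝ) (s : ℝ) (u : L2Cyl Ω) (y : ℝ) : L2Cyl Ω :=
  (y * (4 ^ s * Real.Gamma s)⁻¹) •
    ((y ^ 2 / 4) • subord (fun τ => heat φ lam τ u) (s + 2) (y ^ 2 / 4) -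
      (1 + s) • subord (fun τ => heat φ lam τ u) (s + 1) (y ^ 2 / 4))

theorem hasDerivAt_extension (hlam : ∀ k, 0 ≤ lam k) (u : L2Cyl Ω) {s y : ℝ} (hs : 0 < s)
    (hy : 0 < y) :
    HasDerivAt (extension φ lam s u) (y ^ (2 * s - 1) • flux φ lam s u y) y := by
  rw [extension_eq_subExt]
  exact hasDerivAt_subExt (aestronglyMeasurable_heat φ hlam u)
    (fun τ hτ => norm_heat_le φ hlam (le_of_lt hτ) u) hs hy

theorem hasDerivAt_flux (hlam : ∀ k, 0 ≤ lam k) (u : L2Cyl Ω) {s y : ℝ} (hs : 0 < s)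
    (hy : 0 < y) : HasDerivAt (flux φ lam s u) (fluxDeriv φ lam s u y) y :=
  hasDerivAt_subExtFlux (aestronglyMeasurable_heat φ hlam u)
    (fun _ hτ => norm_heat_le φ hlam (le_of_lt hτ) u) hs hy

theorem specFun_flux (hlam : ∀ k, 0 ≤ lam k) (u : L2Cyl Ω) {s y : ℝ} (hs : 0 < s)
    (hy : 0 < y) : specFun φ (flux φ lam s u y) =ᵐ[mFreq]
      fun q => subExtFlux s (expo (symbol lam q)) y * specFun φ u q := by
  unfold flux subExtFlux
  have hp : 0 < y ^ 2 / 4 := by positivity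
  filter_upwards [specFun_smul φ ((4 ^ s * Real.Gamma s)⁻¹)
      ((2 * s) • subord (fun τ => heat φ lam τ u) s (y ^ 2 / 4) -
        (y ^ 2 / 2) • subord (fun τ => heat φ lam τ u) (s + 1) (y ^ 2 / 4)),
    specFun_sub φ ((2 * s) • subord (fun τ => heat φ lam τ u) s (y ^ 2 / 4))
      ((y ^ 2 / 2) • subord (fun τ => heat φ lam τ u) (s + 1) (y ^ 2 / 4)),
    specFun_smul φ (2 * s) (subord (fun τ => heat φ lam τ u) s (y ^ 2 / 4)),
    specFun_smul φ (y ^ 2 / 2) (subord (fun τ => heat φ lam τ u) (s + 1) (y ^ 2 / 4)),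
    specFun_subord φ hlam u hs hp,
    specFun_subord φ hlam u (by linarith : 0 < s + 1) hp] with q h1 h2 h3 h4 h5 h6
  rw [h1, h2, h3, h4, h5, h6]
  simp only [Complex.real_smul]
  ring

/-- The scalar flux has been differentiated twice, once for a general curve and once through the
recursion; uniqueness of the derivative equates the results. Where `λ_k = 0` both sides vanish with
the transform of `u`. -/
theorem specFun_fluxDeriv (hlam : ∀ k, 0 ≤ lam k) (u : L2Cyl Ω)
    (hu0 : ∀ k, lam k = 0 → component φ u k = 0) {s y : ℝ} (hs : 0 < s)
    (hy : 0 < y) : specFun φ (fluxDeriv φ lam s u y) =ᵐ[mFreq] fun q =>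
      (y ^ (1 - 2 * s) : ℝ) * (symbol lam q * specFun φ (extension φ lam s u y) q) := by
  unfold fluxDeriv
  have hp : 0 < y ^ 2 / 4 := by positivity
  filter_upwards [specFun_smul φ (y * (4 ^ s * Real.Gamma s)⁻¹)
      ((y ^ 2 / 4) • subord (fun τ => heat φ lam τ u) (s + 2) (y ^ 2 / 4) -
        (1 + s) • subord (fun τ => heat φ lam τ u) (s + 1) (y ^ 2 / 4)),
    specFun_sub φ ((y ^ 2 / 4) • subord (fun τ => heat φ lam τ u) (s + 2) (y ^ 2 / 4))
      ((1 + s) • subord (fun τ => heat φ lam τ u) (s + 1) (y ^ 2 / 4)),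
    specFun_smul φ (y ^ 2 / 4) (subord (fun τ => heat φ lam τ u) (s + 2) (y ^ 2 / 4)),
    specFun_smul φ (1 + s) (subord (fun τ => heat φ lam τ u) (s + 1) (y ^ 2 / 4)),
    specFun_subord φ hlam u (by linarith : 0 < s + 2) hp,
    specFun_subord φ hlam u (by linarith : 0 < s + 1) hp,
    specFun_eq_zero φ hu0, specFun_extension φ hlam u hs hy] with q h1 h2 h3 h4 h5 h6 h7 h8
  rw [h1, h2, h3, h4, h5, h6, h8]
  rcases (hlam q.2).eq_or_lt with h0 | h0
  · rw [h7 h0.symm]; simp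
  · have hz : 0 < (symbol lam q).re := by rwa [symbol_re]
    have hm : AEStronglyMeasurable (expo (symbol lam q)) (volume.restrict (Ioi (0 : ℝ))) :=
      (continuous_expo _).aestronglyMeasurable
    have e := (hasDerivAt_subExtFlux hm (fun _ hτ => norm_expo_le_one hz.le (le_of_lt hτ))
      hs hy).unique (hasDerivAt_subExtFlux_expo hs hy hz)
    simp only [Complex.real_smul] at e
    linear_combination specFun φ u q * e

theorem deriv_extension_eventuallyEq (hlam : ∀ k, 0 ≤ lam k) (u : L2Cyl Ω) {s y : ℝ} (hs : 0 < s)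
    (hy : 0 < y) : deriv (extension φ lam s u) =ᶠ[𝓝 y]
      fun y => y ^ (2 * s - 1) • flux φ lam s u y := by
  filter_upwards [lt_mem_nhds hy] with x hx
  exact (hasDerivAt_extension φ hlam u hs hx).deriv

/-- Since `∂_y U` is `y^{2s-1}` times the flux, the product rule produces a term from the power, and
this is exactly what `(1-2s)/y` times `∂_y U` cancels. -/
theorem bessel_extension (hlam : ∀ k, 0 ≤ lam k) (u : L2Cyl Ω) {s y : ℝ} (hs : 0 < s)
    (hy : 0 < y) :
    ((1 - 2 * s) / y) • deriv (extension φ lam s u) y + deriv (deriv (extension φ lam s u)) y =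
      y ^ (2 * s - 1) • fluxDeriv φ lam s u y := by
  have h1 := deriv_extension_eventuallyEq φ hlam u hs hy
  rw [h1.deriv_eq, h1.eq_of_nhds]
  have h2 := (Real.hasDerivAt_rpow_const (p := 2 * s - 1) (Or.inl hy.ne')).smul
    (hasDerivAt_flux φ hlam u hs hy)
  have h3 := h2.deriv
  simp only [Pi.smul_def'] at h3
  rw [h3, smul_smul]
  rw [show (1 - 2 * s) / y * y ^ (2 * s - 1) = -((2 * s - 1) * y ^ (2 * s - 1 - 1)) by
    rw [Real.rpow_sub_one hy.ne' (2 * s - 1)]; field_simp; ring]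
  module

theorem deriv_weighted_extension (hlam : ∀ k, 0 ≤ lam k) (u : L2Cyl Ω) {s y : ℝ} (hs : 0 < s)
    (hy : 0 < y) :
    deriv (fun η : ℝ => η ^ (1 - 2 * s) • deriv (extension φ lam s u) η) y =
      fluxDeriv φ lam s u y := by
  have h : (fun η : ℝ => η ^ (1 - 2 * s) • deriv (extension φ lam s u) η) =ᶠ[𝓝 y]
      flux φ lam s u := by
    filter_upwards [lt_mem_nhds hy] with x hx
    rw [(hasDerivAt_extension φ hlam u hs hx).deriv, smul_smul, ← Real.rpow_add hx]
    simp
  rw [h.deriv_eq, (hasDerivAt_flux φ hlam u hs hy).deriv]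

end

section

/-! ### Test functions -/

section TestFunctions

variable {X Y : Type*} [NormedAddCommGroup X] [NormedSpace ℝ X] [NormedAddCommGroup Y]
  [NormedSpace ℝ Y] {S : Opens X} {T : Opens Y}

/-- The derivative of a test function in the direction `v`. -/
def dirDeriv (ψ : 𝓓(S, ℝ)) (v : X) : 𝓓(S, ℝ) where
  toFun := fun x => fderiv ℝ ψ x v
  contDiff' := ((ψ.contDiff.fderiv_right (m := ∞) (by simp)).clm_apply contDiff_const)
  hasCompactSupport' := (ψ.hasCompactSupport.fderiv ℝ).comp_left
    (g := fun L : X →L[ℝ] ℝ => L v) (by simp)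
  tsupport_subset' := ((tsupport_comp_subset (g := fun L : X →L[ℝ] ℝ => L v) (by simp) _).trans
    (tsupport_fderiv_subset ℝ)).trans ψ.tsupport_subset

@[simp]
theorem dirDeriv_apply (ψ : 𝓓(S, ℝ)) (v x : X) : dirDeriv ψ v x = fderiv ℝ ψ x v := rfl

/-- The restriction of a test function along a smooth embedding with a continuous retraction. -/
def pullTest (ψ : 𝓓(T, ℝ)) (ι : X → Y) (π : Y → X) (hι : ContDiff ℝ ∞ ι) (hπ : Continuous π)
    (h : Function.LeftInverse π ι) (hT : ∀ x, ι x ∈ T → x ∈ S) : 𝓓(S, ℝ) where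
  toFun := fun x => ψ (ι x)
  contDiff' := ψ.contDiff.comp hι
  hasCompactSupport' := ψ.hasCompactSupport.comp_isClosedEmbedding
    (h.isClosedEmbedding hπ hι.continuous)
  tsupport_subset' := fun x hx => hT x (ψ.tsupport_subset
    (tsupport_comp_subset_preimage ψ hι.continuous hx))

theorem fderiv_comp_affine (ψ : 𝓓(T, ℝ)) {ι : X → Y} {L : X →L[ℝ] Y} {x : X}
    (hι : HasFDerivAt ι L x) (v : X) : fderiv ℝ (fun x => ψ (ι x)) x v = fderiv ℝ ψ (ι x) (L v) := by
  have h1 : HasFDerivAt ψ (fderiv ℝ ψ (ι x)) (ι x) :=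
    (ψ.contDiff.differentiable (by simp) (ι x)).hasFDerivAt
  exact congrArg (fun M : X →L[ℝ] ℝ => M v) (h1.comp x hι).fderiv

theorem exists_bound_test (ψ : 𝓓(S, ℝ)) : ∃ M, ∀ x, ‖ψ x‖ ≤ M :=
  ψ.hasCompactSupport.exists_bound_of_continuous ψ.continuous

end TestFunctions

variable {n : ℕ} {Ω : Opens (Sp n)}

/-- The slice `v(t, ·)`. -/
def sliceT (v : 𝓓(cyl Ω, ℝ)) (t : ℝ) : 𝓓(Ω, ℝ) :=
  pullTest v (fun x => (t, x)) Prod.snd (by fun_prop) continuous_snd (fun _ => rfl) fun _ hx => hx.2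

/-- The slice `v(·, y)`. -/
def sliceH (v : 𝓓(halfCyl Ω, ℝ)) (y : ℝ) : 𝓓(Ω, ℝ) :=
  pullTest v (fun x => (x, y)) Prod.fst (by fun_prop) continuous_fst (fun _ => rfl) fun _ hx => hx.1

/-- The slice `V(·, ·, y)`. -/
def sliceY (V : 𝓓(fullCyl Ω, ℝ)) (y : ℝ) : 𝓓(cyl Ω, ℝ) :=
  pullTest V (fun p => (p.1, p.2, y)) (fun q => (q.1, q.2.1)) (by fun_prop) (by fun_prop)
    (fun _ => rfl) fun _ hx => ⟨mem_univ _, hx.2.1⟩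

@[simp]
theorem sliceT_apply (v : 𝓓(cyl Ω, ℝ)) (t : ℝ) (x : Sp n) : sliceT v t x = v (t, x) := rfl

@[simp]
theorem sliceH_apply (v : 𝓓(halfCyl Ω, ℝ)) (y : ℝ) (x : Sp n) : sliceH v y x = v (x, y) := rfl

@[simp]
theorem sliceY_apply (V : 𝓓(fullCyl Ω, ℝ)) (y : ℝ) (p : ℝ × Sp n) :
    sliceY V y p = V (p.1, p.2, y) := rfl

theorem fderiv_sliceT (v : 𝓓(cyl Ω, ℝ)) (t : ℝ) (x ξ : Sp n) :
    fderiv ℝ (sliceT v t) x ξ = fderiv ℝ v (t, x) (0, ξ) := by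
  have h : HasFDerivAt (fun x : Sp n => (t, x)) (ContinuousLinearMap.inr ℝ ℝ (Sp n)) x :=
    hasFDerivAt_prodMk_right t x
  refine (fderiv_comp_affine v h ξ).trans ?_
  simp

theorem fderiv_sliceH (v : 𝓓(halfCyl Ω, ℝ)) (y : ℝ) (x ξ : Sp n) :
    fderiv ℝ (sliceH v y) x ξ = fderiv ℝ v (x, y) (ξ, 0) := by
  have h : HasFDerivAt (fun x : Sp n => (x, y)) (ContinuousLinearMap.inl ℝ (Sp n) ℝ) x :=
    hasFDerivAt_prodMk_left x y
  refine (fderiv_comp_affine v h ξ).trans ?_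
  simp

theorem fderiv_sliceY (V : 𝓓(fullCyl Ω, ℝ)) (y : ℝ) (p ξ : ℝ × Sp n) :
    fderiv ℝ (sliceY V y) p ξ = fderiv ℝ V (p.1, p.2, y) (ξ.1, ξ.2, 0) := by
  have h : HasFDerivAt (fun p : ℝ × Sp n => (p.1, p.2, y))
      ((ContinuousLinearMap.fst ℝ ℝ (Sp n)).prod ((ContinuousLinearMap.snd ℝ ℝ (Sp n)).prod 0)) p :=
    hasFDerivAt_fst.prodMk (hasFDerivAt_snd.prodMk (hasFDerivAt_const y p))
  refine (fderiv_comp_affine V h ξ).trans ?_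
  simp

theorem coeFn_testL2 (v : 𝓓(cyl Ω, ℝ)) : testL2 v =ᵐ[mCyl Ω] fun p => (v p : ℂ) :=
  (memLp_test v).coeFn_toLp

theorem integral_mul_test (F : L2Cyl Ω) (v : 𝓓(cyl Ω, ℝ)) :
    ∫ p, F p * v p ∂(mCyl Ω) = ⟪testL2 v, F⟫_ℂ := by
  rw [L2.inner_def]
  refine integral_congr_ae ?_
  filter_upwards [coeFn_testL2 v] with p hp
  rw [hp, RCLike.inner_apply, Complex.conj_ofReal]

theorem testL2_sub (v w : 𝓓(cyl Ω, ℝ)) : testL2 (v - w) = testL2 v - testL2 w := by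
  refine Lp.ext ?_
  filter_upwards [coeFn_testL2 v, coeFn_testL2 w, coeFn_testL2 (v - w),
    Lp.coeFn_sub (testL2 v) (testL2 w)] with p h1 h2 h3 h4
  rw [h3, h4, Pi.sub_apply, h1, h2]
  simp

/-! ### Weak derivatives -/

section WeakDeriv

variable {X F : Type*} [NormedAddCommGroup X] [NormedSpace ℝ X] [MeasureSpace X]
  [NormedAddCommGroup F] [NormedSpace ℝ F] {S : Opens X} {v : X}

theorem integrableOn_test_smul [BorelSpace X] {w : X → F} (hw : LocallyIntegrableOn w (S : Set X))
    (ψ : 𝓓(S, ℝ)) : IntegrableOn (fun x => ψ x • w x) (S : Set X) := by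
  have hK : IsCompact (tsupport ψ) := ψ.hasCompactSupport
  have h1 : IntegrableOn w (tsupport ψ) := hw.integrableOn_compact_subset ψ.tsupport_subset hK
  obtain ⟨M, hM⟩ := exists_bound_test ψ
  have h2 : IntegrableOn (fun x => ψ x • w x) (tsupport ψ) :=
    h1.bdd_smul M ψ.continuous.aestronglyMeasurable (ae_of_all _ hM)
  refine IntegrableOn.mono_set ((integrableOn_iff_integrable_of_support_subset
    (s := tsupport ψ) ?_).1 h2).integrableOn (subset_univ _)
  intro x hx
  refine subset_tsupport _ fun h => hx ?_
  simp [h]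

theorem HasWeakDeriv.congr_left {w w' g : X → F} (h : HasWeakDeriv S v w g)
    (hw : w =ᵐ[volume.restrict (S : Set X)] w') (hw' : LocallyIntegrableOn w' (S : Set X)) :
    HasWeakDeriv S v w' g := by
  refine ⟨hw', h.2.1, fun ψ => ?_⟩
  rw [← h.2.2 ψ]
  refine integral_congr_ae ?_
  filter_upwards [hw] with x hx
  rw [hx]

theorem HasWeakDeriv.congr_right {w g g' : X → F} (h : HasWeakDeriv S v w g)
    (hg : g =ᵐ[volume.restrict (S : Set X)] g') (hg' : LocallyIntegrableOn g' (S : Set X)) :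
    HasWeakDeriv S v w g' := by
  refine ⟨h.1, hg', fun ψ => ?_⟩
  rw [h.2.2 ψ]
  congr 1
  refine integral_congr_ae ?_
  filter_upwards [hg] with x hx
  rw [hx]

theorem HasWeakDeriv.add [BorelSpace X] {w w' g g' : X → F} (h : HasWeakDeriv S v w g)
    (h' : HasWeakDeriv S v w' g') :
    HasWeakDeriv S v (fun x => w x + w' x) (fun x => g x + g' x) := by
  refine ⟨h.1.add h'.1, h.2.1.add h'.2.1, fun ψ => ?_⟩
  have i1 := integrableOn_test_smul h.1 (dirDeriv ψ v)
  have i2 := integrableOn_test_smul h'.1 (dirDeriv ψ v)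
  simp only [dirDeriv_apply] at i1 i2
  simp only [smul_add]
  rw [integral_add i1 i2, h.2.2 ψ, h'.2.2 ψ,
    integral_add (integrableOn_test_smul h.2.1 ψ) (integrableOn_test_smul h'.2.1 ψ)]
  abel

theorem HasWeakDeriv.const_smul {𝕜 : Type*} [RCLike 𝕜] [NormedSpace 𝕜 F]
    {w g : X → F} (h : HasWeakDeriv S v w g) (c : 𝕜) [SMulCommClass ℝ 𝕜 F] :
    HasWeakDeriv S v (fun x => c • w x) (fun x => c • g x) := by
  refine ⟨h.1.smul c, h.2.1.smul c, fun ψ => ?_⟩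
  simp only [smul_comm _ c]
  rw [integral_smul, integral_smul, h.2.2 ψ, smul_neg]

theorem hasWeakDeriv_zero : HasWeakDeriv S v (fun _ => (0 : F)) (fun _ => 0) :=
  ⟨locallyIntegrableOn_zero, locallyIntegrableOn_zero, fun ψ => by simp⟩

theorem HasWeakDeriv.sum [BorelSpace X] {ι : Type*} {w g : ι → X → F} {s : Finset ι}
    (h : ∀ i ∈ s, HasWeakDeriv S v (w i) (g i)) :
    HasWeakDeriv S v (fun x => ∑ i ∈ s, w i x) (fun x => ∑ i ∈ s, g i x) := by
  classical
  induction s using Finset.induction_on with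
  | empty => simpa using hasWeakDeriv_zero
  | insert i s hi ih =>
    simp only [Finset.sum_insert hi]
    exact (h i (Finset.mem_insert_self i s)).add
      (ih fun j hj => h j (Finset.mem_insert_of_mem hj))

theorem HasWeakDeriv.ofReal {w g : X → ℝ} (h : HasWeakDeriv S v w g) :
    HasWeakDeriv S v (fun x => (w x : ℂ)) (fun x => (g x : ℂ)) := by
  have hc : ∀ {f : X → ℝ}, LocallyIntegrableOn f (S : Set X) →
      LocallyIntegrableOn (fun x => (f x : ℂ)) (S : Set X) := fun hf x hx => by
    obtain ⟨U, hU, hi⟩ := hf x hx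
    exact ⟨U, hU, hi.ofReal⟩
  refine ⟨hc h.1, hc h.2.1, fun ψ => ?_⟩
  have h1 := congrArg (fun r : ℝ => (r : ℂ)) (h.2.2 ψ)
  simp only [smul_eq_mul, Complex.ofReal_neg] at h1
  rw [← integral_complex_ofReal, ← integral_complex_ofReal] at h1
  simpa using h1

theorem enorm_integral_test_smul_le [BorelSpace X] {h : X → F} (hh : AEStronglyMeasurable h
    (volume.restrict (S : Set X))) (ψ : 𝓓(S, ℝ)) :
    ‖∫ x in (S : Set X), ψ x • h x‖ₑ ≤
      eLpNorm ψ 2 (volume.restrict (S : Set X)) * eLpNorm h 2 (volume.restrict (S : Set X)) := by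
  refine (enorm_integral_le_lintegral_enorm _).trans ?_
  rw [← eLpNorm_one_eq_lintegral_enorm]
  exact eLpNorm_smul_le_mul_eLpNorm (p := 2) (q := 2) (r := 1) hh
    ψ.continuous.aestronglyMeasurable

theorem eLpNorm_test_lt_top [BorelSpace X] [IsLocallyFiniteMeasure (volume : Measure X)] (ψ : 𝓓(S, ℝ)) :
    eLpNorm ψ 2 (volume.restrict (S : Set X)) < ⊤ :=
  (ψ.continuous.memLp_of_hasCompactSupport ψ.hasCompactSupport).restrict _ |>.2

/-- Weak derivatives are closed under limits in `L²`. -/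
theorem hasWeakDeriv_of_approx [BorelSpace X] [IsLocallyFiniteMeasure (volume : Measure X)]
    [SecondCountableTopology X] {w g : X → F} (hw : LocallyIntegrableOn w (S : Set X))
    (hg : LocallyIntegrableOn g (S : Set X))
    (h : ∀ ε : ENNReal, 0 < ε → ∃ w' g' : X → F, HasWeakDeriv S v w' g' ∧
      eLpNorm (w - w') 2 (volume.restrict (S : Set X)) ≤ ε ∧
      eLpNorm (g - g') 2 (volume.restrict (S : Set X)) ≤ ε) : HasWeakDeriv S v w g := by
  refine ⟨hw, hg, fun ψ => ?_⟩
  rw [← sub_eq_zero, ← enorm_eq_zero, ← nonpos_iff_eq_zero]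
  set A := eLpNorm (dirDeriv ψ v) 2 (volume.restrict (S : Set X)) +
    eLpNorm ψ 2 (volume.restrict (S : Set X)) with hA
  have hAt : A ≠ ⊤ := (ENNReal.add_lt_top.2 ⟨eLpNorm_test_lt_top _, eLpNorm_test_lt_top _⟩).ne
  refine ENNReal.le_of_forall_pos_le_add fun ε hε _ => ?_
  rw [zero_add]
  -- The two errors are paired by Cauchy–Schwarz with the derivative of `ψ` and with `ψ`, whose
  -- norms add up to `A`. The `1` covers the case `A = 0`.
  obtain ⟨w', g', hd, h1, h2⟩ := h (ε / (A + 1)) (ENNReal.div_pos (by exact_mod_cast hε.ne')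
    (ENNReal.add_lt_top.2 ⟨hAt.lt_top, ENNReal.one_lt_top⟩).ne)
  have i1 := integrableOn_test_smul hw (dirDeriv ψ v)
  have i2 := integrableOn_test_smul hd.1 (dirDeriv ψ v)
  have j1 := integrableOn_test_smul hg ψ
  have j2 := integrableOn_test_smul hd.2.1 ψ
  have e : (∫ x in (S : Set X), (fderiv ℝ ψ x v) • w x) - -∫ x in (S : Set X), ψ x • g x =
      (∫ x in (S : Set X), dirDeriv ψ v x • (w - w') x) +
        ∫ x in (S : Set X), ψ x • (g - g') x := by
    simp only [Pi.sub_apply, smul_sub]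
    rw [integral_sub i1 i2, integral_sub j1 j2]
    have := hd.2.2 ψ
    simp only [dirDeriv_apply]
    rw [this]
    abel
  rw [e]
  refine (enorm_add_le _ _).trans ?_
  refine (add_le_add (enorm_integral_test_smul_le (hw.aestronglyMeasurable.sub
    hd.1.aestronglyMeasurable) _) (enorm_integral_test_smul_le (hg.aestronglyMeasurable.sub
    hd.2.1.aestronglyMeasurable) _)).trans ?_
  calc _ ≤ eLpNorm (dirDeriv ψ v) 2 (volume.restrict (S : Set X)) * (ε / (A + 1)) +
        eLpNorm ψ 2 (volume.restrict (S : Set X)) * (ε / (A + 1)) := by gcongr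
    _ = A * (ε / (A + 1)) := by rw [hA, add_mul]
    _ ≤ (A + 1) * (ε / (A + 1)) := by gcongr; exact le_self_add
    _ ≤ ε := ENNReal.mul_div_le

end WeakDeriv

theorem locallyIntegrableOn_of_memLp {X F : Type*} [TopologicalSpace X] [MeasureSpace X]
    [NormedAddCommGroup F] [IsLocallyFiniteMeasure (volume : Measure X)] {S : Opens X} {w : X → F}
    (hw : MemLp w 2 (volume.restrict (S : Set X))) : LocallyIntegrableOn w (S : Set X) := by
  intro x hx
  obtain ⟨U, hU, hfin⟩ := (volume : Measure X).finiteAt_nhds x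
  refine ⟨S ∩ U, inter_mem self_mem_nhdsWithin (nhdsWithin_le_nhds hU), ?_⟩
  have h1 : MemLp w 2 (volume.restrict ((S : Set X) ∩ U)) :=
    hw.mono_measure (Measure.restrict_mono inter_subset_left le_rfl)
  have : IsFiniteMeasure (volume.restrict ((S : Set X) ∩ U)) :=
    ⟨by rw [Measure.restrict_apply_univ]; exact (measure_mono inter_subset_right).trans_lt hfin⟩
  exact h1.integrable (by norm_num)

theorem HasWeakDeriv.unique {X F : Type*} [NormedAddCommGroup X] [NormedSpace ℝ X]
    [FiniteDimensional ℝ X] [MeasureSpace X] [BorelSpace X] [NormedAddCommGroup F]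
    [NormedSpace ℝ F] [CompleteSpace F] {S : Opens X} {v : X} {w g g' : X → F}
    (h : HasWeakDeriv S v w g)
    (h' : HasWeakDeriv S v w g') : g =ᵐ[volume.restrict (S : Set X)] g' := by
  have h1 := IsOpen.ae_eq_zero_of_integral_contDiff_smul_eq_zero (μ := (volume : Measure X))
    S.isOpen (f := fun x => g x - g' x) (h.2.1.sub h'.2.1) fun ψ hψ hc hs => ?_
  · rw [EventuallyEq, ae_restrict_iff' S.isOpen.measurableSet]
    filter_upwards [h1] with x hx hxS
    exact sub_eq_zero.1 (hx hxS)
  · set Ψ : 𝓓(S, ℝ) := ⟨ψ, hψ, hc, hs⟩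
    have e : ∫ x, ψ x • (g x - g' x) = ∫ x in (S : Set X), Ψ x • (g x - g' x) := by
      refine (setIntegral_eq_integral_of_forall_compl_eq_zero fun x hx => ?_).symm
      have : ψ x = 0 := image_eq_zero_of_notMem_tsupport fun hx' => hx (hs hx')
      change ψ x • _ = 0
      rw [this, zero_smul]
    rw [e]
    simp only [smul_sub]
    rw [integral_sub (integrableOn_test_smul h.2.1 Ψ) (integrableOn_test_smul h'.2.1 Ψ),
      sub_eq_zero]
    exact neg_injective ((h.2.2 Ψ).symm.trans (h'.2.2 Ψ))

end

section

variable {n : ℕ} {Ω : Opens (Sp n)} {a : Sp n → Matrix (Fin n) (Fin n) ℝ} {c : Sp n → ℝ} {Λ : ℝ}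
  {𝒱 : Submodule ℝ (L2 Ω)} {lam : ℕ → ℝ} {φ : HilbertBasis ℕ ℝ (L2 Ω)}

/-! ### The energy space -/

theorem hasWeakDeriv_wpartial {w : L2 Ω} (h : HasFiniteEnergy Ω c w) (i : Fin n) :
    HasWeakDeriv Ω (e i) w (wpartial Ω i w) := by
  obtain ⟨g, -, hg⟩ := h.1 i
  have hex : ∃ g, HasWeakDeriv Ω (e i) w g := ⟨g, hg⟩
  rw [wpartial, dif_pos hex]
  exact hex.choose_spec

theorem wpartial_ae_eq {w : L2 Ω} {g : Sp n → ℝ} {i : Fin n} (hg : HasWeakDeriv Ω (e i) w g) :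
    wpartial Ω i w =ᵐ[mΩ Ω] g := by
  have hex : ∃ g, HasWeakDeriv Ω (e i) w g := ⟨g, hg⟩
  rw [wpartial, dif_pos hex]
  exact hex.choose_spec.unique hg

/-- The first order data of `w`: its weak partial derivatives, and `|c|^{1/2} w`. -/
def jetFun (Ω : Opens (Sp n)) (c : Sp n → ℝ) (w : L2 Ω) : Option (Fin n) → Sp n → ℝ
  | some i => wpartial Ω i w
  | none => fun x => √|c x| * w x

theorem memLp_jetFun (hc : AEMeasurable c (mΩ Ω)) {w : L2 Ω} (h : HasFiniteEnergy Ω c w)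
    (j : Option (Fin n)) : MemLp (jetFun Ω c w j) 2 (mΩ Ω) := by
  rcases j with _ | i
  · have hm : AEStronglyMeasurable (fun x => √|c x| * w x) (mΩ Ω) := by
      refine AEStronglyMeasurable.mul ?_ (Lp.aestronglyMeasurable w)
      exact (Real.continuous_sqrt.measurable.comp_aemeasurable
        (continuous_abs.measurable.comp_aemeasurable hc)).aestronglyMeasurable
    refine (memLp_two_iff_integrable_sq hm).2 (h.2.congr (ae_of_all _ fun x => ?_))
    simp only [mul_pow, Real.sq_sqrt (abs_nonneg _)]
  · obtain ⟨g, hg, hd⟩ := h.1 i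
    exact (memLp_congr_ae (wpartial_ae_eq hd)).2 hg

/-- The first order data of an element of the form domain. -/
def jet (hc : AEMeasurable c (mΩ Ω)) (h𝒱 : IsFormDomain Ω a c 𝒱) (j : Option (Fin n)) :
    𝒱 →ₗ[ℝ] L2 Ω where
  toFun w := (memLp_jetFun hc (h𝒱.energy w w.2) j).toLp _
  map_add' w v := by
    rw [← MemLp.toLp_add, MemLp.toLp_eq_toLp_iff]
    have hadd := Lp.coeFn_add (w : L2 Ω) (v : L2 Ω)
    rcases j with _ | i
    · filter_upwards [hadd] with x hx
      simp only [jetFun, Submodule.coe_add, Pi.add_apply] at hx ⊢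
      rw [hx]; ring
    · refine wpartial_ae_eq ?_
      refine ((hasWeakDeriv_wpartial (h𝒱.energy w w.2) i).add
        (hasWeakDeriv_wpartial (h𝒱.energy v v.2) i)).congr_left hadd.symm
        (locallyIntegrableOn_of_memLp (Lp.memLp _))
  map_smul' r w := by
    rw [RingHom.id_apply, ← MemLp.toLp_const_smul, MemLp.toLp_eq_toLp_iff]
    have hadd := Lp.coeFn_smul r (w : L2 Ω)
    rcases j with _ | i
    · filter_upwards [hadd] with x hx
      simp only [jetFun, Submodule.coe_smul, Pi.smul_apply, smul_eq_mul] at hx ⊢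
      rw [hx]; ring
    · refine wpartial_ae_eq ?_
      refine ((hasWeakDeriv_wpartial (h𝒱.energy w w.2) i).const_smul r).congr_left hadd.symm
        (locallyIntegrableOn_of_memLp (Lp.memLp _))

theorem coeFn_jet (hc : AEMeasurable c (mΩ Ω)) (h𝒱 : IsFormDomain Ω a c 𝒱) (j : Option (Fin n))
    (w : 𝒱) : jet hc h𝒱 j w =ᵐ[mΩ Ω] jetFun Ω c w j :=
  (memLp_jetFun hc (h𝒱.energy w w.2) j).coeFn_toLp

/-- The coefficients of the form of `L` in terms of the first order data. -/
def coef (a : Sp n → Matrix (Fin n) (Fin n) ℝ) (c : Sp n → ℝ) (x : Sp n) :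
    Option (Fin n) → Option (Fin n) → ℝ
  | some i, some j => a x i j
  | none, none => (SignType.sign (c x) : ℝ)
  | _, _ => 0

/-- Through `c w v = sign(c) (|c|^{1/2} w) (|c|^{1/2} v)` the density of the form becomes a form in
the first order data with bounded coefficients. This makes the form continuous for `L²` convergence
of the data although `c` may be unbounded. -/
theorem sum_coef {R : Type*} [CommRing R] [Algebra ℝ R] (x : Sp n) (p q : Option (Fin n) → R) :
    ∑ j, ∑ l, algebraMap ℝ R (coef a c x j l) * p j * q l =
      (∑ i, ∑ j, algebraMap ℝ R (a x i j) * p (some i) * q (some j)) +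
        algebraMap ℝ R (SignType.sign (c x) : ℝ) * p none * q none := by
  simp only [Fintype.sum_option, coef, map_zero, zero_mul, Finset.sum_const_zero, add_zero,
    zero_add]
  rw [add_comm]

theorem sign_mul_sqrt_mul_sqrt (r : ℝ) : (SignType.sign r : ℝ) * (√|r| * √|r|) = r := by
  rw [Real.mul_self_sqrt (abs_nonneg _), sign_mul_abs]

theorem aemeasurable_coef (hL : IsAdmissible Ω a c Λ) (j l : Option (Fin n)) :
    AEMeasurable (fun x => coef a c x j l) (mΩ Ω) := by
  rcases j with _ | i <;> rcases l with _ | l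
  · simp only [coef]
    have : Measurable (fun r : ℝ => (SignType.sign r : ℝ)) := by
      have h : (fun r : ℝ => (SignType.sign r : ℝ)) =
          fun r => if 0 < r then 1 else if r < 0 then -1 else 0 := by
        funext r; simp only [sign_apply]; split_ifs <;> simp
      rw [h]
      exact Measurable.ite measurableSet_Ioi measurable_const
        (Measurable.ite measurableSet_Iio measurable_const measurable_const)
    exact this.comp_aemeasurable hL.meas_c
  · exact aemeasurable_const
  · exact aemeasurable_const
  · exact hL.meas_a i l

theorem coef_symm (hL : IsAdmissible Ω a c Λ) :
    ∀ᵐ x ∂(mΩ Ω), ∀ j l, coef a c x j l = coef a c x l j := by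
  filter_upwards [hL.symm] with x hx j l
  rcases j with _ | i <;> rcases l with _ | l <;> simp only [coef]
  exact (hx.apply l i)

/-- Polarization: ellipticity is tested on `e_i + ε e_l` with `ε = ±1`, and the two inequalities are
compared using symmetry. The extra `1` in the bound accommodates the sign of `c`. -/
theorem abs_coef_le (hL : IsAdmissible Ω a c Λ) :
    ∀ᵐ x ∂(mΩ Ω), ∀ j l, |coef a c x j l| ≤ Λ + 1 := by
  have hΛ := hL.pos
  filter_upwards [hL.symm, hL.elliptic] with x hx he j l
  rcases j with _ | i <;> rcases l with _ | l <;> simp only [coef]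
  · rcases lt_trichotomy (c x) 0 with h | h | h <;> simp [h] <;> linarith
  · simp; linarith
  · simp; linarith
  · have hq : ∀ (ε : ℝ), ε ^ 2 = 1 →
        0 ≤ a x i i + a x l l + ε * (a x i l + a x l i) ∧
          a x i i + a x l l + ε * (a x i l + a x l i) ≤ 2 * Λ + 2 * ε * (if i = l then Λ else 0) := by
      intro ε hε
      have h := he (fun m => (if m = i then 1 else 0) + ε * (if m = l then 1 else 0))
      have e1 : ∑ i', ∑ j', a x i' j' * ((if i' = i then 1 else 0) + ε * (if i' = l then 1 else 0)) *
          ((if j' = i then 1 else 0) + ε * (if j' = l then 1 else 0)) =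
          a x i i + ε ^ 2 * a x l l + ε * (a x i l + a x l i) := by
        simp only [mul_add, add_mul, Finset.sum_add_distrib, mul_ite, ite_mul, mul_one, mul_zero,
          zero_mul, Finset.sum_ite_eq', Finset.mem_univ, if_true]
        ring
      have e2 : ∑ m : Fin n, ((if m = i then 1 else 0) + ε * (if m = l then 1 else 0)) ^ 2 =
          1 + ε ^ 2 + 2 * ε * (if i = l then 1 else 0) := by
        simp only [add_sq, Finset.sum_add_distrib, ite_pow, one_pow, mul_ite, ite_mul,
          mul_one, mul_zero, zero_mul, ne_eq, OfNat.ofNat_ne_zero, not_false_eq_true, zero_pow,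
          Finset.sum_ite_eq', Finset.mem_univ, if_true]
        by_cases hil : i = l
        · subst hil; simp; ring
        · have : l ≠ i := fun h => hil h.symm
          simp [hil, this]
      rw [e1, e2, hε, one_mul] at h
      refine ⟨le_trans (mul_nonneg (inv_nonneg.2 hΛ.le) ?_) h.1, h.2.trans (le_of_eq ?_)⟩
      · split_ifs
        · nlinarith [sq_nonneg (1 + ε)]
        · norm_num
      · split_ifs <;> ring
    have h1 := hq 1 (by norm_num)
    have h2 := hq (-1) (by norm_num)
    have h3 : a x l i = a x i l := hx.apply i l
    rw [h3] at h1 h2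
    rw [abs_le]
    constructor <;> split_ifs at h1 h2 <;> linarith [h1.1, h1.2, h2.1, h2.2]

theorem integrable_coef_mul {X : Type*} [MeasurableSpace X] {μ : Measure X} {b : X → ℝ} {M : ℝ}
    (hb : AEMeasurable b μ) (hM : ∀ᵐ x ∂μ, |b x| ≤ M) {f g : X → ℝ} (hf : MemLp f 2 μ)
    (hg : MemLp g 2 μ) : Integrable (fun x => b x * f x * g x) μ := by
  have h : Integrable (fun x => f x * g x) μ := hf.integrable_mul hg
  refine (h.bdd_mul hb.aestronglyMeasurable hM).congr (ae_of_all _ fun x => ?_)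
  simp only [mul_assoc]

theorem energyForm_eq (hL : IsAdmissible Ω a c Λ) (h𝒱 : IsFormDomain Ω a c 𝒱) (w v : 𝒱) :
    energyForm Ω a c w v =
      ∑ j, ∑ l, ∫ x, coef a c x j l * jet hL.meas_c h𝒱 j w x * jet hL.meas_c h𝒱 l v x ∂(mΩ Ω) := by
  have hi : ∀ j l, Integrable (fun x => coef a c x j l * jet hL.meas_c h𝒱 j w x *
      jet hL.meas_c h𝒱 l v x) (mΩ Ω) := fun j l =>
    integrable_coef_mul (aemeasurable_coef hL j l)
      ((abs_coef_le hL).mono fun x hx => hx j l) (Lp.memLp _) (Lp.memLp _)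
  simp_rw [← integral_finsetSum Finset.univ fun l _ => hi _ l]
  rw [← integral_finsetSum Finset.univ fun j _ => integrable_finsetSum _ fun l _ => hi j l]
  refine integral_congr_ae ?_
  have h1 := fun j => coeFn_jet hL.meas_c h𝒱 j w
  have h2 := fun j => coeFn_jet hL.meas_c h𝒱 j v
  filter_upwards [ae_all_iff.2 h1, ae_all_iff.2 h2] with x hx hx'
  have := sum_coef (R := ℝ) (a := a) (c := c) x (fun j => jet hL.meas_c h𝒱 j w x)
    (fun j => jet hL.meas_c h𝒱 j v x)
  simp only [Algebra.algebraMap_self, RingHom.id_apply] at this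
  rw [this]
  simp only [hx, hx', jetFun]
  congr 1
  nth_rewrite 1 [← sign_mul_sqrt_mul_sqrt (c x)]
  ring

/-- The form of `L` on its form domain. -/
def formL (hL : IsAdmissible Ω a c Λ) (h𝒱 : IsFormDomain Ω a c 𝒱) : LinearMap.BilinForm ℝ 𝒱 :=
  LinearMap.mk₂ ℝ (fun w v => energyForm Ω a c w v)
    (fun w w' v => by
      have hi : ∀ (w : 𝒱) j l, Integrable (fun x => coef a c x j l * jet hL.meas_c h𝒱 j w x *
          jet hL.meas_c h𝒱 l v x) (mΩ Ω) := fun w j l =>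
        integrable_coef_mul (aemeasurable_coef hL j l)
          ((abs_coef_le hL).mono fun x hx => hx j l) (Lp.memLp _) (Lp.memLp _)
      simp only [energyForm_eq hL h𝒱, ← Finset.sum_add_distrib, map_add]
      refine Finset.sum_congr rfl fun j _ => Finset.sum_congr rfl fun l _ => ?_
      rw [← integral_add (hi w j l) (hi w' j l)]
      refine integral_congr_ae ?_
      filter_upwards [Lp.coeFn_add (jet hL.meas_c h𝒱 j w) (jet hL.meas_c h𝒱 j w')] with x hx
      rw [hx, Pi.add_apply]; ring)
    (fun r w v => by
      simp only [energyForm_eq hL h𝒱, smul_eq_mul, Finset.mul_sum, map_smul]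
      refine Finset.sum_congr rfl fun j _ => Finset.sum_congr rfl fun l _ => ?_
      rw [← integral_const_mul]
      refine integral_congr_ae ?_
      filter_upwards [Lp.coeFn_smul r (jet hL.meas_c h𝒱 j w)] with x hx
      rw [hx, Pi.smul_apply, smul_eq_mul]; ring)
    (fun v w w' => by
      have hi : ∀ (w : 𝒱) j l, Integrable (fun x => coef a c x j l * jet hL.meas_c h𝒱 j v x *
          jet hL.meas_c h𝒱 l w x) (mΩ Ω) := fun w j l =>
        integrable_coef_mul (aemeasurable_coef hL j l)
          ((abs_coef_le hL).mono fun x hx => hx j l) (Lp.memLp _) (Lp.memLp _)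
      simp only [energyForm_eq hL h𝒱, ← Finset.sum_add_distrib, map_add]
      refine Finset.sum_congr rfl fun j _ => Finset.sum_congr rfl fun l _ => ?_
      rw [← integral_add (hi w j l) (hi w' j l)]
      refine integral_congr_ae ?_
      filter_upwards [Lp.coeFn_add (jet hL.meas_c h𝒱 l w) (jet hL.meas_c h𝒱 l w')] with x hx
      rw [hx, Pi.add_apply]; ring)
    (fun r v w => by
      simp only [energyForm_eq hL h𝒱, smul_eq_mul, Finset.mul_sum, map_smul]
      refine Finset.sum_congr rfl fun j _ => Finset.sum_congr rfl fun l _ => ?_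
      rw [← integral_const_mul]
      refine integral_congr_ae ?_
      filter_upwards [Lp.coeFn_smul r (jet hL.meas_c h𝒱 l w)] with x hx
      rw [hx, Pi.smul_apply, smul_eq_mul]; ring)

theorem formL_apply (hL : IsAdmissible Ω a c Λ) (h𝒱 : IsFormDomain Ω a c 𝒱) (w v : 𝒱) :
    formL hL h𝒱 w v = energyForm Ω a c w v := rfl

theorem formL_symm (hL : IsAdmissible Ω a c Λ) (h𝒱 : IsFormDomain Ω a c 𝒱) (w v : 𝒱) :
    formL hL h𝒱 w v = formL hL h𝒱 v w := by
  simp only [formL_apply, energyForm_eq hL h𝒱]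
  rw [Finset.sum_comm]
  refine Finset.sum_congr rfl fun j _ => Finset.sum_congr rfl fun l _ => ?_
  refine integral_congr_ae ?_
  filter_upwards [coef_symm hL] with x hx
  rw [hx]; ring

/-- The square of the norm of the first order data. -/
def jetSq (hL : IsAdmissible Ω a c Λ) (h𝒱 : IsFormDomain Ω a c 𝒱) (w : 𝒱) : ℝ :=
  ∑ j, ‖jet hL.meas_c h𝒱 j w‖ ^ 2

theorem norm_sq_eq_integral {X : Type*} [MeasurableSpace X] {μ : Measure X} (f : Lp ℝ 2 μ) :
    ‖f‖ ^ 2 = ∫ x, f x ^ 2 ∂μ := by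
  rw [← real_inner_self_eq_norm_sq, L2.inner_def]
  refine integral_congr_ae (ae_of_all _ fun x => ?_)
  simp [pow_two]

theorem jetSq_eq (hL : IsAdmissible Ω a c Λ) (h𝒱 : IsFormDomain Ω a c 𝒱) (w : 𝒱) :
    jetSq hL h𝒱 w = ∫ x, ((∑ i, wpartial Ω i w x ^ 2) + |c x| * (w : L2 Ω) x ^ 2) ∂(mΩ Ω) := by
  simp only [jetSq, norm_sq_eq_integral]
  rw [← integral_finsetSum _ fun j _ => (Lp.memLp (jet hL.meas_c h𝒱 j w)).integrable_sq]
  refine integral_congr_ae ?_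
  filter_upwards [ae_all_iff.2 fun j => coeFn_jet hL.meas_c h𝒱 j w] with x hx
  simp only [hx, Fintype.sum_option, jetFun, mul_pow, Real.sq_sqrt (abs_nonneg _)]
  rw [add_comm]

theorem jetSq_nonneg (hL : IsAdmissible Ω a c Λ) (h𝒱 : IsFormDomain Ω a c 𝒱) (w : 𝒱) :
    0 ≤ jetSq hL h𝒱 w := Finset.sum_nonneg fun _ _ => sq_nonneg _

theorem formL_le (hL : IsAdmissible Ω a c Λ) (h𝒱 : IsFormDomain Ω a c 𝒱) (w : 𝒱) :
    formL hL h𝒱 w w ≤ (Λ + 1) * jetSq hL h𝒱 w := by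
  have hΛ := hL.pos
  rw [jetSq_eq, formL_apply, energyForm, ← integral_const_mul]
  have hi := (h𝒱.energy w w.2)
  have hg : Integrable (fun x => (∑ i, wpartial Ω i w x ^ 2) + |c x| * (w : L2 Ω) x ^ 2) (mΩ Ω) :=
    (integrable_finsetSum _ fun i _ =>
      (memLp_jetFun hL.meas_c hi (some i)).integrable_sq).add hi.2
  -- Were the density not integrable, its integral would be `0` by convention and the bound trivial,
  -- so integrability need not be established here.
  by_cases hf : Integrable (fun x => (∑ i, ∑ j, a x i j * wpartial Ω i w x * wpartial Ω j w x) +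
      c x * (w : L2 Ω) x * (w : L2 Ω) x) (mΩ Ω)
  · refine integral_mono_ae hf (hg.const_mul _) ?_
    filter_upwards [hL.elliptic] with x hx
    have h1 := (hx fun i => wpartial Ω i w x).2
    have h2 : c x * (w : L2 Ω) x * (w : L2 Ω) x ≤ |c x| * (w : L2 Ω) x ^ 2 := by
      rw [mul_assoc, ← pow_two]
      exact mul_le_mul_of_nonneg_right (le_abs_self _) (sq_nonneg _)
    have h3 : 0 ≤ ∑ i, wpartial Ω i w x ^ 2 := Finset.sum_nonneg fun _ _ => sq_nonneg _
    have h4 : 0 ≤ |c x| * (w : L2 Ω) x ^ 2 := by positivity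
    have h5 : Λ * ∑ i, wpartial Ω i w x ^ 2 + |c x| * (w : L2 Ω) x ^ 2 ≤
        (Λ + 1) * ((∑ i, wpartial Ω i w x ^ 2) + |c x| * (w : L2 Ω) x ^ 2) := by nlinarith
    exact (add_le_add h1 h2).trans h5
  · rw [integral_undef hf]
    refine integral_nonneg fun x => ?_
    have h3 : 0 ≤ ∑ i, wpartial Ω i w x ^ 2 := Finset.sum_nonneg fun _ _ => sq_nonneg _
    simp only [Pi.zero_apply]
    positivity

theorem jetSq_le (hL : IsAdmissible Ω a c Λ) (h𝒱 : IsFormDomain Ω a c 𝒱) :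
    ∃ C₁ C₂ : ℝ, ∀ w : 𝒱, jetSq hL h𝒱 w ≤ C₁ * formL hL h𝒱 w w + C₂ * ‖(w : L2 Ω)‖ ^ 2 := by
  obtain ⟨C₁, C₂, h⟩ := h𝒱.coercive
  exact ⟨C₁, C₂, fun w => (jetSq_eq hL h𝒱 w).trans_le (h w w.2)⟩

/-- An eigenfunction as an element of the form domain. -/
def eigV (hφ : IsEigenbasis Ω a c 𝒱 lam φ) (k : ℕ) : 𝒱 := ⟨φ k, hφ.mem k⟩

theorem formL_eigV (hL : IsAdmissible Ω a c Λ) (h𝒱 : IsFormDomain Ω a c 𝒱)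
    (hφ : IsEigenbasis Ω a c 𝒱 lam φ) (k : ℕ) (w : 𝒱) :
    formL hL h𝒱 (eigV hφ k) w = lam k * ⟪φ k, (w : L2 Ω)⟫_ℝ := by
  rw [formL_apply, eigV, hφ.eigen k w w.2, L2.inner_def]
  congr 1
  refine integral_congr_ae (ae_of_all _ fun x => ?_)
  simp [mul_comm]

theorem inner_eigV (hφ : IsEigenbasis Ω a c 𝒱 lam φ) (F : Finset ℕ) (b : ℕ → ℝ) (k : ℕ) :
    ⟪φ k, ((∑ l ∈ F, b l • eigV hφ l : 𝒱) : L2 Ω)⟫_ℝ = if k ∈ F then b k else 0 := by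
  rw [Submodule.coe_sum, inner_sum]
  simp only [Submodule.coe_smul, eigV, inner_smul_right,
    orthonormal_iff_ite.1 φ.orthonormal, mul_ite, mul_one, mul_zero, Finset.sum_ite_eq]

theorem norm_sq_sum_eigV (hφ : IsEigenbasis Ω a c 𝒱 lam φ) (F : Finset ℕ) (b : ℕ → ℝ) :
    ‖((∑ l ∈ F, b l • eigV hφ l : 𝒱) : L2 Ω)‖ ^ 2 = ∑ l ∈ F, b l ^ 2 := by
  rw [← real_inner_self_eq_norm_sq]
  nth_rewrite 1 [Submodule.coe_sum]
  rw [sum_inner]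
  refine Finset.sum_congr rfl fun l hl => ?_
  rw [Submodule.coe_smul, real_inner_smul_left]
  change b l * ⟪φ l, _⟫_ℝ = _
  rw [inner_eigV, if_pos hl, pow_two]

theorem formL_sum_eigV (hL : IsAdmissible Ω a c Λ) (h𝒱 : IsFormDomain Ω a c 𝒱)
    (hφ : IsEigenbasis Ω a c 𝒱 lam φ) (F : Finset ℕ) (b : ℕ → ℝ) (w : 𝒱) :
    formL hL h𝒱 (∑ l ∈ F, b l • eigV hφ l) w = ∑ l ∈ F, lam l * b l * ⟪φ l, (w : L2 Ω)⟫_ℝ := by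
  rw [map_sum, LinearMap.sum_apply]
  refine Finset.sum_congr rfl fun l _ => ?_
  rw [map_smul, LinearMap.smul_apply, formL_eigV, smul_eq_mul]; ring

theorem formL_sum_eigV_self (hL : IsAdmissible Ω a c Λ) (h𝒱 : IsFormDomain Ω a c 𝒱)
    (hφ : IsEigenbasis Ω a c 𝒱 lam φ) (F : Finset ℕ) (b : ℕ → ℝ) :
    formL hL h𝒱 (∑ l ∈ F, b l • eigV hφ l) (∑ l ∈ F, b l • eigV hφ l) =
      ∑ l ∈ F, lam l * b l ^ 2 := by
  rw [formL_sum_eigV]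
  refine Finset.sum_congr rfl fun l hl => ?_
  rw [inner_eigV, if_pos hl]; ring

/-- The first order data of finite combinations of eigenfunctions are controlled by the
coefficients. -/
theorem exists_jetSq_sum_eigV_le (hL : IsAdmissible Ω a c Λ) (h𝒱 : IsFormDomain Ω a c 𝒱)
    (hφ : IsEigenbasis Ω a c 𝒱 lam φ) : ∃ C : ℝ, 0 ≤ C ∧ ∀ (F : Finset ℕ) (b : ℕ → ℝ),
      jetSq hL h𝒱 (∑ l ∈ F, b l • eigV hφ l) ≤ C * ∑ l ∈ F, (1 + lam l) * b l ^ 2 := by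
  obtain ⟨C₁, C₂, h⟩ := jetSq_le hL h𝒱
  -- The coercivity constants carry no sign. On a finite combination the form is `∑ λ_l b_l²` and
  -- the squared norm is `∑ b_l²`; both are at most `∑ (1 + λ_l) b_l²`.
  refine ⟨|C₁| + |C₂|, by positivity, fun F b => (h _).trans ?_⟩
  rw [formL_sum_eigV_self, norm_sq_sum_eigV, Finset.mul_sum, Finset.mul_sum, Finset.mul_sum,
    ← Finset.sum_add_distrib]
  refine Finset.sum_le_sum fun l _ => ?_
  have h1 := hφ.nonneg l
  have h2 : 0 ≤ lam l * b l ^ 2 := by positivity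
  have h3 := mul_le_mul_of_nonneg_right (le_abs_self C₁) h2
  have h4 := mul_le_mul_of_nonneg_right (le_abs_self C₂) (sq_nonneg (b l))
  have h5 := mul_nonneg (abs_nonneg C₂) h2
  have h6 := mul_nonneg (abs_nonneg C₁) (sq_nonneg (b l))
  nlinarith

/-- A Bessel inequality for the form of `L`. -/
theorem exists_sum_lam_inner_sq_le (hL : IsAdmissible Ω a c Λ) (h𝒱 : IsFormDomain Ω a c 𝒱)
    (hφ : IsEigenbasis Ω a c 𝒱 lam φ) : ∃ C : ℝ, 0 ≤ C ∧ ∀ (w : 𝒱) (F : Finset ℕ),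
      ∑ l ∈ F, lam l * ⟪φ l, (w : L2 Ω)⟫_ℝ ^ 2 ≤ C * (jetSq hL h𝒱 w + ‖(w : L2 Ω)‖ ^ 2) := by
  have hΛ := hL.pos
  obtain ⟨C₁, C₂, h⟩ := jetSq_le hL h𝒱
  have hbes : ∀ (w : 𝒱) (F : Finset ℕ), ∑ l ∈ F, ⟪φ l, (w : L2 Ω)⟫_ℝ ^ 2 ≤ ‖(w : L2 Ω)‖ ^ 2 := by
    intro w F
    have := φ.orthonormal.sum_inner_products_le (x := (w : L2 Ω)) (s := F)
    simpa using this
  -- If `C₁ ≤ 0`, coercivity bounds the first order data of every eigenfunction by `|C₂|`, so the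
  -- eigenvalues are bounded and the ordinary Bessel inequality suffices.
  rcases le_or_gt C₁ 0 with hC | hC
  · have hlam : ∀ k, lam k ≤ (Λ + 1) * |C₂| := by
      intro k
      have h0 : formL hL h𝒱 (eigV hφ k) (eigV hφ k) = lam k := by
        rw [formL_eigV, eigV, real_inner_self_eq_norm_sq, φ.orthonormal.1 k]; ring
      have h1 := formL_le hL h𝒱 (eigV hφ k)
      have h2 := h (eigV hφ k)
      have h3 : ‖((eigV hφ k : 𝒱) : L2 Ω)‖ = 1 := φ.orthonormal.1 k
      rw [h0] at h1 h2
      rw [h3] at h2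
      have h4 : jetSq hL h𝒱 (eigV hφ k) ≤ |C₂| := by
        nlinarith [mul_nonneg_of_nonpos_of_nonpos hC (neg_nonpos.2 (hφ.nonneg k)), le_abs_self C₂]
      exact h1.trans (mul_le_mul_of_nonneg_left h4 (by linarith))
    refine ⟨(Λ + 1) * |C₂|, by positivity, fun w F => ?_⟩
    calc _ ≤ ∑ l ∈ F, (Λ + 1) * |C₂| * ⟪φ l, (w : L2 Ω)⟫_ℝ ^ 2 :=
          Finset.sum_le_sum fun l _ => mul_le_mul_of_nonneg_right (hlam l) (sq_nonneg _)
      _ ≤ (Λ + 1) * |C₂| * ‖(w : L2 Ω)‖ ^ 2 := by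
          rw [← Finset.mul_sum]
          exact mul_le_mul_of_nonneg_left (hbes w F) (by positivity)
      _ ≤ _ := by
          refine mul_le_mul_of_nonneg_left ?_ (by positivity)
          linarith [jetSq_nonneg hL h𝒱 w]
  · refine ⟨Λ + 1 + |C₂| / C₁, by positivity, fun w F => ?_⟩
    -- The projection of `w` onto the span of the chosen eigenfunctions, orthogonal for the form as
    -- well. The form is not assumed nonnegative, but coercivity with `C₁ > 0` bounds it below on `w
    -- - p` by `-(C₂/C₁)` times the squared norm.
    set p : 𝒱 := ∑ l ∈ F, ⟪φ l, (w : L2 Ω)⟫_ℝ • eigV hφ l with hp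
    have e1 : formL hL h𝒱 (w - p) (w - p) =
        formL hL h𝒱 w w - ∑ l ∈ F, lam l * ⟪φ l, (w : L2 Ω)⟫_ℝ ^ 2 := by
      have h1 : formL hL h𝒱 p p = ∑ l ∈ F, lam l * ⟪φ l, (w : L2 Ω)⟫_ℝ ^ 2 :=
        formL_sum_eigV_self hL h𝒱 hφ F _
      have h2 : formL hL h𝒱 p w = ∑ l ∈ F, lam l * ⟪φ l, (w : L2 Ω)⟫_ℝ ^ 2 := by
        rw [hp, formL_sum_eigV]
        exact Finset.sum_congr rfl fun l _ => by ring
      rw [map_sub, map_sub, LinearMap.sub_apply, LinearMap.sub_apply, formL_symm hL h𝒱 w p, h1, h2]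
      ring
    have e2 : ‖((w - p : 𝒱) : L2 Ω)‖ ^ 2 ≤ ‖(w : L2 Ω)‖ ^ 2 := by
      have h1 : ⟪(p : L2 Ω), (w : L2 Ω)⟫_ℝ = ∑ l ∈ F, ⟪φ l, (w : L2 Ω)⟫_ℝ ^ 2 := by
        rw [hp, Submodule.coe_sum, sum_inner]
        refine Finset.sum_congr rfl fun l _ => ?_
        rw [Submodule.coe_smul, real_inner_smul_left, eigV, pow_two]
      have h2 := norm_sq_sum_eigV hφ F fun l => ⟪φ l, (w : L2 Ω)⟫_ℝ
      rw [← hp] at h2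
      rw [Submodule.coe_sub, norm_sub_sq_real, real_inner_comm, h1, h2]
      have : 0 ≤ ∑ l ∈ F, ⟪φ l, (w : L2 Ω)⟫_ℝ ^ 2 := Finset.sum_nonneg fun _ _ => sq_nonneg _
      linarith
    have h1 := (jetSq_nonneg hL h𝒱 (w - p)).trans (h (w - p))
    rw [e1] at h1
    have h2 : C₂ * ‖((w - p : 𝒱) : L2 Ω)‖ ^ 2 ≤ |C₂| * ‖(w : L2 Ω)‖ ^ 2 :=
      (mul_le_mul_of_nonneg_right (le_abs_self _) (sq_nonneg _)).trans
        (mul_le_mul_of_nonneg_left e2 (abs_nonneg _))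
    have h3 := formL_le hL h𝒱 w
    have h4 : ∑ l ∈ F, lam l * ⟪φ l, (w : L2 Ω)⟫_ℝ ^ 2 ≤
        formL hL h𝒱 w w + |C₂| / C₁ * ‖(w : L2 Ω)‖ ^ 2 := by
      rw [← mul_le_mul_iff_right₀ hC, mul_add, ← mul_assoc, mul_div_cancel₀ _ hC.ne']
      nlinarith
    have h5 := jetSq_nonneg hL h𝒱 w
    have h6 : 0 ≤ |C₂| / C₁ := by positivity
    nlinarith [mul_nonneg h6 h5, mul_nonneg (by linarith : 0 ≤ Λ + 1) (sq_nonneg ‖(w : L2 Ω)‖)]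

end

section

/-! ### Sesquilinear forms with bounded coefficients -/

section FormLp

variable {X ι : Type*} [MeasurableSpace X] {μ : Measure X} [Fintype ι]

theorem memLp_bdd_mul {b : X → ℝ} {M : ℝ} (hb : AEMeasurable b μ) (hM : ∀ᵐ x ∂μ, |b x| ≤ M)
    {f : X → ℂ} (hf : MemLp f 2 μ) : MemLp (fun x => (b x : ℂ) * f x) 2 μ := by
  refine hf.of_le_mul (c := M) ((Complex.measurable_ofReal.comp_aemeasurable
    hb).aestronglyMeasurable.mul hf.1) ?_
  filter_upwards [hM] with x hx
  rw [norm_mul, Complex.norm_real, Real.norm_eq_abs]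
  exact mul_le_mul_of_nonneg_right hx (norm_nonneg _)

/-- Multiplication by a bounded function on `L²`. -/
def bddMul {b : X → ℝ} {M : ℝ} (hb : AEMeasurable b μ) (hM : ∀ᵐ x ∂μ, |b x| ≤ M) :
    Lp ℂ 2 μ →L[ℂ] Lp ℂ 2 μ :=
  LinearMap.mkContinuous
    { toFun := fun f => (memLp_bdd_mul hb hM (Lp.memLp f)).toLp _
      map_add' := fun f g => by
        rw [← MemLp.toLp_add, MemLp.toLp_eq_toLp_iff]
        filter_upwards [Lp.coeFn_add f g] with x hx
        rw [hx, Pi.add_apply, Pi.add_apply, mul_add]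
      map_smul' := fun c f => by
        rw [RingHom.id_apply, ← MemLp.toLp_const_smul, MemLp.toLp_eq_toLp_iff]
        filter_upwards [Lp.coeFn_smul c f] with x hx
        rw [hx, Pi.smul_apply, Pi.smul_apply, smul_eq_mul, smul_eq_mul]; ring } M
    fun f => by
      refine Lp.norm_le_mul_norm_of_ae_le_mul ?_
      filter_upwards [hM, (memLp_bdd_mul hb hM (Lp.memLp f)).coeFn_toLp] with x hx h
      rw [LinearMap.coe_mk, AddHom.coe_mk, h, norm_mul, Complex.norm_real, Real.norm_eq_abs]
      exact mul_le_mul_of_nonneg_right hx (norm_nonneg _)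

theorem coeFn_bddMul {b : X → ℝ} {M : ℝ} (hb : AEMeasurable b μ) (hM : ∀ᵐ x ∂μ, |b x| ≤ M)
    (f : Lp ℂ 2 μ) : bddMul hb hM f =ᵐ[μ] fun x => (b x : ℂ) * f x :=
  (memLp_bdd_mul hb hM (Lp.memLp f)).coeFn_toLp

variable {b : X → ι → ι → ℝ} {M : ℝ} (hb : ∀ j l, AEMeasurable (fun x => b x j l) μ)
  (hM : ∀ᵐ x ∂μ, ∀ j l, |b x j l| ≤ M)

/-- The form `∫ ∑ b_{jl} f_j conj g_l` on `L²`. -/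
def formLp (f g : ι → Lp ℂ 2 μ) : ℂ :=
  ∑ j, ∑ l, ⟪g l, bddMul (hb j l) (hM.mono fun _ hx => hx j l) (f j)⟫_ℂ

theorem formLp_sum_left {κ : Type*} (F : Finset κ) (f : κ → ι → Lp ℂ 2 μ) (g : ι → Lp ℂ 2 μ) :
    formLp hb hM (fun j => ∑ k ∈ F, f k j) g = ∑ k ∈ F, formLp hb hM (f k) g := by
  simp only [formLp, map_sum, inner_sum]
  rw [Finset.sum_comm (s := F)]
  exact Finset.sum_congr rfl fun j _ => Finset.sum_comm

theorem formLp_sum_right {κ : Type*} (F : Finset κ) (f : ι → Lp ℂ 2 μ) (g : κ → ι → Lp ℂ 2 μ) :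
    formLp hb hM f (fun j => ∑ k ∈ F, g k j) = ∑ k ∈ F, formLp hb hM f (g k) := by
  simp only [formLp, sum_inner]
  rw [Finset.sum_comm (s := F)]
  exact Finset.sum_congr rfl fun j _ => Finset.sum_comm

theorem formLp_smul_left (z : ℂ) (f g : ι → Lp ℂ 2 μ) :
    formLp hb hM (fun j => z • f j) g = z * formLp hb hM f g := by
  simp only [formLp, map_smul, inner_smul_right, Finset.mul_sum]

theorem formLp_smul_right (z : ℂ) (f g : ι → Lp ℂ 2 μ) :
    formLp hb hM f (fun j => z • g j) = conj z * formLp hb hM f g := by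
  simp only [formLp, inner_smul_left, Finset.mul_sum]

theorem tendsto_formLp {κ : Type*} {L : Filter κ} {f g : κ → ι → Lp ℂ 2 μ} {f₀ g₀ : ι → Lp ℂ 2 μ}
    (hf : ∀ j, Tendsto (fun k => f k j) L (𝓝 (f₀ j)))
    (hg : ∀ j, Tendsto (fun k => g k j) L (𝓝 (g₀ j))) :
    Tendsto (fun k => formLp hb hM (f k) (g k)) L (𝓝 (formLp hb hM f₀ g₀)) := by
  refine tendsto_finsetSum _ fun j _ => tendsto_finsetSum _ fun l _ => ?_
  exact (hg l).inner (((bddMul _ _).continuous.tendsto _).comp (hf j))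

theorem integrable_form {b : X → ι → ι → ℝ} {M : ℝ} (hb : ∀ j l, AEMeasurable (fun x => b x j l) μ)
    (hM : ∀ᵐ x ∂μ, ∀ j l, |b x j l| ≤ M) {f g : ι → X → ℂ} {f' g' : ι → Lp ℂ 2 μ} (hf : ∀ j, f' j =ᵐ[μ] f j)
    (hg : ∀ j, g' j =ᵐ[μ] g j) :
    Integrable (fun x => ∑ j, ∑ l, (b x j l : ℂ) * f j x * conj (g l x)) μ := by
  refine integrable_finsetSum _ fun j _ => integrable_finsetSum _ fun l _ => ?_
  refine (L2.integrable_inner (𝕜 := ℂ) (g' l)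
    (bddMul (hb j l) (hM.mono fun _ hx => hx j l) (f' j))).congr ?_
  filter_upwards [hf j, hg l, coeFn_bddMul (hb j l) (hM.mono fun _ hx => hx j l) (f' j)]
    with x h1 h2 h3
  rw [h3, h1, h2, RCLike.inner_apply]

theorem formLp_eq_integral {f g : ι → X → ℂ} {f' g' : ι → Lp ℂ 2 μ} (hf : ∀ j, f' j =ᵐ[μ] f j)
    (hg : ∀ j, g' j =ᵐ[μ] g j) :
    formLp hb hM f' g' = ∫ x, ∑ j, ∑ l, (b x j l : ℂ) * f j x * conj (g l x) ∂μ := by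
  have hi : ∀ j l, (fun x => ⟪g' l x, bddMul (hb j l) (hM.mono fun _ hx => hx j l) (f' j) x⟫_ℂ) =ᵐ[μ]
      fun x => (b x j l : ℂ) * f j x * conj (g l x) := fun j l => by
    filter_upwards [hf j, hg l, coeFn_bddMul (hb j l) (hM.mono fun _ hx => hx j l) (f' j)]
      with x h1 h2 h3
    rw [h3, h1, h2, RCLike.inner_apply]
  have hint : ∀ j l, Integrable (fun x => (b x j l : ℂ) * f j x * conj (g l x)) μ := fun j l =>
    (L2.integrable_inner (𝕜 := ℂ) (g' l)
      (bddMul (hb j l) (hM.mono fun _ hx => hx j l) (f' j))).congr (hi j l)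
  rw [integral_finsetSum _ fun j _ => integrable_finsetSum _ fun l _ => hint j l]
  refine Finset.sum_congr rfl fun j _ => ?_
  rw [integral_finsetSum _ fun l _ => hint j l]
  refine Finset.sum_congr rfl fun l _ => ?_
  rw [L2.inner_def]
  exact integral_congr_ae (hi j l)

/-- A relation `g = m f` is preserved under limits in `L²`. -/
theorem ae_eq_mul_of_tendsto {m : X → ℂ} {f g : ℕ → Lp ℂ 2 μ} {f₀ g₀ : Lp ℂ 2 μ}
    (hf : Tendsto f atTop (𝓝 f₀)) (hg : Tendsto g atTop (𝓝 g₀))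
    (h : ∀ N, g N =ᵐ[μ] fun x => m x * f N x) : g₀ =ᵐ[μ] fun x => m x * f₀ x := by
  -- The function `m` may be unbounded, so multiplication by it need not be continuous on `L²`.
  -- Almost everywhere convergent subsequences are used instead, first for `f` and then a further
  -- one for `g`.
  obtain ⟨ns, hns, h1⟩ := (tendstoInMeasure_of_tendsto_Lp hf).exists_seq_tendsto_ae
  obtain ⟨ms, hms, h2⟩ := (tendstoInMeasure_of_tendsto_Lp
    (hg.comp hns.tendsto_atTop)).exists_seq_tendsto_ae
  filter_upwards [h1, h2, ae_all_iff.2 h] with x h1 h2 h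
  refine tendsto_nhds_unique h2 ?_
  simp only [Function.comp_apply, h]
  exact (h1.comp hms.tendsto_atTop).const_mul _

end FormLp

/-! ### First order data on the cylinder -/

variable {n : ℕ} {Ω : Opens (Sp n)} {a : Sp n → Matrix (Fin n) (Fin n) ℝ} {c : Sp n → ℝ} {Λ : ℝ}
  {𝒱 : Submodule ℝ (L2 Ω)} {lam : ℕ → ℝ} {φ : HilbertBasis ℕ ℝ (L2 Ω)}

/-- Both sides expand into the Gram matrix of the `d k`. The formula transfers inequalities for real
linear combinations in `L²(Ω)`, applied at each `t` to real and imaginary parts, to sums of tensors.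
-/
theorem norm_sq_sum_tensorLp (F : Finset ℕ) (d : ℕ → L2 Ω) (g : ℕ → Lp ℂ 2 (volume : Measure ℝ)) :
    ‖∑ k ∈ F, tensorLp (d k) (g k)‖ ^ 2 =
      ∫ t, (‖∑ k ∈ F, (g k t).re • d k‖ ^ 2 + ‖∑ k ∈ F, (g k t).im • d k‖ ^ 2) := by
  have hexp : ∀ b : ℕ → ℝ, ‖∑ k ∈ F, b k • d k‖ ^ 2 =
      ∑ k ∈ F, ∑ l ∈ F, b k * b l * ⟪d k, d l⟫_ℝ := fun b => by
    rw [← real_inner_self_eq_norm_sq, sum_inner]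
    refine Finset.sum_congr rfl fun k _ => ?_
    rw [inner_sum]
    refine Finset.sum_congr rfl fun l _ => ?_
    rw [real_inner_smul_left, real_inner_smul_right]; ring
  have hre : ∀ k l t, ((g k t).re * (g l t).re * ⟪d k, d l⟫_ℝ + (g k t).im * (g l t).im * ⟪d k, d l⟫_ℝ)
      = RCLike.re (⟪g k t, g l t⟫_ℂ) * ⟪d k, d l⟫_ℝ := fun k l t => by
    rw [RCLike.inner_apply]
    simp; ring
  have hi : ∀ k l, Integrable (fun t => RCLike.re (⟪g k t, g l t⟫_ℂ) * ⟪d k, d l⟫_ℝ) :=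
    fun k l => (L2.integrable_inner (𝕜 := ℂ) (g k) (g l)).re.mul_const _
  simp only [hexp, ← Finset.sum_add_distrib, hre]
  rw [integral_finsetSum _ fun k _ => integrable_finsetSum _ fun l _ => hi k l,
    ← inner_self_eq_norm_sq (𝕜 := ℂ), sum_inner, map_sum]
  refine Finset.sum_congr rfl fun k _ => ?_
  rw [integral_finsetSum _ fun l _ => hi k l, inner_sum, map_sum]
  refine Finset.sum_congr rfl fun l _ => ?_
  rw [inner_tensorLp, integral_mul_const, integral_re (L2.integrable_inner (𝕜 := ℂ) (g k) (g l)),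
    L2.inner_def, RCLike.re_eq_complex_re, Complex.re_mul_ofReal]

/-- The first order data of the `k`-th eigenfunction. -/
def eigJet (hL : IsAdmissible Ω a c Λ) (h𝒱 : IsFormDomain Ω a c 𝒱)
    (hφ : IsEigenbasis Ω a c 𝒱 lam φ) (j : Option (Fin n)) (k : ℕ) : L2 Ω :=
  jet hL.meas_c h𝒱 j (eigV hφ k)

/-- Obtained by integrating `exists_jetSq_sum_eigV_le` in `t`. For a single index `j` the data of
different eigenfunctions need not be orthogonal, so this estimate takes the place of Parseval's
identity. -/
theorem exists_norm_sq_sum_eigJet_le (hL : IsAdmissible Ω a c Λ) (h𝒱 : IsFormDomain Ω a c 𝒱)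
    (hφ : IsEigenbasis Ω a c 𝒱 lam φ) : ∃ C : ℝ, 0 ≤ C ∧ ∀ (j : Option (Fin n)) (F : Finset ℕ)
      (g : ℕ → Lp ℂ 2 (volume : Measure ℝ)), ‖∑ k ∈ F, tensorLp (eigJet hL h𝒱 hφ j k) (g k)‖ ^ 2 ≤
        C * ∑ k ∈ F, (1 + lam k) * ‖g k‖ ^ 2 := by
  obtain ⟨C, hC, h⟩ := exists_jetSq_sum_eigV_le hL h𝒱 hφ
  refine ⟨C, hC, fun j F g => ?_⟩
  have hb : ∀ b : ℕ → ℝ, ‖∑ k ∈ F, b k • eigJet hL h𝒱 hφ j k‖ ^ 2 ≤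
      C * ∑ k ∈ F, (1 + lam k) * b k ^ 2 := fun b => by
    refine le_trans ?_ (h F b)
    have e1 : ∑ k ∈ F, b k • eigJet hL h𝒱 hφ j k =
        jet hL.meas_c h𝒱 j (∑ l ∈ F, b l • eigV hφ l) := by
      simp only [map_sum, map_smul, eigJet]
    rw [e1]
    exact Finset.single_le_sum (f := fun j => ‖jet hL.meas_c h𝒱 j (∑ l ∈ F, b l • eigV hφ l)‖ ^ 2)
      (fun _ _ => sq_nonneg _) (Finset.mem_univ j)
  have hi : ∀ k, Integrable fun t => (1 + lam k) * ‖g k t‖ ^ 2 := fun k =>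
    (Lp.memLp (g k)).integrable_norm_pow (by norm_num) |>.const_mul _
  calc _ ≤ ∫ t, C * ∑ k ∈ F, (1 + lam k) * ‖g k t‖ ^ 2 := by
        rw [norm_sq_sum_tensorLp]
        refine integral_mono_of_nonneg (ae_of_all _ fun t => by positivity)
          ((integrable_finsetSum _ fun k _ => hi k).const_mul C) (ae_of_all _ fun t => ?_)
        refine (add_le_add (hb fun k => (g k t).re) (hb fun k => (g k t).im)).trans_eq ?_
        rw [← mul_add, ← Finset.sum_add_distrib]
        congr 1
        refine Finset.sum_congr rfl fun k _ => ?_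
        rw [← mul_add, Complex.sq_norm, Complex.normSq_apply, pow_two, pow_two]
    _ = _ := by
        rw [integral_const_mul, integral_finsetSum _ fun k _ => hi k]
        congr 1
        refine Finset.sum_congr rfl fun k _ => ?_
        rw [integral_const_mul]
        congr 1
        rw [← inner_self_eq_norm_sq (𝕜 := ℂ), L2.inner_def,
          ← integral_re (L2.integrable_inner (𝕜 := ℂ) (g k) (g k))]
        exact integral_congr_ae (ae_of_all _ fun t => (inner_self_eq_norm_sq (𝕜 := ℂ) _).symm)

/-- `∑ λ_k ‖u_k‖² < ∞`. -/
def InFormDom (φ : HilbertBasis ℕ ℝ (L2 Ω)) (lam : ℕ → ℝ) (u : L2Cyl Ω) : Prop :=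
  Summable fun k => lam k * ‖compLp (φ k) u‖ ^ 2

/-- The weak gradient of `u`, and `|c|^{1/2} u`, as sums over the eigenfunctions. -/
def jetCyl (hL : IsAdmissible Ω a c Λ) (h𝒱 : IsFormDomain Ω a c 𝒱)
    (hφ : IsEigenbasis Ω a c 𝒱 lam φ) (j : Option (Fin n)) (u : L2Cyl Ω) : L2Cyl Ω :=
  ∑' k, tensorLp (eigJet hL h𝒱 hφ j k) (compLp (φ k) u)

/-- Cauchy's criterion: the bound on finite sums reduces the claim to summability of `(1 + λ_k)
‖u_k‖²`. -/
theorem hasSum_jetCyl (hL : IsAdmissible Ω a c Λ) (h𝒱 : IsFormDomain Ω a c 𝒱)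
    (hφ : IsEigenbasis Ω a c 𝒱 lam φ) (j : Option (Fin n)) {u : L2Cyl Ω}
    (hu : InFormDom φ lam u) :
    HasSum (fun k => tensorLp (eigJet hL h𝒱 hφ j k) (compLp (φ k) u)) (jetCyl hL h𝒱 hφ j u) := by
  refine Summable.hasSum ?_
  obtain ⟨C, hC, h⟩ := exists_norm_sq_sum_eigJet_le hL h𝒱 hφ
  have hs : Summable fun k => (1 + lam k) * ‖compLp (φ k) u‖ ^ 2 := by
    refine ((hasSum_norm_sq_compLp φ u).summable.add hu).congr fun k => by ring
  rw [summable_iff_vanishing_norm] at hs ⊢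
  intro ε hε
  obtain ⟨s, hs⟩ := hs (ε ^ 2 / (C + 1)) (by positivity)
  refine ⟨s, fun t ht => ?_⟩
  have h1 := (le_abs_self _).trans_lt (hs t ht)
  have h2 := h j t fun k => compLp (φ k) u
  refine lt_of_pow_lt_pow_left₀ 2 hε.le (h2.trans_lt ?_)
  rw [lt_div_iff₀ (by positivity)] at h1
  have h3 : 0 ≤ ∑ k ∈ t, (1 + lam k) * ‖compLp (φ k) u‖ ^ 2 :=
    Finset.sum_nonneg fun k _ => mul_nonneg (by linarith [hφ.nonneg k]) (sq_nonneg _)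
  nlinarith

theorem restrict_cyl : (volume : Measure (ℝ × Sp n)).restrict (cyl Ω : Set (ℝ × Sp n)) = mCyl Ω := by
  change (volume.prod volume).restrict (univ ×ˢ (Ω : Set (Sp n))) = _
  rw [← Measure.prod_restrict, Measure.restrict_univ]

theorem locallyIntegrableOn_cyl (u : L2Cyl Ω) : LocallyIntegrableOn u (cyl Ω : Set (ℝ × Sp n)) :=
  locallyIntegrableOn_of_memLp (by rw [restrict_cyl]; exact Lp.memLp u)

/-- By Fubini, since for fixed `t` the slice of a test function on the cylinder is a test function
on `Ω`. -/
theorem hasWeakDeriv_tensorLp {f f' : L2 Ω} {i : Fin n} (h : HasWeakDeriv Ω (e i) f f')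
    (g : Lp ℂ 2 (volume : Measure ℝ)) :
    HasWeakDeriv (cyl Ω) (0, e i) (tensorLp f g) (tensorLp f' g) := by
  refine ⟨locallyIntegrableOn_cyl _, locallyIntegrableOn_cyl _, fun ψ => ?_⟩
  have i1 := integrableOn_test_smul (locallyIntegrableOn_cyl (tensorLp f g)) (dirDeriv ψ (0, e i))
  have i2 := integrableOn_test_smul (locallyIntegrableOn_cyl (tensorLp f' g)) ψ
  simp only [dirDeriv_apply, IntegrableOn, restrict_cyl] at i1 i2 ⊢
  have e1 : (fun p => (fderiv ℝ ψ p (0, e i)) • tensorLp f g p) =ᵐ[mCyl Ω]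
      fun p => (fderiv ℝ ψ p (0, e i)) • (g p.1 * (f p.2 : ℂ)) := by
    filter_upwards [coeFn_tensorLp f g] with p hp
    rw [hp]
  have e2 : (fun p => ψ p • tensorLp f' g p) =ᵐ[mCyl Ω]
      fun p => ψ p • (g p.1 * (f' p.2 : ℂ)) := by
    filter_upwards [coeFn_tensorLp f' g] with p hp
    rw [hp]
  rw [integral_congr_ae e1, integral_congr_ae e2, integral_prod _ (i1.congr e1),
    integral_prod _ (i2.congr e2), ← integral_neg]
  congr 1
  funext t
  have h1 := h.ofReal.2.2 (sliceT ψ t)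
  simp only [fderiv_sliceT, sliceT_apply] at h1
  simp only [mul_comm (g t), ← smul_mul_assoc]
  rw [integral_mul_const, integral_mul_const, h1, neg_mul]

theorem hasWeakDeriv_jetCyl (hL : IsAdmissible Ω a c Λ) (h𝒱 : IsFormDomain Ω a c 𝒱)
    (hφ : IsEigenbasis Ω a c 𝒱 lam φ) (i : Fin n) {u : L2Cyl Ω} (hu : InFormDom φ lam u) :
    HasWeakDeriv (cyl Ω) (0, e i) u (jetCyl hL h𝒱 hφ (some i) u) := by
  have h1 := (hasSum_tensorLp_compLp φ u).tendsto_sum_nat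
  have h2 := (hasSum_jetCyl hL h𝒱 hφ (some i) hu).tendsto_sum_nat
  refine hasWeakDeriv_of_approx (locallyIntegrableOn_cyl _) (locallyIntegrableOn_cyl _)
    fun ε hε => ?_
  rw [Lp.tendsto_Lp_iff_tendsto_eLpNorm', ENNReal.tendsto_nhds_zero] at h1 h2
  obtain ⟨N, hN1, hN2⟩ := ((h1 ε hε).and (h2 ε hε)).exists
  rw [restrict_cyl]
  refine ⟨_, _, ?_, (eLpNorm_sub_comm _ _ _ _).trans_le hN1,
    (eLpNorm_sub_comm _ _ _ _).trans_le hN2⟩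
  have hd : ∀ k, HasWeakDeriv (cyl Ω) (0, e i) (tensorLp (φ k) (compLp (φ k) u))
      (tensorLp (eigJet hL h𝒱 hφ (some i) k) (compLp (φ k) u)) := fun k => by
    refine hasWeakDeriv_tensorLp ?_ _
    exact (hasWeakDeriv_wpartial (h𝒱.energy _ (hφ.mem k)) i).congr_right
      (coeFn_jet hL.meas_c h𝒱 (some i) (eigV hφ k)).symm
      (locallyIntegrableOn_of_memLp (Lp.memLp _))
  refine ((HasWeakDeriv.sum (s := Finset.range N) fun k _ => hd k).congr_left ?_
    (locallyIntegrableOn_cyl _)).congr_right ?_ (locallyIntegrableOn_cyl _)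
  · rw [restrict_cyl]
    exact (Lp.coeFn_fun_finsetSum _ _).symm
  · rw [restrict_cyl]
    exact (Lp.coeFn_fun_finsetSum _ _).symm

theorem jetCyl_none (hL : IsAdmissible Ω a c Λ) (h𝒱 : IsFormDomain Ω a c 𝒱)
    (hφ : IsEigenbasis Ω a c 𝒱 lam φ) {u : L2Cyl Ω} (hu : InFormDom φ lam u) :
    jetCyl hL h𝒱 hφ none u =ᵐ[mCyl Ω] fun p => ((√|c p.2| : ℝ) : ℂ) * u p := by
  refine ae_eq_mul_of_tendsto (hasSum_tensorLp_compLp φ u).tendsto_sum_nat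
    (hasSum_jetCyl hL h𝒱 hφ none hu).tendsto_sum_nat fun N => ?_
  have h2 : ∀ k, ∀ᵐ p ∂(mCyl Ω), eigJet hL h𝒱 hφ none k p.2 = √|c p.2| * φ k p.2 := fun k =>
    Measure.quasiMeasurePreserving_snd.ae (coeFn_jet hL.meas_c h𝒱 none (eigV hφ k))
  filter_upwards [Lp.coeFn_fun_finsetSum (Finset.range N) fun k => tensorLp (φ k) (compLp (φ k) u),
    Lp.coeFn_fun_finsetSum (Finset.range N)
      fun k => tensorLp (eigJet hL h𝒱 hφ none k) (compLp (φ k) u), ae_all_iff.2 h2,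
    ae_all_iff.2 fun k => coeFn_tensorLp (φ k) (compLp (φ k) u),
    ae_all_iff.2 fun k => coeFn_tensorLp (eigJet hL h𝒱 hφ none k) (compLp (φ k) u)]
    with p h3 h4 h5 h6 h7
  rw [h3, h4, Finset.mul_sum]
  refine Finset.sum_congr rfl fun k _ => ?_
  rw [h6, h7, h5]
  push_cast
  ring

end

section

variable {n : ℕ} {Ω : Opens (Sp n)} {a : Sp n → Matrix (Fin n) (Fin n) ℝ} {c : Sp n → ℝ} {Λ : ℝ}
  {𝒱 : Submodule ℝ (L2 Ω)} {lam : ℕ → ℝ} {φ : HilbertBasis ℕ ℝ (L2 Ω)}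

/-! ### Test functions in the form domain -/

theorem hasWeakDeriv_test (ψ : 𝓓(Ω, ℝ)) (i : Fin n) :
    HasWeakDeriv Ω (e i) ψ (fun x => fderiv ℝ ψ x (e i)) := by
  refine ⟨ψ.continuous.locallyIntegrable.locallyIntegrableOn _,
    (dirDeriv ψ (e i)).continuous.locallyIntegrable.locallyIntegrableOn _, fun χ => ?_⟩
  have hz : ∀ x, x ∉ (Ω : Set (Sp n)) → χ x = 0 := fun x hx =>
    image_eq_zero_of_notMem_tsupport fun h => hx (χ.tsupport_subset h)
  have hz' : ∀ x, x ∉ (Ω : Set (Sp n)) → fderiv ℝ χ x (e i) = 0 := fun x hx =>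
    image_eq_zero_of_notMem_tsupport (f := dirDeriv χ (e i))
      fun h => hx ((dirDeriv χ (e i)).tsupport_subset h)
  rw [setIntegral_eq_integral_of_forall_compl_eq_zero fun x hx => by rw [hz' x hx, zero_smul],
    setIntegral_eq_integral_of_forall_compl_eq_zero fun x hx => by rw [hz x hx, zero_smul]]
  have hi : ∀ ψ₁ ψ₂ : 𝓓(Ω, ℝ), Integrable fun x => ψ₁ x * ψ₂ x := fun ψ₁ ψ₂ =>
    (ψ₁.continuous.mul ψ₂.continuous).integrable_of_hasCompactSupport
      (ψ₁.hasCompactSupport.mul_right)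
  have h := integral_mul_fderiv_eq_neg_fderiv_mul_of_integrable (μ := (volume : Measure (Sp n)))
    (f := χ) (g := ψ) (v := e i) (hi (dirDeriv χ (e i)) ψ) (hi χ (dirDeriv ψ (e i))) (hi χ ψ)
    (fun x _ => χ.contDiff.differentiable (by simp) x)
    (fun x _ => ψ.contDiff.differentiable (by simp) x)
  simp only [smul_eq_mul]
  rw [h, neg_neg]

theorem memLp_testOm (ψ : 𝓓(Ω, ℝ)) : MemLp ψ 2 (mΩ Ω) :=
  (ψ.continuous.memLp_of_hasCompactSupport ψ.hasCompactSupport).restrict _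

/-- A test function on `Ω` as an element of the form domain. -/
def testOm (h𝒱 : IsFormDomain Ω a c 𝒱) (ψ : 𝓓(Ω, ℝ)) : 𝒱 :=
  ⟨(memLp_testOm ψ).toLp _, h𝒱.test ψ _ (memLp_testOm ψ).coeFn_toLp⟩

theorem coeFn_testOm (h𝒱 : IsFormDomain Ω a c 𝒱) (ψ : 𝓓(Ω, ℝ)) :
    (testOm h𝒱 ψ : L2 Ω) =ᵐ[mΩ Ω] ψ := (memLp_testOm ψ).coeFn_toLp

/-- The first order data of a test function. -/
def testJetFun (c : Sp n → ℝ) (v : 𝓓(cyl Ω, ℝ)) : Option (Fin n) → ℝ × Sp n → ℝ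
  | some i => fun p => fderiv ℝ v p (0, e i)
  | none => fun p => √|c p.2| * v p

theorem jet_testOm (hc : AEMeasurable c (mΩ Ω)) (h𝒱 : IsFormDomain Ω a c 𝒱) (v : 𝓓(cyl Ω, ℝ))
    (t : ℝ) (j : Option (Fin n)) :
    jet hc h𝒱 j (testOm h𝒱 (sliceT v t)) =ᵐ[mΩ Ω] fun x => testJetFun c v j (t, x) := by
  refine (coeFn_jet hc h𝒱 j _).trans ?_
  rcases j with _ | i
  · filter_upwards [coeFn_testOm h𝒱 (sliceT v t)] with x hx
    simp only [jetFun, testJetFun, hx, sliceT_apply]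
  · refine wpartial_ae_eq ?_
    have h := (hasWeakDeriv_test (sliceT v t) i).congr_left (coeFn_testOm h𝒱 (sliceT v t)).symm
      (locallyIntegrableOn_of_memLp (Lp.memLp _))
    simpa only [testJetFun, fderiv_sliceT] using h

theorem exists_ae_abs_le (hL : IsAdmissible Ω a c Λ) {K : Set (Sp n)} (hK : IsCompact K)
    (hKΩ : K ⊆ Ω) : ∃ M : ℝ, 0 ≤ M ∧ ∀ᵐ p ∂(mCyl Ω), p.2 ∈ K → |c p.2| ≤ M := by
  obtain ⟨M, hM⟩ := hL.locBdd_c K hK hKΩ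
  refine ⟨max M 0, le_max_right _ _, ?_⟩
  have h1 : ∀ᵐ x ∂(mΩ Ω), x ∈ K → |c x| ≤ max M 0 := by
    refine ae_restrict_of_ae ?_
    filter_upwards [(ae_restrict_iff' hK.measurableSet).1 hM] with x hx hxK
    exact (hx hxK).trans (le_max_left _ _)
  exact Measure.quasiMeasurePreserving_snd.ae h1

theorem ae_norm_testJetFun_none_le {v : 𝓓(cyl Ω, ℝ)} {K : Set (Sp n)} {M : ℝ}
    (hM : ∀ᵐ p ∂(mCyl Ω), p.2 ∈ K → |c p.2| ≤ M) (hv : ∀ p : ℝ × Sp n, p.2 ∉ K → v p = 0) :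
    ∀ᵐ p ∂(mCyl Ω), ‖(testJetFun c v none p : ℂ)‖ ≤ √M * ‖(v p : ℂ)‖ := by
  filter_upwards [hM] with p hp
  simp only [testJetFun, Complex.ofReal_mul, norm_mul, Complex.norm_real, Real.norm_eq_abs,
    abs_of_nonneg (Real.sqrt_nonneg _)]
  by_cases h : p.2 ∈ K
  · exact mul_le_mul_of_nonneg_right (Real.sqrt_le_sqrt (hp h)) (abs_nonneg _)
  · simp [hv p h]

theorem isCompact_snd_tsupport (v : 𝓓(cyl Ω, ℝ)) : IsCompact (Prod.snd '' tsupport v) :=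
  (show IsCompact (tsupport v) from v.hasCompactSupport).image continuous_snd

theorem snd_tsupport_subset (v : 𝓓(cyl Ω, ℝ)) : Prod.snd '' tsupport v ⊆ (Ω : Set (Sp n)) := by
  rintro _ ⟨p, hp, rfl⟩
  exact (v.tsupport_subset hp).2

theorem eq_zero_of_notMem_snd_tsupport (v : 𝓓(cyl Ω, ℝ)) (p : ℝ × Sp n)
    (hp : p.2 ∉ Prod.snd '' tsupport v) : v p = 0 :=
  image_eq_zero_of_notMem_tsupport fun h => hp ⟨p, h, rfl⟩

theorem memLp_testJetFun (hL : IsAdmissible Ω a c Λ) (v : 𝓓(cyl Ω, ℝ)) (j : Option (Fin n)) :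
    MemLp (fun p => (testJetFun c v j p : ℂ)) 2 (mCyl Ω) := by
  rcases j with _ | i
  · obtain ⟨M, -, hM⟩ := exists_ae_abs_le hL (isCompact_snd_tsupport v) (snd_tsupport_subset v)
    refine (memLp_test v).of_le_mul ?_
      (ae_norm_testJetFun_none_le hM (eq_zero_of_notMem_snd_tsupport v))
    have h1 : AEMeasurable (fun p : ℝ × Sp n => √|c p.2|) (mCyl Ω) :=
      Real.continuous_sqrt.measurable.comp_aemeasurable
        (continuous_abs.measurable.comp_aemeasurable
          (hL.meas_c.comp_quasiMeasurePreserving Measure.quasiMeasurePreserving_snd))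
    exact (Complex.measurable_ofReal.comp_aemeasurable
      (h1.mul v.continuous.measurable.aemeasurable)).aestronglyMeasurable
  · exact memLp_test (dirDeriv v (0, e i))

/-- The first order data of a test function, in `L²(ℝ × Ω)`. -/
def testJet (hL : IsAdmissible Ω a c Λ) (v : 𝓓(cyl Ω, ℝ)) (j : Option (Fin n)) : L2Cyl Ω :=
  (memLp_testJetFun hL v j).toLp _

theorem coeFn_testJet (hL : IsAdmissible Ω a c Λ) (v : 𝓓(cyl Ω, ℝ)) (j : Option (Fin n)) :
    testJet hL v j =ᵐ[mCyl Ω] fun p => (testJetFun c v j p : ℂ) :=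
  (memLp_testJetFun hL v j).coeFn_toLp

theorem norm_testJet_none_le (hL : IsAdmissible Ω a c Λ) {v : 𝓓(cyl Ω, ℝ)} {K : Set (Sp n)} {M : ℝ}
    (hM : ∀ᵐ p ∂(mCyl Ω), p.2 ∈ K → |c p.2| ≤ M) (hv : ∀ p : ℝ × Sp n, p.2 ∉ K → v p = 0) :
    ‖testJet hL v none‖ ≤ √M * ‖testL2 v‖ := by
  refine Lp.norm_le_mul_norm_of_ae_le_mul ?_
  filter_upwards [coeFn_testJet hL v none, coeFn_testL2 v, ae_norm_testJetFun_none_le hM hv]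
    with p h1 h2 h3
  rwa [h1, h2]

theorem compLp_testL2 (h𝒱 : IsFormDomain Ω a c 𝒱) (v : 𝓓(cyl Ω, ℝ)) (f : L2 Ω) :
    compLp f (testL2 v) =ᵐ[volume] fun t => ((⟪f, (testOm h𝒱 (sliceT v t) : L2 Ω)⟫_ℝ : ℝ) : ℂ) := by
  filter_upwards [coeFn_compLp f (testL2 v), Measure.ae_ae_of_ae_prod (coeFn_testL2 v)] with t h1 h2
  rw [h1, L2.inner_def, ← integral_complex_ofReal]
  refine integral_congr_ae ?_
  filter_upwards [h2, coeFn_testOm h𝒱 (sliceT v t)] with x h3 h4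
  simp [h3, h4]

theorem norm_sq_eq_integral_complex {X : Type*} [MeasurableSpace X] {μ : Measure X}
    (f : Lp ℂ 2 μ) : ‖f‖ ^ 2 = ∫ x, ‖f x‖ ^ 2 ∂μ := by
  rw [← inner_self_eq_norm_sq (𝕜 := ℂ), L2.inner_def,
    ← integral_re (L2.integrable_inner (𝕜 := ℂ) f f)]
  exact integral_congr_ae (ae_of_all _ fun t => inner_self_eq_norm_sq (𝕜 := ℂ) _)

/-- A Bessel inequality for test functions on the cylinder. -/
theorem exists_sum_lam_compLp_le (hL : IsAdmissible Ω a c Λ) (h𝒱 : IsFormDomain Ω a c 𝒱)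
    (hφ : IsEigenbasis Ω a c 𝒱 lam φ) : ∃ C : ℝ, 0 ≤ C ∧ ∀ (v : 𝓓(cyl Ω, ℝ)) (F : Finset ℕ),
      ∑ k ∈ F, lam k * ‖compLp (φ k) (testL2 v)‖ ^ 2 ≤
        C * ((∑ j, ‖testJet hL v j‖ ^ 2) + ‖testL2 v‖ ^ 2) := by
  obtain ⟨C, hC, h⟩ := exists_sum_lam_inner_sq_le hL h𝒱 hφ
  refine ⟨C, hC, fun v F => ?_⟩
  set w : ℝ → 𝒱 := fun t => testOm h𝒱 (sliceT v t) with hw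
  have i1 : ∀ j, Integrable (fun p => testJetFun c v j p ^ 2) (mCyl Ω) := fun j => by
    refine ((memLp_testJetFun hL v j).integrable_norm_pow (by norm_num)).congr
      (ae_of_all _ fun p => ?_)
    simp [Complex.norm_real]
  have i2 : Integrable (fun p => v p ^ 2) (mCyl Ω) := by
    refine ((memLp_test v).integrable_norm_pow (by norm_num)).congr
      (ae_of_all _ fun p => ?_)
    simp [Complex.norm_real]
  have e1 : ∀ j, ‖testJet hL v j‖ ^ 2 = ∫ p, testJetFun c v j p ^ 2 ∂(mCyl Ω) := fun j => by
    rw [norm_sq_eq_integral_complex]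
    refine integral_congr_ae ?_
    filter_upwards [coeFn_testJet hL v j] with p hp
    rw [hp]; simp [Complex.norm_real]
  have e2 : ‖testL2 v‖ ^ 2 = ∫ p, v p ^ 2 ∂(mCyl Ω) := by
    rw [norm_sq_eq_integral_complex]
    refine integral_congr_ae ?_
    filter_upwards [coeFn_testL2 v] with p hp
    rw [hp]; simp [Complex.norm_real]
  have i3 : Integrable (fun p => (∑ j, testJetFun c v j p ^ 2) + v p ^ 2) (mCyl Ω) :=
    (integrable_finsetSum _ fun j _ => i1 j).add i2
  have e3 : (∑ j, ‖testJet hL v j‖ ^ 2) + ‖testL2 v‖ ^ 2 =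
      ∫ t, ∫ x, ((∑ j, testJetFun c v j (t, x) ^ 2) + v (t, x) ^ 2) ∂(mΩ Ω) := by
    rw [← integral_prod _ i3, integral_add (integrable_finsetSum _ fun j _ => i1 j) i2,
      integral_finsetSum _ fun j _ => i1 j, e2]
    simp only [e1]
  have e4 : ∀ᵐ t : ℝ, jetSq hL h𝒱 (w t) + ‖(w t : L2 Ω)‖ ^ 2 =
      ∫ x, ((∑ j, testJetFun c v j (t, x) ^ 2) + v (t, x) ^ 2) ∂(mΩ Ω) := by
    filter_upwards [ae_all_iff.2 fun j => (i1 j).prod_right_ae, i2.prod_right_ae] with t h1 h2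
    rw [integral_add (integrable_finsetSum _ fun j _ => h1 j) h2,
      integral_finsetSum _ fun j _ => h1 j]
    simp only [jetSq, norm_sq_eq_integral]
    congr 1
    · refine Finset.sum_congr rfl fun j _ => integral_congr_ae ?_
      filter_upwards [jet_testOm hL.meas_c h𝒱 v t j] with x hx
      rw [hx]
    · refine integral_congr_ae ?_
      filter_upwards [coeFn_testOm h𝒱 (sliceT v t)] with x hx
      rw [hx, sliceT_apply]
  have i4 : ∀ k, Integrable fun t => lam k * ‖compLp (φ k) (testL2 v) t‖ ^ 2 := fun k =>
    ((Lp.memLp _).integrable_norm_pow (by norm_num)).const_mul _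
  have e5 : ∑ k ∈ F, lam k * ‖compLp (φ k) (testL2 v)‖ ^ 2 =
      ∫ t, ∑ k ∈ F, lam k * ‖compLp (φ k) (testL2 v) t‖ ^ 2 := by
    rw [integral_finsetSum _ fun k _ => i4 k]
    refine Finset.sum_congr rfl fun k _ => ?_
    rw [integral_const_mul, norm_sq_eq_integral_complex]
  rw [e3, ← integral_const_mul, e5]
  -- The Bessel inequality for the form is applied to the slice `v(t, ·) ∈ 𝒱` for almost every `t`
  -- and then integrated.
  refine integral_mono_ae (integrable_finsetSum _ fun k _ => i4 k)
    (i3.integral_prod_left.const_mul C) ?_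
  filter_upwards [e4, ae_all_iff.2 fun k => compLp_testL2 h𝒱 v (φ k)] with t h1 h2
  simp only [h2, Complex.norm_real, Real.norm_eq_abs, sq_abs]
  rw [← h1]
  exact h (w t) F

theorem inFormDom_testL2 (hL : IsAdmissible Ω a c Λ) (h𝒱 : IsFormDomain Ω a c 𝒱)
    (hφ : IsEigenbasis Ω a c 𝒱 lam φ) (v : 𝓓(cyl Ω, ℝ)) : InFormDom φ lam (testL2 v) := by
  obtain ⟨C, -, h⟩ := exists_sum_lam_compLp_le hL h𝒱 hφ
  exact summable_of_sum_le (fun k => mul_nonneg (hφ.nonneg k) (sq_nonneg _)) (h v)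

/-- When the supports lie over a fixed compact `K`, the bound of `c` on `K` absorbs `|c|^{1/2} v`
into `v`, and the constant becomes uniform in `v`. This uniformity is used for the differences `V(y)
- V(0)`. -/
theorem exists_tsum_lam_compLp_le (hL : IsAdmissible Ω a c Λ) (h𝒱 : IsFormDomain Ω a c 𝒱)
    (hφ : IsEigenbasis Ω a c 𝒱 lam φ) {K : Set (Sp n)} (hK : IsCompact K) (hKΩ : K ⊆ Ω) :
    ∃ C : ℝ, ∀ v : 𝓓(cyl Ω, ℝ), (∀ p : ℝ × Sp n, p.2 ∉ K → v p = 0) →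
      ∑' k, lam k * ‖compLp (φ k) (testL2 v)‖ ^ 2 ≤
        C * ((∑ i, ‖testL2 (dirDeriv v (0, e i))‖ ^ 2) + ‖testL2 v‖ ^ 2) := by
  obtain ⟨C, hC, h⟩ := exists_sum_lam_compLp_le hL h𝒱 hφ
  obtain ⟨M, hM0, hM⟩ := exists_ae_abs_le hL hK hKΩ
  refine ⟨C * (M + 1), fun v hv => ?_⟩
  refine (Real.tsum_le_of_sum_le (fun k => mul_nonneg (hφ.nonneg k) (sq_nonneg _)) (h v)).trans ?_
  rw [Fintype.sum_option, mul_assoc]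
  refine mul_le_mul_of_nonneg_left ?_ hC
  have h1 := pow_le_pow_left₀ (norm_nonneg _) (norm_testJet_none_le hL hM hv) 2
  rw [mul_pow, Real.sq_sqrt hM0] at h1
  have h2 : ∀ i, testJet hL v (some i) = testL2 (dirDeriv v (0, e i)) := fun i => rfl
  simp only [h2]
  have h3 : 0 ≤ ∑ i, ‖testL2 (dirDeriv v (0, e i))‖ ^ 2 := Finset.sum_nonneg fun _ _ => sq_nonneg _
  nlinarith [mul_nonneg hM0 h3]

/-! ### The form of `L` on the cylinder -/

theorem aemeasurable_coef_cyl (hL : IsAdmissible Ω a c Λ) (j l : Option (Fin n)) :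
    AEMeasurable (fun p : ℝ × Sp n => coef a c p.2 j l) (mCyl Ω) :=
  (aemeasurable_coef hL j l).comp_quasiMeasurePreserving Measure.quasiMeasurePreserving_snd

theorem abs_coef_cyl_le (hL : IsAdmissible Ω a c Λ) :
    ∀ᵐ p ∂(mCyl Ω), ∀ j l, |coef a c p.2 j l| ≤ Λ + 1 :=
  Measure.quasiMeasurePreserving_snd.ae (abs_coef_le hL)

theorem integral_coef_jet (hL : IsAdmissible Ω a c Λ) (h𝒱 : IsFormDomain Ω a c 𝒱) (w v : 𝒱) :
    ∫ x, ∑ j, ∑ l, coef a c x j l * jet hL.meas_c h𝒱 j w x * jet hL.meas_c h𝒱 l v x ∂(mΩ Ω) =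
      formL hL h𝒱 w v := by
  have hi : ∀ j l, Integrable (fun x => coef a c x j l * jet hL.meas_c h𝒱 j w x *
      jet hL.meas_c h𝒱 l v x) (mΩ Ω) := fun j l =>
    integrable_coef_mul (aemeasurable_coef hL j l)
      ((abs_coef_le hL).mono fun x hx => hx j l) (Lp.memLp _) (Lp.memLp _)
  rw [formL_apply, energyForm_eq hL h𝒱,
    integral_finsetSum Finset.univ fun j _ => integrable_finsetSum _ fun l _ => hi j l]
  exact Finset.sum_congr rfl fun j _ => integral_finsetSum _ fun l _ => hi j l

/-- By Fubini this reduces to the eigenfunction equation tested with `v(t, ·)`, which belongs to `𝒱`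
because the form domain contains the test functions. -/
theorem formLp_eigJet (hL : IsAdmissible Ω a c Λ) (h𝒱 : IsFormDomain Ω a c 𝒱)
    (hφ : IsEigenbasis Ω a c 𝒱 lam φ) (v : 𝓓(cyl Ω, ℝ)) (k : ℕ) (g : Lp ℂ 2 (volume : Measure ℝ)) :
    formLp (aemeasurable_coef_cyl hL) (abs_coef_cyl_le hL)
      (fun j => tensorLp (eigJet hL h𝒱 hφ j k) g) (testJet hL v) =
        lam k * ⟪compLp (φ k) (testL2 v), g⟫_ℂ := by
  have h1 := fun j => coeFn_tensorLp (eigJet hL h𝒱 hφ j k) g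
  have h2 := fun j => coeFn_testJet hL v j
  rw [formLp_eq_integral _ _ h1 h2, integral_prod _
    (integrable_form (aemeasurable_coef_cyl hL) (abs_coef_cyl_le hL) h1 h2), L2.inner_def,
    ← integral_const_mul]
  refine integral_congr_ae ?_
  filter_upwards [compLp_testL2 h𝒱 v (φ k)] with t ht
  have h3 := integral_coef_jet hL h𝒱 (eigV hφ k) (testOm h𝒱 (sliceT v t))
  rw [formL_eigV] at h3
  rw [ht, RCLike.inner_apply, Complex.conj_ofReal, mul_left_comm, ← Complex.ofReal_mul, ← h3,
    ← integral_complex_ofReal, ← integral_const_mul]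
  refine integral_congr_ae ?_
  filter_upwards [ae_all_iff.2 fun l => jet_testOm hL.meas_c h𝒱 v t l] with x hx
  simp only [hx, Complex.ofReal_sum, Complex.ofReal_mul, Finset.mul_sum, Complex.conj_ofReal, eigJet]
  exact Finset.sum_congr rfl fun j _ => Finset.sum_congr rfl fun l _ => by ring

theorem hasSum_formLp (hL : IsAdmissible Ω a c Λ) (h𝒱 : IsFormDomain Ω a c 𝒱)
    (hφ : IsEigenbasis Ω a c 𝒱 lam φ) {u : L2Cyl Ω} (hu : InFormDom φ lam u) (v : 𝓓(cyl Ω, ℝ)) :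
    HasSum (fun k => lam k * ⟪compLp (φ k) (testL2 v), compLp (φ k) u⟫_ℂ)
      (formLp (aemeasurable_coef_cyl hL) (abs_coef_cyl_le hL)
        (fun j => jetCyl hL h𝒱 hφ j u) (testJet hL v)) := by
  have h1 := fun j => hasSum_jetCyl hL h𝒱 hφ j hu
  have h2 := tendsto_formLp (aemeasurable_coef_cyl hL) (abs_coef_cyl_le hL)
    (L := SummationFilter.unconditional ℕ |>.filter) h1 (g := fun _ => testJet hL v)
    (fun j => tendsto_const_nhds)
  simp only [formLp_sum_left, formLp_eigJet] at h2
  exact h2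

theorem formLp_jetCyl_testJet (hL : IsAdmissible Ω a c Λ) (h𝒱 : IsFormDomain Ω a c 𝒱)
    (hφ : IsEigenbasis Ω a c 𝒱 lam φ) {u : L2Cyl Ω} (hu : InFormDom φ lam u) (v : 𝓓(cyl Ω, ℝ))
    {U : ℝ × Sp n → ℂ} {G : Fin n → ℝ × Sp n → ℂ} (hU : u =ᵐ[mCyl Ω] U)
    (hG : ∀ i, jetCyl hL h𝒱 hφ (some i) u =ᵐ[mCyl Ω] G i) :
    formLp (aemeasurable_coef_cyl hL) (abs_coef_cyl_le hL)
        (fun j => jetCyl hL h𝒱 hφ j u) (testJet hL v) =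
      ∫ p, ((∑ i, ∑ j, a p.2 i j * G i p * fderiv ℝ v p (0, e j)) + c p.2 * U p * v p)
        ∂(mCyl Ω) := by
  rw [formLp_eq_integral _ _ (fun j => EventuallyEq.rfl) (fun j => coeFn_testJet hL v j)]
  refine integral_congr_ae ?_
  filter_upwards [hU, ae_all_iff.2 hG, jetCyl_none hL h𝒱 hφ hu] with p h1 h2 h3
  have h4 := sum_coef (R := ℂ) (a := a) (c := c) p.2 (fun j => jetCyl hL h𝒱 hφ j u p)
    (fun j => (testJetFun c v j p : ℂ))
  simp only [Complex.coe_algebraMap] at h4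
  simp only [Complex.conj_ofReal]
  rw [h4]
  simp only [h1, h2, h3, testJetFun]
  congr 1
  have h5 := congrArg (fun r : ℝ => (r : ℂ)) (sign_mul_sqrt_mul_sqrt (c p.2))
  simp only [Complex.ofReal_mul] at h5
  simp only [Complex.ofReal_mul]
  linear_combination U p * v p * h5

end

section

variable {n : ℕ} {Ω : Opens (Sp n)} {a : Sp n → Matrix (Fin n) (Fin n) ℝ} {c : Sp n → ℝ} {Λ : ℝ}
  {𝒱 : Submodule ℝ (L2 Ω)} {lam : ℕ → ℝ} {φ : HilbertBasis ℕ ℝ (L2 Ω)}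

/-! ### The spectral transform of time derivatives -/

/-- The translate `v(t - τ, x)` of a test function. -/
def shiftTest (v : 𝓓(cyl Ω, ℝ)) (τ : ℝ) : 𝓓(cyl Ω, ℝ) :=
  pullTest v (fun p => (p.1 - τ, p.2)) (fun p => (p.1 + τ, p.2)) (by fun_prop) (by fun_prop)
    (fun p => by simp) fun _ hp => ⟨mem_univ _, hp.2⟩

theorem compLp_shiftTest (v : 𝓓(cyl Ω, ℝ)) (τ : ℝ) (f : L2 Ω) :
    compLp f (testL2 (shiftTest v τ)) = shiftLp τ (compLp f (testL2 v)) := by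
  have h0 : ∀ v : 𝓓(cyl Ω, ℝ), compLp f (testL2 v) =ᵐ[volume]
      fun t => ∫ x, (v (t, x) : ℂ) * (f x : ℂ) ∂(mΩ Ω) := fun v => by
    filter_upwards [coeFn_compLp f (testL2 v), Measure.ae_ae_of_ae_prod (coeFn_testL2 v)]
      with t h1 h2
    rw [h1]
    refine integral_congr_ae ?_
    filter_upwards [h2] with x hx
    rw [hx]
  refine Lp.ext ?_
  filter_upwards [h0 (shiftTest v τ), coeFn_shiftLp τ (compLp f (testL2 v)),
    (measurePreserving_sub_right volume τ).quasiMeasurePreserving.ae (h0 v)] with t h1 h2 h3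
  rw [h1, h2, h3]
  rfl

theorem specFun_shiftTest (v : 𝓓(cyl Ω, ℝ)) (τ : ℝ) :
    specFun φ (testL2 (shiftTest v τ)) =ᵐ[mFreq]
      fun q => Complex.exp (-(τ * (Complex.I * q.1))) * specFun φ (testL2 v) q := by
  refine ae_mFreq_of_forall fun k => ?_
  filter_upwards [hat_shiftLp τ (compLp (φ k) (testL2 v))] with ρ h
  simp only [specFun, compLp_shiftTest, h]

theorem hasDerivAt_shiftTest (v : 𝓓(cyl Ω, ℝ)) :
    HasDerivAt (fun τ => testL2 (shiftTest v τ)) (-testL2 (dirDeriv v (1, 0))) 0 := by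
  have hK : IsCompact ((fun q : (ℝ × Sp n) × ℝ => (q.1.1 + q.2, q.1.2)) ''
      (tsupport v ×ˢ Icc (-1) 1)) :=
    ((show IsCompact (tsupport v) from v.hasCompactSupport).prod isCompact_Icc).image (by fun_prop)
  refine hasDerivAt_Lp_of_continuous (Φ := fun q : (ℝ × Sp n) × ℝ => (v (q.1.1 - q.2, q.1.2) : ℂ))
    (D := fun q : (ℝ × Sp n) × ℝ => ((-fderiv ℝ v (q.1.1 - q.2, q.1.2) (1, 0) : ℝ) : ℂ)) ?_ ?_
    ?_ ?_ hK ?_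
  · exact Complex.continuous_ofReal.comp
      (((dirDeriv v (1, 0)).continuous.comp (by fun_prop)).neg)
  · intro p τ
    have h1 : HasDerivAt (fun τ : ℝ => (p.1 - τ, p.2)) ((-1 : ℝ), (0 : Sp n)) τ :=
      ((hasDerivAt_id τ).const_sub p.1).prodMk (hasDerivAt_const τ p.2)
    have h2 := ((v.contDiff.differentiable (by simp) (p.1 - τ, p.2)).hasFDerivAt.comp_hasDerivAt
      τ h1).ofReal_comp
    have h3 : fderiv ℝ v (p.1 - τ, p.2) ((-1 : ℝ), (0 : Sp n)) =
        -fderiv ℝ v (p.1 - τ, p.2) (1, 0) := by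
      rw [← map_neg]; simp
    rw [h3] at h2
    exact h2
  · exact fun τ => coeFn_testL2 (shiftTest v τ)
  · filter_upwards [Lp.coeFn_neg (testL2 (dirDeriv v (1, 0))),
      coeFn_testL2 (dirDeriv v (1, 0))] with p h1 h2
    rw [h1, Pi.neg_apply, h2]
    simp
  · intro τ p hτ hp
    have : v (p.1 - τ, p.2) = 0 := by
      refine image_eq_zero_of_notMem_tsupport fun h => hp ⟨((p.1 - τ, p.2), τ), ⟨h, ?_⟩, by simp⟩
      rw [sub_zero, abs_lt] at hτ
      exact ⟨hτ.1.le, hτ.2.le⟩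
    simp [this]

theorem specFun_neg (u : L2Cyl Ω) : specFun φ (-u) =ᵐ[mFreq] fun q => -specFun φ u q := by
  have := specFun_smul φ (-1) u
  simpa using this

/-- The difference quotients of the translates of `v` converge in `L²` to `-∂_t v`. Their transforms
are those of `v` multiplied by difference quotients of `e^{-iρτ}`, which converge pointwise to
`-iρ`. A subsequence converging almost everywhere identifies the two limits. -/
theorem specFun_dirDeriv_time (v : 𝓓(cyl Ω, ℝ)) :
    specFun φ (testL2 (dirDeriv v (1, 0))) =ᵐ[mFreq]
      fun q => Complex.I * q.1 * specFun φ (testL2 v) q := by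
  have h1 := hasDerivAt_iff_tendsto_slope_zero.1 (hasDerivAt_shiftTest v)
  have hτ : Tendsto (fun m : ℕ => 1 / ((m : ℝ) + 1)) atTop (𝓝[≠] 0) :=
    tendsto_nhdsWithin_iff.2 ⟨tendsto_one_div_add_atTop_nhds_zero_nat,
      Eventually.of_forall fun m => by
        simp only [mem_compl_iff, mem_singleton_iff]; positivity⟩
  have h2 := ((specLp φ).continuous.tendsto _).comp (h1.comp hτ)
  obtain ⟨ns, hns, h3⟩ := (tendstoInMeasure_of_tendsto_Lp h2).exists_seq_tendsto_ae
  have h4 : ∀ m : ℕ, specLp φ ((1 / ((m : ℝ) + 1))⁻¹ •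
      (testL2 (shiftTest v (0 + 1 / ((m : ℝ) + 1))) - testL2 (shiftTest v 0))) =ᵐ[mFreq]
      fun q => (((1 / ((m : ℝ) + 1))⁻¹ : ℝ) : ℂ) *
        (Complex.exp (-((0 + 1 / ((m : ℝ) + 1) : ℝ) * (Complex.I * q.1))) -
          Complex.exp (-((0 : ℝ) * (Complex.I * q.1)))) * specFun φ (testL2 v) q := fun m => by
    refine (coeFn_specLp φ _).trans ?_
    filter_upwards [specFun_smul φ (1 / ((m : ℝ) + 1))⁻¹
      (testL2 (shiftTest v (0 + 1 / ((m : ℝ) + 1))) - testL2 (shiftTest v 0)),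
      specFun_sub φ (testL2 (shiftTest v (0 + 1 / ((m : ℝ) + 1)))) (testL2 (shiftTest v 0)),
      specFun_shiftTest (φ := φ) v (0 + 1 / ((m : ℝ) + 1)), specFun_shiftTest (φ := φ) v 0]
      with q h1 h2 h3 h4
    rw [h1, h2, h3, h4]
    ring
  filter_upwards [h3, ae_all_iff.2 h4, coeFn_specLp φ (-testL2 (dirDeriv v (1, 0))),
    specFun_neg (φ := φ) (testL2 (dirDeriv v (1, 0)))] with q h3 h4 h5 h6
  rw [h5, h6] at h3
  have hd : HasDerivAt (fun τ : ℝ => Complex.exp (-(τ * (Complex.I * q.1))))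
      (-(Complex.I * q.1)) 0 := by
    have h := (((hasDerivAt_id (0 : ℝ)).ofReal_comp.mul_const (Complex.I * (q.1 : ℂ))).neg).cexp
    simpa using h
  have h7 := (((hasDerivAt_iff_tendsto_slope_zero.1 hd).comp hτ).comp hns.tendsto_atTop).mul_const
    (specFun φ (testL2 v) q)
  have h8 := tendsto_nhds_unique h3 (h7.congr fun m => by
    simp only [Function.comp_apply]
    rw [h4 (ns m), Complex.real_smul])
  rw [neg_mul] at h8
  exact neg_injective h8

/-! ### Domains -/

theorem lintegral_weight_specFun (u : L2Cyl Ω) {m : ℕ → ℝ} (hm : ∀ k, 0 ≤ m k) :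
    ∫⁻ q, ENNReal.ofReal (m q.2 * ‖specFun φ u q‖ ^ 2) ∂mFreq =
      ∑' k, ENNReal.ofReal (m k * ‖compLp (φ k) u‖ ^ 2) := by
  have hmeas : Measurable fun q : ℝ × ℕ => ENNReal.ofReal (m q.2 * ‖specFun φ u q‖ ^ 2) :=
    (((measurable_from_nat (f := m)).comp measurable_snd).mul
      ((measurable_specFun φ u).norm.pow_const 2)).ennreal_ofReal
  rw [lintegral_mFreq' hmeas]
  refine tsum_congr fun k => ?_
  simp only [ENNReal.ofReal_mul (hm k), ENNReal.ofReal_pow (norm_nonneg _), ofReal_norm, specFun]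
  rw [lintegral_const_mul' _ _ ENNReal.ofReal_ne_top, lintegral_hat]

theorem summable_weight_iff (u : L2Cyl Ω) {m : ℕ → ℝ} (hm : ∀ k, 0 ≤ m k) :
    (Summable fun k => m k * ‖compLp (φ k) u‖ ^ 2) ↔
      ∫⁻ q, ENNReal.ofReal (m q.2 * ‖specFun φ u q‖ ^ 2) ∂mFreq < ⊤ := by
  rw [lintegral_weight_specFun u hm]
  have h0 : ∀ k, 0 ≤ m k * ‖compLp (φ k) u‖ ^ 2 := fun k => mul_nonneg (hm k) (sq_nonneg _)
  refine ⟨fun h => ?_, fun h => ?_⟩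
  · rw [← ENNReal.ofReal_tsum_of_nonneg h0 h]
    exact ENNReal.ofReal_lt_top
  · exact (ENNReal.summable_toReal h.ne).congr fun k => ENNReal.toReal_ofReal (h0 k)

theorem lam_le_norm_symbol (hlam : ∀ k, 0 ≤ lam k) (q : ℝ × ℕ) : lam q.2 ≤ ‖symbol lam q‖ := by
  have := Complex.abs_re_le_norm (symbol lam q)
  rwa [symbol_re, abs_of_nonneg (hlam _)] at this

theorem norm_symbol_le (hlam : ∀ k, 0 ≤ lam k) (q : ℝ × ℕ) :
    ‖symbol lam q‖ ≤ lam q.2 + |q.1| := by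
  have := Complex.norm_le_abs_re_add_abs_im (symbol lam q)
  rwa [symbol_re, symbol_im, abs_of_nonneg (hlam _)] at this

theorem rpow_le_one_add {x s : ℝ} (hx : 0 ≤ x) (hs0 : 0 ≤ s) (hs1 : s ≤ 1) : x ^ s ≤ 1 + x := by
  rcases le_or_gt x 1 with h | h
  · exact (Real.rpow_le_one hx h hs0).trans (by linarith)
  · exact (Real.rpow_le_rpow_of_exponent_le h.le hs1).trans (by rw [Real.rpow_one]; linarith)

theorem lintegral_ofReal_sq_lt_top {X : Type*} [MeasurableSpace X] {μ : Measure X} {f : X → ℂ}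
    (hf : MemLp f 2 μ) : ∫⁻ x, ENNReal.ofReal (‖f x‖ ^ 2) ∂μ < ⊤ := by
  simpa only [ENNReal.ofReal_pow (norm_nonneg _), ofReal_norm] using
    (memLp_two_iff_lintegral.1 hf).2

theorem memDomH_of_memLp_symbol {s : ℝ} (hs0 : 0 ≤ s) (hs1 : s ≤ 1) {u : L2Cyl Ω}
    (h : MemLp (fun q => symbol lam q * specFun φ u q) 2 mFreq) : MemDomH φ lam s u := by
  rw [memDomH_iff]
  have hi := (((memLp_specFun φ u).integrable_norm_pow (by norm_num)).const_mul 2).add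
    (h.integrable_norm_pow (by norm_num))
  refine lt_of_le_of_lt (lintegral_mono fun q => ENNReal.ofReal_le_ofReal ?_) hi.lintegral_lt_top
  have h1 := rpow_le_one_add (norm_nonneg (symbol lam q)) hs0 hs1
  have h2 : ‖symbol lam q‖ ^ s ≤ 2 + ‖symbol lam q‖ ^ 2 := by
    nlinarith [sq_nonneg (‖symbol lam q‖ - 1)]
  simp only [Pi.add_apply, norm_mul, mul_pow, ← add_mul]
  gcongr

theorem summable_lam_sq_of_memLp_symbol (hlam : ∀ k, 0 ≤ lam k) {u : L2Cyl Ω}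
    (h : MemLp (fun q => symbol lam q * specFun φ u q) 2 mFreq) :
    Summable fun k => lam k ^ 2 * ‖compLp (φ k) u‖ ^ 2 := by
  rw [summable_weight_iff u fun k => sq_nonneg (lam k)]
  refine lt_of_le_of_lt (lintegral_mono fun q => ENNReal.ofReal_le_ofReal ?_)
    (lintegral_ofReal_sq_lt_top h)
  rw [norm_mul, mul_pow]
  exact mul_le_mul_of_nonneg_right (pow_le_pow_left₀ (hlam _) (lam_le_norm_symbol hlam q) 2)
    (sq_nonneg _)

theorem inFormDom_of_memLp_symbol (hlam : ∀ k, 0 ≤ lam k) {u : L2Cyl Ω}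
    (h : MemLp (fun q => symbol lam q * specFun φ u q) 2 mFreq) : InFormDom φ lam u := by
  refine Summable.of_nonneg_of_le (fun k => mul_nonneg (hlam k) (sq_nonneg _)) (fun k => ?_)
    ((hasSum_norm_sq_compLp φ u).summable.add (summable_lam_sq_of_memLp_symbol hlam h))
  nlinarith [mul_nonneg (sq_nonneg (lam k - 1)) (sq_nonneg ‖compLp (φ k) u‖),
    mul_nonneg (hlam k) (sq_nonneg ‖compLp (φ k) u‖)]

theorem memLp_time_testL2 (v : 𝓓(cyl Ω, ℝ)) :
    MemLp (fun q : ℝ × ℕ => Complex.I * q.1 * specFun φ (testL2 v) q) 2 mFreq :=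
  (memLp_congr_ae (specFun_dirDeriv_time v)).1 (memLp_specFun φ _)

/-- The weight is `|z|^s ≤ 1 + |z| ≤ 2 + ρ² + λ_k`. The term `ρ²` is controlled by `∂_t v ∈ L²`, and
the term `λ_k` by membership of `v` in the form domain, so no second derivatives in `x` are
involved. -/
theorem memDomH_testL2 (hL : IsAdmissible Ω a c Λ) (h𝒱 : IsFormDomain Ω a c 𝒱)
    (hφ : IsEigenbasis Ω a c 𝒱 lam φ) {s : ℝ} (hs0 : 0 ≤ s) (hs1 : s ≤ 1) (v : 𝓓(cyl Ω, ℝ)) :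
    MemDomH φ lam s (testL2 v) := by
  have h0 := (summable_weight_iff (testL2 v) hφ.nonneg).1 (inFormDom_testL2 hL h𝒱 hφ v)
  have hm : AEStronglyMeasurable (fun q => lam q.2 * ‖specFun φ (testL2 v) q‖ ^ 2) mFreq :=
    (((measurable_from_nat (f := lam)).comp measurable_snd).mul
      ((measurable_specFun φ _).norm.pow_const 2)).aestronglyMeasurable
  have hi := ((((memLp_specFun φ (testL2 v)).integrable_norm_pow (by norm_num)).const_mul 2).add
    ((memLp_time_testL2 (φ := φ) v).integrable_norm_pow (by norm_num))).add
    ((lintegral_ofReal_ne_top_iff_integrable hm (ae_of_all _ fun q =>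
      mul_nonneg (hφ.nonneg _) (sq_nonneg _))).1 h0.ne)
  rw [memDomH_iff]
  refine lt_of_le_of_lt (lintegral_mono fun q => ENNReal.ofReal_le_ofReal ?_) hi.lintegral_lt_top
  have h1 := rpow_le_one_add (norm_nonneg (symbol lam q)) hs0 hs1
  have h2 := norm_symbol_le hφ.nonneg q
  have h3 : ‖symbol lam q‖ ^ s ≤ 2 + q.1 ^ 2 + lam q.2 := by
    nlinarith [sq_nonneg (|q.1| - 1), sq_abs q.1]
  simp only [Pi.add_apply, norm_mul, Complex.norm_I, one_mul, Complex.norm_real, mul_pow,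
    Real.norm_eq_abs, sq_abs, ← add_mul]
  gcongr

/-! ### The form of `L` in terms of the spectral transform -/

theorem hasSum_inner_compLp (u v : L2Cyl Ω) :
    HasSum (fun k => ⟪compLp (φ k) v, compLp (φ k) u⟫_ℂ) ⟪v, u⟫_ℂ := by
  have h := (hasSum_tensorLp_compLp φ u).mapL (innerSL ℂ v)
  simpa only [innerSL_apply_apply, compLp, ContinuousLinearMap.adjoint_inner_left] using h

/-- Because `λ_k ≤ |z|`, the series `∑ λ_k u_k ⊗ φ_k` defines an element `w` of `L²`. Its inner
product with `v` is computed once through components and once through the spectral transform. -/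
theorem tsum_lam_inner (hlam : ∀ k, 0 ≤ lam k) {u v : L2Cyl Ω}
    (h : MemLp (fun q => symbol lam q * specFun φ u q) 2 mFreq) :
    HasSum (fun k => lam k * ⟪compLp (φ k) v, compLp (φ k) u⟫_ℂ)
      (∫ q, lam q.2 * specFun φ u q * conj (specFun φ v q) ∂mFreq) := by
  have hs : Summable fun k => ‖(lam k : ℂ) • compLp (φ k) u‖ ^ 2 := by
    refine (summable_lam_sq_of_memLp_symbol hlam h).congr fun k => ?_
    rw [norm_smul, Complex.norm_real, mul_pow, Real.norm_eq_abs, sq_abs]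
  set w : L2Cyl Ω := ∑' k, tensorLp (φ k) ((lam k : ℂ) • compLp (φ k) u) with hw
  have hk : ∀ k, compLp (φ k) w = (lam k : ℂ) • compLp (φ k) u := compLp_tsum φ hs
  have h1 := hasSum_inner_compLp (φ := φ) w v
  simp only [hk, inner_smul_right] at h1
  rw [inner_eq_integral_specFun φ] at h1
  convert h1 using 1
  refine integral_congr_ae (ae_mFreq_of_forall fun k => ?_)
  filter_upwards [hat_smul (lam k : ℂ) (compLp (φ k) u)] with ρ hρ
  simp only [specFun, hk, hρ, Pi.smul_apply, smul_eq_mul]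

theorem specFun_smul_fluxDeriv (hlam : ∀ k, 0 ≤ lam k) (u : L2Cyl Ω)
    (hu0 : ∀ k, lam k = 0 → component φ u k = 0) {s y : ℝ} (hs : 0 < s) (hy : 0 < y) :
    specFun φ (y ^ (2 * s - 1) • fluxDeriv φ lam s u y) =ᵐ[mFreq]
      fun q => symbol lam q * specFun φ (extension φ lam s u y) q := by
  filter_upwards [specFun_smul φ (y ^ (2 * s - 1)) (fluxDeriv φ lam s u y),
    specFun_fluxDeriv φ hlam u hu0 hs hy] with q h1 h2
  rw [h1, h2, ← mul_assoc, ← Complex.ofReal_mul, ← Real.rpow_add hy]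
  simp

/-- The product is the transform of a weighted `y`-derivative of the flux, which is already known to
lie in `L²`. No estimate of `z m_z(y)` is needed. -/
theorem memLp_symbol_mul_specFun (hlam : ∀ k, 0 ≤ lam k) (u : L2Cyl Ω)
    (hu0 : ∀ k, lam k = 0 → component φ u k = 0) {s y : ℝ} (hs : 0 < s) (hy : 0 < y) :
    MemLp (fun q => symbol lam q * specFun φ (extension φ lam s u y) q) 2 mFreq :=
  (memLp_congr_ae (specFun_smul_fluxDeriv hlam u hu0 hs hy)).1 (memLp_specFun φ _)

theorem integrable_mul_conj {X : Type*} [MeasurableSpace X] {μ : Measure X} {f g : X → ℂ}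
    (hf : MemLp f 2 μ) (hg : MemLp g 2 μ) : Integrable (fun x => f x * conj (g x)) μ :=
  hf.integrable_mul hg.star

theorem pairH_one_extension (hlam : ∀ k, 0 ≤ lam k) (u : L2Cyl Ω)
    (hu0 : ∀ k, lam k = 0 → component φ u k = 0) {s y : ℝ} (hs : 0 < s) (hy : 0 < y)
    (w : L2Cyl Ω) : pairH φ lam 1 (extension φ lam s u y) w =
      ⟪w, y ^ (2 * s - 1) • fluxDeriv φ lam s u y⟫_ℂ := by
  have hi := integrable_mul_conj (memLp_symbol_mul_specFun hlam u hu0 hs hy) (memLp_specFun φ w)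
  rw [pairH_eq]
  · rw [inner_eq_integral_specFun φ]
    refine integral_congr_ae ?_
    filter_upwards [specFun_smul_fluxDeriv hlam u hu0 hs hy] with q hq
    rw [hq]
    simp
  · simpa using hi

/-- The equation for `U(·, ·, y)`, tested with a function on `ℝ × Ω`. -/
theorem weak_equation_slice (hL : IsAdmissible Ω a c Λ) (h𝒱 : IsFormDomain Ω a c 𝒱)
    (hφ : IsEigenbasis Ω a c 𝒱 lam φ) (u : L2Cyl Ω)
    (hu0 : ∀ k, lam k = 0 → component φ u k = 0) {s y : ℝ} (hs : 0 < s) (hy : 0 < y)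
    (v : 𝓓(cyl Ω, ℝ)) :
    ⟪testL2 (dirDeriv v (1, 0)), extension φ lam s u y⟫_ℂ =
      formLp (aemeasurable_coef_cyl hL) (abs_coef_cyl_le hL)
        (fun j => jetCyl hL h𝒱 hφ j (extension φ lam s u y)) (testJet hL v) -
      ⟪testL2 v, y ^ (2 * s - 1) • fluxDeriv φ lam s u y⟫_ℂ := by
  have hlam := hφ.nonneg
  have hm := memLp_symbol_mul_specFun hlam u hu0 hs hy
  have h1 := (hasSum_formLp hL h𝒱 hφ (inFormDom_of_memLp_symbol hlam hm) v).unique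
    (tsum_lam_inner (v := testL2 v) hlam hm)
  rw [h1, inner_eq_integral_specFun φ, inner_eq_integral_specFun φ]
  have hv := memLp_specFun φ (testL2 v)
  have hm' : MemLp (fun q => (lam q.2 : ℂ) * specFun φ (extension φ lam s u y) q) 2 mFreq := by
    refine hm.of_le ?_ (ae_of_all _ fun q => ?_)
    · exact ((Complex.measurable_ofReal.comp ((measurable_from_nat (f := lam)).comp
        measurable_snd)).mul (measurable_specFun φ _)).aestronglyMeasurable
    · rw [norm_mul, norm_mul, Complex.norm_real, Real.norm_eq_abs, abs_of_nonneg (hlam _)]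
      exact mul_le_mul_of_nonneg_right (lam_le_norm_symbol hlam q) (norm_nonneg _)
  have hm2 : Integrable (fun q => specFun φ (y ^ (2 * s - 1) • fluxDeriv φ lam s u y) q *
      conj (specFun φ (testL2 v) q)) mFreq := integrable_mul_conj (memLp_specFun φ _) hv
  rw [← integral_sub (integrable_mul_conj hm' hv) hm2]
  refine integral_congr_ae ?_
  filter_upwards [specFun_smul_fluxDeriv hlam u hu0 hs hy, specFun_dirDeriv_time (φ := φ) v]
    with q h2 h3
  rw [h2, h3]
  -- With `∂_t` on the test function the factor is `conj(iρ) = -iρ = λ_k - z`, the difference of the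
  -- form term and the term in `y`.
  simp only [map_mul, Complex.conj_I, Complex.conj_ofReal, symbol, symb]
  ring

end

section

/-! ### The weighted measures -/

theorem measurable_weight (s : ℝ) : Measurable fun y : ℝ => ENNReal.ofReal (y ^ (1 - 2 * s)) :=
  (measurable_id.pow_const _).ennreal_ofReal

theorem ae_wMeas_iff {s : ℝ} {P : ℝ → Prop} :
    (∀ᵐ y ∂(wMeas s), P y) ↔ ∀ᵐ y ∂(volume.restrict (Ioi (0 : ℝ))), P y := by
  rw [wMeas, ae_withDensity_iff (measurable_weight s)]
  refine eventually_congr ?_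
  filter_upwards [ae_restrict_mem measurableSet_Ioi] with y hy
  have : ENNReal.ofReal (y ^ (1 - 2 * s)) ≠ 0 := by
    rw [ENNReal.ofReal_ne_zero_iff]; exact Real.rpow_pos_of_pos hy _
  simp [this]

theorem ae_wMeas_of_forall {s : ℝ} {P : ℝ → Prop} (h : ∀ y, 0 < y → P y) :
    ∀ᵐ y ∂(wMeas s), P y :=
  ae_wMeas_iff.2 ((ae_restrict_mem measurableSet_Ioi).mono h)

/-- Away from `y = 0` the inverse weight `y^{2s-1}` is bounded on bounded intervals. Weighted square
integrability therefore gives local integrability in the open set `D`. -/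
theorem restrict_Icc_le_smul_wMeas (s : ℝ) {α β : ℝ} (hα : 0 < α) :
    ∃ C : ENNReal, C ≠ ⊤ ∧ volume.restrict (Icc α β) ≤ C • wMeas s := by
  obtain ⟨M, hM⟩ := (isCompact_Icc (a := α) (b := β)).exists_bound_of_continuousOn
    (f := fun y : ℝ => y ^ (2 * s - 1)) (fun y hy => (Real.continuousAt_rpow_const _ _
      (Or.inl (hα.trans_le hy.1).ne')).continuousWithinAt)
  refine ⟨ENNReal.ofReal M, ENNReal.ofReal_ne_top, Measure.le_iff.2 fun A hA => ?_⟩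
  rw [Measure.smul_apply, wMeas, withDensity_apply _ hA, Measure.restrict_restrict hA,
    Measure.restrict_apply hA, smul_eq_mul, ← lintegral_const_mul' _ _ ENNReal.ofReal_ne_top,
    ← setLIntegral_one]
  have hsub : A ∩ Icc α β ⊆ A ∩ Ioi 0 := fun y hy => ⟨hy.1, hα.trans_le hy.2.1⟩
  refine le_trans (setLIntegral_mono_ae' (hA.inter measurableSet_Icc)
    (ae_of_all _ fun y hy => ?_)) (lintegral_mono_set hsub)
  have hy0 : 0 < y := hα.trans_le hy.2.1
  have h1 := hM y hy.2
  rw [Real.norm_eq_abs, abs_of_pos (Real.rpow_pos_of_pos hy0 _)] at h1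
  rw [← ENNReal.ofReal_mul ((Real.rpow_nonneg hy0.le _).trans h1), ← ENNReal.ofReal_one]
  refine ENNReal.ofReal_le_ofReal ?_
  calc (1 : ℝ) = y ^ (2 * s - 1) * y ^ (1 - 2 * s) := by
        rw [← Real.rpow_add hy0]; simp
    _ ≤ M * y ^ (1 - 2 * s) := by gcongr

theorem memLp_restrict_Icc {X F : Type*} [MeasurableSpace X] {μ : Measure X} [SFinite μ]
    [NormedAddCommGroup F] {s : ℝ} {f : X × ℝ → F} (hf : MemLp f 2 (μ.prod (wMeas s))) {α β : ℝ}
    (hα : 0 < α) : MemLp f 2 (μ.prod (volume.restrict (Icc α β))) := by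
  obtain ⟨C, hC, h⟩ := restrict_Icc_le_smul_wMeas s (β := β) hα
  have h1 : MemLp f 2 (C • μ.prod (wMeas s)) := hf.smul_measure hC
  rw [← Measure.prod_smul_right] at h1
  exact h1.mono_measure (Measure.prod_mono le_rfl h)

theorem integrableOn_Icc_of_memLp {F : Type*} [NormedAddCommGroup F] {s : ℝ} {f : ℝ → F}
    (hf : MemLp f 2 (wMeas s)) {α β : ℝ} (hα : 0 < α) : IntegrableOn f (Icc α β) := by
  obtain ⟨C, hC, h⟩ := restrict_Icc_le_smul_wMeas s (β := β) hα
  have h1 : MemLp f 2 (volume.restrict (Icc α β)) := (hf.smul_measure hC).mono_measure h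
  exact h1.integrable (by norm_num)

variable {n : ℕ} {Ω : Opens (Sp n)}

theorem restrict_halfCyl : (volume : Measure (Sp n × ℝ)).restrict (halfCyl Ω : Set (Sp n × ℝ)) =
    (mΩ Ω).prod (volume.restrict (Ioi 0)) := by
  change (volume.prod volume).restrict ((Ω : Set (Sp n)) ×ˢ Ioi (0 : ℝ)) = _
  rw [Measure.prod_restrict]

theorem locallyIntegrableOn_halfCyl {F : Type*} [NormedAddCommGroup F] {s : ℝ} {w : Sp n × ℝ → F}
    (hw : MemLp w 2 (mD Ω s)) : LocallyIntegrableOn w (halfCyl Ω : Set (Sp n × ℝ)) := by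
  intro q hq
  have hq2 : 0 < q.2 := hq.2
  refine ⟨(halfCyl Ω : Set (Sp n × ℝ)) ∩ (Metric.ball q.1 1 ×ˢ Icc (q.2 / 2) (q.2 + 1)),
    inter_mem self_mem_nhdsWithin (nhdsWithin_le_nhds (prod_mem_nhds (Metric.ball_mem_nhds _ one_pos)
      (Icc_mem_nhds (by linarith) (by linarith)))), ?_⟩
  have h1 := memLp_restrict_Icc (β := q.2 + 1) hw (by linarith : 0 < q.2 / 2)
  have h2 : MemLp w 2 (((mΩ Ω).restrict (Metric.ball q.1 1)).prod
      (volume.restrict (Icc (q.2 / 2) (q.2 + 1)))) :=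
    h1.mono_measure (Measure.prod_mono Measure.restrict_le_self le_rfl)
  have hfin : IsFiniteMeasure ((mΩ Ω).restrict (Metric.ball q.1 1)) :=
    ⟨by
      rw [Measure.restrict_apply_univ]
      exact (Measure.restrict_apply_le _ _).trans_lt measure_ball_lt_top⟩
  have h3 := h2.integrable (by norm_num)
  refine h3.mono_measure ?_
  rw [Measure.restrict_restrict Metric.isOpen_ball.measurableSet, Measure.prod_restrict]
  refine Measure.restrict_mono_set _ fun p hp => ?_
  exact ⟨⟨hp.2.1, hp.1.1⟩, hp.2.2⟩

theorem lintegral_mExt {s : ℝ} {f : ℝ × Sp n × ℝ → ENNReal} (hf : Measurable f) :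
    ∫⁻ q, f q ∂(mExt Ω s) = ∫⁻ y, ∫⁻ p, f (p.1, p.2, y) ∂(mCyl Ω) ∂(wMeas s) := by
  rw [← (measurePreserving_prodAssoc volume (mΩ Ω) (wMeas s)).lintegral_comp hf,
    lintegral_prod_symm (fun z => f (MeasurableEquiv.prodAssoc z))
      (hf.comp MeasurableEquiv.prodAssoc.measurable).aemeasurable]
  rfl

theorem exists_joint_representative {𝒞 : ℝ → L2Cyl Ω} (h : StronglyMeasurable 𝒞) :
    ∃ U : ℝ × Sp n × ℝ → ℂ, Measurable U ∧ ∀ y, (fun p => U (p.1, p.2, y)) =ᵐ[mCyl Ω] 𝒞 y := by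
  have : Fact ((2 : ENNReal) ≠ ⊤) := ⟨by simp⟩
  borelize (L2Cyl Ω)
  obtain ⟨U, hU, h⟩ := exists_measurable_representative h.measurable
  exact ⟨fun q => U ((q.1, q.2.1), q.2.2), hU.comp (by fun_prop), h⟩

/-! ### Integration by parts on a half line -/

/-- Since `Y` is merely integrable, its primitive is only absolutely continuous, and integration by
parts is used in that class. -/
theorem integral_deriv_mul_primitive {χ : ℝ → ℝ} (hχ : ContDiff ℝ 1 χ) {Y : ℝ → ℝ} {α β : ℝ}
    (hY : IntervalIntegrable Y volume α β) (hα : χ α = 0) (hβ : χ β = 0) :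
    ∫ y in α..β, deriv χ y * ∫ η in α..y, Y η = -∫ y in α..β, χ y * Y y := by
  have h1 : AbsolutelyContinuousOnInterval χ α β :=
    hχ.contDiffOn.absolutelyContinuousOnInterval
  have h2 : AbsolutelyContinuousOnInterval (fun y => ∫ η in α..y, Y η) α β :=
    hY.absolutelyContinuousOnInterval_intervalIntegral (by simp)
  have h3 := h1.integral_mul_deriv_eq_deriv_mul h2
  rw [hα, hβ] at h3
  have h4 : ∫ x in α..β, χ x * deriv (fun y => ∫ η in α..y, Y η) x = ∫ x in α..β, χ x * Y x := by
    refine intervalIntegral.integral_congr_ae ?_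
    filter_upwards [hY.ae_hasDerivAt_integral] with x hx hx'
    rw [(hx (uIoc_subset_uIcc hx') α (by simp)).deriv]
  rw [h4] at h3
  linarith

theorem integral_deriv_smul_primitive {χ : ℝ → ℝ} (hχ : ContDiff ℝ 1 χ) {Y : ℝ → ℂ} {α β : ℝ}
    (hY : IntervalIntegrable Y volume α β) (hα : χ α = 0) (hβ : χ β = 0) (C : ℂ) :
    ∫ y in α..β, deriv χ y • (C + ∫ η in α..y, Y η) = -∫ y in α..β, χ y • Y y := by
  have hχ' : Continuous (deriv χ) := hχ.continuous_deriv le_rfl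
  have hF : ContinuousOn (fun y => ∫ η in α..y, Y η) (uIcc α β) :=
    intervalIntegral.continuousOn_primitive_interval' hY left_mem_uIcc
  have i1 : IntervalIntegrable (fun y => deriv χ y • (C + ∫ η in α..y, Y η)) volume α β :=
    (hχ'.continuousOn.smul (continuousOn_const.add hF)).intervalIntegrable
  have i2 : IntervalIntegrable (fun y => χ y • Y y) volume α β :=
    hY.continuousOn_smul hχ.continuous.continuousOn
  have key : ∀ L : ℂ →L[ℝ] ℝ, L (∫ y in α..β, deriv χ y • (C + ∫ η in α..y, Y η)) =
      L (-∫ y in α..β, χ y • Y y) := fun L => by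
    have hLY : IntervalIntegrable (fun y => L (Y y)) volume α β :=
      ⟨L.integrable_comp hY.1, L.integrable_comp hY.2⟩
    have hLF : ContinuousOn (fun y => ∫ η in α..y, L (Y η)) (uIcc α β) :=
      intervalIntegral.continuousOn_primitive_interval' hLY left_mem_uIcc
    rw [map_neg, ← L.intervalIntegral_comp_comm i1, ← L.intervalIntegral_comp_comm i2]
    simp only [map_smul, smul_eq_mul]
    rw [← integral_deriv_mul_primitive hχ hLY hα hβ]
    have e1 : ∫ y in α..β, deriv χ y * L (C + ∫ η in α..y, Y η) =
        ∫ y in α..β, (deriv χ y * L C + deriv χ y * ∫ η in α..y, L (Y η)) := by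
      refine intervalIntegral.integral_congr fun y hy => ?_
      simp only [map_add, mul_add]
      rw [L.intervalIntegral_comp_comm (hY.mono_set (uIcc_subset_uIcc left_mem_uIcc hy))]
    rw [e1, intervalIntegral.integral_add (f := fun y => deriv χ y * L C)
        (g := fun y => deriv χ y * ∫ η in α..y, L (Y η))
        (hχ'.mul continuous_const).continuousOn.intervalIntegrable
        (hχ'.continuousOn.mul hLF).intervalIntegrable, intervalIntegral.integral_mul_const,
      intervalIntegral.integral_deriv_eq_sub (fun y _ => hχ.differentiable one_ne_zero y)
        hχ'.continuousOn.intervalIntegrable, hα, hβ]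
    ring
  exact Complex.ext (key Complex.reCLM) (key Complex.imCLM)

/-! ### The energy of the extension -/

/-- If some eigenvalue is positive, the first positive one bounds all the later ones from below by
monotonicity. The gap is what allows `‖U‖²` to be recovered from `∑ λ_k ‖U_k‖²`, and what bounds
`λ_k^{s-1}`. -/
theorem exists_pos_le_of_monotone {lam : ℕ → ℝ} (h0 : ∀ k, 0 ≤ lam k) (hm : Monotone lam) :
    ∃ δ > 0, ∀ k, lam k = 0 ∨ δ ≤ lam k := by
  classical
  by_cases h : ∃ k, 0 < lam k
  · refine ⟨lam (Nat.find h), Nat.find_spec h, fun k => ?_⟩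
    rcases lt_or_ge k (Nat.find h) with hk | hk
    · exact Or.inl (le_antisymm (not_lt.1 (Nat.find_min h hk)) (h0 k))
    · exact Or.inr (hm hk)
  · push Not at h
    exact ⟨1, one_pos, fun k => Or.inl (le_antisymm (h k) (h0 k))⟩

variable {lam : ℕ → ℝ} {φ : HilbertBasis ℕ ℝ (L2 Ω)}

theorem measurable_real_smul {X : Type*} [MeasurableSpace X] {r : X → ℝ} {f : X → ℂ}
    (hr : Measurable r) (hf : Measurable f) : Measurable fun x => r x • f x :=
  hr.smul hf

theorem measurable_subord_symbol (r : ℝ) :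
    Measurable fun q : (ℝ × ℕ) × ℝ => subord (expo (symbol lam q.1)) r (q.2 ^ 2 / 4) := by
  have h : Measurable fun q : ((ℝ × ℕ) × ℝ) × ℝ =>
      subKernel r (q.1.2 ^ 2 / 4) q.2 • expo (symbol lam q.1.1) q.2 := by
    refine measurable_real_smul ?_ ?_
    · unfold subKernel
      fun_prop
    · exact (measurable_expo_symbol (lam := lam)).comp
        ((measurable_fst.comp measurable_fst).prodMk measurable_snd)
  exact (h.stronglyMeasurable.integral_prod_right'
    (ν := volume.restrict (Ioi (0 : ℝ)))).measurable

theorem measurable_subExt_symbol (s : ℝ) :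
    Measurable fun q : (ℝ × ℕ) × ℝ => subExt s (expo (symbol lam q.1)) q.2 := by
  unfold subExt
  exact measurable_real_smul (by fun_prop) (measurable_subord_symbol s)

theorem measurable_subExtFlux_symbol (s : ℝ) :
    Measurable fun q : (ℝ × ℕ) × ℝ => subExtFlux s (expo (symbol lam q.1)) q.2 := by
  unfold subExtFlux
  have h1 := measurable_subord_symbol (lam := lam) s
  have h2 := measurable_subord_symbol (lam := lam) (s + 1)
  exact measurable_real_smul measurable_const ((measurable_real_smul measurable_const h1).sub
    (measurable_real_smul (by fun_prop) h2))

/-- By Tonelli the integral in `y` is taken first, at a fixed frequency, where the scalar energy is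
at most a multiple of `|z|^s`; what remains is the integral defining `Dom(H^s)`. The
undifferentiated term is absorbed with the factor `δ⁻¹`. -/
theorem lintegral_energy_extension (hlam : ∀ k, 0 ≤ lam k) (hmono : Monotone lam) (u : L2Cyl Ω)
    {s : ℝ} (hs0 : 0 < s) (hs1 : s < 1) (hu : MemDomH φ lam s u)
    (hu0 : ∀ k, lam k = 0 → component φ u k = 0) :
    ∫⁻ y, (‖extension φ lam s u y‖ₑ ^ 2 +
      (∑' k, ENNReal.ofReal (lam k * ‖compLp (φ k) (extension φ lam s u y)‖ ^ 2)) +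
      ‖deriv (extension φ lam s u) y‖ₑ ^ 2) ∂(wMeas s) < ⊤ := by
  obtain ⟨δ, hδ, hgap⟩ := exists_pos_le_of_monotone hlam hmono
  set K : ℝ × ℕ → ℝ → ENNReal := fun q y =>
    ENNReal.ofReal (‖y ^ (2 * s - 1) • subExtFlux s (expo (symbol lam q)) y‖ ^ 2 +
      (symbol lam q).re * ‖subExt s (expo (symbol lam q)) y‖ ^ 2) with hK
  have hKm : Measurable fun q : (ℝ × ℕ) × ℝ => K q.1 q.2 := by
    have h1 := measurable_subExt_symbol (lam := lam) s
    have h2 := measurable_subExtFlux_symbol (lam := lam) s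
    have h3 := measurable_symbol lam
    simp only [hK]
    refine Measurable.ennreal_ofReal (Measurable.add ?_ ?_)
    · exact ((measurable_real_smul (by fun_prop) h2).norm).pow_const 2
    · exact (Complex.measurable_re.comp (h3.comp measurable_fst)).mul (h1.norm.pow_const 2)
  clear_value K
  have hKq : ∀ q, Measurable (K q) := fun q => hKm.comp (measurable_prodMk_left (x := q))
  set E : ℝ → ENNReal := fun y => ∫⁻ q, K q y * ENNReal.ofReal (‖specFun φ u q‖ ^ 2) ∂mFreq with hE
  have hum : Measurable fun q => ENNReal.ofReal (‖specFun φ u q‖ ^ 2) :=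
    ((measurable_specFun φ u).norm.pow_const 2).ennreal_ofReal
  have hEm : Measurable E := by
    have : Measurable fun z : ℝ × (ℝ × ℕ) => K z.2 z.1 * ENNReal.ofReal (‖specFun φ u z.2‖ ^ 2) :=
      (hKm.comp measurable_swap).mul (hum.comp measurable_snd)
    exact this.lintegral_prod_right'
  have hcoef : ∀ y, 0 < y → ‖extension φ lam s u y‖ₑ ^ 2 +
      (∑' k, ENNReal.ofReal (lam k * ‖compLp (φ k) (extension φ lam s u y)‖ ^ 2)) +
      ‖deriv (extension φ lam s u) y‖ₑ ^ 2 ≤ (ENNReal.ofReal δ⁻¹ + 1) * E y := by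
    intro y hy
    rw [(hasDerivAt_extension φ hlam u hs0 hy).deriv, ← lintegral_weight_specFun _ hlam,
      ← lintegral_specFun φ, ← lintegral_specFun φ, ← lintegral_add_left
      ((measurable_specFun φ _).enorm.pow_const 2), ← lintegral_add_right _
      ((measurable_specFun φ _).enorm.pow_const 2), hE, ← lintegral_const_mul]
    · refine lintegral_mono_ae ?_
      filter_upwards [specFun_extension φ hlam u hs0 hy, specFun_flux φ hlam u hs0 hy,
        specFun_smul φ (y ^ (2 * s - 1)) (flux φ lam s u y), specFun_eq_zero φ hu0]
        with q h1 h2 h3 h4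
      have e : ∀ z : ℂ, ‖z‖ₑ ^ 2 = ENNReal.ofReal (‖z‖ ^ 2) := fun z => by
        rw [← ofReal_norm, ENNReal.ofReal_pow (norm_nonneg _)]
      have hl := hlam q.2
      rw [h3, h2, h1, e, e, hK]
      simp only [symbol_re]
      rw [← ENNReal.ofReal_add (by positivity) (by positivity),
        ← ENNReal.ofReal_add (by positivity) (by positivity),
        ← ENNReal.ofReal_mul (by positivity), ← ENNReal.ofReal_one,
        ← ENNReal.ofReal_add (by positivity) (by positivity),
        ← ENNReal.ofReal_mul (by positivity)]
      refine ENNReal.ofReal_le_ofReal ?_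
      rcases hgap q.2 with h | h
      · rw [h4 h]; simp
      · rw [norm_smul, norm_mul, norm_mul, norm_mul, Complex.norm_real]
        set A := ‖y ^ (2 * s - 1)‖ * ‖subExtFlux s (expo (symbol lam q)) y‖
        set B := ‖subExt s (expo (symbol lam q)) y‖
        set D := ‖specFun φ u q‖
        have h5 : 1 ≤ δ⁻¹ * lam q.2 := by
          rw [inv_mul_eq_div, le_div_iff₀ hδ]; linarith
        have h6 : B ^ 2 * D ^ 2 ≤ δ⁻¹ * lam q.2 * (B ^ 2 * D ^ 2) :=
          le_mul_of_one_le_left (by positivity) h5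
        have h7 : 0 ≤ δ⁻¹ * (A ^ 2 * D ^ 2) := by positivity
        have e2 : ‖y ^ (2 * s - 1)‖ * (‖subExtFlux s (expo (symbol lam q)) y‖ * D) = A * D := by
          ring
        rw [e2]
        nlinarith
    · exact (hKm.comp (measurable_id.prodMk measurable_const)).mul hum
  refine lt_of_le_of_lt (lintegral_mono_ae (ae_wMeas_of_forall hcoef)) ?_
  rw [lintegral_const_mul _ hEm]
  refine ENNReal.mul_lt_top (by simp) ?_
  have hsw : ∫⁻ y, E y ∂(wMeas s) =
      ∫⁻ q, (∫⁻ y, K q y ∂(wMeas s)) * ENNReal.ofReal (‖specFun φ u q‖ ^ 2) ∂mFreq := by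
    simp only [hE]
    rw [lintegral_lintegral_swap]
    · refine lintegral_congr fun q => ?_
      exact lintegral_mul_const _ (hKq q)
    · exact ((hKm.comp measurable_swap).mul (hum.comp measurable_snd)).aemeasurable
  rw [hsw]
  set Cs : ℝ := Real.Gamma (1 - s) / (4 ^ (s - 1 / 2) * Real.Gamma s) with hCs
  have hCs0 : 0 ≤ Cs := by
    have h1 := Real.Gamma_pos_of_pos hs0
    have h2 := Real.Gamma_pos_of_pos (by linarith : 0 < 1 - s)
    positivity
  have hb : ∫⁻ q, (∫⁻ y, K q y ∂(wMeas s)) * ENNReal.ofReal (‖specFun φ u q‖ ^ 2) ∂mFreq ≤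
      ∫⁻ q, ENNReal.ofReal Cs *
        ENNReal.ofReal (‖symbol lam q‖ ^ s * ‖specFun φ u q‖ ^ 2) ∂mFreq := by
    refine lintegral_mono_ae ?_
    filter_upwards [specFun_eq_zero φ hu0] with q hq
    rcases hgap q.2 with h | h
    · rw [hq h]; simp
    · have hz : 0 < (symbol lam q).re := by rw [symbol_re]; linarith
      rw [← ENNReal.ofReal_mul hCs0, ← mul_assoc, ENNReal.ofReal_mul (by positivity)]
      gcongr
      rw [hK]
      exact lintegral_energy_subExt_expo hs0 hs1 hz
  refine hb.trans_lt ?_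
  rw [lintegral_const_mul' _ _ ENNReal.ofReal_ne_top]
  exact ENNReal.mul_lt_top ENNReal.ofReal_lt_top ((memDomH_iff φ lam s u).1 hu)

end

section

variable {n : ℕ} {Ω : Opens (Sp n)} {a : Sp n → Matrix (Fin n) (Fin n) ℝ} {c : Sp n → ℝ} {Λ : ℝ}
  {𝒱 : Submodule ℝ (L2 Ω)} {lam : ℕ → ℝ} {φ : HilbertBasis ℕ ℝ (L2 Ω)}

/-! ### Slices -/

/-- A real function as a complex one. -/
def cLp (f : L2 Ω) : Lp ℂ 2 (mΩ Ω) := (Lp.memLp f).ofReal.toLp _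

theorem coeFn_cLp (f : L2 Ω) : cLp f =ᵐ[mΩ Ω] fun x => (f x : ℂ) := (Lp.memLp f).ofReal.coeFn_toLp

theorem formLp_cLp_eigJet (hL : IsAdmissible Ω a c Λ) (h𝒱 : IsFormDomain Ω a c 𝒱)
    (hφ : IsEigenbasis Ω a c 𝒱 lam φ) (k l : ℕ) :
    formLp (aemeasurable_coef hL) (abs_coef_le hL) (fun j => cLp (eigJet hL h𝒱 hφ j k))
      (fun j => cLp (eigJet hL h𝒱 hφ j l)) = if k = l then (lam k : ℂ) else 0 := by
  rw [formLp_eq_integral _ _ (fun j => coeFn_cLp _) (fun j => coeFn_cLp _)]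
  have h := integral_coef_jet hL h𝒱 (eigV hφ k) (eigV hφ l)
  have h2 : ⟪φ k, ((eigV hφ l : 𝒱) : L2 Ω)⟫_ℝ = if k = l then 1 else 0 :=
    orthonormal_iff_ite.1 φ.orthonormal k l
  rw [formL_eigV, h2] at h
  have h1 := congrArg (fun r : ℝ => (r : ℂ)) h
  simp only [← integral_complex_ofReal] at h1
  push_cast at h1
  simp only [Complex.conj_ofReal]
  refine h1.trans ?_
  split_ifs <;> simp

theorem formLp_sum_cLp_eigJet (hL : IsAdmissible Ω a c Λ) (h𝒱 : IsFormDomain Ω a c 𝒱)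
    (hφ : IsEigenbasis Ω a c 𝒱 lam φ) (F : Finset ℕ) (b : ℕ → ℂ) :
    formLp (aemeasurable_coef hL) (abs_coef_le hL)
      (fun j => ∑ k ∈ F, b k • cLp (eigJet hL h𝒱 hφ j k))
      (fun j => ∑ k ∈ F, b k • cLp (eigJet hL h𝒱 hφ j k)) = ∑ k ∈ F, (lam k * ‖b k‖ ^ 2 : ℝ) := by
  rw [formLp_sum_left, Complex.ofReal_sum]
  refine Finset.sum_congr rfl fun k hk => ?_
  rw [formLp_sum_right]
  simp only [formLp_smul_left, formLp_smul_right, formLp_cLp_eigJet, mul_ite, mul_zero,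
    Finset.sum_ite_eq, if_pos hk]
  rw [Complex.ofReal_mul, Complex.ofReal_pow, ← Complex.conj_mul']
  ring

/-- The eigenfunctions, and their first order data. -/
def eigData (hL : IsAdmissible Ω a c Λ) (h𝒱 : IsFormDomain Ω a c 𝒱)
    (hφ : IsEigenbasis Ω a c 𝒱 lam φ) : Option (Option (Fin n)) → ℕ → L2 Ω
  | none => fun k => φ k
  | some j => eigJet hL h𝒱 hφ j

variable (hL : IsAdmissible Ω a c Λ) (h𝒱 : IsFormDomain Ω a c 𝒱)
  (hφ : IsEigenbasis Ω a c 𝒱 lam φ) {b : ℕ → ℂ} {N : ℕ → ℕ}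
  {w : Option (Option (Fin n)) → Lp ℂ 2 (mΩ Ω)}

theorem hasWeakDeriv_of_tendsto_sum (h : ∀ κ, Tendsto
    (fun m => ∑ k ∈ Finset.range (N m), b k • cLp (eigData hL h𝒱 hφ κ k)) atTop (𝓝 (w κ)))
    (i : Fin n) : HasWeakDeriv Ω (e i) (w none) (w (some (some i))) := by
  have hloc : ∀ f : Lp ℂ 2 (mΩ Ω), LocallyIntegrableOn f (Ω : Set (Sp n)) := fun f =>
    locallyIntegrableOn_of_memLp (Lp.memLp f)
  have h1 := h none
  have h2 := h (some (some i))
  refine hasWeakDeriv_of_approx (hloc _) (hloc _) fun ε hε => ?_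
  rw [Lp.tendsto_Lp_iff_tendsto_eLpNorm', ENNReal.tendsto_nhds_zero] at h1 h2
  obtain ⟨m, hm1, hm2⟩ := ((h1 ε hε).and (h2 ε hε)).exists
  refine ⟨_, _, ?_, (eLpNorm_sub_comm _ _ _ _).trans_le hm1,
    (eLpNorm_sub_comm _ _ _ _).trans_le hm2⟩
  have hd : ∀ k, HasWeakDeriv Ω (e i) (fun x => b k • ((φ k x : ℝ) : ℂ))
      (fun x => b k • ((eigJet hL h𝒱 hφ (some i) k x : ℝ) : ℂ)) := fun k =>
    ((hasWeakDeriv_wpartial (h𝒱.energy _ (hφ.mem k)) i).congr_right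
      (coeFn_jet hL.meas_c h𝒱 (some i) (eigV hφ k)).symm
      (locallyIntegrableOn_of_memLp (Lp.memLp _))).ofReal.const_smul (b k)
  have hs : ∀ d : ℕ → L2 Ω, (fun x => ∑ k ∈ Finset.range (N m), b k • ((d k x : ℝ) : ℂ)) =ᵐ[mΩ Ω]
      (∑ k ∈ Finset.range (N m), b k • cLp (d k) : Lp ℂ 2 (mΩ Ω)) := fun d => by
    filter_upwards [Lp.coeFn_fun_finsetSum (Finset.range (N m)) fun k => b k • cLp (d k),
      ae_all_iff.2 fun k => Lp.coeFn_smul (b k) (cLp (d k)),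
      ae_all_iff.2 fun k => coeFn_cLp (d k)] with x h1 h2 h3
    rw [h1]
    refine Finset.sum_congr rfl fun k _ => ?_
    rw [h2, Pi.smul_apply, h3]
  exact ((HasWeakDeriv.sum (s := Finset.range (N m)) fun k _ => hd k).congr_left (hs _)
    (hloc _)).congr_right (hs _) (hloc _)

theorem none_ae_eq_of_tendsto_sum (h : ∀ κ, Tendsto
    (fun m => ∑ k ∈ Finset.range (N m), b k • cLp (eigData hL h𝒱 hφ κ k)) atTop (𝓝 (w κ))) :
    w (some none) =ᵐ[mΩ Ω] fun x => ((√|c x| : ℝ) : ℂ) * w none x := by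
  refine ae_eq_mul_of_tendsto (h none) (h (some none)) fun m => ?_
  filter_upwards [Lp.coeFn_fun_finsetSum (Finset.range (N m))
      fun k => b k • cLp (eigData hL h𝒱 hφ none k),
    Lp.coeFn_fun_finsetSum (Finset.range (N m))
      fun k => b k • cLp (eigData hL h𝒱 hφ (some none) k),
    ae_all_iff.2 fun k => Lp.coeFn_smul (b k) (cLp (eigData hL h𝒱 hφ none k)),
    ae_all_iff.2 fun k => Lp.coeFn_smul (b k) (cLp (eigData hL h𝒱 hφ (some none) k)),
    ae_all_iff.2 fun k => coeFn_cLp (eigData hL h𝒱 hφ none k),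
    ae_all_iff.2 fun k => coeFn_cLp (eigData hL h𝒱 hφ (some none) k),
    ae_all_iff.2 fun k => coeFn_jet hL.meas_c h𝒱 none (eigV hφ k)]
    with x h1 h2 h3 h4 h5 h6 h7
  rw [h1, h2, Finset.mul_sum]
  refine Finset.sum_congr rfl fun k _ => ?_
  rw [h3, h4, Pi.smul_apply, Pi.smul_apply, h5, h6]
  simp only [eigData, eigJet, h7, jetFun]
  change b k • (((√|c x| * φ k x : ℝ)) : ℂ) = _
  push_cast
  simp only [smul_eq_mul]
  ring

/-- On partial sums the form equals `∑ λ_k |b_k|²`, because the eigenfunctions are orthogonal for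
the form. One side passes to the limit by continuity of `formLp`, the other as a series of
nonnegative terms, and convergence of the former yields finiteness of the latter. -/
theorem tsum_eq_of_tendsto_sum (hN : Tendsto N atTop atTop) (h : ∀ κ, Tendsto
    (fun m => ∑ k ∈ Finset.range (N m), b k • cLp (eigData hL h𝒱 hφ κ k)) atTop (𝓝 (w κ))) :
    (∑' k, ENNReal.ofReal (lam k * ‖b k‖ ^ 2)) < ⊤ ∧
      ∫ x, ((∑ i, ∑ j, a x i j * (w (some (some i)) x * conj (w (some (some j)) x)).re) +
        c x * ‖w none x‖ ^ 2) ∂(mΩ Ω) = (∑' k, ENNReal.ofReal (lam k * ‖b k‖ ^ 2)).toReal := by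
  have h0 : ∀ k, 0 ≤ lam k * ‖b k‖ ^ 2 := fun k => mul_nonneg (hφ.nonneg k) (sq_nonneg _)
  have h1 := tendsto_formLp (aemeasurable_coef hL) (abs_coef_le hL) (fun j => h (some j))
    (fun j => h (some j))
  have h2 : ∀ m, formLp (aemeasurable_coef hL) (abs_coef_le hL)
      (fun j => ∑ k ∈ Finset.range (N m), b k • cLp (eigData hL h𝒱 hφ (some j) k))
      (fun j => ∑ k ∈ Finset.range (N m), b k • cLp (eigData hL h𝒱 hφ (some j) k)) =
        (∑ k ∈ Finset.range (N m), lam k * ‖b k‖ ^ 2 : ℝ) := fun m =>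
    (formLp_sum_cLp_eigJet hL h𝒱 hφ _ b)
  simp only [h2] at h1
  set Q := formLp (aemeasurable_coef hL) (abs_coef_le hL) (fun j => w (some j))
    (fun j => w (some j)) with hQ
  have h3 : Tendsto (fun m => ∑ k ∈ Finset.range (N m), lam k * ‖b k‖ ^ 2) atTop (𝓝 Q.re) := by
    exact (Complex.continuous_re.tendsto _).comp h1
  have h4 : Tendsto (fun m => ∑ k ∈ Finset.range (N m), ENNReal.ofReal (lam k * ‖b k‖ ^ 2)) atTop
      (𝓝 (∑' k, ENNReal.ofReal (lam k * ‖b k‖ ^ 2))) :=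
    (ENNReal.tendsto_nat_tsum _).comp hN
  simp only [← ENNReal.ofReal_sum_of_nonneg fun k _ => h0 k] at h4
  have h5 := tendsto_nhds_unique h4 (ENNReal.tendsto_ofReal h3)
  have h6 : 0 ≤ Q.re := ge_of_tendsto' h3 fun m => Finset.sum_nonneg fun k _ => h0 k
  rw [h5, ENNReal.toReal_ofReal h6]
  refine ⟨ENNReal.ofReal_lt_top, ?_⟩
  have h7 := integrable_form (aemeasurable_coef hL) (abs_coef_le hL)
    (fun j => (EventuallyEq.rfl : w (some j) =ᵐ[mΩ Ω] w (some j)))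
    (fun j => (EventuallyEq.rfl : w (some j) =ᵐ[mΩ Ω] w (some j)))
  rw [hQ, formLp_eq_integral _ _ (fun j => EventuallyEq.rfl) (fun j => EventuallyEq.rfl),
    ← RCLike.re_eq_complex_re, ← integral_re h7]
  refine integral_congr_ae ?_
  filter_upwards [none_ae_eq_of_tendsto_sum hL h𝒱 hφ h] with x hx
  have h8 := sum_coef (R := ℂ) (a := a) (c := c) x (fun j => w (some j) x)
    (fun j => conj (w (some j) x))
  simp only [Complex.coe_algebraMap] at h8
  rw [h8, hx, RCLike.re_eq_complex_re, Complex.add_re, Complex.re_sum]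
  congr 1
  · refine Finset.sum_congr rfl fun i _ => ?_
    rw [Complex.re_sum]
    refine Finset.sum_congr rfl fun j _ => ?_
    rw [mul_assoc, Complex.re_ofReal_mul]
  · have h9 : ((SignType.sign (c x) : ℝ) : ℂ) * (((√|c x| : ℝ) : ℂ) * w none x) *
        conj (((√|c x| : ℝ) : ℂ) * w none x) = ((c x * ‖w none x‖ ^ 2 : ℝ) : ℂ) := by
      have h10 := congrArg (fun r : ℝ => (r : ℂ)) (sign_mul_sqrt_mul_sqrt (c x))
      simp only [Complex.ofReal_mul] at h10
      rw [Complex.ofReal_mul, Complex.ofReal_pow, ← Complex.conj_mul', map_mul,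
        Complex.conj_ofReal]
      linear_combination (conj (w none x) * w none x) * h10
    rw [h9, Complex.ofReal_re]

end

section

/-! ### Joint representatives and their slices -/

theorem tendsto_Lp_of_lintegral {X ι : Type*} [MeasurableSpace X] {μ : Measure X} {l : Filter ι}
    {f : ι → Lp ℂ 2 μ} {f₀ : Lp ℂ 2 μ}
    (h : Tendsto (fun m => ∫⁻ x, ‖f₀ x - f m x‖ₑ ^ 2 ∂μ) l (𝓝 0)) : Tendsto f l (𝓝 f₀) := by
  rw [tendsto_iff_edist_tendsto_0]
  have h1 : ∀ m, edist (f m) f₀ = (∫⁻ x, ‖f₀ x - f m x‖ₑ ^ 2 ∂μ) ^ (1 / 2 : ℝ) := fun m => by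
    have h2 : ∫⁻ x, ‖f₀ x - f m x‖ₑ ^ 2 ∂μ = ‖f₀ - f m‖ₑ ^ 2 := by
      rw [enorm_sq_eq_lintegral]
      refine lintegral_congr_ae ?_
      filter_upwards [Lp.coeFn_sub f₀ (f m)] with x hx
      rw [hx, Pi.sub_apply]
    rw [h2, edist_comm, edist_eq_enorm_sub, ← ENNReal.rpow_natCast, ← ENNReal.rpow_mul]
    norm_num
  simp only [h1]
  have h3 := (ENNReal.continuous_rpow_const (y := (1 / 2 : ℝ))).tendsto 0
  rw [ENNReal.zero_rpow_of_pos (by norm_num)] at h3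
  exact h3.comp h

variable {n : ℕ} {Ω : Opens (Sp n)} {a : Sp n → Matrix (Fin n) (Fin n) ℝ} {c : Sp n → ℝ} {Λ : ℝ}
  {𝒱 : Submodule ℝ (L2 Ω)} {lam : ℕ → ℝ} {φ : HilbertBasis ℕ ℝ (L2 Ω)}

/-- The properties of the slices of a function and of its first order data. -/
structure IsFormSlice (Ω : Opens (Sp n)) (a : Sp n → Matrix (Fin n) (Fin n) ℝ) (c : Sp n → ℝ)
    (φ : HilbertBasis ℕ ℝ (L2 Ω)) (lam : ℕ → ℝ) (w : Option (Option (Fin n)) → Sp n → ℂ) :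
    Prop where
  memLp : ∀ κ, MemLp (w κ) 2 (mΩ Ω)
  weak : ∀ i, HasWeakDeriv Ω (e i) (w none) (w (some (some i)))
  zero_order : w (some none) =ᵐ[mΩ Ω] fun x => ((√|c x| : ℝ) : ℂ) * w none x
  lt_top : (∑' k, ENNReal.ofReal (lam k * ‖∫ x, w none x * (φ k x : ℂ) ∂(mΩ Ω)‖ ^ 2)) < ⊤
  energy : ∫ x, ((∑ i, ∑ j, a x i j * (w (some (some i)) x * conj (w (some (some j)) x)).re) +
    c x * ‖w none x‖ ^ 2) ∂(mΩ Ω) =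
      (∑' k, ENNReal.ofReal (lam k * ‖∫ x, w none x * (φ k x : ℂ) ∂(mΩ Ω)‖ ^ 2)).toReal

theorem stronglyMeasurable_indicator_Ioi {𝒞 : ℝ → L2Cyl Ω} (h : ContinuousOn 𝒞 (Ioi 0)) :
    StronglyMeasurable ((Ioi 0).indicator 𝒞) := by
  have : Fact ((2 : ENNReal) ≠ ⊤) := ⟨by simp⟩
  borelize (L2Cyl Ω)
  refine Measurable.stronglyMeasurable ?_
  rw [← piecewise_eq_indicator]
  exact h.measurable_piecewise continuousOn_const measurableSet_Ioi

variable (hL : IsAdmissible Ω a c Λ) (h𝒱 : IsFormDomain Ω a c 𝒱) (hφ : IsEigenbasis Ω a c 𝒱 lam φ)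

/-- The errors are summed over `κ`, so a single subsequence makes the expansion converge in `L²(Ω)`
together with all its first order data. Every required property then passes to the limit along it.
-/
theorem isFormSlice_of_liminf {w : Option (Option (Fin n)) → Sp n → ℂ}
    (hw : ∀ κ, MemLp (w κ) 2 (mΩ Ω))
    (h : liminf (fun N => ∑ κ, ∫⁻ x, ‖w κ x - ∑ k ∈ Finset.range N,
      (∫ x, w none x * (φ k x : ℂ) ∂(mΩ Ω)) * (eigData hL h𝒱 hφ κ k x : ℂ)‖ₑ ^ 2 ∂(mΩ Ω))
        atTop = 0) : IsFormSlice Ω a c φ lam w := by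
  set b : ℕ → ℂ := fun k => ∫ x, w none x * (φ k x : ℂ) ∂(mΩ Ω) with hb
  obtain ⟨N, hN, hlt⟩ := extraction_forall_of_frequently (P := fun m N =>
    ∑ κ, ∫⁻ x, ‖w κ x - ∑ k ∈ Finset.range N, b k * (eigData hL h𝒱 hφ κ k x : ℂ)‖ₑ ^ 2 ∂(mΩ Ω) <
      ((m : ENNReal) + 1)⁻¹) fun m => frequently_lt_of_liminf_lt (by isBoundedDefault) (by
        rw [h]; exact ENNReal.inv_pos.2 (by finiteness))
  have ht : ∀ κ, Tendsto (fun m => ∑ k ∈ Finset.range (N m), b k • cLp (eigData hL h𝒱 hφ κ k))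
      atTop (𝓝 ((hw κ).toLp _)) := fun κ => by
    refine tendsto_Lp_of_lintegral (tendsto_of_tendsto_of_tendsto_of_le_of_le
      (h := fun m : ℕ => ((m : ENNReal) + 1)⁻¹) tendsto_const_nhds ?_ (fun _ => zero_le)
      fun m => ?_)
    · have h0 := ENNReal.tendsto_inv_nat_nhds_zero.comp (tendsto_add_atTop_nat 1)
      refine h0.congr fun m => ?_
      simp
    · refine le_trans (le_of_eq ?_) ((Finset.single_le_sum (f := fun κ => ∫⁻ x, ‖w κ x -
        ∑ k ∈ Finset.range (N m), b k * (eigData hL h𝒱 hφ κ k x : ℂ)‖ₑ ^ 2 ∂(mΩ Ω))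
        (fun _ _ => zero_le) (Finset.mem_univ κ)).trans (hlt m).le)
      refine lintegral_congr_ae ?_
      filter_upwards [(hw κ).coeFn_toLp, Lp.coeFn_fun_finsetSum (Finset.range (N m))
        fun k => b k • cLp (eigData hL h𝒱 hφ κ k),
        ae_all_iff.2 fun k => Lp.coeFn_smul (b k) (cLp (eigData hL h𝒱 hφ κ k)),
        ae_all_iff.2 fun k => coeFn_cLp (eigData hL h𝒱 hφ κ k)] with x h1 h2 h3 h4
      rw [h1, h2]
      congr 3
      refine Finset.sum_congr rfl fun k _ => ?_
      rw [h3, Pi.smul_apply, h4, smul_eq_mul]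
  have e : ∀ κ, (hw κ).toLp _ =ᵐ[mΩ Ω] w κ := fun κ => (hw κ).coeFn_toLp
  have h5 := tsum_eq_of_tendsto_sum (w := fun κ => (hw κ).toLp _) hL h𝒱 hφ hN.tendsto_atTop ht
  refine ⟨hw, fun i => ?_, ?_, h5.1, ?_⟩
  · have h1 := hasWeakDeriv_of_tendsto_sum (w := fun κ => (hw κ).toLp _) hL h𝒱 hφ ht i
    exact (h1.congr_left (e _) (locallyIntegrableOn_of_memLp (hw _))).congr_right (e _)
      (locallyIntegrableOn_of_memLp (hw _))
  · filter_upwards [none_ae_eq_of_tendsto_sum (w := fun κ => (hw κ).toLp _) hL h𝒱 hφ ht, e none,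
      e (some none)] with x h1 h2 h3
    rw [← h3, h1, h2]
  · rw [← h5.2]
    refine integral_congr_ae ?_
    filter_upwards [e none, ae_all_iff.2 fun i => e (some (some i))] with x h1 h2
    simp only [h1, h2]

/-- A function in the form domain, and its first order data. -/
def dataCyl (u : L2Cyl Ω) : Option (Option (Fin n)) → L2Cyl Ω
  | none => u
  | some j => jetCyl hL h𝒱 hφ j u

theorem hasSum_dataCyl {u : L2Cyl Ω} (hu : InFormDom φ lam u) (κ : Option (Option (Fin n))) :
    HasSum (fun k => tensorLp (eigData hL h𝒱 hφ κ k) (compLp (φ k) u)) (dataCyl hL h𝒱 hφ u κ) := by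
  cases κ with
  | none => exact hasSum_tensorLp_compLp φ u
  | some j => exact hasSum_jetCyl hL h𝒱 hφ j hu

theorem exists_representative_of_continuousOn {𝒞 : ℝ → L2Cyl Ω} (h : ContinuousOn 𝒞 (Ioi 0)) :
    ∃ U : ℝ × Sp n × ℝ → ℂ, Measurable U ∧
      ∀ y, 0 < y → (fun p => U (p.1, p.2, y)) =ᵐ[mCyl Ω] 𝒞 y := by
  obtain ⟨U, hU, h1⟩ := exists_joint_representative (stronglyMeasurable_indicator_Ioi h)
  refine ⟨U, hU, fun y hy => (h1 y).trans ?_⟩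
  rw [indicator_of_mem (mem_Ioi.2 hy)]

/-- The partial sums are continuous in `y`, and the data are their limits for each `y`. This gives
strong measurability in `y`, which suffices for a joint representative; continuity of the data is
not needed. -/
theorem exists_dataCyl_representative {𝒰 : ℝ → L2Cyl Ω} (h𝒰 : ContinuousOn 𝒰 (Ioi 0))
    (hform : ∀ y, 0 < y → InFormDom φ lam (𝒰 y)) :
    ∃ W : Option (Option (Fin n)) → ℝ × Sp n × ℝ → ℂ, (∀ κ, Measurable (W κ)) ∧
      ∀ κ y, 0 < y → (fun p => W κ (p.1, p.2, y)) =ᵐ[mCyl Ω] dataCyl hL h𝒱 hφ (𝒰 y) κ := by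
  have hm : ∀ κ, StronglyMeasurable ((Ioi 0).indicator fun y => dataCyl hL h𝒱 hφ (𝒰 y) κ) :=
    fun κ => by
      refine stronglyMeasurable_of_tendsto atTop (f := fun N => (Ioi 0).indicator
        fun y => ∑ k ∈ Finset.range N,
          tensorLp (eigData hL h𝒱 hφ κ k) (compLp (φ k) (𝒰 y))) (fun N => ?_) ?_
      · refine stronglyMeasurable_indicator_Ioi (continuousOn_finsetSum _ fun k _ => ?_)
        exact ((tensorLp (eigData hL h𝒱 hφ κ k)).continuous.comp
          (compLp (φ k)).continuous).comp_continuousOn h𝒰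
      · refine tendsto_pi_nhds.2 fun y => ?_
        by_cases hy : y ∈ Ioi (0 : ℝ)
        · simp only [indicator_of_mem hy]
          exact (hasSum_dataCyl hL h𝒱 hφ (hform y hy) κ).tendsto_sum_nat
        · simp only [indicator_of_notMem hy]
          exact tendsto_const_nhds
  choose W hW h1 using fun κ => exists_joint_representative (hm κ)
  refine ⟨W, hW, fun κ y hy => (h1 κ y).trans ?_⟩
  rw [indicator_of_mem (mem_Ioi.2 hy)]

theorem ae_component_eq {u : L2Cyl Ω} {w : ℝ × Sp n → ℂ} (hw : w =ᵐ[mCyl Ω] u) (k : ℕ) :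
    ∀ᵐ t, ∫ x, w (t, x) * (φ k x : ℂ) ∂(mΩ Ω) = compLp (φ k) u t := by
  filter_upwards [coeFn_compLp (φ k) u, Measure.ae_ae_of_ae_prod hw] with t h1 h2
  rw [h1]
  refine integral_congr_ae ?_
  filter_upwards [h2] with x hx
  rw [hx]

/-- Convergence in `L²(ℝ × Ω)` need not give convergence on almost every slice, but by Fatou's lemma
the lower limit of the slice errors vanishes for almost every `t`. The resulting subsequence may
depend on `t`, which is harmless. -/
theorem ae_liminf_eq_zero {u : L2Cyl Ω} (hu : InFormDom φ lam u)
    {w : Option (Option (Fin n)) → ℝ × Sp n → ℂ} (hm : ∀ κ, Measurable (w κ))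
    (hw : ∀ κ, w κ =ᵐ[mCyl Ω] dataCyl hL h𝒱 hφ u κ) :
    ∀ᵐ t, liminf (fun N => ∑ κ, ∫⁻ x, ‖w κ (t, x) - ∑ k ∈ Finset.range N,
      (∫ x, w none (t, x) * (φ k x : ℂ) ∂(mΩ Ω)) * (eigData hL h𝒱 hφ κ k x : ℂ)‖ₑ ^ 2 ∂(mΩ Ω))
        atTop = 0 := by
  have hbm : ∀ k, Measurable fun t => ∫ x, w none (t, x) * (φ k x : ℂ) ∂(mΩ Ω) := fun k => by
    refine (StronglyMeasurable.integral_prod_right' (f := fun p : ℝ × Sp n =>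
      w none p * (φ k p.2 : ℂ)) ?_).measurable
    exact ((hm none).mul (Complex.measurable_ofReal.comp
      ((Lp.stronglyMeasurable (φ k)).measurable.comp measurable_snd))).stronglyMeasurable
  have hEm : ∀ N κ, Measurable fun p : ℝ × Sp n => ‖w κ p - ∑ k ∈ Finset.range N,
      (∫ x, w none (p.1, x) * (φ k x : ℂ) ∂(mΩ Ω)) * (eigData hL h𝒱 hφ κ k p.2 : ℂ)‖ₑ ^ 2 :=
    fun N κ => by
      refine ((hm κ).sub (Finset.measurable_fun_sum _ fun k _ => ?_)).enorm.pow_const 2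
      exact ((hbm k).comp measurable_fst).mul (Complex.measurable_ofReal.comp
        ((Lp.stronglyMeasurable _).measurable.comp measurable_snd))
  have hEm' : ∀ N, Measurable fun t => ∑ κ, ∫⁻ x, ‖w κ (t, x) - ∑ k ∈ Finset.range N,
      (∫ x, w none (t, x) * (φ k x : ℂ) ∂(mΩ Ω)) * (eigData hL h𝒱 hφ κ k x : ℂ)‖ₑ ^ 2 ∂(mΩ Ω) :=
    fun N => Finset.measurable_fun_sum _ fun κ _ => (hEm N κ).lintegral_prod_right'
  have hval : ∀ N, ∫⁻ t, (∑ κ, ∫⁻ x, ‖w κ (t, x) - ∑ k ∈ Finset.range N,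
      (∫ x, w none (t, x) * (φ k x : ℂ) ∂(mΩ Ω)) * (eigData hL h𝒱 hφ κ k x : ℂ)‖ₑ ^ 2 ∂(mΩ Ω)) =
      ∑ κ, ‖dataCyl hL h𝒱 hφ u κ - ∑ k ∈ Finset.range N,
        tensorLp (eigData hL h𝒱 hφ κ k) (compLp (φ k) u)‖ₑ ^ 2 := fun N => by
    rw [lintegral_finsetSum _ fun κ _ => (hEm N κ).lintegral_prod_right']
    refine Finset.sum_congr rfl fun κ _ => ?_
    rw [← lintegral_prod _ (hEm N κ).aemeasurable, enorm_sq_eq_lintegral]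
    have h0 : ∀ᵐ p : ℝ × Sp n ∂(mCyl Ω), ∀ k,
        ∫ x, w none (p.1, x) * (φ k x : ℂ) ∂(mΩ Ω) = compLp (φ k) u p.1 :=
      Measure.quasiMeasurePreserving_fst.ae (ae_all_iff.2 fun k => ae_component_eq (hw none) k)
    refine lintegral_congr_ae ?_
    filter_upwards [hw κ, h0, Lp.coeFn_sub (dataCyl hL h𝒱 hφ u κ) (∑ k ∈ Finset.range N,
        tensorLp (eigData hL h𝒱 hφ κ k) (compLp (φ k) u)),
      Lp.coeFn_fun_finsetSum (Finset.range N)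
        fun k => tensorLp (eigData hL h𝒱 hφ κ k) (compLp (φ k) u),
      ae_all_iff.2 fun k => coeFn_tensorLp (eigData hL h𝒱 hφ κ k) (compLp (φ k) u)]
      with p h1 h2 h3 h4 h5
    rw [h3, Pi.sub_apply, h4, h1]
    simp only [h2, h5]
  have hlim : Tendsto (fun N => ∑ κ, ‖dataCyl hL h𝒱 hφ u κ - ∑ k ∈ Finset.range N,
        tensorLp (eigData hL h𝒱 hφ κ k) (compLp (φ k) u)‖ₑ ^ 2) atTop (𝓝 0) := by
    have h0 : (0 : ENNReal) = ∑ _κ : Option (Option (Fin n)), 0 := by simp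
    rw [h0]
    refine tendsto_finsetSum _ fun κ _ => ?_
    have h1 := (hasSum_dataCyl hL h𝒱 hφ hu κ).tendsto_sum_nat
    have h2 := ((tendsto_const_nhds (x := dataCyl hL h𝒱 hφ u κ)).sub h1).enorm
    rw [sub_self, enorm_zero] at h2
    simpa using ENNReal.Tendsto.pow (n := 2) h2
  have h3 := lintegral_liminf_le (μ := (volume : Measure ℝ)) (u := atTop) hEm'
  simp only [hval, hlim.liminf_eq] at h3
  exact (lintegral_eq_zero_iff (Measurable.liminf hEm')).1 (le_antisymm h3 zero_le)

/-- The information holds for each `y` and almost every `t`, and is needed for almost every `t` and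
almost every `y`. Exchanging the quantifiers requires a measurable set of pairs. For this reason the
exchange is made for the condition `P`, built from integrals of jointly measurable functions, and
`IsFormSlice` is deduced afterwards. -/
theorem ae_ae_isFormSlice {s : ℝ} {𝒰 : ℝ → L2Cyl Ω} (hform : ∀ y, 0 < y → InFormDom φ lam (𝒰 y))
    {W : Option (Option (Fin n)) → ℝ × Sp n × ℝ → ℂ} (hm : ∀ κ, Measurable (W κ))
    (hW : ∀ κ y, 0 < y → (fun p : ℝ × Sp n => W κ (p.1, p.2, y)) =ᵐ[mCyl Ω] dataCyl hL h𝒱 hφ (𝒰 y) κ) :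
    ∀ᵐ t, ∀ᵐ y ∂(wMeas s), IsFormSlice Ω a c φ lam fun κ x => W κ (t, x, y) := by
  set P : ℝ → ℝ → Prop := fun t y => (∀ κ, ∫⁻ x, ‖W κ (t, x, y)‖ₑ ^ 2 ∂(mΩ Ω) < ⊤) ∧
    liminf (fun N => ∑ κ, ∫⁻ x, ‖W κ (t, x, y) - ∑ k ∈ Finset.range N,
      (∫ x, W none (t, x, y) * (φ k x : ℂ) ∂(mΩ Ω)) * (eigData hL h𝒱 hφ κ k x : ℂ)‖ₑ ^ 2 ∂(mΩ Ω))
        atTop = 0 with hP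
  have hW2 : ∀ κ, Measurable fun z : (ℝ × ℝ) × Sp n => W κ (z.1.1, z.2, z.1.2) := fun κ =>
    (hm κ).comp (by fun_prop)
  have hbm : ∀ k, Measurable fun z : ℝ × ℝ =>
      ∫ x, W none (z.1, x, z.2) * (φ k x : ℂ) ∂(mΩ Ω) := fun k => by
    refine (StronglyMeasurable.integral_prod_right' (f := fun z : (ℝ × ℝ) × Sp n =>
      W none (z.1.1, z.2, z.1.2) * (φ k z.2 : ℂ)) ?_).measurable
    exact ((hW2 none).mul (Complex.measurable_ofReal.comp
      ((Lp.stronglyMeasurable (φ k)).measurable.comp measurable_snd))).stronglyMeasurable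
  have hPm : MeasurableSet {z : ℝ × ℝ | P z.1 z.2} := by
    refine MeasurableSet.inter ?_ ?_
    · refine MeasurableSet.congr (MeasurableSet.iInter fun κ => measurableSet_lt
        (Measurable.lintegral_prod_right' (ν := mΩ Ω) ((hW2 κ).enorm.pow_const 2))
          (measurable_const (a := (⊤ : ENNReal)))) ?_
      ext z
      rw [mem_iInter]
      rfl
    · refine measurableSet_eq_fun (Measurable.liminf fun N => Finset.measurable_fun_sum _
        fun κ _ => ?_) measurable_const
      refine Measurable.lintegral_prod_right' (f := fun z : (ℝ × ℝ) × Sp n =>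
        ‖W κ (z.1.1, z.2, z.1.2) - ∑ k ∈ Finset.range N,
          (∫ x, W none (z.1.1, x, z.1.2) * (φ k x : ℂ) ∂(mΩ Ω)) *
            (eigData hL h𝒱 hφ κ k z.2 : ℂ)‖ₑ ^ 2) ?_
      refine ((hW2 κ).sub (Finset.measurable_fun_sum _ fun k _ => ?_)).enorm.pow_const 2
      exact ((hbm k).comp measurable_fst).mul (Complex.measurable_ofReal.comp
        ((Lp.stronglyMeasurable _).measurable.comp measurable_snd))
  have h1 : ∀ᵐ y ∂(wMeas s), ∀ᵐ t, P t y := by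
    refine ae_wMeas_of_forall fun y hy => ?_
    have hmy : ∀ κ, Measurable fun p : ℝ × Sp n => W κ (p.1, p.2, y) := fun κ =>
      (hm κ).comp (by fun_prop)
    have h2 : ∀ κ, ∀ᵐ t, MemLp (fun x => W κ (t, x, y)) 2 (mΩ Ω) := fun κ =>
      memLp_two_prod_right ((memLp_congr_ae (hW κ y hy)).2 (Lp.memLp _))
    filter_upwards [ae_all_iff.2 h2, ae_liminf_eq_zero hL h𝒱 hφ (hform y hy) hmy fun κ => hW κ y hy]
      with t h3 h4
    exact ⟨fun κ => (memLp_two_iff_lintegral.1 (h3 κ)).2, h4⟩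
  filter_upwards [(Measure.ae_ae_comm hPm).2 h1] with t ht
  filter_upwards [ht] with y hy
  exact isFormSlice_of_liminf hL h𝒱 hφ (fun κ => memLp_two_iff_lintegral.2
    ⟨((hm κ).comp (by fun_prop : Measurable fun x : Sp n => (t, x, y))).aestronglyMeasurable,
      hy.1 κ⟩) hy.2

end

section

/-! ### Weak derivatives in `D` from slices -/

variable {n : ℕ} {Ω : Opens (Sp n)}

theorem hasWeakDeriv_halfCyl_of_slices {s : ℝ} {w g : Sp n × ℝ → ℂ} (hw : MemLp w 2 (mD Ω s))
    (hg : MemLp g 2 (mD Ω s)) {i : Fin n} (h : ∀ᵐ y ∂(wMeas s),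
      HasWeakDeriv Ω (e i) (fun x => w (x, y)) (fun x => g (x, y))) :
    HasWeakDeriv (halfCyl Ω) (e i, 0) w g := by
  have hwl := locallyIntegrableOn_halfCyl hw
  have hgl := locallyIntegrableOn_halfCyl hg
  refine ⟨hwl, hgl, fun ψ => ?_⟩
  have i1 := integrableOn_test_smul hwl (dirDeriv ψ (e i, 0))
  have i2 := integrableOn_test_smul hgl ψ
  rw [IntegrableOn, restrict_halfCyl] at i1 i2
  simp only [dirDeriv_apply] at i1
  rw [restrict_halfCyl, integral_prod_symm _ i1, integral_prod_symm _ i2, ← integral_neg]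
  refine integral_congr_ae ?_
  filter_upwards [ae_wMeas_iff.1 h] with y hy
  have h1 := hy.2.2 (sliceH ψ y)
  simpa only [fderiv_sliceH, sliceH_apply] using h1

/-- The lower end is taken among the countably many points `1/(m+1)`, so that the null sets excluded
when `w` is written as a primitive from those points can be united. -/
theorem exists_support_bounds (ψ : 𝓓(halfCyl Ω, ℝ)) :
    ∃ (m : ℕ) (β : ℝ), 1 / ((m : ℝ) + 1) ≤ β ∧
      ∀ q : Sp n × ℝ, q.2 ≤ 1 / ((m : ℝ) + 1) ∨ β ≤ q.2 → ψ q = 0 := by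
  set K : Set ℝ := Prod.snd '' tsupport ψ with hK
  have hKc : IsCompact K := ψ.hasCompactSupport.isCompact.image continuous_snd
  have hpos : ∀ y ∈ K, 0 < y := by
    rintro _ ⟨q, hq, rfl⟩
    exact (ψ.tsupport_subset hq).2
  obtain ⟨ε, hε, hball⟩ := Metric.isOpen_iff.1 hKc.isClosed.isOpen_compl 0
    fun h => (hpos 0 h).false
  obtain ⟨B, hB⟩ := hKc.bddAbove
  obtain ⟨m, hm⟩ := exists_nat_one_div_lt hε
  have hm0 : 0 < 1 / ((m : ℝ) + 1) := Nat.one_div_pos_of_nat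
  refine ⟨m, max (1 / ((m : ℝ) + 1)) (B + 1), le_max_left _ _, fun q hq => ?_⟩
  by_contra h0
  have hqK : q.2 ∈ K := ⟨q, subset_tsupport _ h0, rfl⟩
  have h1 := hpos _ hqK
  rcases hq with hq | hq
  · refine hball (a := q.2) ?_ hqK
    rw [Metric.mem_ball, dist_zero_right, Real.norm_eq_abs, abs_of_pos h1]
    exact hq.trans_lt hm
  · have := hB hqK
    have := (le_max_right (1 / ((m : ℝ) + 1)) (B + 1)).trans hq
    linarith

/-- For almost every `x` the function `w(x, ·)` is a primitive of `g(x, ·)` started from a base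
point below the support of `ψ(x, ·)`, and a one-dimensional integration by parts applies. Since the
base points are countable, the exceptional set of `x` does not depend on `ψ`. -/
theorem hasWeakDeriv_halfCyl_of_primitive {s : ℝ} {w g : Sp n × ℝ → ℂ} (hw : MemLp w 2 (mD Ω s))
    (hg : MemLp g 2 (mD Ω s)) (h : ∀ᵐ x ∂(mΩ Ω), ∀ m : ℕ,
      ∀ᵐ y ∂(volume.restrict (Ioi (0 : ℝ))), 1 / ((m : ℝ) + 1) ≤ y →
        w (x, y) = w (x, 1 / ((m : ℝ) + 1)) + ∫ η in (1 / ((m : ℝ) + 1))..y, g (x, η)) :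
    HasWeakDeriv (halfCyl Ω) (0, 1) w g := by
  have hwl := locallyIntegrableOn_halfCyl hw
  have hgl := locallyIntegrableOn_halfCyl hg
  refine ⟨hwl, hgl, fun ψ => ?_⟩
  have i1 := integrableOn_test_smul hwl (dirDeriv ψ (0, 1))
  have i2 := integrableOn_test_smul hgl ψ
  rw [IntegrableOn, restrict_halfCyl] at i1 i2
  simp only [dirDeriv_apply] at i1
  rw [restrict_halfCyl, integral_prod _ i1, integral_prod _ i2, ← integral_neg]
  refine integral_congr_ae ?_
  obtain ⟨m, β, hαβ, h0⟩ := exists_support_bounds ψ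
  set α := 1 / ((m : ℝ) + 1) with hα
  have hα0 : 0 < α := Nat.one_div_pos_of_nat
  filter_upwards [h, memLp_two_prod_right hg] with x hx hgx
  have hχ : ContDiff ℝ ∞ fun y : ℝ => ψ (x, y) :=
    ψ.contDiff.comp (contDiff_const.prodMk contDiff_id)
  have hd : ∀ y, deriv (fun y : ℝ => ψ (x, y)) y = fderiv ℝ ψ (x, y) (0, 1) := fun y => by
    have h1 : HasFDerivAt ψ (fderiv ℝ ψ (x, y)) (x, y) :=
      (ψ.contDiff.differentiable (by simp) (x, y)).hasFDerivAt
    exact (h1.comp_hasDerivAt y ((hasDerivAt_const y x).prodMk (hasDerivAt_id y))).deriv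
  have hY : IntervalIntegrable (fun η => g (x, η)) volume α β :=
    (intervalIntegrable_iff_integrableOn_Icc_of_le hαβ).2 (integrableOn_Icc_of_memLp hgx hα0)
  have key := integral_deriv_smul_primitive (hχ.of_le (by norm_num)) hY
    (h0 (x, α) (Or.inl le_rfl)) (h0 (x, β) (Or.inr le_rfl)) (w (x, α))
  have hd0 : ∀ y, y ∉ Ioc α β → deriv (fun y : ℝ => ψ (x, y)) y = 0 := fun y hy => by
    rw [mem_Ioc, not_and_or, not_lt, not_le] at hy
    rcases hy with hy | hy
    -- At `y = α` it is known only on the left that `ψ(x, ·)` vanishes, so its derivative there is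
    -- computed as a limit from the left.
    · have h2 : Tendsto (deriv fun y : ℝ => ψ (x, y)) (𝓝[<] y)
          (𝓝 (deriv (fun y : ℝ => ψ (x, y)) y)) :=
        ((hχ.continuous_deriv (by simp)).tendsto y).mono_left nhdsWithin_le_nhds
      refine tendsto_nhds_unique h2 (tendsto_const_nhds.congr' ?_)
      filter_upwards [self_mem_nhdsWithin] with z hz
      refine ((EventuallyEq.deriv_eq (f := fun _ => (0 : ℝ)) ?_).trans (deriv_const _ _)).symm
      filter_upwards [Iio_mem_nhds hz] with z' hz'
      exact h0 (x, z') (Or.inl ((mem_Iio.1 hz').le.trans hy))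
    · refine EventuallyEq.deriv_eq (f := fun _ => (0 : ℝ)) ?_ |>.trans (deriv_const _ _)
      filter_upwards [Ioi_mem_nhds hy] with z hz
      exact h0 (x, z) (Or.inr (le_of_lt hz))
  have hsub : Ioc α β ⊆ Ioi 0 := fun y hy => hα0.trans hy.1
  have e1 : ∫ y in Ioi (0 : ℝ), (fderiv ℝ ψ (x, y) (0, 1)) • w (x, y) =
      ∫ y in α..β, deriv (fun y : ℝ => ψ (x, y)) y • (w (x, α) + ∫ η in α..y, g (x, η)) := by
    rw [intervalIntegral.integral_of_le hαβ, ← setIntegral_eq_of_subset_of_forall_sdiff_eq_zero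
      measurableSet_Ioi hsub fun y hy => by rw [hd0 y hy.2, zero_smul]]
    refine integral_congr_ae ?_
    filter_upwards [hx m] with y hy
    rw [hd]
    rcases le_or_gt α y with h1 | h1
    · rw [hy h1]
    · rw [← hd, hd0 y fun h2 => (h1.trans h2.1).false, zero_smul, zero_smul]
  have e2 : ∫ y in Ioi (0 : ℝ), ψ (x, y) • g (x, y) = ∫ y in α..β, ψ (x, y) • g (x, y) := by
    rw [intervalIntegral.integral_of_le hαβ, setIntegral_eq_of_subset_of_forall_sdiff_eq_zero
      measurableSet_Ioi hsub fun y hy => ?_]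
    have h3 : y ∉ Ioc α β := hy.2
    rw [mem_Ioc, not_and_or, not_lt, not_le] at h3
    rw [h0 (x, y) (h3.imp_right le_of_lt), zero_smul]
  rw [e1, e2, key]

/-- A `C¹` curve in `L²(ℝ × Ω)` is pointwise the primitive of its derivative. -/
theorem ae_eq_add_primitive {𝒰 𝒰' : ℝ → L2Cyl Ω}
    (hd : ∀ y, 0 < y → HasDerivAt 𝒰 (𝒰' y) y) (hc : ContinuousOn 𝒰' (Ioi 0))
    {U Y : ℝ × Sp n × ℝ → ℂ} (hUm : Measurable U) (hYm : Measurable Y)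
    (hU : ∀ y, 0 < y → (fun p : ℝ × Sp n => U (p.1, p.2, y)) =ᵐ[mCyl Ω] 𝒰 y)
    (hY : ∀ y, 0 < y → (fun p : ℝ × Sp n => Y (p.1, p.2, y)) =ᵐ[mCyl Ω] 𝒰' y) {α : ℝ}
    (hα : 0 < α) : ∀ᵐ p ∂(mCyl Ω), ∀ᵐ y ∂(volume.restrict (Ioi (0 : ℝ))), α ≤ y →
      U (p.1, p.2, y) = U (p.1, p.2, α) + ∫ η in α..y, Y (p.1, p.2, η) := by
  -- The primitive is written with an indicator over the whole line, so that it is jointly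
  -- measurable in `(p, y)`. The exchange of "almost every `y`" and "almost every `p`" at the end
  -- depends on this.
  set I : (ℝ × Sp n) → ℝ → ℂ := fun p y =>
    ∫ η, (Ioc α y).indicator (fun η => Y (p.1, p.2, η)) η with hI
  have hIm : Measurable fun z : (ℝ × Sp n) × ℝ => I z.1 z.2 := by
    have h1 : Measurable fun z : ((ℝ × Sp n) × ℝ) × ℝ =>
        (Ioc α z.1.2).indicator (fun η => Y (z.1.1.1, z.1.1.2, η)) z.2 := by
      have h2 : MeasurableSet {z : ((ℝ × Sp n) × ℝ) × ℝ | α < z.2 ∧ z.2 ≤ z.1.2} :=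
        (measurableSet_lt measurable_const measurable_snd).inter
          (measurableSet_le measurable_snd (measurable_snd.comp measurable_fst))
      exact (hYm.comp (by fun_prop : Measurable fun z : ((ℝ × Sp n) × ℝ) × ℝ =>
        (z.1.1.1, z.1.1.2, z.2))).indicator h2
    exact (h1.stronglyMeasurable.integral_prod_right' (ν := (volume : Measure ℝ))).measurable
  have hI2 : ∀ p y, α ≤ y → I p y = ∫ η in α..y, Y (p.1, p.2, η) := fun p y hy => by
    rw [intervalIntegral.integral_of_le hy, ← integral_indicator measurableSet_Ioc]
  have hPm : MeasurableSet {z : (ℝ × Sp n) × ℝ | α ≤ z.2 →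
      U (z.1.1, z.1.2, z.2) = U (z.1.1, z.1.2, α) + I z.1 z.2} := by
    have h1 : MeasurableSet {z : (ℝ × Sp n) × ℝ |
        U (z.1.1, z.1.2, z.2) = U (z.1.1, z.1.2, α) + I z.1 z.2} :=
      measurableSet_eq_fun (hUm.comp (by fun_prop)) ((hUm.comp (by fun_prop)).add hIm)
    have h2 : MeasurableSet {z : (ℝ × Sp n) × ℝ | α ≤ z.2} :=
      measurableSet_le measurable_const measurable_snd
    exact (h2.compl.union h1).congr (by ext z; simp [imp_iff_not_or])
  have key : ∀ᵐ y ∂(volume.restrict (Ioi (0 : ℝ))), ∀ᵐ p ∂(mCyl Ω), α ≤ y →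
      U (p.1, p.2, y) = U (p.1, p.2, α) + I p y := by
    refine ae_of_all _ fun y => ?_
    rcases lt_or_ge y α with hy | hy
    · exact ae_of_all _ fun p h => absurd h (not_le.2 hy)
    have hsub : uIcc α y ⊆ Ioi 0 := fun z hz => by
      rw [uIcc_of_le hy] at hz
      exact hα.trans_le hz.1
    have hint : IntervalIntegrable 𝒰' volume α y := (hc.mono hsub).intervalIntegrable
    have h1 := intervalIntegral.integral_eq_sub_of_hasDerivAt
      (fun z hz => hd z (hsub hz)) hint
    rw [intervalIntegral.integral_of_le hy] at h1
    have h2 := coeFn_integral_eq ((intervalIntegrable_iff_integrableOn_Ioc_of_le hy).1 hint)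
      (φ := fun z : (ℝ × Sp n) × ℝ => Y (z.1.1, z.1.2, z.2))
      (hYm.comp (by fun_prop)).aestronglyMeasurable (by
        filter_upwards [ae_restrict_mem measurableSet_Ioc] with z hz
        exact hY z (hα.trans hz.1))
    rw [h1] at h2
    filter_upwards [h2, hU y (hα.trans_le hy), hU α hα, Lp.coeFn_sub (𝒰 y) (𝒰 α)]
      with p e1 e2 e3 e4 _
    rw [hI2 p y hy, intervalIntegral.integral_of_le hy, ← e1, e4, Pi.sub_apply, ← e2, ← e3]
    ring
  filter_upwards [(Measure.ae_ae_comm hPm).2 key] with p hp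
  filter_upwards [hp] with y hy h1
  rw [hy h1, hI2 p y h1]

end

section

/-! ### Membership in `L²(ℝ; H¹_{L,y}(D))` -/

variable {n : ℕ} {Ω : Opens (Sp n)} {a : Sp n → Matrix (Fin n) (Fin n) ℝ} {c : Sp n → ℝ} {Λ : ℝ}
  {𝒱 : Submodule ℝ (L2 Ω)} {lam : ℕ → ℝ} {φ : HilbertBasis ℕ ℝ (L2 Ω)} {s : ℝ}

theorem measurable_component {β : Type*} [MeasurableSpace β] {w : Sp n × β → ℂ}
    (hw : Measurable w) (k : ℕ) :
    Measurable fun b => ∫ x, w (x, b) * (φ k x : ℂ) ∂(mΩ Ω) := by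
  refine (StronglyMeasurable.integral_prod_left' (f := fun q : Sp n × β =>
    w q * (φ k q.1 : ℂ)) ?_).measurable
  exact (hw.mul (Complex.measurable_ofReal.comp
    ((Lp.stronglyMeasurable (φ k)).measurable.comp measurable_fst))).stronglyMeasurable

theorem measurable_spectral {β : Type*} [MeasurableSpace β] {w : Sp n × β → ℂ}
    (hw : Measurable w) : Measurable fun b =>
      ∑' k, ENNReal.ofReal (lam k * ‖∫ x, w (x, b) * (φ k x : ℂ) ∂(mΩ Ω)‖ ^ 2) :=
  Measurable.tsum fun k => (((measurable_component hw k).norm.pow_const 2).const_mul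
    (lam k)).ennreal_ofReal

theorem sq_norm_sqrt_mul (r : ℝ) (z : ℂ) : ‖((√|r| : ℝ) : ℂ) * z‖ ^ 2 = |r| * ‖z‖ ^ 2 := by
  rw [norm_mul, Complex.norm_real, Real.norm_eq_abs, abs_of_nonneg (Real.sqrt_nonneg _), mul_pow,
    Real.sq_sqrt (abs_nonneg r)]

theorem memH1_of_slices (hL : IsAdmissible Ω a c Λ)
    {w : Option (Option (Fin n)) → Sp n × ℝ → ℂ} {h : Sp n × ℝ → ℂ}
    (hm : ∀ κ, Measurable (w κ)) (hw : ∀ κ, MemLp (w κ) 2 (mD Ω s)) (hh : MemLp h 2 (mD Ω s))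
    (hy : HasWeakDeriv (halfCyl Ω) (0, 1) (w none) h)
    (hs : ∀ᵐ y ∂(wMeas s), IsFormSlice Ω a c φ lam fun κ x => w κ (x, y))
    (hS : spectralEnergy φ lam s (w none) < ⊤) :
    MemH1 Ω a c φ lam s (w none) (fun i => w (some (some i))) h := by
  have hc : Integrable (fun q : Sp n × ℝ => |c q.1| * ‖w none q‖ ^ 2) (mD Ω s) := by
    have hcm : AEMeasurable (fun q : Sp n × ℝ => |c q.1|) (mD Ω s) :=
      (hL.meas_c.comp_fst).norm
    have hm1 : AEMeasurable (fun q : Sp n × ℝ => |c q.1| * ‖w none q‖ ^ 2) (mD Ω s) :=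
      hcm.mul ((hm none).norm.pow_const 2).aemeasurable
    refine ⟨hm1.aestronglyMeasurable, ?_⟩
    have h1 := (memLp_two_iff_lintegral.1 (hw (some none))).2
    rw [lintegral_prod_symm _ ((hm (some none)).enorm.pow_const 2).aemeasurable] at h1
    rw [HasFiniteIntegral, lintegral_prod_symm _ hm1.enorm]
    refine lt_of_le_of_lt (lintegral_mono_ae ?_) h1
    filter_upwards [hs] with y hy
    refine lintegral_mono_ae ?_
    filter_upwards [hy.zero_order] with x hx
    rw [hx, ← ofReal_norm (((√|c x| : ℝ) : ℂ) * w none (x, y)), ← ENNReal.ofReal_pow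
      (norm_nonneg _), sq_norm_sqrt_mul, ← ofReal_norm, Real.norm_of_nonneg (by positivity)]
  have hai : Integrable (fun q : Sp n × ℝ => ∑ i, ∑ j,
      a q.1 i j * (w (some (some i)) q * conj (w (some (some j)) q)).re) (mD Ω s) := by
    refine integrable_finsetSum _ fun i _ => integrable_finsetSum _ fun j _ => ?_
    refine Integrable.bdd_mul (c := Λ + 1)
      (RCLike.reCLM.integrable_comp (integrable_mul_conj (hw (some (some i))) (hw (some (some j)))))
      ((hL.meas_a i j).comp_fst).aestronglyMeasurable ?_
    filter_upwards [Measure.quasiMeasurePreserving_fst.ae (abs_coef_le hL)] with q hq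
    exact hq (some i) (some j)
  have hci : Integrable (fun q : Sp n × ℝ => c q.1 * ‖w none q‖ ^ 2) (mD Ω s) := by
    refine hc.mono' ?_ (ae_of_all _ fun q => ?_)
    · exact (hL.meas_c.comp_fst.mul ((hm none).norm.pow_const 2).aemeasurable).aestronglyMeasurable
    · rw [norm_mul, Real.norm_eq_abs, norm_pow, norm_norm]
  refine ⟨hw _, fun i => hasWeakDeriv_halfCyl_of_slices (hw _) (hw _) ?_, hy, fun i => hw _, hh, hc,
    hS, ?_⟩
  · filter_upwards [hs] with y h1 using h1.weak i
  · refine (integral_prod_symm _ (hai.add hci)).trans ?_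
    have h2 : ∫ y, (∑' k, ENNReal.ofReal
        (lam k * ‖∫ x, w none (x, y) * (φ k x : ℂ) ∂(mΩ Ω)‖ ^ 2)).toReal ∂(wMeas s) =
        (spectralEnergy φ lam s (w none)).toReal :=
      integral_toReal (measurable_spectral (hm none)).aemeasurable (hs.mono fun y h1 => h1.lt_top)
    rw [← h2]
    refine integral_congr_ae ?_
    filter_upwards [hs] with y h1 using h1.energy

variable (hL : IsAdmissible Ω a c Λ) (h𝒱 : IsFormDomain Ω a c 𝒱) (hφ : IsEigenbasis Ω a c 𝒱 lam φ)

theorem exists_enorm_sq_dataCyl_le : ∃ C : ENNReal, C ≠ ⊤ ∧ ∀ (u : L2Cyl Ω),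
    InFormDom φ lam u → ∀ κ, ‖dataCyl hL h𝒱 hφ u κ‖ₑ ^ 2 ≤
      C * (‖u‖ₑ ^ 2 + ∑' k, ENNReal.ofReal (lam k * ‖compLp (φ k) u‖ ^ 2)) := by
  obtain ⟨C, hC, h⟩ := exists_norm_sq_sum_eigJet_le hL h𝒱 hφ
  refine ⟨max 1 (ENNReal.ofReal C), by simp, fun u hu κ => ?_⟩
  cases κ with
  | none =>
    refine le_trans ?_ (mul_le_mul_left (le_max_left _ _) _)
    rw [one_mul]
    exact le_self_add
  | some j =>
    have h0 : ∀ k, 0 ≤ lam k * ‖compLp (φ k) u‖ ^ 2 := fun k =>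
      mul_nonneg (hφ.nonneg k) (sq_nonneg _)
    have hs1 := hasSum_norm_sq_compLp φ u
    have hs2 : HasSum (fun k => (1 + lam k) * ‖compLp (φ k) u‖ ^ 2)
        (‖u‖ ^ 2 + ∑' k, lam k * ‖compLp (φ k) u‖ ^ 2) := by
      refine (hs1.add hu.hasSum).congr_fun fun k => ?_
      ring
    have h1 : ‖dataCyl hL h𝒱 hφ u (some j)‖ ^ 2 ≤
        C * (‖u‖ ^ 2 + ∑' k, lam k * ‖compLp (φ k) u‖ ^ 2) := by
      refine le_of_tendsto_of_tendsto'
        (((hasSum_dataCyl hL h𝒱 hφ hu (some j)).tendsto_sum_nat.norm).pow 2)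
        (hs2.tendsto_sum_nat.const_mul C) fun N => h j (Finset.range N) _
    refine le_trans ?_ (mul_le_mul_left (le_max_right _ _) _)
    rw [← ENNReal.ofReal_tsum_of_nonneg h0 hu, ← ofReal_norm, ← ofReal_norm,
      ← ENNReal.ofReal_pow (norm_nonneg _), ← ENNReal.ofReal_pow (norm_nonneg _),
      ← ENNReal.ofReal_add (sq_nonneg _) (tsum_nonneg h0), ← ENNReal.ofReal_mul hC]
    exact ENNReal.ofReal_le_ofReal h1

theorem lintegral_spectralEnergy {𝒰 : ℝ → L2Cyl Ω} {U : ℝ × Sp n × ℝ → ℂ} (hm : Measurable U)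
    (hlam : ∀ k, 0 ≤ lam k)
    (hU : ∀ y, 0 < y → (fun p : ℝ × Sp n => U (p.1, p.2, y)) =ᵐ[mCyl Ω] 𝒰 y) :
    ∫⁻ t : ℝ, spectralEnergy (Ω := Ω) φ lam s (fun q => U (t, q)) =
      ∫⁻ y, ∑' k, ENNReal.ofReal (lam k * ‖compLp (φ k) (𝒰 y)‖ ^ 2) ∂(wMeas s) := by
  have hm1 : Measurable fun z : Sp n × (ℝ × ℝ) => U (z.2.1, z.1, z.2.2) := hm.comp (by fun_prop)
  have hm2 : Measurable fun z : ℝ × ℝ => ∑' k, ENNReal.ofReal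
      (lam k * ‖∫ x, U (z.1, x, z.2) * (φ k x : ℂ) ∂(mΩ Ω)‖ ^ 2) := by
    simpa only using measurable_spectral (lam := lam) (φ := φ) hm1
  refine (lintegral_lintegral_swap hm2.aemeasurable).trans
    (lintegral_congr_ae (ae_wMeas_of_forall fun y hy => ?_))
  have hm3 : Measurable fun z : Sp n × ℝ => U (z.2, z.1, y) := hm.comp (by fun_prop)
  have hbm : ∀ k, Measurable fun t => ∫ x, U (t, x, y) * (φ k x : ℂ) ∂(mΩ Ω) :=
    measurable_component hm3
  refine (lintegral_tsum fun k =>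
    (((hbm k).norm.pow_const 2).const_mul (lam k)).ennreal_ofReal.aemeasurable).trans
    (tsum_congr fun k => ?_)
  have e1 : ∀ z : ℂ, ENNReal.ofReal (lam k * ‖z‖ ^ 2) = ENNReal.ofReal (lam k) * ‖z‖ₑ ^ 2 :=
    fun z => by
      rw [ENNReal.ofReal_mul (hlam k), ENNReal.ofReal_pow (norm_nonneg _), ofReal_norm]
  have e2 : ENNReal.ofReal (lam k * ‖compLp (φ k) (𝒰 y)‖ ^ 2) =
      ENNReal.ofReal (lam k) * ∫⁻ t, ‖compLp (φ k) (𝒰 y) t‖ₑ ^ 2 := by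
    rw [ENNReal.ofReal_mul (hlam k), ENNReal.ofReal_pow (norm_nonneg _), ofReal_norm,
      enorm_sq_eq_lintegral]
  simp only [e1]
  rw [e2, lintegral_const_mul _ ((hbm k).enorm.pow_const 2)]
  congr 1
  refine lintegral_congr_ae ?_
  filter_upwards [ae_component_eq (hU y hy) k] with t ht
  rw [ht]

theorem measurable_spectralEnergy {U : ℝ × Sp n × ℝ → ℂ} (hm : Measurable U) :
    Measurable fun t : ℝ => spectralEnergy (Ω := Ω) φ lam s (fun q => U (t, q)) := by
  have hm1 : Measurable fun z : Sp n × (ℝ × ℝ) => U (z.2.1, z.1, z.2.2) := hm.comp (by fun_prop)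
  exact (measurable_spectral (lam := lam) (φ := φ) hm1).lintegral_prod_right'

theorem memLp_mExt {𝒰 : ℝ → L2Cyl Ω} {U : ℝ × Sp n × ℝ → ℂ} (hm : Measurable U)
    (hU : ∀ y, 0 < y → (fun p : ℝ × Sp n => U (p.1, p.2, y)) =ᵐ[mCyl Ω] 𝒰 y)
    (h : ∫⁻ y, ‖𝒰 y‖ₑ ^ 2 ∂(wMeas s) < ⊤) : MemLp U 2 (mExt Ω s) := by
  refine memLp_two_iff_lintegral.2 ⟨hm.aestronglyMeasurable, ?_⟩
  rw [lintegral_mExt (hm.enorm.pow_const 2)]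
  refine lt_of_le_of_lt (le_of_eq (lintegral_congr_ae (ae_wMeas_of_forall fun y hy => ?_))) h
  simp only
  rw [enorm_sq_eq_lintegral]
  refine lintegral_congr_ae ?_
  filter_upwards [hU y hy] with p hp
  rw [hp]

/-- Tonelli turns the energy integral over `y` into square integrability on `ℝ × Ω × (0, ∞)`, and
hence into finite energy for almost every `t`. For such `t` the `x`-structure comes from
`ae_ae_isFormSlice` and the weak `y`-derivative from the primitive representation. -/
theorem memL2H1_of_curve {𝒰 𝒰' : ℝ → L2Cyl Ω} (hd : ∀ y, 0 < y → HasDerivAt 𝒰 (𝒰' y) y)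
    (hc : ContinuousOn 𝒰' (Ioi 0)) (hform : ∀ y, 0 < y → InFormDom φ lam (𝒰 y))
    (hE : ∫⁻ y, (‖𝒰 y‖ₑ ^ 2 + (∑' k, ENNReal.ofReal (lam k * ‖compLp (φ k) (𝒰 y)‖ ^ 2)) +
      ‖𝒰' y‖ₑ ^ 2) ∂(wMeas s) < ⊤)
    {W : Option (Option (Fin n)) → ℝ × Sp n × ℝ → ℂ} (hWm : ∀ κ, Measurable (W κ))
    (hW : ∀ κ y, 0 < y →
      (fun p : ℝ × Sp n => W κ (p.1, p.2, y)) =ᵐ[mCyl Ω] dataCyl hL h𝒱 hφ (𝒰 y) κ)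
    {Y : ℝ × Sp n × ℝ → ℂ} (hYm : Measurable Y)
    (hY : ∀ y, 0 < y → (fun p : ℝ × Sp n => Y (p.1, p.2, y)) =ᵐ[mCyl Ω] 𝒰' y) :
    (∀ κ, MemLp (W κ) 2 (mExt Ω s)) ∧ MemLp Y 2 (mExt Ω s) ∧
      MemL2H1 Ω a c φ lam s (W none) (fun i => W (some (some i))) Y := by
  have hU := hW none
  change ∀ y, 0 < y → (fun p : ℝ × Sp n => W none (p.1, p.2, y)) =ᵐ[mCyl Ω] 𝒰 y at hU
  obtain ⟨C, hC, hle⟩ := exists_enorm_sq_dataCyl_le hL h𝒱 hφ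
  have hLp : ∀ κ, MemLp (W κ) 2 (mExt Ω s) := fun κ => by
    refine memLp_mExt (hWm κ) (hW κ) ?_
    refine lt_of_le_of_lt (lintegral_mono_ae (g := fun y => C * (‖𝒰 y‖ₑ ^ 2 +
      (∑' k, ENNReal.ofReal (lam k * ‖compLp (φ k) (𝒰 y)‖ ^ 2)) + ‖𝒰' y‖ₑ ^ 2))
      (ae_wMeas_of_forall fun y hy =>
        (hle _ (hform y hy) κ).trans (mul_le_mul_right le_self_add _))) ?_
    rw [lintegral_const_mul' _ _ hC]
    exact ENNReal.mul_lt_top hC.lt_top hE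
  have hLpY : MemLp Y 2 (mExt Ω s) :=
    memLp_mExt hYm hY (lt_of_le_of_lt (lintegral_mono fun y => le_add_self) hE)
  have hS : ∫⁻ t : ℝ, spectralEnergy (Ω := Ω) φ lam s (fun q => W none (t, q)) < ⊤ := by
    rw [lintegral_spectralEnergy (hWm none) hφ.nonneg hU]
    exact lt_of_le_of_lt (lintegral_mono fun y => le_add_self.trans le_self_add) hE
  have hSm := measurable_spectralEnergy (Ω := Ω) (φ := φ) (lam := lam) (s := s) (hWm none)
  have hlin : ∀ {Z : ℝ × Sp n × ℝ → ℂ}, MemLp Z 2 (mExt Ω s) → Measurable Z →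
      ∫⁻ t : ℝ, ∫⁻ q, ‖Z (t, q)‖ₑ ^ 2 ∂(mD Ω s) < ⊤ := fun hZ hZm => by
    rw [← lintegral_prod _ (hZm.enorm.pow_const 2).aemeasurable]
    exact (memLp_two_iff_lintegral.1 hZ).2
  refine ⟨hLp, hLpY, hLp none |>.1, fun i => hLp _, hLpY.1, ?_, ?_⟩
  · have h1 : ∀ m : ℕ, ∀ᵐ p ∂(mCyl Ω), _ := fun m =>
      ae_eq_add_primitive hd hc (hWm none) hYm hU hY (Nat.one_div_pos_of_nat (n := m))
    have h2 := Measure.ae_ae_of_ae_prod (ae_all_iff.2 h1)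
    filter_upwards [h2, ae_ae_isFormSlice (s := s) hL h𝒱 hφ hform hWm hW,
      ae_lt_top hSm hS.ne, ae_all_iff.2 fun κ => memLp_two_prod_right (hLp κ),
      memLp_two_prod_right hLpY] with t h3 h4 h5 h6 h7
    exact memH1_of_slices (w := fun κ q => W κ (t, q)) hL
      (fun κ => (hWm κ).comp measurable_prodMk_left) h6 h7
      (hasWeakDeriv_halfCyl_of_primitive (h6 none) h7 h3) h4 h5
  · unfold normSqH1
    have m1 : Measurable fun t : ℝ => ∫⁻ q, ‖W none (t, q)‖ₑ ^ 2 ∂(mD Ω s) :=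
      ((hWm none).enorm.pow_const 2).lintegral_prod_right'
    rw [lintegral_add_left m1, lintegral_add_left hSm]
    exact ENNReal.add_lt_top.2 ⟨hlin (hLp none) (hWm none),
      ENNReal.add_lt_top.2 ⟨hS, hlin hLpY hYm⟩⟩

theorem represents_of_curve {𝒰 : ℝ → L2Cyl Ω} (hform : ∀ y, 0 < y → InFormDom φ lam (𝒰 y))
    {W : Option (Option (Fin n)) → ℝ × Sp n × ℝ → ℂ}
    (hW : ∀ κ y, 0 < y →
      (fun p : ℝ × Sp n => W κ (p.1, p.2, y)) =ᵐ[mCyl Ω] dataCyl hL h𝒱 hφ (𝒰 y) κ)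
    {Y : ℝ × Sp n × ℝ → ℂ}
    (hY : ∀ y, 0 < y → (fun p : ℝ × Sp n => Y (p.1, p.2, y)) =ᵐ[mCyl Ω]
      (deriv 𝒰 y : L2Cyl Ω)) :
    Represents Ω 𝒰 (W none) (fun i => W (some (some i))) Y := by
  refine ⟨hW none, fun y hy i => ?_, hY⟩
  have hLp : ∀ κ, MemLp (fun p : ℝ × Sp n => W κ (p.1, p.2, y)) 2 (mCyl Ω) := fun κ =>
    (memLp_congr_ae (hW κ y hy)).2 (Lp.memLp _)
  have hloc : ∀ κ, LocallyIntegrableOn (fun p : ℝ × Sp n => W κ (p.1, p.2, y))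
      (cyl Ω : Set (ℝ × Sp n)) := fun κ =>
    locallyIntegrableOn_of_memLp (by rw [restrict_cyl]; exact hLp κ)
  refine ⟨hLp _, ((hasWeakDeriv_jetCyl hL h𝒱 hφ i (hform y hy)).congr_left ?_
    (hloc none)).congr_right ?_ (hloc _)⟩
  · rw [restrict_cyl]; exact (hW none y hy).symm
  · rw [restrict_cyl]; exact (hW (some (some i)) y hy).symm

end

section

/-! ### The trace of the flux -/

variable {n : ℕ} {Ω : Opens (Sp n)} {a : Sp n → Matrix (Fin n) (Fin n) ℝ} {c : Sp n → ℝ} {Λ : ℝ}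
  {𝒱 : Submodule ℝ (L2 Ω)} {lam : ℕ → ℝ} {φ : HilbertBasis ℕ ℝ (L2 Ω)} {s : ℝ}

theorem ofReal_norm_sq (z : ℂ) : ENNReal.ofReal (‖z‖ ^ 2) = ‖z‖ₑ ^ 2 := by
  rw [ENNReal.ofReal_pow (norm_nonneg _), ofReal_norm]

theorem ofReal_rpow_two {r : ℝ} (hr : 0 ≤ r) :
    ENNReal.ofReal r ^ (2 : ℝ) = ENNReal.ofReal (r ^ 2) := by
  rw [ENNReal.ofReal_pow hr]
  norm_num

/-- The square of the norm of a test function in `L²(ℝ; Dom(L^{1/2})) ∩ H¹(ℝ; L²(Ω))`. -/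
def parabolicNormSq (φ : HilbertBasis ℕ ℝ (L2 Ω)) (lam : ℕ → ℝ) (v : 𝓓(cyl Ω, ℝ)) : ENNReal :=
  ‖testL2 v‖ₑ ^ 2 + (∑' k, ENNReal.ofReal (lam k * ‖compLp (φ k) (testL2 v)‖ ^ 2)) +
    ‖testL2 (dirDeriv v (1, 0))‖ₑ ^ 2

theorem parabolicNormSq_eq (hlam : ∀ k, 0 ≤ lam k) (v : 𝓓(cyl Ω, ℝ)) :
    ∫⁻ q, ENNReal.ofReal ((1 + lam q.2 + q.1 ^ 2) * ‖specFun φ (testL2 v) q‖ ^ 2) ∂mFreq =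
      parabolicNormSq φ lam v := by
  have hm := measurable_specFun φ (testL2 v)
  have hm1 : Measurable fun q => ‖specFun φ (testL2 v) q‖ₑ ^ 2 := hm.enorm.pow_const 2
  rw [parabolicNormSq, ← lintegral_specFun φ, ← lintegral_weight_specFun _ hlam,
    ← lintegral_specFun φ, ← lintegral_add_left hm1,
    ← lintegral_add_right _ ((measurable_specFun φ _).enorm.pow_const 2)]
  refine lintegral_congr_ae ?_
  filter_upwards [specFun_dirDeriv_time (φ := φ) v] with q hq
  have h0 := hlam q.2
  rw [hq, ← ofReal_norm_sq, ← ofReal_norm_sq, ← ENNReal.ofReal_add (by positivity) (by positivity),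
    ← ENNReal.ofReal_add (by positivity) (by positivity)]
  congr 1
  rw [norm_mul, norm_mul, Complex.norm_I, Complex.norm_real, mul_pow, one_mul, Real.norm_eq_abs,
    sq_abs]
  ring

/-- The bound of the flux is shared between `u` and the test function. In `|z| ≤ λ + |ρ|`, the part
`λ^s` is split into halves, one dominated by `|z|^{s/2}` and going to `u`. The part with `|ρ|` goes
entirely to the test function through its time derivative, the gap giving `λ^{s-1} ≤ δ^{s-1}`. -/
theorem symbol_weight_le (hlam : ∀ k, 0 ≤ lam k) (hs0 : 0 < s) (hs1 : s < 1) {δ : ℝ} (hδ : 0 < δ)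
    {q : ℝ × ℕ} (hq : δ ≤ lam q.2) : ‖symbol lam q‖ * lam q.2 ^ (s - 1) ≤
      (‖symbol lam q‖ ^ (s / 2) + δ ^ (s - 1)) * √(1 + lam q.2 + q.1 ^ 2) := by
  have hl : 0 < lam q.2 := hδ.trans_le hq
  have h1 : lam q.2 ^ (s - 1) ≤ δ ^ (s - 1) :=
    Real.rpow_le_rpow_of_nonpos hδ hq (by linarith)
  have h2 : |q.1| ≤ √(1 + lam q.2 + q.1 ^ 2) := by
    rw [← Real.sqrt_sq_eq_abs]
    exact Real.sqrt_le_sqrt (by linarith)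
  have h3 : lam q.2 ^ (s / 2) ≤ √(1 + lam q.2 + q.1 ^ 2) := by
    have : lam q.2 ^ (s / 2) = √(lam q.2 ^ s) := by
      rw [Real.sqrt_eq_rpow, ← Real.rpow_mul hl.le]
      ring_nf
    rw [this]
    refine Real.sqrt_le_sqrt ?_
    have := rpow_le_one_add hl.le hs0.le hs1.le
    nlinarith [sq_nonneg q.1]
  have h4 : lam q.2 ^ (s / 2) ≤ ‖symbol lam q‖ ^ (s / 2) :=
    Real.rpow_le_rpow hl.le (lam_le_norm_symbol hlam q) (by linarith)
  have h5 : lam q.2 * lam q.2 ^ (s - 1) = lam q.2 ^ (s / 2) * lam q.2 ^ (s / 2) := by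
    rw [← Real.rpow_add hl, ← Real.rpow_one_add' hl.le (by linarith)]
    ring_nf
  calc ‖symbol lam q‖ * lam q.2 ^ (s - 1) ≤ (lam q.2 + |q.1|) * lam q.2 ^ (s - 1) := by
        gcongr; exact norm_symbol_le hlam q
    _ = lam q.2 ^ (s / 2) * lam q.2 ^ (s / 2) + lam q.2 ^ (s - 1) * |q.1| := by
        rw [add_mul, h5]; ring
    _ ≤ ‖symbol lam q‖ ^ (s / 2) * √(1 + lam q.2 + q.1 ^ 2) +
        δ ^ (s - 1) * √(1 + lam q.2 + q.1 ^ 2) := by gcongr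
    _ = _ := by ring

/-- Cauchy–Schwarz after `symbol_weight_le`: the factor with `u` is square integrable by `u ∈
Dom(H^s)`, and the other factor is the parabolic norm of `v`. -/
theorem exists_lintegral_symbol_weight_le (hlam : ∀ k, 0 ≤ lam k) (hmono : Monotone lam)
    (u : L2Cyl Ω) (hs0 : 0 < s) (hs1 : s < 1) (hu : MemDomH φ lam s u)
    (hu0 : ∀ k, lam k = 0 → component φ u k = 0) : ∃ K : ENNReal, K ≠ ⊤ ∧ ∀ v : 𝓓(cyl Ω, ℝ),
      ∫⁻ q, ENNReal.ofReal (‖symbol lam q‖ * lam q.2 ^ (s - 1) *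
        (‖specFun φ u q‖ * ‖specFun φ (testL2 v) q‖)) ∂mFreq ≤
          K * parabolicNormSq φ lam v ^ (1 / 2 : ℝ) := by
  obtain ⟨δ, hδ, hgap⟩ := exists_pos_le_of_monotone hlam hmono
  have hl : Measurable fun q : ℝ × ℕ => lam q.2 :=
    (measurable_from_nat (f := lam)).comp measurable_snd
  have hz := (measurable_symbol lam).norm
  have hum := (measurable_specFun φ u).norm
  set f : ℝ × ℕ → ℝ := fun q => (‖symbol lam q‖ ^ (s / 2) + δ ^ (s - 1)) * ‖specFun φ u q‖ with hf
  have hf0 : ∀ q, 0 ≤ f q := fun q => by positivity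
  have hfm : Measurable f := ((hz.pow_const _).add_const _).mul hum
  have hfi : ∫⁻ q, ENNReal.ofReal (f q) ^ (2 : ℝ) ∂mFreq < ⊤ := by
    have hle : ∀ q, ENNReal.ofReal (f q) ^ (2 : ℝ) ≤
        2 * ENNReal.ofReal (‖symbol lam q‖ ^ s * ‖specFun φ u q‖ ^ 2) +
          ENNReal.ofReal (2 * (δ ^ (s - 1)) ^ 2) * ‖specFun φ u q‖ₑ ^ 2 := fun q => by
      have e1 : (‖symbol lam q‖ ^ (s / 2)) ^ 2 = ‖symbol lam q‖ ^ s := by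
        rw [← Real.rpow_natCast, ← Real.rpow_mul (norm_nonneg _)]
        norm_num
      rw [ofReal_rpow_two (hf0 q), ← ofReal_norm_sq, ← ENNReal.ofReal_mul (by positivity),
        show (2 : ENNReal) = ENNReal.ofReal 2 by simp, ← ENNReal.ofReal_mul (by positivity),
        ← ENNReal.ofReal_add (by positivity) (by positivity), ← e1]
      refine ENNReal.ofReal_le_ofReal ?_
      simp only [hf, mul_pow]
      nlinarith [mul_nonneg (sq_nonneg (‖symbol lam q‖ ^ (s / 2) - δ ^ (s - 1)))
        (sq_nonneg ‖specFun φ u q‖)]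
    refine lt_of_le_of_lt (lintegral_mono hle) ?_
    rw [lintegral_add_right _ (((measurable_specFun φ u).enorm.pow_const 2).const_mul _),
      lintegral_const_mul' _ _ (by simp), lintegral_const_mul' _ _ ENNReal.ofReal_ne_top,
      lintegral_specFun]
    exact ENNReal.add_lt_top.2 ⟨ENNReal.mul_lt_top (by simp) ((memDomH_iff φ lam s u).1 hu),
      ENNReal.mul_lt_top ENNReal.ofReal_lt_top (by finiteness)⟩
  refine ⟨(∫⁻ q, ENNReal.ofReal (f q) ^ (2 : ℝ) ∂mFreq) ^ (1 / 2 : ℝ),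
    ENNReal.rpow_ne_top_of_nonneg (by norm_num) hfi.ne, fun v => ?_⟩
  set g : ℝ × ℕ → ℝ := fun q => √(1 + lam q.2 + q.1 ^ 2) * ‖specFun φ (testL2 v) q‖ with hg
  have hg0 : ∀ q, 0 ≤ g q := fun q => by positivity
  have hgm : Measurable g :=
    (((hl.const_add 1).add (measurable_fst.pow_const 2)).sqrt).mul (measurable_specFun φ _).norm
  have h1 := ENNReal.lintegral_mul_le_Lp_mul_Lq mFreq Real.HolderConjugate.two_two
    hfm.ennreal_ofReal.aemeasurable hgm.ennreal_ofReal.aemeasurable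
  have h2 : ∫⁻ q, ENNReal.ofReal (g q) ^ (2 : ℝ) ∂mFreq = parabolicNormSq φ lam v := by
    rw [← parabolicNormSq_eq hlam]
    refine lintegral_congr fun q => ?_
    have h0 := hlam q.2
    rw [ofReal_rpow_two (hg0 q)]
    simp only [hg]
    rw [mul_pow, Real.sq_sqrt (by positivity)]
  rw [h2] at h1
  refine le_trans (lintegral_mono_ae ?_) h1
  filter_upwards [specFun_eq_zero φ hu0] with q hq
  rw [Pi.mul_apply, ← ENNReal.ofReal_mul (hf0 q)]
  refine ENNReal.ofReal_le_ofReal ?_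
  rcases hgap q.2 with h | h
  · simp [hq h, hf]
  · have := mul_le_mul_of_nonneg_right (symbol_weight_le hlam hs0 hs1 hδ h)
      (mul_nonneg (norm_nonneg (specFun φ u q)) (norm_nonneg (specFun φ (testL2 v) q)))
    refine this.trans_eq ?_
    simp only [hf, hg]
    ring

/-! ### Slices of test functions as curves -/

theorem isCompact_image_tsupport (V : 𝓓(fullCyl Ω, ℝ)) :
    IsCompact ((fun q : ℝ × Sp n × ℝ => (q.1, q.2.1)) '' tsupport V) :=
  (show IsCompact (tsupport V) from V.hasCompactSupport).image (by fun_prop)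

theorem eq_zero_of_notMem_image (V : 𝓓(fullCyl Ω, ℝ)) (y : ℝ) {p : ℝ × Sp n}
    (hp : p ∉ (fun q : ℝ × Sp n × ℝ => (q.1, q.2.1)) '' tsupport V) : V (p.1, p.2, y) = 0 :=
  image_eq_zero_of_notMem_tsupport fun h => hp ⟨_, h, rfl⟩

theorem tendsto_testL2_sliceY (V : 𝓓(fullCyl Ω, ℝ)) (y : ℝ) :
    Tendsto (fun y => testL2 (sliceY V y)) (𝓝 y) (𝓝 (testL2 (sliceY V y))) := by
  refine tendsto_Lp_of_continuous (Φ := fun q : (ℝ × Sp n) × ℝ => (V (q.1.1, q.1.2, q.2) : ℂ)) ?_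
    (fun y => coeFn_testL2 (sliceY V y)) (isCompact_image_tsupport V) fun y p _ hp => ?_
  · exact Complex.continuous_ofReal.comp (V.continuous.comp (by fun_prop))
  · simp [eq_zero_of_notMem_image V y hp]

theorem hasDerivAt_testL2_sliceY (V : 𝓓(fullCyl Ω, ℝ)) (y : ℝ) :
    HasDerivAt (fun y => testL2 (sliceY V y)) (testL2 (sliceY (dirDeriv V (0, 0, 1)) y)) y := by
  refine hasDerivAt_Lp_of_continuous (Φ := fun q : (ℝ × Sp n) × ℝ => (V (q.1.1, q.1.2, q.2) : ℂ))
    (D := fun q : (ℝ × Sp n) × ℝ => (dirDeriv V (0, 0, 1) (q.1.1, q.1.2, q.2) : ℂ)) ?_ ?_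
    (fun y => coeFn_testL2 (sliceY V y)) (coeFn_testL2 _) (isCompact_image_tsupport V)
    fun y p _ hp => ?_
  · exact Complex.continuous_ofReal.comp ((dirDeriv V (0, 0, 1)).continuous.comp (by fun_prop))
  · intro p y
    have h1 : HasDerivAt (fun y : ℝ => (p.1, p.2, y)) ((0 : ℝ), (0 : Sp n), (1 : ℝ)) y :=
      (hasDerivAt_const y p.1).prodMk ((hasDerivAt_const y p.2).prodMk (hasDerivAt_id y))
    exact ((V.contDiff.differentiable (by simp) (p.1, p.2, y)).hasFDerivAt.comp_hasDerivAt
      y h1).ofReal_comp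
  · simp [eq_zero_of_notMem_image V y hp]

theorem dirDeriv_sliceY (V : 𝓓(fullCyl Ω, ℝ)) (y : ℝ) (ξ : ℝ × Sp n) :
    dirDeriv (sliceY V y) ξ = sliceY (dirDeriv V (ξ.1, ξ.2, 0)) y := by
  ext p
  rw [dirDeriv_apply, fderiv_sliceY, sliceY_apply, dirDeriv_apply]

theorem dirDeriv_sub {X : Type*} [NormedAddCommGroup X] [NormedSpace ℝ X] {S : Opens X}
    (v w : 𝓓(S, ℝ)) (ξ : X) : dirDeriv (v - w) ξ = dirDeriv v ξ - dirDeriv w ξ := by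
  ext p
  have h := fderiv_sub (v.contDiff.differentiable (by simp) p) (w.contDiff.differentiable (by simp) p)
  change fderiv ℝ (⇑v - ⇑w) p ξ = fderiv ℝ v p ξ - fderiv ℝ w p ξ
  rw [h]
  rfl

theorem tendsto_testL2_sliceY_sub (V : 𝓓(fullCyl Ω, ℝ)) :
    Tendsto (fun y => ‖testL2 (sliceY V y - sliceY V 0)‖ ^ 2) (𝓝 0) (𝓝 0) := by
  have h := ((tendsto_testL2_sliceY V 0).sub_const (testL2 (sliceY V 0))).norm.pow 2
  simpa [testL2_sub] using h

theorem tendsto_testL2_dirDeriv_sub (V : 𝓓(fullCyl Ω, ℝ)) (ξ : ℝ × Sp n) :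
    Tendsto (fun y => ‖testL2 (dirDeriv (sliceY V y - sliceY V 0) ξ)‖ ^ 2) (𝓝 0) (𝓝 0) := by
  simp only [dirDeriv_sub, dirDeriv_sliceY]
  exact tendsto_testL2_sliceY_sub _

theorem parabolicNormSq_eq_ofReal (v : 𝓓(cyl Ω, ℝ)) (hv : InFormDom φ lam (testL2 v))
    (hlam : ∀ k, 0 ≤ lam k) : parabolicNormSq φ lam v = ENNReal.ofReal (‖testL2 v‖ ^ 2 +
      (∑' k, lam k * ‖compLp (φ k) (testL2 v)‖ ^ 2) + ‖testL2 (dirDeriv v (1, 0))‖ ^ 2) := by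
  have h0 : ∀ k, 0 ≤ lam k * ‖compLp (φ k) (testL2 v)‖ ^ 2 := fun k =>
    mul_nonneg (hlam k) (sq_nonneg _)
  have h1 : 0 ≤ ∑' k, lam k * ‖compLp (φ k) (testL2 v)‖ ^ 2 := tsum_nonneg h0
  rw [parabolicNormSq, ← ENNReal.ofReal_tsum_of_nonneg h0 hv, ← ofReal_norm, ← ofReal_norm,
    ← ENNReal.ofReal_pow (norm_nonneg _), ← ENNReal.ofReal_pow (norm_nonneg _),
    ← ENNReal.ofReal_add (by positivity) h1, ← ENNReal.ofReal_add (by positivity) (by positivity)]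

/-- All slices vanish off one compact set in `x`, so the eigenvalue-weighted sum is bounded with a
fixed constant by `L²` norms of `V(y) - V(0)` and its `x`-derivatives. These tend to zero by uniform
continuity. -/
theorem tendsto_parabolicNormSq (hL : IsAdmissible Ω a c Λ) (h𝒱 : IsFormDomain Ω a c 𝒱)
    (hφ : IsEigenbasis Ω a c 𝒱 lam φ) (V : 𝓓(fullCyl Ω, ℝ)) :
    Tendsto (fun y => parabolicNormSq φ lam (sliceY V y - sliceY V 0)) (𝓝 0) (𝓝 0) := by
  set K : Set (Sp n) := (fun q : ℝ × Sp n × ℝ => q.2.1) '' tsupport V with hK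
  have hKc : IsCompact K :=
    (show IsCompact (tsupport V) from V.hasCompactSupport).image (by fun_prop)
  have hKΩ : K ⊆ Ω := by
    rintro _ ⟨q, hq, rfl⟩
    exact (V.tsupport_subset hq).2.1
  obtain ⟨C, hC⟩ := exists_tsum_lam_compLp_le hL h𝒱 hφ hKc hKΩ
  have hV : ∀ y (p : ℝ × Sp n), p.2 ∉ K → V (p.1, p.2, y) = 0 := fun y p hp =>
    image_eq_zero_of_notMem_tsupport fun h => hp ⟨_, h, rfl⟩
  have h1 : ∀ y, ∑' k, lam k * ‖compLp (φ k) (testL2 (sliceY V y - sliceY V 0))‖ ^ 2 ≤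
      C * ((∑ i, ‖testL2 (dirDeriv (sliceY V y - sliceY V 0) (0, e i))‖ ^ 2) +
        ‖testL2 (sliceY V y - sliceY V 0)‖ ^ 2) := fun y => hC _ fun p hp => by
    change sliceY V y p - sliceY V 0 p = 0
    rw [sliceY_apply, sliceY_apply, hV y p hp, hV 0 p hp, sub_zero]
  have h2 : Tendsto (fun y => C * ((∑ i, ‖testL2 (dirDeriv (sliceY V y - sliceY V 0)
      (0, e i))‖ ^ 2) + ‖testL2 (sliceY V y - sliceY V 0)‖ ^ 2)) (𝓝 0) (𝓝 0) := by
    have := ((tendsto_finsetSum (Finset.univ : Finset (Fin n)) fun i _ =>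
      tendsto_testL2_dirDeriv_sub V (0, e i)).add (tendsto_testL2_sliceY_sub V)).const_mul C
    simpa using this
  have h3 := squeeze_zero (fun y => tsum_nonneg fun k => mul_nonneg (hφ.nonneg k) (sq_nonneg _))
    h1 h2
  have h4 := ENNReal.tendsto_ofReal (((tendsto_testL2_sliceY_sub V).add h3).add
    (tendsto_testL2_dirDeriv_sub V (1, 0)))
  simp only [add_zero, ENNReal.ofReal_zero] at h4
  exact h4.congr fun y =>
    (parabolicNormSq_eq_ofReal _ (inFormDom_testL2 hL h𝒱 hφ _) hφ.nonneg).symm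

end

/-! ### The limit at `y = 0` of the flux tested with smooth functions -/

section

variable {n : ℕ} {Ω : Opens (Sp n)} {a : Sp n → Matrix (Fin n) (Fin n) ℝ} {c : Sp n → ℝ} {Λ : ℝ}
  {𝒱 : Submodule ℝ (L2 Ω)} {lam : ℕ → ℝ} {φ : HilbertBasis ℕ ℝ (L2 Ω)} {s : ℝ}

/-- A bound of the symbol of the flux, uniform in `y`. -/
theorem ae_norm_flux_symbol_le (hlam : ∀ k, 0 ≤ lam k) (u : L2Cyl Ω) (hs0 : 0 < s) (hs1 : s < 1)
    (hu0 : ∀ k, lam k = 0 → component φ u k = 0) (v : L2Cyl Ω) :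
    ∀ᵐ q ∂mFreq, ∀ y, 0 < y →
      ‖subExtFlux s (expo (symbol lam q)) y * specFun φ u q * conj (specFun φ v q)‖ ≤
        2 * (4 ^ s * Real.Gamma s)⁻¹ * Real.Gamma (1 - s) * (‖symbol lam q‖ * lam q.2 ^ (s - 1) *
          (‖specFun φ u q‖ * ‖specFun φ v q‖)) := by
  filter_upwards [specFun_eq_zero φ hu0] with q hq y hy
  rcases (hlam q.2).eq_or_lt with h | h
  · simp [hq h.symm]
  · have h1 := norm_subExtFlux_expo_le hs0 hs1 hy (z := symbol lam q) (by rwa [symbol_re])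
    rw [symbol_re] at h1
    rw [norm_mul, norm_mul, RCLike.norm_conj, mul_assoc]
    refine (mul_le_mul_of_nonneg_right h1 (by positivity)).trans_eq ?_
    ring

theorem inner_flux (hlam : ∀ k, 0 ≤ lam k) (u v : L2Cyl Ω) (hs0 : 0 < s) {y : ℝ} (hy : 0 < y) :
    ⟪v, flux φ lam s u y⟫_ℂ =
      ∫ q, subExtFlux s (expo (symbol lam q)) y * specFun φ u q * conj (specFun φ v q) ∂mFreq := by
  rw [inner_eq_integral_specFun φ]
  refine integral_congr_ae ?_
  filter_upwards [specFun_flux φ hlam u hs0 hy] with q hq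
  rw [hq]

theorem gamma_const_nonneg (hs0 : 0 < s) (hs1 : s < 1) :
    0 ≤ 2 * (4 ^ s * Real.Gamma s)⁻¹ * Real.Gamma (1 - s) := by
  have h1 := Real.Gamma_pos_of_pos hs0
  have h2 := Real.Gamma_pos_of_pos (sub_pos.2 hs1)
  positivity

theorem exists_enorm_inner_flux_le (hlam : ∀ k, 0 ≤ lam k) (hmono : Monotone lam)
    (u : L2Cyl Ω) (hs0 : 0 < s) (hs1 : s < 1) (hu : MemDomH φ lam s u)
    (hu0 : ∀ k, lam k = 0 → component φ u k = 0) : ∃ K : ENNReal, K ≠ ⊤ ∧ ∀ v : 𝓓(cyl Ω, ℝ), ∀ y,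
      0 < y → ‖⟪testL2 v, flux φ lam s u y⟫_ℂ‖ₑ ≤ K * parabolicNormSq φ lam v ^ (1 / 2 : ℝ) := by
  obtain ⟨K, hK, h⟩ := exists_lintegral_symbol_weight_le hlam hmono u hs0 hs1 hu hu0
  refine ⟨ENNReal.ofReal (2 * (4 ^ s * Real.Gamma s)⁻¹ * Real.Gamma (1 - s)) * K,
    ENNReal.mul_ne_top ENNReal.ofReal_ne_top hK, fun v y hy => ?_⟩
  rw [inner_flux hlam u _ hs0 hy, mul_assoc]
  refine (enorm_integral_le_lintegral_enorm _).trans (le_trans ?_ (mul_le_mul_right (h v) _))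
  rw [← lintegral_const_mul' _ _ ENNReal.ofReal_ne_top]
  refine lintegral_mono_ae ?_
  filter_upwards [ae_norm_flux_symbol_le hlam u hs0 hs1 hu0 (testL2 v)] with q hq
  rw [← ENNReal.ofReal_mul (gamma_const_nonneg hs0 hs1), ← ofReal_norm]
  exact ENNReal.ofReal_le_ofReal (hq y hy)

theorem integrable_symbol_weight (hlam : ∀ k, 0 ≤ lam k) (hmono : Monotone lam)
    (u : L2Cyl Ω) (hs0 : 0 < s) (hs1 : s < 1) (hu : MemDomH φ lam s u)
    (hu0 : ∀ k, lam k = 0 → component φ u k = 0) (v : 𝓓(cyl Ω, ℝ))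
    (hv : InFormDom φ lam (testL2 v)) : Integrable (fun q => ‖symbol lam q‖ * lam q.2 ^ (s - 1) *
      (‖specFun φ u q‖ * ‖specFun φ (testL2 v) q‖)) mFreq := by
  obtain ⟨K, hK, h⟩ := exists_lintegral_symbol_weight_le hlam hmono u hs0 hs1 hu hu0
  have hl : Measurable fun q : ℝ × ℕ => lam q.2 :=
    (measurable_from_nat (f := lam)).comp measurable_snd
  have hm : Measurable fun q => ‖symbol lam q‖ * lam q.2 ^ (s - 1) *
      (‖specFun φ u q‖ * ‖specFun φ (testL2 v) q‖) :=
    ((measurable_symbol lam).norm.mul (hl.pow_const _)).mul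
      ((measurable_specFun φ _).norm.mul (measurable_specFun φ _).norm)
  refine ⟨hm.aestronglyMeasurable, ?_⟩
  rw [hasFiniteIntegral_iff_ofReal (ae_of_all _ fun q => by
    have := Real.rpow_nonneg (hlam q.2) (s - 1)
    positivity)]
  refine (h v).trans_lt (ENNReal.mul_lt_top hK.lt_top ?_)
  rw [parabolicNormSq_eq_ofReal v hv hlam]
  exact ENNReal.rpow_lt_top_of_nonneg (by norm_num) ENNReal.ofReal_ne_top

/-- Since `λ_k ≤ |z|` and `s < 1`, one has `|z|^s ≤ |z| λ_k^{s-1}`, so the function dominating the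
flux also dominates its limit. -/
theorem integrable_symbol_cpow (hlam : ∀ k, 0 ≤ lam k) (hmono : Monotone lam)
    (u : L2Cyl Ω) (hs0 : 0 < s) (hs1 : s < 1) (hu : MemDomH φ lam s u)
    (hu0 : ∀ k, lam k = 0 → component φ u k = 0) (v : 𝓓(cyl Ω, ℝ))
    (hv : InFormDom φ lam (testL2 v)) : Integrable (fun q => symbol lam q ^ (s : ℂ) *
      specFun φ u q * conj (specFun φ (testL2 v) q)) mFreq := by
  have hi := integrable_symbol_weight hlam hmono u hs0 hs1 hu hu0 v hv
  have hz : Measurable fun q => symbol lam q ^ (s : ℂ) * specFun φ u q *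
      conj (specFun φ (testL2 v) q) :=
    (((measurable_symbol lam).pow_const _).mul (measurable_specFun φ u)).mul
      (Complex.continuous_conj.measurable.comp (measurable_specFun φ _))
  refine hi.mono' hz.aestronglyMeasurable ?_
  filter_upwards [specFun_eq_zero φ hu0] with q hq
  rcases (hlam q.2).eq_or_lt with h | h
  · simp [hq h.symm]
  · have h0 : 0 < ‖symbol lam q‖ := h.trans_le (lam_le_norm_symbol hlam q)
    rw [norm_mul, norm_mul, RCLike.norm_conj, Complex.norm_cpow_real, mul_assoc]
    gcongr
    calc ‖symbol lam q‖ ^ s = ‖symbol lam q‖ * ‖symbol lam q‖ ^ (s - 1) := by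
          rw [← Real.rpow_one_add' h0.le (by linarith)]
          ring_nf
      _ ≤ ‖symbol lam q‖ * lam q.2 ^ (s - 1) := by
          gcongr ?_ * ?_
          exact Real.rpow_le_rpow_of_nonpos h (lam_le_norm_symbol hlam q) (by linarith)

theorem measurable_flux_symbol (u v : L2Cyl Ω) (y : ℝ) : Measurable fun q =>
    subExtFlux s (expo (symbol lam q)) y * specFun φ u q * conj (specFun φ v q) := by
  have h1 : Measurable fun q => subExtFlux s (expo (symbol lam q)) y := by
    simpa only [Function.comp_def] using
      (measurable_subExtFlux_symbol (lam := lam) s).comp (measurable_prodMk_right (y := y))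
  exact (h1.mul (measurable_specFun φ u)).mul
    (Complex.continuous_conj.measurable.comp (measurable_specFun φ _))

theorem tendsto_inner_flux (hL : IsAdmissible Ω a c Λ) (h𝒱 : IsFormDomain Ω a c 𝒱)
    (hφ : IsEigenbasis Ω a c 𝒱 lam φ) (u : L2Cyl Ω) (hs0 : 0 < s) (hs1 : s < 1)
    (hu : MemDomH φ lam s u) (hu0 : ∀ k, lam k = 0 → component φ u k = 0) (v : 𝓓(cyl Ω, ℝ)) :
    Tendsto (fun y => ⟪testL2 v, flux φ lam s u y⟫_ℂ) (𝓝[>] 0)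
      (𝓝 (-(Real.Gamma (1 - s) / (4 ^ (s - 1 / 2) * Real.Gamma s) : ℝ) *
        pairH φ lam s u (testL2 v))) := by
  have hi := integrable_symbol_weight hφ.nonneg hφ.mono u hs0 hs1 hu hu0 v
    (inFormDom_testL2 hL h𝒱 hφ v)
  have hi2 := integrable_symbol_cpow hφ.nonneg hφ.mono u hs0 hs1 hu hu0 v
    (inFormDom_testL2 hL h𝒱 hφ v)
  rw [pairH_eq φ lam s u _ hi2, ← integral_const_mul]
  have key : Tendsto (fun y => ∫ q, subExtFlux s (expo (symbol lam q)) y * specFun φ u q *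
      conj (specFun φ (testL2 v) q) ∂mFreq) (𝓝[>] 0)
      (𝓝 (∫ q, -(Real.Gamma (1 - s) / (4 ^ (s - 1 / 2) * Real.Gamma s) : ℝ) *
        (symbol lam q ^ (s : ℂ) * specFun φ u q * conj (specFun φ (testL2 v) q)) ∂mFreq)) := by
    refine tendsto_integral_filter_of_dominated_convergence _ ?_ ?_
      (hi.const_mul (2 * (4 ^ s * Real.Gamma s)⁻¹ * Real.Gamma (1 - s))) ?_
    · exact Eventually.of_forall fun y => (measurable_flux_symbol u _ y).aestronglyMeasurable
    · filter_upwards [self_mem_nhdsWithin] with y hy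
      filter_upwards [ae_norm_flux_symbol_le hφ.nonneg u hs0 hs1 hu0 (testL2 v)] with q hq
      exact hq y hy
    · filter_upwards [specFun_eq_zero φ hu0] with q hq
      rcases (hφ.nonneg q.2).eq_or_lt with h | h
      · simp only [hq h.symm, mul_zero, zero_mul]
        exact tendsto_const_nhds
      · have h1 := ((tendsto_subExtFlux_expo_zero hs1 (z := symbol lam q)
          (by rwa [symbol_re])).mul_const (specFun φ u q)).mul_const
            (conj (specFun φ (testL2 v) q))
        convert h1 using 2
        ring
  refine key.congr' ?_
  filter_upwards [self_mem_nhdsWithin] with y hy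
  exact (inner_flux hφ.nonneg u _ hs0 hy).symm

/-- The trace of the flux at `y = 0`. -/
theorem tendsto_inner_flux_sliceY (hL : IsAdmissible Ω a c Λ) (h𝒱 : IsFormDomain Ω a c 𝒱)
    (hφ : IsEigenbasis Ω a c 𝒱 lam φ) (u : L2Cyl Ω) (hs0 : 0 < s) (hs1 : s < 1)
    (hu : MemDomH φ lam s u) (hu0 : ∀ k, lam k = 0 → component φ u k = 0)
    (V : 𝓓(fullCyl Ω, ℝ)) :
    Tendsto (fun y => ⟪testL2 (sliceY V y), flux φ lam s u y⟫_ℂ) (𝓝[>] 0)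
      (𝓝 (-(Real.Gamma (1 - s) / (4 ^ (s - 1 / 2) * Real.Gamma s) : ℝ) *
        pairH φ lam s u (testL2 (bottom V)))) := by
  obtain ⟨K, hK, hle⟩ := exists_enorm_inner_flux_le hφ.nonneg hφ.mono u hs0 hs1 hu hu0
  have h1 := tendsto_inner_flux hL h𝒱 hφ u hs0 hs1 hu hu0 (sliceY V 0)
  -- The available uniform bound of the flux is in duality with the parabolic norm, not in `L²`, so
  -- the difference of the slices has to be small in that norm.
  have h2 : Tendsto (fun y => ⟪testL2 (sliceY V y - sliceY V 0), flux φ lam s u y⟫_ℂ) (𝓝[>] 0)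
      (𝓝 0) := by
    rw [tendsto_zero_iff_enorm_tendsto_zero]
    have h3 := (tendsto_parabolicNormSq hL h𝒱 hφ V).mono_left (nhdsWithin_le_nhds (s := Ioi 0))
    have h4 := ((ENNReal.continuous_rpow_const (y := (1 / 2 : ℝ))).tendsto 0).comp h3
    rw [ENNReal.zero_rpow_of_pos (by norm_num)] at h4
    have h5 := ENNReal.Tendsto.const_mul h4 (Or.inr hK)
    rw [mul_zero] at h5
    refine tendsto_of_tendsto_of_tendsto_of_le_of_le' tendsto_const_nhds h5
      (Eventually.of_forall fun _ => zero_le) ?_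
    filter_upwards [self_mem_nhdsWithin] with y hy
    exact hle _ y hy
  have h6 := h2.add h1
  rw [zero_add] at h6
  refine h6.congr fun y => ?_
  rw [testL2_sub, inner_sub_left, sub_add_cancel]

end

section

/-! ### The weak equation -/

variable {n : ℕ} {Ω : Opens (Sp n)} {a : Sp n → Matrix (Fin n) (Fin n) ℝ} {c : Sp n → ℝ} {Λ : ℝ}
  {𝒱 : Submodule ℝ (L2 Ω)} {lam : ℕ → ℝ} {φ : HilbertBasis ℕ ℝ (L2 Ω)} {s : ℝ}

/-- The exponent `1 - 2s` exceeds `-1`, so the weight is integrable up to `y = 0`. This matters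
because the test functions need not vanish there. -/
theorem isFiniteMeasureOnCompacts_wMeas (hs1 : s < 1) : IsFiniteMeasureOnCompacts (wMeas s) := by
  refine ⟨fun K hK => ?_⟩
  obtain ⟨R, hR⟩ := hK.bddAbove
  have h1 : IntegrableOn (fun y : ℝ => y ^ (1 - 2 * s)) (Ioc 0 (max R 0)) :=
    (intervalIntegrable_iff_integrableOn_Ioc_of_le (le_max_right _ _)).1
      (intervalIntegral.intervalIntegrable_rpow' (by linarith))
  rw [wMeas, withDensity_apply _ hK.measurableSet, Measure.restrict_restrict hK.measurableSet]
  refine lt_of_le_of_lt (lintegral_mono_set (t := Ioc 0 (max R 0)) fun y hy =>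
    ⟨hy.2, (hR hy.1).trans (le_max_left _ _)⟩) ?_
  exact h1.lintegral_lt_top

theorem memLp_test_mExt (hs1 : s < 1) (V : 𝓓(fullCyl Ω, ℝ)) :
    MemLp (fun q => (V q : ℂ)) 2 (mExt Ω s) := by
  have := isFiniteMeasureOnCompacts_wMeas hs1
  exact (Complex.continuous_ofReal.comp V.continuous).memLp_of_hasCompactSupport
    (V.hasCompactSupport.comp_left Complex.ofReal_zero)

theorem integrable_mul_test (hs1 : s < 1) {U : ℝ × Sp n × ℝ → ℂ} (hU : MemLp U 2 (mExt Ω s))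
    (V : 𝓓(fullCyl Ω, ℝ)) : Integrable (fun q => U q * V q) (mExt Ω s) :=
  hU.integrable_mul (memLp_test_mExt hs1 V)

theorem quasiMeasurePreserving_space : Measure.QuasiMeasurePreserving
    (fun q : ℝ × Sp n × ℝ => q.2.1) (mExt Ω s) (mΩ Ω) :=
  Measure.quasiMeasurePreserving_fst.comp Measure.quasiMeasurePreserving_snd

theorem integrable_coef_mul_test (hL : IsAdmissible Ω a c Λ) (hs1 : s < 1)
    {U : ℝ × Sp n × ℝ → ℂ} (hU : MemLp U 2 (mExt Ω s)) (V : 𝓓(fullCyl Ω, ℝ)) :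
    Integrable (fun q => c q.2.1 * U q * V q) (mExt Ω s) := by
  set K : Set (Sp n) := (fun q : ℝ × Sp n × ℝ => q.2.1) '' tsupport V with hK
  have hKc : IsCompact K :=
    (show IsCompact (tsupport V) from V.hasCompactSupport).image (by fun_prop)
  have hKΩ : K ⊆ Ω := by
    rintro _ ⟨q, hq, rfl⟩
    exact (V.tsupport_subset hq).2.1
  obtain ⟨M, hM⟩ := hL.locBdd_c K hKc hKΩ
  rw [ae_restrict_iff' hKc.measurableSet] at hM
  have hM2 : ∀ᵐ q ∂(mExt Ω s), q.2.1 ∈ K → |c q.2.1| ≤ M :=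
    quasiMeasurePreserving_space.ae (ae_restrict_of_ae hM)
  have hcm : AEStronglyMeasurable (fun q : ℝ × Sp n × ℝ => ((c q.2.1 : ℝ) : ℂ)) (mExt Ω s) :=
    (Complex.measurable_ofReal.comp_aemeasurable
      (hL.meas_c.comp_quasiMeasurePreserving quasiMeasurePreserving_space)).aestronglyMeasurable
  have h1 := (integrable_mul_test hs1 hU V).norm.const_mul M
  refine h1.mono' ((hcm.mul hU.1).mul (memLp_test_mExt hs1 V).1) ?_
  filter_upwards [hM2] with q hq
  by_cases h : q.2.1 ∈ K
  · rw [mul_assoc, norm_mul, Complex.norm_real]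
    exact mul_le_mul_of_nonneg_right (hq h) (norm_nonneg _)
  · have : V q = 0 := image_eq_zero_of_notMem_tsupport fun h2 => h ⟨q, h2, rfl⟩
    simp [this]

theorem integrable_gradient_mul_test (hL : IsAdmissible Ω a c Λ) (hs1 : s < 1)
    {G : Fin n → ℝ × Sp n × ℝ → ℂ} (hG : ∀ i, MemLp (G i) 2 (mExt Ω s)) (V : 𝓓(fullCyl Ω, ℝ)) :
    Integrable (fun q => ∑ i, ∑ j, a q.2.1 i j * G i q * fderiv ℝ V q (0, e j, 0))
      (mExt Ω s) := by
  refine integrable_finsetSum _ fun i _ => integrable_finsetSum _ fun j _ => ?_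
  have h1 := integrable_mul_test hs1 (hG i) (dirDeriv V (0, e j, 0))
  have h2 : Integrable (fun q : ℝ × Sp n × ℝ => ((a q.2.1 i j : ℝ) : ℂ) *
      (G i q * (dirDeriv V (0, e j, 0) q : ℂ))) (mExt Ω s) := by
    refine Integrable.bdd_mul (c := Λ + 1) h1 (Complex.measurable_ofReal.comp_aemeasurable
      ((hL.meas_a i j).comp_quasiMeasurePreserving
        quasiMeasurePreserving_space)).aestronglyMeasurable ?_
    filter_upwards [quasiMeasurePreserving_space.ae (abs_coef_le hL)] with q hq
    rw [Complex.norm_real]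
    exact hq (some i) (some j)
  refine h2.congr (ae_of_all _ fun q => ?_)
  simp only [dirDeriv_apply]
  ring

theorem integral_mExt {F : ℝ × Sp n × ℝ → ℂ} (hF : Integrable F (mExt Ω s)) :
    Integrable (fun y => ∫ p, F (p.1, p.2, y) ∂(mCyl Ω)) (wMeas s) ∧
      ∫ q, F q ∂(mExt Ω s) = ∫ y, ∫ p, F (p.1, p.2, y) ∂(mCyl Ω) ∂(wMeas s) := by
  have hp := measurePreserving_prodAssoc (volume : Measure ℝ) (mΩ Ω) (wMeas s)
  have h1 : Integrable (fun z => F (MeasurableEquiv.prodAssoc z)) ((mCyl Ω).prod (wMeas s)) :=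
    (hp.integrable_comp_emb MeasurableEquiv.prodAssoc.measurableEmbedding).2 hF
  refine ⟨h1.integral_prod_right, ?_⟩
  rw [← hp.integral_comp' F, integral_prod_symm _ h1]
  rfl

theorem integral_wMeas (g : ℝ → ℂ) :
    ∫ y, g y ∂(wMeas s) = ∫ y in Ioi (0 : ℝ), y ^ (1 - 2 * s) • g y := by
  rw [wMeas, integral_withDensity_eq_integral_toReal_smul (measurable_weight s)
    (ae_of_all _ fun _ => ENNReal.ofReal_lt_top)]
  refine setIntegral_congr_fun measurableSet_Ioi fun y hy => ?_
  rw [ENNReal.toReal_ofReal (Real.rpow_nonneg (le_of_lt hy) _)]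

theorem integrableOn_of_integrable_wMeas {g : ℝ → ℂ} (hg : Integrable g (wMeas s)) :
    IntegrableOn (fun y => y ^ (1 - 2 * s) • g y) (Ioi 0) := by
  rw [wMeas, integrable_withDensity_iff_integrable_smul' (measurable_weight s)
    (ae_of_all _ fun _ => ENNReal.ofReal_lt_top)] at hg
  refine hg.congr ?_
  filter_upwards [ae_restrict_mem measurableSet_Ioi] with y hy
  rw [ENNReal.toReal_ofReal (Real.rpow_nonneg (le_of_lt hy) _)]

theorem inner_real_smul (v w : L2Cyl Ω) (r : ℝ) : ⟪v, r • w⟫_ℂ = r • ⟪v, w⟫_ℂ := by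
  have h : r • w = (r : ℂ) • w := (algebraMap_smul ℂ r w).symm
  rw [h, inner_smul_right, Complex.real_smul]

theorem tendsto_inner_flux_atTop (V : 𝓓(fullCyl Ω, ℝ)) (F : ℝ → L2Cyl Ω) :
    Tendsto (fun y => ⟪testL2 (sliceY V y), F y⟫_ℂ) atTop (𝓝 0) := by
  have hKc : IsCompact ((fun q : ℝ × Sp n × ℝ => q.2.2) '' tsupport V) :=
    (show IsCompact (tsupport V) from V.hasCompactSupport).image (by fun_prop)
  obtain ⟨R, hR⟩ := hKc.bddAbove
  refine tendsto_const_nhds.congr' ?_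
  filter_upwards [eventually_gt_atTop R] with y hy
  have h1 : testL2 (sliceY V y) = 0 := by
    refine Lp.ext ?_
    filter_upwards [coeFn_testL2 (sliceY V y), Lp.coeFn_zero ℂ 2 (mCyl Ω)] with p h2 h3
    rw [h2, h3, sliceY_apply]
    have : V (p.1, p.2, y) = 0 := image_eq_zero_of_notMem_tsupport fun h =>
      (not_le.2 hy) (hR ⟨_, h, rfl⟩)
    simp [this]
  rw [h1, inner_zero_left]

theorem weak_form_slice (hL : IsAdmissible Ω a c Λ) (h𝒱 : IsFormDomain Ω a c 𝒱)
    (hφ : IsEigenbasis Ω a c 𝒱 lam φ) (u : L2Cyl Ω) (hs0 : 0 < s)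
    (hu0 : ∀ k, lam k = 0 → component φ u k = 0) {y : ℝ} (hy : 0 < y)
    {W : Option (Option (Fin n)) → ℝ × Sp n × ℝ → ℂ}
    (hW : ∀ κ, (fun p : ℝ × Sp n => W κ (p.1, p.2, y)) =ᵐ[mCyl Ω]
      dataCyl hL h𝒱 hφ (extension φ lam s u y) κ) (V : 𝓓(fullCyl Ω, ℝ)) :
    ∫ p : ℝ × Sp n, W none (p.1, p.2, y) * fderiv ℝ V (p.1, p.2, y) (1, 0, 0) ∂(mCyl Ω) =
      ∫ p : ℝ × Sp n, ((∑ i, ∑ j, a p.2 i j * W (some (some i)) (p.1, p.2, y) *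
          fderiv ℝ V (p.1, p.2, y) (0, e j, 0)) +
        c p.2 * W none (p.1, p.2, y) * V (p.1, p.2, y)) ∂(mCyl Ω) -
      ⟪testL2 (sliceY V y), y ^ (2 * s - 1) • fluxDeriv φ lam s u y⟫_ℂ := by
  have h1 := weak_equation_slice hL h𝒱 hφ u hu0 hs0 hy (sliceY V y)
  have hform := inFormDom_of_memLp_symbol hφ.nonneg
    (memLp_symbol_mul_specFun hφ.nonneg u hu0 hs0 hy)
  rw [formLp_jetCyl_testJet hL h𝒱 hφ hform (sliceY V y) (hW none).symm
    (fun i => (hW (some (some i))).symm), ← integral_mul_test] at h1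
  have h2 : ∫ p : ℝ × Sp n, W none (p.1, p.2, y) * fderiv ℝ V (p.1, p.2, y) (1, 0, 0) ∂(mCyl Ω) =
      ∫ p, extension φ lam s u y p * dirDeriv (sliceY V y) (1, 0) p ∂(mCyl Ω) := by
    refine integral_congr_ae ?_
    filter_upwards [hW none] with p hp
    rw [hp, dirDeriv_apply, fderiv_sliceY]
    rfl
  rw [h2, h1]
  simp only [fderiv_sliceY, sliceY_apply]

/-- The slice identity, weighted by `y^{1-2s}` and increased by the `∂_y U ∂_y V` term, is exactly
the `y`-derivative of the pairing of `V(y)` with the flux. Integrating over `(0, ∞)` leaves only the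
boundary term at `0`, which is `tendsto_inner_flux_sliceY`; at infinity `V` vanishes. -/
theorem weak_form (hL : IsAdmissible Ω a c Λ) (h𝒱 : IsFormDomain Ω a c 𝒱)
    (hφ : IsEigenbasis Ω a c 𝒱 lam φ) (u : L2Cyl Ω) (hs0 : 0 < s) (hs1 : s < 1)
    (hu : MemDomH φ lam s u) (hu0 : ∀ k, lam k = 0 → component φ u k = 0)
    {W : Option (Option (Fin n)) → ℝ × Sp n × ℝ → ℂ} (hWLp : ∀ κ, MemLp (W κ) 2 (mExt Ω s))
    (hW : ∀ κ y, 0 < y → (fun p : ℝ × Sp n => W κ (p.1, p.2, y)) =ᵐ[mCyl Ω]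
      dataCyl hL h𝒱 hφ (extension φ lam s u y) κ)
    {Y : ℝ × Sp n × ℝ → ℂ} (hYLp : MemLp Y 2 (mExt Ω s))
    (hY : ∀ y, 0 < y → (fun p : ℝ × Sp n => Y (p.1, p.2, y)) =ᵐ[mCyl Ω]
      (deriv (extension φ lam s u) y : L2Cyl Ω)) (V : 𝓓(fullCyl Ω, ℝ)) :
    ∫ q, W none q * fderiv ℝ V q (1, 0, 0) ∂(mExt Ω s) =
      ∫ q, ((∑ i, ∑ j, a q.2.1 i j * W (some (some i)) q * fderiv ℝ V q (0, e j, 0)) +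
        Y q * fderiv ℝ V q (0, 0, 1) + c q.2.1 * W none q * V q) ∂(mExt Ω s) -
      (Real.Gamma (1 - s) / (4 ^ (s - 1 / 2) * Real.Gamma s) : ℝ) *
        pairH φ lam s u (testL2 (bottom V)) := by
  have i1 := (integrable_gradient_mul_test hL hs1 (fun i => hWLp (some (some i))) V).add
    (integrable_coef_mul_test hL hs1 (hWLp none) V)
  have i2 := integrable_mul_test hs1 hYLp (dirDeriv V (0, 0, 1))
  have i3 := integrable_mul_test hs1 (hWLp none) (dirDeriv V (1, 0, 0))
  obtain ⟨j1, e1⟩ := integral_mExt i1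
  obtain ⟨j2, e2⟩ := integral_mExt i2
  obtain ⟨j3, e3⟩ := integral_mExt i3
  have hsplit : ∫ q, ((∑ i, ∑ j, a q.2.1 i j * W (some (some i)) q * fderiv ℝ V q (0, e j, 0)) +
        Y q * fderiv ℝ V q (0, 0, 1) + c q.2.1 * W none q * V q) ∂(mExt Ω s) =
      ∫ q, ((∑ i, ∑ j, a q.2.1 i j * W (some (some i)) q * fderiv ℝ V q (0, e j, 0)) +
        c q.2.1 * W none q * V q) ∂(mExt Ω s) +
      ∫ q, Y q * (dirDeriv V (0, 0, 1) q : ℂ) ∂(mExt Ω s) := by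
    refine Eq.trans ?_ (integral_add i1 i2)
    refine integral_congr_ae (ae_of_all _ fun q => ?_)
    simp only [dirDeriv_apply]
    ring
  have hderiv : ∀ y ∈ Ioi (0 : ℝ), HasDerivAt
      (fun y => ⟪testL2 (sliceY V y), flux φ lam s u y⟫_ℂ)
      (⟪testL2 (sliceY V y), fluxDeriv φ lam s u y⟫_ℂ +
        ⟪testL2 (sliceY (dirDeriv V (0, 0, 1)) y), flux φ lam s u y⟫_ℂ) y := fun y hy =>
    (hasDerivAt_testL2_sliceY V y).inner ℂ (hasDerivAt_flux φ hφ.nonneg u hs0 hy)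
  have hval : ∀ y ∈ Ioi (0 : ℝ), y ^ (1 - 2 * s) •
      ((∫ p : ℝ × Sp n, ((∑ i, ∑ j, a p.2 i j * W (some (some i)) (p.1, p.2, y) *
          fderiv ℝ V (p.1, p.2, y) (0, e j, 0)) +
        c p.2 * W none (p.1, p.2, y) * V (p.1, p.2, y)) ∂(mCyl Ω)) +
      (∫ p : ℝ × Sp n, Y (p.1, p.2, y) * (dirDeriv V (0, 0, 1) (p.1, p.2, y) : ℂ) ∂(mCyl Ω)) -
      ∫ p : ℝ × Sp n, W none (p.1, p.2, y) * (dirDeriv V (1, 0, 0) (p.1, p.2, y) : ℂ) ∂(mCyl Ω)) =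
      ⟪testL2 (sliceY V y), fluxDeriv φ lam s u y⟫_ℂ +
        ⟪testL2 (sliceY (dirDeriv V (0, 0, 1)) y), flux φ lam s u y⟫_ℂ := fun y hy => by
    have h1 := weak_form_slice hL h𝒱 hφ u hs0 hu0 hy (fun κ => hW κ y hy) V
    have h2 : ∫ p : ℝ × Sp n, Y (p.1, p.2, y) * (dirDeriv V (0, 0, 1) (p.1, p.2, y) : ℂ) ∂(mCyl Ω) =
        ⟪testL2 (sliceY (dirDeriv V (0, 0, 1)) y), y ^ (2 * s - 1) • flux φ lam s u y⟫_ℂ := by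
      rw [← integral_mul_test, ← (hasDerivAt_extension φ hφ.nonneg u hs0 hy).deriv]
      refine integral_congr_ae ?_
      filter_upwards [hY y hy] with p hp
      rw [hp, sliceY_apply]
    have h3 : y ^ (1 - 2 * s) * y ^ (2 * s - 1) = 1 := by
      rw [← Real.rpow_add hy]
      simp
    simp only [dirDeriv_apply] at h2 ⊢
    have h4 : ∀ A B D : ℂ, A + B - (A - D) = D + B := fun A B D => by ring
    rw [h2, h1, h4, inner_real_smul, inner_real_smul, ← smul_add, smul_smul, h3, one_smul]
  -- Integrability of the `y`-derivative of the pairing is not estimated directly: by `hval` it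
  -- equals a weighted combination of integrals already known to be integrable in `y`.
  have hint := integrableOn_of_integrable_wMeas ((j1.add j2).sub j3)
  have hFTC := integral_Ioi_of_hasDerivAt_of_tendsto_nhdsGT hderiv
    (hint.congr_fun (fun y hy => hval y hy) measurableSet_Ioi)
    (tendsto_inner_flux_sliceY hL h𝒱 hφ u hs0 hs1 hu hu0 V) (tendsto_inner_flux_atTop V _)
  rw [← setIntegral_congr_fun measurableSet_Ioi hval, ← integral_wMeas] at hFTC
  have hsum := (integral_sub (j1.add j2) j3).symm.trans hFTC
  rw [integral_add' j1 j2] at hsum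
  simp only [Pi.add_apply] at hsum e1
  rw [← e1, ← e2, ← e3] at hsum
  rw [hsplit]
  simp only [dirDeriv_apply] at hsum ⊢
  linear_combination -hsum

end

end ParabolicExtension

end

/-! ### The theorem -/

theorem mainTheorem6 {n : ℕ} (Ω : Opens (Sp n))
    (a : Sp n → Matrix (Fin n) (Fin n) ℝ) (c : Sp n → ℝ) (Λ : ℝ) (hL : IsAdmissible Ω a c Λ)
    (𝒱 : Submodule ℝ (L2 Ω)) (h𝒱 : IsFormDomain Ω a c 𝒱)
    (lam : ℕ → ℝ) (φ : HilbertBasis ℕ ℝ (L2 Ω)) (hφ : IsEigenbasis Ω a c 𝒱 lam φ)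
    (s : ℝ) (hs0 : 0 < s) (hs1 : s < 1)
    (u : L2Cyl Ω) (hu : MemDomH φ lam s u) (hu0 : ∀ k, lam k = 0 → component φ u k = 0) :
    ContDiffOn ℝ ∞ (extension φ lam s u) (Ioi 0) ∧
    Tendsto (extension φ lam s u) (𝓝[>] 0) (𝓝 u) ∧
    (∀ y : ℝ, 0 < y → MemDomH φ lam 1 (extension φ lam s u y) ∧
      ∀ v : 𝓓(cyl Ω, ℝ), MemDomH φ lam 1 (testL2 v) ∧
        pairH φ lam 1 (extension φ lam s u y) (testL2 v) =
          ∫ p, (((1 - 2 * s) / y) • deriv (extension φ lam s u) y +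
            deriv (deriv (extension φ lam s u)) y) p * v p ∂(mCyl Ω) ∧
        pairH φ lam 1 (extension φ lam s u y) (testL2 v) =
          (y ^ (2 * s - 1) : ℝ) * ∫ p, (deriv (fun η : ℝ =>
            η ^ (1 - 2 * s) • deriv (extension φ lam s u) η) y) p * v p ∂(mCyl Ω)) ∧
    ∃ (U : ℝ × Sp n × ℝ → ℂ) (G : Fin n → ℝ × Sp n × ℝ → ℂ) (Y : ℝ × Sp n × ℝ → ℂ),
      Represents Ω (extension φ lam s u) U G Y ∧
      MemL2H1 Ω a c φ lam s U G Y ∧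
      ∀ V : 𝓓(fullCyl Ω, ℝ),
        (∀ y : ℝ, 0 < y →
          ∫ p : ℝ × Sp n, U (p.1, p.2, y) * fderiv ℝ V (p.1, p.2, y) (1, 0, 0) ∂(mCyl Ω) =
            ∫ p : ℝ × Sp n, ((∑ i, ∑ j, a p.2 i j * G i (p.1, p.2, y) *
                fderiv ℝ V (p.1, p.2, y) (0, e j, 0)) +
              c p.2 * U (p.1, p.2, y) * V (p.1, p.2, y)) ∂(mCyl Ω) -
            ∫ p : ℝ × Sp n, (((1 - 2 * s) / y) • deriv (extension φ lam s u) y +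
              deriv (deriv (extension φ lam s u)) y) p * V (p.1, p.2, y) ∂(mCyl Ω)) ∧
        MemDomH φ lam s (testL2 (bottom V)) ∧
        ∫ q, U q * fderiv ℝ V q (1, 0, 0) ∂(mExt Ω s) =
          ∫ q, ((∑ i, ∑ j, a q.2.1 i j * G i q * fderiv ℝ V q (0, e j, 0)) +
            Y q * fderiv ℝ V q (0, 0, 1) + c q.2.1 * U q * V q) ∂(mExt Ω s) -
          (Real.Gamma (1 - s) / (4 ^ (s - 1 / 2) * Real.Gamma s) : ℝ) *
            pairH φ lam s u (testL2 (bottom V)) := by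
  have hlam := hφ.nonneg
  have hform : ∀ y, 0 < y → InFormDom φ lam (extension φ lam s u y) := fun y hy =>
    inFormDom_of_memLp_symbol hlam (memLp_symbol_mul_specFun hlam u hu0 hs0 hy)
  have hcd := contDiffOn_extension φ hlam hs0 u
  have hd : ∀ y, 0 < y → HasDerivAt (extension φ lam s u) (deriv (extension φ lam s u) y) y :=
    fun y hy => (hasDerivAt_extension φ hlam u hs0 hy).differentiableAt.hasDerivAt
  have hc' : ContinuousOn (deriv (extension φ lam s u)) (Ioi 0) :=
    hcd.continuousOn_deriv_of_isOpen isOpen_Ioi (by simp)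
  refine ⟨hcd, tendsto_extension φ hlam hs0 u, fun y hy => ⟨?_, fun v => ⟨?_, ?_, ?_⟩⟩, ?_⟩
  · exact memDomH_of_memLp_symbol zero_le_one le_rfl (memLp_symbol_mul_specFun hlam u hu0 hs0 hy)
  · exact memDomH_testL2 hL h𝒱 hφ zero_le_one le_rfl v
  · rw [pairH_one_extension hlam u hu0 hs0 hy, bessel_extension φ hlam u hs0 hy, integral_mul_test]
  · rw [pairH_one_extension hlam u hu0 hs0 hy, deriv_weighted_extension φ hlam u hs0 hy,
      integral_mul_test, inner_real_smul, Complex.real_smul]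
  obtain ⟨W, hWm, hW⟩ := exists_dataCyl_representative hL h𝒱 hφ hcd.continuousOn hform
  obtain ⟨Y, hYm, hY⟩ := exists_representative_of_continuousOn hc'
  obtain ⟨hWLp, hYLp, hmem⟩ := memL2H1_of_curve (s := s) hL h𝒱 hφ hd hc' hform
    (lintegral_energy_extension hlam hφ.mono u hs0 hs1 hu hu0) hWm hW hYm hY
  refine ⟨W none, fun i => W (some (some i)), Y, represents_of_curve hL h𝒱 hφ hform hW hY, hmem,
    fun V => ⟨fun y hy => ?_, memDomH_testL2 hL h𝒱 hφ hs0.le hs1.le _,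
      weak_form hL h𝒱 hφ u hs0 hs1 hu hu0 hWLp hW hYLp hY V⟩⟩
  rw [weak_form_slice hL h𝒱 hφ u hs0 hu0 hy (fun κ => hW κ y hy) V,
    bessel_extension φ hlam u hs0 hy, ← integral_mul_test]
  simp only [sliceY_apply]
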